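/- **Setting.** Let $\Sigma=G\backslash\mathbb H^2$ be a closed oriented hyperbolic surface (so $\Sigma=S_g$ with $g\ge 2$), where $G=\pi_1(\Sigma)$ is its deck group, acting freely, properly discontinuously and cocompactly on $\mathbb H^2$ by orientation preserving isometries. Let $\Delta$ be a one-vertex triangulation of $\Sigma$, let $\widetilde\Delta$ be its lift to $\mathbb H^2$, and let $Gv_0$ be the vertex set of $\widetilde\Delta$. *Foliations.* A homomorphism $\rho:G\to\mathrm{Homeo}^+(\mathbb R)$ is *allowed* if $g\mapsto\rho(g)(0)$ is injective. It defines a function $F:\mathbb H^2\to\mathbb R$ with $F(gv_0)=\rho(g)(0)$ as follows. On an edge with endpoints $hv_0,gv_0$ and $F(hv_0)<F(gv_0)$, $F$ is linear if $g=1$, and in general $F(x)=\rho(g)(F(g^{-1}x))$. In every triangle the level sets of $F$ are the linear segments spanned by the points of the boundary with a given value. The leaves of the singular foliation $\widetilde{\mathcal F}_\rho$ of $\mathbb H^2$ are the connected components of the level sets of $F$; they are the lifts of the leaves of a singular foliation $\mathcal F_\rho$ of $\Sigma$. A leaf is nonsingular if it contains no vertex. *Straightening.* $S(\rho)\subset\Sigma$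 denotes the closure of the union of the images in $\Sigma$ of all geodesics of $\mathbb H^2$ that have the same pair of endpoints in $\partial\mathbb H^2=S^1$ as some nonsingular leaf of $\widetilde{\mathcal F}_\rho$. *Orders.* Let $O$ be a left order on $G$, and let $s_0=1,s_1,s_2,\dots$ be an enumeration of $G$. The minimal embedding $i:G\to\mathbb R$ is defined by $i(s_0)=0$ and, for $n>0$, by $i(s_n)=\max_{p<n}i(s_p)+1$ if $s_n>s_p$ for all $p<n$, by $i(s_n)=\min_{p<n}i(s_p)-1$ if $s_n<s_p$ for all $p<n$, and otherwise by $i(s_n)=\frac12(i(s_a)+i(s_b))$, where $s_a<s_n<s_b$ are the closest neighbours of $s_n$ among $s_0,\dots,s_{n-1}$. The canonical action $\rho_O$ is the allowed representation with $\rho_O(g)(i(h))=i(gh)$ for which every $\rho_O(g)$ is affine on each interval complementary to $i(G)$. Put $\mathcal F_O=\mathcal F_{\rho_O}$ and $\lambda_O=S(\rho_O)$. **Theorem.** 1. There are constants $K\ge1$, $c\ge0$ (depending only on $\Sigma$ and $\Delta$) such that for every allowed $\rho$ the following holds. Every nonsingular leaf of $\widetilde{\mathcal F}_\rho$ is the image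 of an injective continuous $(K,c)$-quasigeodesic $\mathbb R\to\mathbb H^2$ with well-defined, distinct endpoints in $S^1$. Every leaf through a vertex is a star of at least two (finitely many) prongs starting at that vertex, and any two different prongs together form an injective continuous $(K,c)$-quasigeodesic with well-defined, distinct endpoints. This applies in particular to $\mathcal F_O$ for every left order $O$ on $G$. 2. For every allowed $\rho$, $S(\rho)$ is a (nonempty) geodesic lamination on $\Sigma$, and every geodesic of $\mathbb H^2$ with the same endpoints as a nonsingular leaf of $\widetilde{\mathcal F}_\rho$ is a lift of a leaf of this lamination. 3. The map $\rho\mapsto S(\rho)$ is continuous from the space of allowed representations with the topology of pointwise convergence to the space of geodesic laminations on $\Sigma$ with the Hausdorff topology. 4. For every left order $O$ on $G$ and every enumeration of $G$ with $s_0=1$, the canonical action $\rho_O$ exists and is unique. The geodesic lamination $\lambda_O$ does not depend on the enumeration, and the map $O\mapsto\lambda_O$ is continuous from the space of left orders on $G$ with Sikora's topology (generated by the sets $\{O: a<_O b\}$, $a,b\in G$) to the space of geodesic laminations on $\Sigma$ with the Hausdorff topology. -/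

import Mathlib

open Filter Topology Set
open scoped UpperHalfPlane

namespace FLO

/-! ### Closed hyperbolic surfaces -/

/-- The action of `G` on the hyperbolic plane `ℍ` is that of the deck group `G = π₁(Σ)` of a closed
oriented hyperbolic surface `Σ = G \ ℍ`: it is free, properly discontinuous and cocompact, by
orientation preserving isometries. (By Gauss–Bonnet, `Σ` then has genus at least `2`, and every
closed oriented surface of genus at least `2` is of this form.) -/
structure IsSurfaceGroup (G : Type*) [Group G] [MulAction G ℍ] : Prop where
  orientationPreserving :
    ∀ g : G, ∃ A : Matrix.SpecialLinearGroup (Fin 2) ℝ, ∀ z : ℍ, g • z = A • z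
  free : ∀ (g : G) (z : ℍ), g • z = z → g = 1
  properlyDiscontinuous : ProperlyDiscontinuousSMul G ℍ
  cocompact : CompactSpace (Quotient (MulAction.orbitRel G ℍ))

/-- The surface `Σ = G \ ℍ`, with the quotient topology. -/
abbrev Surface (G : Type*) [Group G] [MulAction G ℍ] : Type :=
  Quotient (MulAction.orbitRel G ℍ)

/-- The universal covering `ℍ → Σ`. -/
def proj (G : Type*) [Group G] [MulAction G ℍ] : ℍ → Surface G :=
  Quotient.mk (MulAction.orbitRel G ℍ)

/-! ### One-vertex triangulations -/

/-- The vertex labelled `g` of the simplicial complexes below, a point of `G → ℝ`. -/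
noncomputable def vert {G : Type*} (g : G) : G → ℝ := Set.indicator {g} (fun _ => 1)

/-- The geometric simplex with vertex set `τ`. -/
def simplex {G : Type*} (τ : Set G) : Set (G → ℝ) := convexHull ℝ (vert '' τ)

/-- A one-vertex triangulation `Δ` of `Σ = G \ ℍ`, given by its preimage `Δ̃` in `ℍ`: a
`G`-invariant, locally finite triangulation of `ℍ` whose vertex set is a single free `G`-orbit.
The vertex `g v₀` is labelled by `g`, so that triangles are three-element subsets of `G`, and
`toPlane` is the homeomorphism from the geometric realization of this simplicial complex to `ℍ`.
It is equivariant, so that the deck group acts by piecewise linear maps.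
(The edges of a one-vertex triangulation of a closed surface of genus at least `2` are
automatically essential and pairwise non-homotopic, hence `Δ̃` is a simplicial complex.) -/
structure OneVertexTriangulation (G : Type*) [Group G] [MulAction G ℍ] where
  /-- The set of triangles of `Δ̃`. -/
  triangles : Set (Set G)
  ncard_triangle : ∀ τ ∈ triangles, τ.ncard = 3
  translate_mem : ∀ (g : G), ∀ τ ∈ triangles, (fun h => g * h) '' τ ∈ triangles
  finite_star : {τ ∈ triangles | (1 : G) ∈ τ}.Finite
  /-- The parametrization of `ℍ` by the geometric realization; its values elsewhere are
  irrelevant. -/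
  toPlane : (G → ℝ) → ℍ
  continuousOn_simplex : ∀ τ ∈ triangles, ContinuousOn toPlane (simplex τ)
  bijOn : BijOn toPlane (⋃ τ ∈ triangles, simplex τ) univ
  equivariant : ∀ (g : G), ∀ τ ∈ triangles, ∀ x ∈ simplex τ,
    toPlane (fun h => x (g⁻¹ * h)) = g • toPlane x

/-! ### Left orders and allowed representations -/

/-- A left order on `G`, given by its strict order relation. -/
@[ext]
structure LeftOrder (G : Type*) [Group G] where
  /-- The strict order. -/
  lt : G → G → Prop
  irrefl : ∀ a, ¬ lt a a
  trans : ∀ a b c, lt a b → lt b c → lt a c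
  total : ∀ a b, lt a b ∨ a = b ∨ lt b a
  left_inv : ∀ a b c, lt a b → lt (c * a) (c * b)

/-- Sikora's topology on the set of left orders: the smallest one for which all the sets
`{O | a <_O b}` are open. -/
instance (G : Type*) [Group G] : TopologicalSpace (LeftOrder G) :=
  TopologicalSpace.generateFrom {U | ∃ a b : G, U = {O : LeftOrder G | O.lt a b}}

/-- An allowed representation `ρ : G → Homeo⁺(ℝ)`: the orbit map of `0` is injective (so that `ρ`
is faithful). Orientation preserving homeomorphisms of `ℝ` are the order automorphisms of `ℝ`. -/
structure AllowedRep (G : Type*) [Group G] where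
  /-- The representation. -/
  hom : G →* (ℝ ≃o ℝ)
  injective_orbit : Function.Injective fun g => hom g 0

/-- The topology of pointwise convergence on allowed representations: `ρₙ → ρ` if and only if
`ρₙ(g)(x) → ρ(g)(x)` for all `g` and `x`. (On `Homeo⁺(ℝ)`, this is the same as locally uniform
convergence of `ρₙ(g)` for every `g`.) -/
instance (G : Type*) [Group G] : TopologicalSpace (AllowedRep G) :=
  TopologicalSpace.induced (fun (ρ : AllowedRep G) (g : G) (x : ℝ) => ρ.hom g x) inferInstance

open Classical in
/-- The minimal embedding of the ordered set `s 0, s 1, …`; the value at `n` is the image of `s n`.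
The sets `A` and `B` consist of the images of the elements that precede `s n` in the enumeration and
lie above, respectively below, `s n`. -/
noncomputable def minimalEmbedding {G : Type*} [Group G] (O : LeftOrder G) (s : ℕ → G) (n : ℕ) :
    ℝ :=
  let A : Set ℝ := {x | ∃ p, ∃ _ : p < n, O.lt (s n) (s p) ∧ x = minimalEmbedding O s p}
  let B : Set ℝ := {x | ∃ p, ∃ _ : p < n, O.lt (s p) (s n) ∧ x = minimalEmbedding O s p}
  if n = 0 then 0
  else if A = ∅ then sSup B + 1
  else if B = ∅ then sInf A - 1
  else (sSup B + sInf A) / 2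
termination_by n

/-- `ρ` is the canonical action `ρ_O` of the left ordered group `G`, for the enumeration `s` of `G`:
on the image of the minimal embedding `i` it is given by `ρ(g)(i(h)) = i(gh)`, and it is affine on
all intervals that are complementary to this image. -/
structure IsCanonicalRep {G : Type*} [Group G] (s : ℕ ≃ G) (O : LeftOrder G) (ρ : AllowedRep G) :
    Prop where
  apply_embedding : ∀ g h : G,
    ρ.hom g (minimalEmbedding O s (s.symm h)) = minimalEmbedding O s (s.symm (g * h))
  affine : ∀ (g : G) (x y : ℝ), x < y → (∀ n, minimalEmbedding O s n ∉ Ioo x y) →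
    ∀ r ∈ Icc (0 : ℝ) 1,
      ρ.hom g ((1 - r) * x + r * y) = (1 - r) * ρ.hom g x + r * ρ.hom g y

/-! ### The boundary circle, geodesics and quasigeodesics -/

/-- The Cayley transform from `ℍ` to the open unit disc. -/
noncomputable def cayley (z : ℍ) : ℂ := ((z : ℂ) - Complex.I) / ((z : ℂ) + Complex.I)

/-- The path `γ` converges along `l` to the point `p` of the circle at infinity, in the closed disc
which compactifies `ℍ`. -/
def ConvergesToBoundary (γ : ℝ → ℍ) (l : Filter ℝ) (p : Circle) : Prop :=
  Tendsto (fun t => cayley (γ t)) l (𝓝 (p : ℂ))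

/-- The bi-infinite path `γ` has the endpoint `p` at `-∞` and the endpoint `q` at `+∞`. -/
def HasEndpoints (γ : ℝ → ℍ) (p q : Circle) : Prop :=
  ConvergesToBoundary γ atBot p ∧ ConvergesToBoundary γ atTop q

/-- A `(K, c)`-quasigeodesic in `ℍ`. -/
def IsQuasigeodesic (K c : ℝ) (γ : ℝ → ℍ) : Prop :=
  ∀ s t : ℝ, K⁻¹ * |s - t| - c ≤ dist (γ s) (γ t) ∧ dist (γ s) (γ t) ≤ K * |s - t| + c

/-- A continuous injective `(K, c)`-quasigeodesic with well-defined distinct endpoints. -/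
def IsGoodLine (K c : ℝ) (γ : ℝ → ℍ) : Prop :=
  Continuous γ ∧ Function.Injective γ ∧ IsQuasigeodesic K c γ ∧
    ∃ p q : Circle, p ≠ q ∧ HasEndpoints γ p q

/-- The complete geodesics of `ℍ`, as subsets. -/
def IsGeodesicLine (ℓ : Set ℍ) : Prop := ∃ c : ℝ → ℍ, Isometry c ∧ range c = ℓ

/-! ### Geodesic laminations on the surface and their Hausdorff topology -/

/-- The subset `lam` of `Σ` is a geodesic lamination, and `leaves` is the set of lifts to `ℍ` of
its leaves: `lam` is closed, nonempty, and its preimage in `ℍ` is the union of the `G`-invariant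
family `leaves` of pairwise disjoint complete geodesics. -/
structure IsLamination {G : Type*} [Group G] [MulAction G ℍ] (lam : Set (Surface G))
    (leaves : Set (Set ℍ)) : Prop where
  isClosed : IsClosed lam
  nonempty : lam.Nonempty
  isGeodesic : ∀ ℓ ∈ leaves, IsGeodesicLine ℓ
  pairwiseDisjoint : leaves.PairwiseDisjoint id
  invariant : ∀ (g : G), ∀ ℓ ∈ leaves, (fun z => g • z) '' ℓ ∈ leaves
  preimage_eq : proj G ⁻¹' lam = ⋃₀ leaves

/-- The space `𝒢ℒ(Σ)` of geodesic laminations on the closed surface `Σ`. Its topology is the subspace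
topology of the Vietoris topology on nonempty compact subsets of `Σ`, which is the topology of the
Hausdorff distance for any metric that induces the topology of `Σ`. -/
abbrev GeodesicLamination (G : Type*) [Group G] [MulAction G ℍ] : Type :=
  {lam : TopologicalSpace.NonemptyCompacts (Surface G) //
    ∃ leaves, IsLamination (lam : Set (Surface G)) leaves}

/-! ### The singular foliation of an allowed representation and its straightening -/

/-- The function `F` on the edge of `Δ̃` from `h` to `g`, where `ρ(h)(0) < ρ(g)(0)`, at the point
with barycentric coordinates `1 - r` and `r`. It is `ρ(g)` applied to the value at the corresponding
point of the edge from `g⁻¹h` to `1`, on which `F` is linear, with values `ρ(g⁻¹h)(0)` and `0` at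
the endpoints. -/
def edgeHeight {G : Type*} [Group G] (ρ : AllowedRep G) (h g : G) (r : ℝ) : ℝ :=
  ρ.hom g ((1 - r) * ρ.hom (g⁻¹ * h) 0 + r * 0)

/-- The points with `F = t` on the edges of the triangle `τ`. -/
def boundaryLevel {G : Type*} [Group G] (ρ : AllowedRep G) (t : ℝ) (τ : Set G) : Set (G → ℝ) :=
  {x | ∃ h ∈ τ, ∃ g ∈ τ, ρ.hom h 0 < ρ.hom g 0 ∧ ∃ r ∈ Icc (0 : ℝ) 1,
    edgeHeight ρ h g r = t ∧ x = (1 - r) • vert h + r • vert g}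

variable {G : Type*} [Group G] [MulAction G ℍ]

/-- The vertex `g v₀` of `Δ̃`. -/
noncomputable def OneVertexTriangulation.vertex (T : OneVertexTriangulation G) (g : G) : ℍ :=
  T.toPlane (vert g)

/-- The level set `F = t` in `ℍ`: in every triangle, it is the linear segment (possibly a single
vertex, or empty) that is spanned by the points of the boundary of the triangle with `F = t`. -/
def OneVertexTriangulation.levelSet (T : OneVertexTriangulation G) (ρ : AllowedRep G) (t : ℝ) :
    Set ℍ :=
  ⋃ τ ∈ T.triangles, T.toPlane '' convexHull ℝ (boundaryLevel ρ t τ)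

/-- `C` is a leaf of the singular foliation of `ℍ` that covers the foliation `𝓕(Δ, ρ)` of `Σ`,
that is, a connected component of a level set of `F`. -/
def OneVertexTriangulation.IsLeaf (T : OneVertexTriangulation G) (ρ : AllowedRep G) (C : Set ℍ) :
    Prop :=
  ∃ t : ℝ, ∃ z ∈ T.levelSet ρ t, C = connectedComponentIn (T.levelSet ρ t) z

/-- A leaf is nonsingular if it passes through no vertex. -/
def OneVertexTriangulation.IsNonsingularLeaf (T : OneVertexTriangulation G) (ρ : AllowedRep G)
    (C : Set ℍ) : Prop :=
  T.IsLeaf ρ C ∧ ∀ g : G, T.vertex g ∉ C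

/-- The geodesics of `ℍ` that are obtained by straightening the nonsingular leaves: those which
have the same endpoints as such a leaf. -/
def OneVertexTriangulation.straightenedLeaves (T : OneVertexTriangulation G) (ρ : AllowedRep G) :
    Set (Set ℍ) :=
  {ℓ | ∃ C, T.IsNonsingularLeaf ρ C ∧
    ∃ γ : ℝ → ℍ, Continuous γ ∧ Function.Injective γ ∧ range γ = C ∧
    ∃ c : ℝ → ℍ, Isometry c ∧ range c = ℓ ∧
    ∃ p q : Circle, HasEndpoints γ p q ∧ HasEndpoints c p q}

/-- The straightening `S(ρ)` of the foliation `𝓕(Δ, ρ)`: the closure in `Σ` of the union of its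
straightened nonsingular leaves. -/
def OneVertexTriangulation.straightening (T : OneVertexTriangulation G) (ρ : AllowedRep G) :
    Set (Surface G) :=
  closure (proj G '' ⋃₀ T.straightenedLeaves ρ)

/-- A leaf `C` through the vertex `v` is a star of `n` prongs which start at `v`, such that any two
different prongs together form a `(K, c)`-quasigeodesic with distinct endpoints. -/
def IsGoodStar (K c : ℝ) (C : Set ℍ) (v : ℍ) (n : ℕ) : Prop :=
  ∃ r : Fin n → ℝ → ℍ, (∀ i, r i 0 = v) ∧ C = ⋃ i, r i '' Ici 0 ∧
    ∀ i j, i ≠ j → IsGoodLine K c fun t => if t ≤ 0 then r i (-t) else r j t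

end FLO

open scoped MatrixGroups ComplexConjugate

open scoped UpperHalfPlane

namespace FLO

/-! ### Continuous logarithms and planar topology -/

/-! An allowed representation orders G by a < b iff ρ(a)(0) < ρ(b)(0). A leaf at height t crosses
exactly those edges, in its sequence of triangles, that join a vertex below t to one above t. Its
combinatorics is therefore governed by a cut A of a left order, and leaves are replaced by
bi-infinite sequences of flags for A (`IsLine`).

The heart of the matter is that these lines are geodesic in the dual graph (`IsLine.abs_sub_le`).
Left invariance makes y ↦ x y⁻¹ x exchange the upper and the lower neighbours of x, so through the
boundary of a finite set of vertices as many edges lead up as down (`flux`). Let a line segment with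
N crossings and a walk of D steps have the same ends and no other triangle of the line in common. As
the plane has no first cohomology modulo two (`exists_coboundary`) and one end
(`finite_or_finite_compl`), they bound a finite set U. The N edges of the line all leave U in the
same direction of the order, so N edges leave it in the opposite direction; only the walk can cross
these, and N ≤ D (`le_of_walk`). Since the dual graph is quasi-isometric to ℍ (`exists_walk_le`),
the leaves are quasigeodesics with uniform constants. At a vertex v one prong starts from each
triangle with middle vertex v; their number is even and positive (`two_le_ncard_isMiddle`). A prong
is a line for the cut just below v and for the cut just above v, and these two lines together keep
it away from the other prongs (`IsProng.lt_length`).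

In the disc model a quasigeodesic outside a large ball is exponentially short
(`exists_norm_cayley_sub_le`). This gives distinct endpoints, a uniform rate of convergence to them,
and a bound on the distance from the geodesic to the quasigeodesic.

To a left order belong the geodesics of all lines of all its cuts (`geodesics`). Cuts are nested, so
two lines can be drawn as disjoint curves; disjoint curves have unlinked endpoints, so the geodesics
do not cross (`gline_eq`). A line depends locally on its cut and the order. Compactness then makes
the union of the geodesics upper semicontinuous in the order (`isClosed_graph`), and finite
agreement makes it lower semicontinuous (`eventually_geodesics_inter`); together this is continuity
in the Vietoris topology. Lines of arbitrary cuts are limits of level lines, hence S(ρ) is the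
lamination of the order of ρ (`straightening_eq`), and it depends on nothing else.

The order of the canonical action is O for every enumeration (`IsCanonicalRep.order_eq`). The action
exists and is unique because the midpoint rule leaves no gap in the image of the minimal embedding
except between neighbours of the order (`exists_gap`), so that the affine pieces are dense and
monotone maps are determined by them. -/

theorem exists_log_of_homotopy {X : Type*} [TopologicalSpace X] (h : unitInterval × X → ℂ)
    (hc : Continuous h) (h0 : ∀ a, h a ≠ 0) (L : X → ℂ) (hL : Continuous L)
    (hexp : ∀ x, Complex.exp (L x) = h (0, x)) :
    ∃ L' : X → ℂ, Continuous L' ∧ ∀ x, Complex.exp (L' x) = h (1, x) := by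
  let H : C(unitInterval × X, {z : ℂ // z ≠ 0}) := ⟨fun a => ⟨h a, h0 a⟩, by fun_prop⟩
  have H0 : ∀ a, H (0, a) = (⟨_, (L a).exp_ne_zero⟩ : {z : ℂ // z ≠ 0}) :=
    fun a => Subtype.ext (hexp a).symm
  let F := Complex.isCoveringMap_exp.liftHomotopy H ⟨L, hL⟩ H0
  refine ⟨fun x => F (1, x), by fun_prop, fun x => ?_⟩
  have := congr_fun (Complex.isCoveringMap_exp.liftHomotopy_lifts H ⟨L, hL⟩ H0) (1, x)
  exact congr_arg Subtype.val this

/-- The difference, divided by 2πi, is a continuous function with integer values. -/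
theorem continuous_log_sub_const {X : Type*} [TopologicalSpace X] [PreconnectedSpace X]
    {L M : X → ℂ} (hL : Continuous L) (hM : Continuous M)
    (h : ∀ x, ∃ n : ℤ, L x - M x = n * (2 * Real.pi * Complex.I)) (x y : X) :
    L x - M x = L y - M y := by
  have hc : Continuous fun x => ((L x - M x) / (2 * Real.pi * Complex.I)).re := by fun_prop
  have hz : (2 * Real.pi * Complex.I) ≠ 0 := Complex.two_pi_I_ne_zero
  have key : ∀ x, ∃ n : ℤ, ((L x - M x) / (2 * Real.pi * Complex.I)).re = n := by
    intro x
    obtain ⟨n, hn⟩ := h x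
    exact ⟨n, by rw [hn, mul_div_cancel_right₀ _ hz]; simp⟩
  choose n hn using h
  have hn' : ∀ x, ((L x - M x) / (2 * Real.pi * Complex.I)).re = n x := by
    intro x
    rw [hn, mul_div_cancel_right₀ _ hz]; simp
  have hcn : Continuous n := by
    have : IsLocallyConstant n := by
      rw [IsLocallyConstant.iff_eventually_eq]
      intro x
      have h1 := hc.continuousAt (x := x)
      have := h1 (Metric.ball_mem_nhds _ one_pos)
      filter_upwards [this] with y hy
      simp only [mem_preimage, Metric.mem_ball, hn', Real.dist_eq] at hy
      have : |n y - n x| < 1 := by exact_mod_cast hy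
      rw [Int.abs_lt_one_iff] at this
      omega
    exact this.continuous
  have : n x = n y := PreconnectedSpace.constant inferInstance hcn
  rw [hn, hn, this]

/-- L(-z) - L(z) is πi plus an integer multiple of 2πi, and it does not depend on z by
connectedness. Comparing z = 1 with z = -1 gives an odd multiple of πi that equals its own negative.
This is the only degree computation in the proof of invariance of domain. -/
theorem not_exists_log_of_odd (g L : Circle → ℂ) (hL : Continuous L)
    (hexp : ∀ z, Complex.exp (L z) = g z) (hodd : ∀ z, g (-z) = - g z) : False := by
  have hlog : ∀ z, ∃ n : ℤ, L (-z) - (L z + Real.pi * Complex.I) = n * (2 * Real.pi * Complex.I) := by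
    intro z
    have : Complex.exp (L (-z)) = Complex.exp (L z + Real.pi * Complex.I) := by
      rw [Complex.exp_add, Complex.exp_pi_mul_I, hexp, hexp, hodd]; ring
    obtain ⟨n, hn⟩ := Complex.exp_eq_exp_iff_exists_int.1 this
    exact ⟨n, by rw [hn]; ring⟩
  have hneg : Continuous fun z : Circle => -z := continuous_neg
  have : PreconnectedSpace Circle := by
    have h : Function.Surjective Circle.exp := fun z => ⟨Complex.arg z, Circle.exp_arg z⟩
    exact ⟨h.range_eq ▸ isPreconnected_range Circle.exp.continuous⟩
  have h2 := continuous_log_sub_const (hL.comp hneg)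
    (M := fun z => L z + Real.pi * Complex.I) (by fun_prop) hlog 1 (-1)
  obtain ⟨n, hn⟩ := hlog 1
  simp only [Function.comp, neg_neg] at h2
  have h3 : ((n : ℂ) * 2 + 1) * (2 * Real.pi * Complex.I) = 0 := by
    linear_combination (-2) * hn + h2
  rcases mul_eq_zero.1 h3 with h | h
  · have h' : ((n * 2 + 1 : ℤ) : ℂ) = 0 := by push_cast; exact h
    have : n * 2 + 1 = 0 := by exact_mod_cast h'
    omega
  · exact Complex.two_pi_I_ne_zero h

/-- Invariance of domain in dimension two. -/
theorem image_closedBall_mem_nhds {f : ℂ → ℂ} {c : ℂ} {r : ℝ} (hr : 0 < r)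
    (hf : ContinuousOn f (Metric.closedBall c r)) (hinj : InjOn f (Metric.closedBall c r)) :
    f '' Metric.closedBall c r ∈ 𝓝 (f c) := by
  have hmem : ∀ (t : ℝ) (z : Circle), |t| ≤ 1 → c + t * r * z ∈ Metric.closedBall c r := by
    intro t z ht
    simp only [Metric.mem_closedBall, dist_eq_norm, add_sub_cancel_left, norm_mul,
      Complex.norm_real, Circle.norm_coe, mul_one, Real.norm_eq_abs, abs_of_pos hr]
    nlinarith
  have hcm : c ∈ Metric.closedBall c r := Metric.mem_closedBall_self hr.le
  have hr0 : (r : ℂ) ≠ 0 := by exact_mod_cast hr.ne'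
  have hcont : ∀ {Y : Type} [TopologicalSpace Y] (t : Y → ℝ) (z : Y → Circle), Continuous t →
      Continuous z → (∀ y, |t y| ≤ 1) → Continuous fun y => f (c + t y * r * z y) := by
    intro Y _ t z ht hz h1
    exact hf.comp_continuous (by fun_prop) (fun y => hmem _ _ (h1 y))
  have hg : Continuous fun z : Circle => f (c + r * z) := by
    simpa using hcont (fun _ : Circle => (1 : ℝ)) id continuous_const continuous_id (by simp)
  have hm1 : ∀ z : Circle, c + r * z ∈ Metric.closedBall c r := by
    intro z; simpa using hmem 1 z (by simp)
  obtain ⟨z0, -, hz0⟩ := (isCompact_univ (X := Circle)).exists_isMinOn ⟨1, mem_univ _⟩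
    (f := fun z => ‖f (c + r * z) - f c‖)
    (hg.sub continuous_const).norm.continuousOn
  have hpos : 0 < ‖f (c + r * z0) - f c‖ := by
    rw [norm_pos_iff, sub_ne_zero]
    intro h
    have := hinj (hm1 z0) hcm h
    simp [hr0] at this
  by_contra hcon
  have : ∃ p, ‖p - f c‖ < ‖f (c + r * z0) - f c‖ ∧ p ∉ f '' Metric.closedBall c r := by
    by_contra! hno
    apply hcon
    filter_upwards [Metric.ball_mem_nhds (f c) hpos] with p hp
    exact hno p (by rwa [Metric.mem_ball, dist_eq_norm] at hp)
  obtain ⟨p, hp, hpn⟩ := this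
  have hI : ∀ t : unitInterval, |(t : ℝ)| ≤ 1 := fun t => by
    rw [abs_of_nonneg t.2.1]; exact t.2.2
  -- Shrinking the circle to its centre inside the ball, whose image misses p, gives a logarithm of
  -- f(c + rz) - p.
  obtain ⟨L1, hL1, e1⟩ := exists_log_of_homotopy
    (fun a : unitInterval × Circle => f (c + (a.1 : ℝ) * r * a.2) - p)
    ((hcont (fun a : unitInterval × Circle => (a.1 : ℝ)) Prod.snd (by fun_prop) (by fun_prop)
      (fun a => hI a.1)).sub continuous_const)
    (fun a h => hpn ⟨_, hmem _ _ (hI a.1), sub_eq_zero.1 h⟩)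
    (fun _ => Complex.log (f c - p)) continuous_const (fun x => by
      rw [Complex.exp_log]
      · simp
      · exact fun h => hpn ⟨_, hcm, sub_eq_zero.1 h⟩)
  -- Moving p to f(c) meets no zero, since p is closer to f(c) than the image of the circle is.
  obtain ⟨L2, hL2, e2⟩ := exists_log_of_homotopy
    (fun a : unitInterval × Circle => f (c + r * a.2) - f c - ((1 - (a.1 : ℝ) : ℝ) : ℂ) * (p - f c))
    (((hg.comp continuous_snd).sub continuous_const).sub (by fun_prop))
    (fun a h => by
      have h1 : ‖f (c + r * a.2) - f c‖ ≤ ‖p - f c‖ := by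
        rw [sub_eq_zero.1 h, norm_mul, Complex.norm_real, Real.norm_eq_abs, abs_of_nonneg
          (by linarith [a.1.2.2])]
        have := a.1.2.1
        nlinarith [norm_nonneg (p - f c)]
      have h2 := hz0 (mem_univ a.2)
      simp only [mem_ofPred_eq] at h2
      linarith)
    L1 hL1 (fun x => by rw [e1]; simp)
  have hpos1 : ∀ a : unitInterval × Circle, (0:ℝ) < 1 + (a.1 : ℝ) := fun a => by
    linarith [a.1.2.1]
  -- The two arguments of f move to c ± rz/2. They stay distinct, so injectivity forbids zeros, and
  -- the final function is odd in z.
  obtain ⟨L3, hL3, e3⟩ := exists_log_of_homotopy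
    (fun a : unitInterval × Circle => f (c + ((1 / (1 + (a.1 : ℝ)) : ℝ) : ℂ) * r * a.2) -
      f (c + ((-(a.1 : ℝ) / (1 + (a.1 : ℝ)) : ℝ) : ℂ) * r * a.2))
    ((hcont (fun a : unitInterval × Circle => (1 / (1 + (a.1 : ℝ)) : ℝ)) Prod.snd
      (by fun_prop (disch := intro a; exact (hpos1 a).ne')) (by fun_prop) (fun a => by
        rw [abs_le, le_div_iff₀ (hpos1 a), div_le_iff₀ (hpos1 a)]
        constructor <;> linarith [a.1.2.1])).sub
      (hcont (fun a : unitInterval × Circle => (-(a.1 : ℝ) / (1 + (a.1 : ℝ)) : ℝ)) Prod.snd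
      (by fun_prop (disch := intro a; exact (hpos1 a).ne')) (by fun_prop) (fun a => by
        rw [abs_le, le_div_iff₀ (hpos1 a), div_le_iff₀ (hpos1 a)]
        constructor <;> linarith [a.1.2.1])))
    (fun a h => by
      have h1 := hinj (hmem _ _ ?_) (hmem _ _ ?_) (sub_eq_zero.1 h)
      · rw [add_right_inj, mul_left_inj' (Circle.coe_ne_zero _), mul_left_inj' hr0,
          Complex.ofReal_inj, div_left_inj' (hpos1 a).ne'] at h1
        linarith [a.1.2.1]
      · rw [abs_le, le_div_iff₀ (hpos1 a), div_le_iff₀ (hpos1 a)]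
        constructor <;> linarith [a.1.2.1]
      · rw [abs_le, le_div_iff₀ (hpos1 a), div_le_iff₀ (hpos1 a)]
        constructor <;> linarith [a.1.2.1])
    L2 hL2 (fun x => by rw [e2]; simp)
  refine not_exists_log_of_odd _ L3 hL3 e3 (fun z => ?_)
  simp only [Set.Icc.coe_one, Circle.coe_neg]
  push_cast
  rw [neg_sub, neg_div, neg_mul, neg_mul, neg_mul, mul_neg, neg_neg]

/-! ### Crossing paths in the disc -/

/-- The extension of a path `γ` on `ℝ` to a path on `[-π/2, π/2]`. -/
noncomputable def compactify (γ : ℝ → ℂ) (p q : ℂ) (x : ℝ) : ℂ :=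
  if x ≤ -(Real.pi / 2) then p else if Real.pi / 2 ≤ x then q else γ (Real.tan x)

theorem continuous_compactify {γ : ℝ → ℂ} {p q : ℂ} (hγ : Continuous γ)
    (hp : Tendsto γ atBot (𝓝 p)) (hq : Tendsto γ atTop (𝓝 q)) :
    Continuous (compactify γ p q) := by
  have hpi := Real.pi_pos
  rw [continuous_iff_continuousAt]
  intro x
  rcases lt_trichotomy x (-(Real.pi / 2)) with h | h | h
  · refine (continuousAt_const (y := p)).congr ?_
    filter_upwards [Iio_mem_nhds h] with y hy
    simp [compactify, (le_of_lt hy : y ≤ _)]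
  · rw [continuousAt_iff_continuous_left'_right']
    have hx : compactify γ p q x = p := by simp [compactify, h.le]
    constructor
    · rw [ContinuousWithinAt, hx]
      refine (tendsto_const_nhds (x := p)).congr' ?_
      filter_upwards [self_mem_nhdsWithin] with y hy
      simp [compactify, ((le_of_lt hy).trans h.le : y ≤ _)]
    · rw [ContinuousWithinAt, hx]
      have h1 : Tendsto Real.tan (𝓝[>] x) atBot := by rw [h]; exact Real.tendsto_tan_neg_pi_div_two
      refine (hp.comp h1).congr' ?_
      have : Ioo x (Real.pi / 2) ∈ 𝓝[>] x := Ioo_mem_nhdsGT (by linarith)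
      filter_upwards [this] with y hy
      simp [compactify, not_le.2 (h ▸ hy.1), not_le.2 hy.2]
  rcases lt_trichotomy x (Real.pi / 2) with h' | h' | h'
  · have : ContinuousAt (fun y => γ (Real.tan y)) x :=
      ContinuousAt.comp hγ.continuousAt (Real.continuousAt_tan.2
        (Real.cos_pos_of_mem_Ioo ⟨h, h'⟩).ne')
    refine this.congr ?_
    filter_upwards [Ioo_mem_nhds h h'] with y hy
    simp [compactify, not_le.2 hy.1, not_le.2 hy.2]
  · rw [continuousAt_iff_continuous_left'_right']
    have hx : compactify γ p q x = q := by
      simp only [compactify, if_neg (not_le.2 h), if_pos h'.ge]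
    constructor
    · rw [ContinuousWithinAt, hx]
      have h1 : Tendsto Real.tan (𝓝[<] x) atTop := by rw [h']; exact Real.tendsto_tan_pi_div_two
      refine (hq.comp h1).congr' ?_
      have : Ioo (-(Real.pi / 2)) x ∈ 𝓝[<] x := Ioo_mem_nhdsLT h
      filter_upwards [this] with y hy
      simp [compactify, not_le.2 hy.1, not_le.2 (h' ▸ hy.2 : y < Real.pi / 2)]
    · rw [ContinuousWithinAt, hx]
      refine (tendsto_const_nhds (x := q)).congr' ?_
      filter_upwards [self_mem_nhdsWithin] with y hy
      have hy' : x < y := hy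
      simp [compactify, not_le.2 (h.trans hy'), (h' ▸ hy'.le : Real.pi / 2 ≤ y)]
  · refine (continuousAt_const (y := q)).congr ?_
    filter_upwards [Ioi_mem_nhds h'] with y hy
    have hy' : Real.pi / 2 < y := hy
    simp only [compactify, if_neg (not_le.2 (by linarith : -(Real.pi/2) < y)), if_pos hy'.le]

/-- A branch of the logarithm of `(p - q) / (q - p)`, up to the rotation that brings `p` to `1` and
`q` to `1`, respectively. -/
noncomputable def linkAngle (p q : ℂ) : ℂ :=
  Complex.log (1 - (starRingEnd ℂ) p * q) - Complex.log (1 - (starRingEnd ℂ) q * p)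

/-- Positivity of the real part keeps these numbers where the principal logarithm is continuous,
which is what makes `linkAngle` usable. -/
theorem one_sub_conj_mul_re_pos {p w : ℂ} (hp : ‖p‖ = 1) (hw : ‖w‖ ≤ 1) (hne : w ≠ p) :
    0 < (1 - (starRingEnd ℂ) p * w).re := by
  have h1 : p.re ^ 2 + p.im ^ 2 = 1 := by
    have := Complex.sq_norm p
    rw [hp, Complex.normSq_apply] at this; nlinarith
  have h2 : w.re ^ 2 + w.im ^ 2 ≤ 1 := by
    have := Complex.sq_norm w
    rw [Complex.normSq_apply] at this
    nlinarith [norm_nonneg w]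
  have h3 : (w.re - p.re) ^ 2 + (w.im - p.im) ^ 2 ≠ 0 := by
    intro h
    apply hne
    have ha : w.re - p.re = 0 := by nlinarith [sq_nonneg (w.re - p.re), sq_nonneg (w.im - p.im)]
    have hb : w.im - p.im = 0 := by nlinarith [sq_nonneg (w.re - p.re), sq_nonneg (w.im - p.im)]
    exact Complex.ext (by linarith) (by linarith)
  have h4 : 0 < (w.re - p.re) ^ 2 + (w.im - p.im) ^ 2 := lt_of_le_of_ne (by positivity) h3.symm
  simp
  nlinarith

/-- Disjoint paths in the disc have unlinked endpoints. -/
theorem linkAngle_add_linkAngle {γ γ' : ℝ → ℂ} {p q p' q' : ℂ}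
    (hγ : Continuous γ) (hγ' : Continuous γ') (h1 : ∀ s, ‖γ s‖ < 1) (h1' : ∀ s, ‖γ' s‖ < 1)
    (hp : Tendsto γ atBot (𝓝 p)) (hq : Tendsto γ atTop (𝓝 q))
    (hp' : Tendsto γ' atBot (𝓝 p')) (hq' : Tendsto γ' atTop (𝓝 q'))
    (np : ‖p‖ = 1) (nq : ‖q‖ = 1) (np' : ‖p'‖ = 1) (nq' : ‖q'‖ = 1)
    (hpp' : p ≠ p') (hpq' : p ≠ q') (hqp' : q ≠ p') (hqq' : q ≠ q')
    (hdis : ∀ s t, γ s ≠ γ' t) :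
    linkAngle p p' + linkAngle q q' = linkAngle p q' + linkAngle q p' := by
  have hpi := Real.pi_pos
  set e := compactify γ p q with he
  set e' := compactify γ' p' q' with he'
  have hc : Continuous e := continuous_compactify hγ hp hq
  have hc' : Continuous e' := continuous_compactify hγ' hp' hq'
  have hnorm : ∀ x, ‖e x‖ ≤ 1 := by
    intro x; simp only [he, compactify]; split_ifs
    exacts [np.le, nq.le, (h1 _).le]
  have hnorm' : ∀ x, ‖e' x‖ ≤ 1 := by
    intro x; simp only [he', compactify]; split_ifs
    exacts [np'.le, nq'.le, (h1' _).le]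
  have hne : ∀ x y, e x ≠ e' y := by
    intro x y
    simp only [he, he', compactify]
    have A : ∀ {a b : ℂ}, ‖a‖ = 1 → ‖b‖ < 1 → a ≠ b := by
      rintro a b ha hb rfl; linarith
    split_ifs
    exacts [hpp', hpq', A np (h1' _), hqp', hqq', A nq (h1' _), (A np' (h1 _)).symm,
      (A nq' (h1 _)).symm, hdis _ _]
  -- The parameters ±2 lie beyond ±π/2, where the compactified paths have already reached their
  -- endpoints.
  have ep : e (-2) = p := by
    have : Real.pi / 2 ≤ 2 := by linarith [Real.pi_le_four]
    simp [he, compactify, this]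
  have eq : e 2 = q := by
    have : Real.pi / 2 ≤ 2 := by linarith [Real.pi_le_four]
    have h2 : ¬ ((2:ℝ) ≤ -(Real.pi / 2)) := by linarith
    simp only [he, compactify, if_neg h2, if_pos this]
  have ep' : e' (-2) = p' := by
    have : Real.pi / 2 ≤ 2 := by linarith [Real.pi_le_four]
    simp [he', compactify, this]
  have eq' : e' 2 = q' := by
    have : Real.pi / 2 ≤ 2 := by linarith [Real.pi_le_four]
    have h2 : ¬ ((2:ℝ) ≤ -(Real.pi / 2)) := by linarith
    simp only [he', compactify, if_neg h2, if_pos this]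
  let f : C(ℝ × ℝ, {z : ℂ // z ≠ 0}) :=
    ⟨fun a => ⟨e a.1 - e' a.2, sub_ne_zero.2 (hne _ _)⟩, by fun_prop⟩
  -- The difference of the two paths never vanishes and is parametrized by the simply connected
  -- plane, so it has a global logarithm F.
  obtain ⟨F, ⟨-, hF⟩, -⟩ := Complex.isCoveringMap_exp.existsUnique_continuousMap_lifts f (0, 0)
    (Complex.log (f (0, 0)).1) (Subtype.ext (Complex.exp_log (f (0, 0)).2))
  have hF' : ∀ s t, Complex.exp (F (s, t)) = e s - e' t := fun s t =>
    congr_arg Subtype.val (congr_fun hF (s, t))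
  -- On a side of the square [-2, 2]² one of the paths rests at a point z of the circle. There F is,
  -- up to a constant, the principal logarithm of 1 - z̄ g, so its increment along the side is an
  -- expression in the endpoints alone.
  have side : ∀ (z : ℂ) (g : ℝ → ℂ) (L : ℝ → ℂ) (κ : ℂ), ‖z‖ = 1 → Continuous g →
      (∀ t, ‖g t‖ ≤ 1) → (∀ t, g t ≠ z) → Continuous L → κ ≠ 0 →
      (∀ t, Complex.exp (L t) = κ * (z - g t)) →
      L (-2) - Complex.log (1 - (starRingEnd ℂ) z * g (-2)) =
        L 2 - Complex.log (1 - (starRingEnd ℂ) z * g 2) := by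
    intro z g L κ hz hg hg1 hgz hL hκ hexp
    have hre := fun t => one_sub_conj_mul_re_pos hz (hg1 t) (hgz t)
    have hzz : z * (starRingEnd ℂ) z = 1 := by
      rw [Complex.mul_conj, Complex.normSq_eq_norm_sq, hz]; simp
    have hz0 : z ≠ 0 := by rintro rfl; simp at hz
    have hlog : Continuous fun t => Complex.log (1 - (starRingEnd ℂ) z * g t) := by
      rw [continuous_iff_continuousAt]
      intro t
      exact ContinuousAt.clog (by fun_prop) (Or.inl (hre t))
    have := continuous_log_sub_const hL
      (M := fun t => Complex.log (1 - (starRingEnd ℂ) z * g t) + Complex.log (κ * z))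
      (hlog.add continuous_const)
      (fun t => by
        have h3 : (1 - (starRingEnd ℂ) z * g t) ≠ 0 := by
          intro h; have := hre t; rw [h] at this; simp at this
        have : Complex.exp (L t) = Complex.exp
            (Complex.log (1 - (starRingEnd ℂ) z * g t) + Complex.log (κ * z)) := by
          rw [hexp, Complex.exp_add, Complex.exp_log h3, Complex.exp_log (mul_ne_zero hκ hz0)]
          linear_combination κ * g t * hzz
        obtain ⟨n, hn⟩ := Complex.exp_eq_exp_iff_exists_int.1 this
        exact ⟨n, by rw [hn]; ring⟩) (-2) 2
    linear_combination this
  have s1 := side p e' (fun t => F (-2, t)) 1 np hc' hnorm' (fun t => ep ▸ (hne _ _).symm)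
    (by fun_prop) one_ne_zero (fun t => by rw [hF', ep, one_mul])
  have s2 := side q e' (fun t => F (2, t)) 1 nq hc' hnorm' (fun t => eq ▸ (hne _ _).symm)
    (by fun_prop) one_ne_zero (fun t => by rw [hF', eq, one_mul])
  have s3 := side p' e (fun t => F (t, -2)) (-1) np' hc hnorm (fun t => ep' ▸ hne _ _)
    (by fun_prop) (by norm_num) (fun t => by rw [hF', ep']; ring)
  have s4 := side q' e (fun t => F (t, 2)) (-1) nq' hc hnorm (fun t => eq' ▸ hne _ _)
    (by fun_prop) (by norm_num) (fun t => by rw [hF', eq']; ring)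
  simp only [ep, eq, ep', eq'] at s1 s2 s3 s4
  simp only [linkAngle]
  -- The increments of F around the boundary of the square add up to zero.
  linear_combination -s1 + s2 + s3 - s4

/-- For antipodal pairs the four angles agree in pairs, so equality would give `linkAngle p p' =
linkAngle p (-p')`; the exponentials of these are opposite nonzero numbers. Hence two different
diameters are linked. -/
theorem linkAngle_antipodal_ne {p p' : ℂ} (np : ‖p‖ = 1) (np' : ‖p'‖ = 1) (h1 : p ≠ p')
    (h2 : p ≠ -p') : linkAngle p p' + linkAngle (-p) (-p') ≠
      linkAngle p (-p') + linkAngle (-p) p' := by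
  intro h
  have e : ∀ {x y : ℂ}, ‖x‖ = 1 → ‖y‖ = 1 → x ≠ y →
      Complex.exp (linkAngle x y) = - (starRingEnd ℂ x * y) := by
    intro x y hx hy hxy
    have a1 : (1 - (starRingEnd ℂ) x * y) ≠ 0 := fun h => by
      have := one_sub_conj_mul_re_pos hx hy.le hxy.symm
      rw [h] at this; simp at this
    have a2 : (1 - (starRingEnd ℂ) y * x) ≠ 0 := fun h => by
      have := one_sub_conj_mul_re_pos hy hx.le hxy
      rw [h] at this; simp at this
    have hxx : x * (starRingEnd ℂ) x = 1 := by
      rw [Complex.mul_conj, Complex.normSq_eq_norm_sq, hx]; simp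
    have hyy : y * (starRingEnd ℂ) y = 1 := by
      rw [Complex.mul_conj, Complex.normSq_eq_norm_sq, hy]; simp
    rw [linkAngle, Complex.exp_sub, Complex.exp_log a1, Complex.exp_log a2, div_eq_iff a2]
    linear_combination -(y * (starRingEnd ℂ) y) * hxx - hyy
  have h' : linkAngle p p' = linkAngle p (-p') := by
    simp only [linkAngle, map_neg, mul_neg, neg_mul, neg_neg] at h ⊢
    linear_combination h / 2
  have := congr_arg Complex.exp h'
  rw [e np np' h1, e np (by simpa using np') h2] at this
  have h0 : (starRingEnd ℂ) p * p' = 0 := by linear_combination (-1/2) * this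
  have : ‖(starRingEnd ℂ) p * p'‖ = 1 := by simp [np, np']
  rw [h0] at this
  simp at this

/-! ### The Cayley transform -/

theorem coe_add_I_ne_zero (z : ℍ) : (z : ℂ) + Complex.I ≠ 0 := by
  intro h
  have := congr_arg Complex.im h
  simp at this
  linarith [z.im_pos]

theorem continuous_cayley : Continuous cayley := by
  unfold cayley
  exact Continuous.div (by fun_prop) (by fun_prop) coe_add_I_ne_zero

theorem cayley_I : cayley UpperHalfPlane.I = 0 := by simp [cayley]

theorem one_sub_normSq_cayley (z : ℍ) :
    1 - ‖cayley z‖ ^ 2 = 4 * z.im / ‖(z : ℂ) + Complex.I‖ ^ 2 := by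
  have h := coe_add_I_ne_zero z
  have h1 : ‖(z : ℂ) + Complex.I‖ ^ 2 ≠ 0 := by simpa using h
  rw [cayley, norm_div, div_pow, eq_div_iff h1, sub_mul, div_mul_cancel₀ _ h1, Complex.sq_norm,
    Complex.sq_norm]
  simp [Complex.normSq_apply]
  ring

theorem norm_cayley_lt_one (z : ℍ) : ‖cayley z‖ < 1 := by
  have h1 : 0 < 4 * z.im / ‖(z : ℂ) + Complex.I‖ ^ 2 := by
    have := norm_pos_iff.2 (coe_add_I_ne_zero z)
    have := z.im_pos
    positivity
  rw [← one_sub_normSq_cayley] at h1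
  nlinarith [norm_nonneg (cayley z)]

theorem cosh_half_dist_I (z : ℍ) :
    Real.cosh (dist z UpperHalfPlane.I / 2) = ‖(z : ℂ) + Complex.I‖ / (2 * √z.im) := by
  rw [UpperHalfPlane.cosh_half_dist]
  simp [dist_eq_norm]

theorem one_sub_normSq_cayley' (z : ℍ) :
    1 - ‖cayley z‖ ^ 2 = 1 / Real.cosh (dist z UpperHalfPlane.I / 2) ^ 2 := by
  rw [one_sub_normSq_cayley, cosh_half_dist_I, div_pow, mul_pow, Real.sq_sqrt z.im_pos.le]
  have := norm_pos_iff.2 (coe_add_I_ne_zero z)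
  have := z.im_pos
  field_simp
  norm_num

/-- All comparisons between hyperbolic distance and Euclidean distance in the disc go through this
formula. -/
theorem norm_cayley_sub (z w : ℍ) : ‖cayley z - cayley w‖ = Real.sinh (dist z w / 2) /
    (Real.cosh (dist z UpperHalfPlane.I / 2) * Real.cosh (dist w UpperHalfPlane.I / 2)) := by
  have h1 := coe_add_I_ne_zero z
  have h2 := coe_add_I_ne_zero w
  have e : cayley z - cayley w = 2 * Complex.I * (z - w) /
      (((z : ℂ) + Complex.I) * ((w : ℂ) + Complex.I)) := by
    rw [cayley, cayley]; field_simp; ring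
  have := z.im_pos
  have := w.im_pos
  have := norm_pos_iff.2 h1
  have := norm_pos_iff.2 h2
  rw [e, cosh_half_dist_I, cosh_half_dist_I, UpperHalfPlane.sinh_half_dist,
    Real.sqrt_mul z.im_pos.le]
  simp only [norm_div, norm_mul, Complex.norm_I, Complex.norm_ofNat, dist_eq_norm]
  field_simp

theorem norm_cayley (z : ℍ) : ‖cayley z‖ = Real.tanh (dist z UpperHalfPlane.I / 2) := by
  have := norm_cayley_sub z UpperHalfPlane.I
  rw [cayley_I, sub_zero] at this
  rw [this, Real.tanh_eq_sinh_div_cosh]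
  simp

theorem cayley_injective : Function.Injective cayley := by
  intro z w h
  have := norm_cayley_sub z w
  rw [h, sub_self, norm_zero, eq_comm, div_eq_zero_iff] at this
  rcases this with h | h
  · rw [Real.sinh_eq_zero] at h
    exact dist_eq_zero.1 (by linarith)
  · have := Real.cosh_pos (dist z UpperHalfPlane.I / 2)
    have := Real.cosh_pos (dist w UpperHalfPlane.I / 2)
    exact absurd h (by positivity)

/-- The inverse of the Cayley transform. -/
noncomputable def invCayley (w : ℂ) (hw : ‖w‖ < 1) : ℍ :=
  ⟨Complex.I * (1 + w) / (1 - w), by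
    have h1 : w.re ^ 2 + w.im ^ 2 < 1 := by
      have := Complex.sq_norm w
      rw [Complex.normSq_apply] at this
      nlinarith [norm_nonneg w]
    have h2 : (1 - w) ≠ 0 := by
      rintro h
      have : w = 1 := by linear_combination -h
      rw [this] at hw; simp at hw
    have h3 := Complex.normSq_pos.2 h2
    rw [Complex.div_im]
    have : 0 < (1 - w.re ^ 2 - w.im ^ 2) / Complex.normSq (1 - w) :=
      div_pos (by linarith) h3
    convert this using 1
    field_simp
    simp
    ring⟩

theorem cayley_invCayley (w : ℂ) (hw : ‖w‖ < 1) : cayley (invCayley w hw) = w := by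
  have h2 : (1 - w) ≠ 0 := by
    rintro h
    have : w = 1 := by linear_combination -h
    rw [this] at hw; simp at hw
  simp only [cayley, invCayley]
  have : Complex.I * (1 + w) / (1 - w) - Complex.I = 2 * Complex.I * w / (1 - w) := by
    field_simp; ring
  rw [this]
  have : Complex.I * (1 + w) / (1 - w) + Complex.I = 2 * Complex.I / (1 - w) := by
    field_simp; ring
  rw [this]
  field_simp

theorem invCayley_cayley (z : ℍ) : invCayley (cayley z) (norm_cayley_lt_one z) = z :=
  cayley_injective (cayley_invCayley _ _)

/-! ### The action of `SL(2, ℝ)` on the disc and on the circle at infinity -/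

/-- The coefficient `α` of the Möbius transformation `(α w + β) / (β̄ w + ᾱ)`. -/
noncomputable def mobA (A : SL(2, ℝ)) : ℂ := ⟨(A 0 0 + A 1 1) / 2, (A 0 1 - A 1 0) / 2⟩

/-- The coefficient `β` of the Möbius transformation `(α w + β) / (β̄ w + ᾱ)`. -/
noncomputable def mobB (A : SL(2, ℝ)) : ℂ := ⟨(A 0 0 - A 1 1) / 2, -(A 0 1 + A 1 0) / 2⟩

theorem sl_det (A : SL(2, ℝ)) : A 0 0 * A 1 1 - A 0 1 * A 1 0 = 1 := by
  rw [← Matrix.det_fin_two]; exact A.2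

theorem mob_det (A : SL(2, ℝ)) : mobA A * conj (mobA A) - mobB A * conj (mobB A) = 1 := by
  have := sl_det A
  apply Complex.ext
  · simp [mobA, mobB]
    linear_combination this
  · simp [mobA, mobB]
    ring

theorem mob_denom_ne_zero (A : SL(2, ℝ)) {w : ℂ} (hw : ‖w‖ ≤ 1) :
    conj (mobB A) * w + conj (mobA A) ≠ 0 := by
  intro h
  have h1 : ‖mobA A‖ ^ 2 - ‖mobB A‖ ^ 2 = 1 := by
    have := mob_det A
    rw [Complex.mul_conj, Complex.mul_conj, Complex.normSq_eq_norm_sq,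
      Complex.normSq_eq_norm_sq] at this
    exact_mod_cast this
  have h2 : ‖mobA A‖ = ‖mobB A‖ * ‖w‖ := by
    have : conj (mobA A) = - (conj (mobB A) * w) := by linear_combination h
    have := congr_arg norm this
    simpa using this
  have h3 : ‖mobA A‖ ≤ ‖mobB A‖ := by
    rw [h2]; nlinarith [norm_nonneg (mobB A), norm_nonneg w]
  nlinarith [norm_nonneg (mobA A), norm_nonneg (mobB A)]

/-- The Cayley transform conjugates SL(2, ℝ) to SU(1, 1), whose elements extend to the closed disc.
-/
theorem cayley_smul (A : SL(2, ℝ)) (z : ℍ) :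
    cayley (A • z) = (mobA A * cayley z + mobB A) / (conj (mobB A) * cayley z + conj (mobA A)) := by
  have h0 := coe_add_I_ne_zero z
  have h1 := mob_denom_ne_zero A (norm_cayley_lt_one z).le
  have h2 : ((A 1 0 : ℂ) * z + A 1 1) ≠ 0 := by
    have := UpperHalfPlane.denom_ne_zero (A : GL (Fin 2) ℝ) z
    simpa [UpperHalfPlane.denom] using this
  have h3 := coe_add_I_ne_zero (A • z)
  have hd : ((A 0 0 : ℂ) * A 1 1 - A 0 1 * A 1 0) = 1 := by exact_mod_cast sl_det A
  have eA : mobA A = ((A 0 0 + A 1 1 : ℂ) + (A 0 1 - A 1 0) * Complex.I) / 2 := by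
    apply Complex.ext <;> simp [mobA]
  have eB : mobB A = ((A 0 0 - A 1 1 : ℂ) - (A 0 1 + A 1 0) * Complex.I) / 2 := by
    apply Complex.ext <;> simp [mobB]
  have eA' : conj (mobA A) = ((A 0 0 + A 1 1 : ℂ) - (A 0 1 - A 1 0) * Complex.I) / 2 := by
    apply Complex.ext
    · simp [mobA]
    · simp [mobA]; ring
  have eB' : conj (mobB A) = ((A 0 0 - A 1 1 : ℂ) + (A 0 1 + A 1 0) * Complex.I) / 2 := by
    apply Complex.ext <;> simp [mobB]; ring
  rw [eA', eB'] at h1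
  rw [eA', eB', eA, eB]
  unfold cayley at h1 ⊢
  rw [UpperHalfPlane.coe_specialLinearGroup_apply] at h3 ⊢
  simp only [Algebra.algebraMap_self, RingHom.id_apply] at h3 ⊢
  have n1 : ((A 0 0 : ℂ) * z + A 0 1) / ((A 1 0 : ℂ) * z + A 1 1) - Complex.I =
      (((A 0 0 : ℂ) * z + A 0 1) - Complex.I * ((A 1 0 : ℂ) * z + A 1 1)) /
        ((A 1 0 : ℂ) * z + A 1 1) := by rw [sub_div, mul_div_assoc, div_self h2, mul_one]
  have n2 : ((A 0 0 : ℂ) * z + A 0 1) / ((A 1 0 : ℂ) * z + A 1 1) + Complex.I =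
      (((A 0 0 : ℂ) * z + A 0 1) + Complex.I * ((A 1 0 : ℂ) * z + A 1 1)) /
        ((A 1 0 : ℂ) * z + A 1 1) := by
    rw [add_div _ (Complex.I * _), mul_div_assoc, div_self h2, mul_one]
  have h3' : ((A 0 0 : ℂ) * z + A 0 1) + Complex.I * ((A 1 0 : ℂ) * z + A 1 1) ≠ 0 := by
    intro h
    apply h3
    rw [n2, h, zero_div]
  rw [n1, n2, div_div_div_cancel_right₀ h2, div_eq_div_iff h3' h1]
  field_simp
  have hI := Complex.I_sq
  ring_nf
  simp only [Complex.I_sq, Complex.I_pow_three]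
  ring_nf

theorem norm_mob (A : SL(2, ℝ)) (p : Circle) :
    ‖(mobA A * p + mobB A) / (conj (mobB A) * p + conj (mobA A))‖ = 1 := by
  have h := mob_denom_ne_zero A (Circle.norm_coe p).le
  rw [norm_div, div_eq_one_iff_eq (norm_ne_zero_iff.2 h)]
  have hp : (p : ℂ) * conj (p : ℂ) = 1 := by
    rw [Complex.mul_conj, Circle.normSq_coe]; simp
  have e : mobA A * p + mobB A = p * conj (conj (mobB A) * p + conj (mobA A)) := by
    simp only [map_add, map_mul, Complex.conj_conj]
    linear_combination -mobB A * hp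
  rw [e, norm_mul, Circle.norm_coe, one_mul, RCLike.norm_conj]

/-- The action of `SL(2, ℝ)` on the circle at infinity. -/
noncomputable def bdry (A : SL(2, ℝ)) (p : Circle) : Circle :=
  ⟨(mobA A * p + mobB A) / (conj (mobB A) * p + conj (mobA A)),
    mem_sphere_zero_iff_norm.2 (norm_mob A p)⟩

theorem coe_bdry (A : SL(2, ℝ)) (p : Circle) :
    (bdry A p : ℂ) = (mobA A * p + mobB A) / (conj (mobB A) * p + conj (mobA A)) := rfl

theorem continuous_bdry (A : SL(2, ℝ)) : Continuous (bdry A) := by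
  refine Continuous.subtype_mk ?_ _
  exact Continuous.div (by fun_prop) (by fun_prop)
    (fun p => mob_denom_ne_zero A (Circle.norm_coe p).le)

theorem tendsto_cayley_smul {ι : Type*} {l : Filter ι} {z : ι → ℍ} {p : Circle} (A : SL(2, ℝ))
    (h : Tendsto (fun n => cayley (z n)) l (𝓝 (p : ℂ))) :
    Tendsto (fun n => cayley (A • z n)) l (𝓝 (bdry A p : ℂ)) := by
  simp only [cayley_smul, coe_bdry]
  exact Tendsto.div ((h.const_mul _).add_const _) ((h.const_mul _).add_const _)
    (mob_denom_ne_zero A (Circle.norm_coe p).le)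

/-- Lets identities for the action on ℍ pass to the boundary circle by a limit, without computing
with the coefficients. -/
theorem exists_tendsto_boundary (p : Circle) :
    ∃ z : ℕ → ℍ, Tendsto (fun n => cayley (z n)) atTop (𝓝 (p : ℂ)) := by
  have hn : ∀ n : ℕ, ‖((n / (n + 1) : ℝ) : ℂ) * p‖ < 1 := by
    intro n
    rw [norm_mul, Circle.norm_coe, mul_one, Complex.norm_real, Real.norm_eq_abs,
      abs_of_nonneg (by positivity), div_lt_one (by positivity)]
    linarith
  refine ⟨fun n => invCayley _ (hn n), ?_⟩
  simp only [cayley_invCayley]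
  have h1 : Tendsto (fun n : ℕ => (n / (n + 1) : ℝ)) atTop (𝓝 1) := tendsto_natCast_div_add_atTop 1
  have h2 := ((Complex.continuous_ofReal.tendsto 1).comp h1).mul_const (p : ℂ)
  simpa using h2

theorem bdry_mul (A B : SL(2, ℝ)) (p : Circle) : bdry (A * B) p = bdry A (bdry B p) := by
  obtain ⟨z, hz⟩ := exists_tendsto_boundary p
  have h1 := tendsto_cayley_smul (A * B) hz
  have h2 := tendsto_cayley_smul A (tendsto_cayley_smul B hz)
  simp only [mul_smul] at h1
  exact Circle.ext (tendsto_nhds_unique h1 h2)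

theorem bdry_one (p : Circle) : bdry 1 p = p := by
  obtain ⟨z, hz⟩ := exists_tendsto_boundary p
  have h1 := tendsto_cayley_smul 1 hz
  simp only [one_smul] at h1
  exact Circle.ext (tendsto_nhds_unique h1 hz)

theorem bdry_inv_bdry (A : SL(2, ℝ)) (p : Circle) : bdry A⁻¹ (bdry A p) = p := by
  rw [← bdry_mul, inv_mul_cancel, bdry_one]

theorem exists_mob (α β : ℂ) (h : α * conj α - β * conj β = 1) :
    ∃ A : SL(2, ℝ), mobA A = α ∧ mobB A = β := by
  have h' : α.re ^ 2 + α.im ^ 2 - β.re ^ 2 - β.im ^ 2 = 1 := by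
    have := congr_arg Complex.re h
    simp at this; linarith
  refine ⟨⟨!![α.re + β.re, α.im - β.im; -α.im - β.im, α.re - β.re], ?_⟩, ?_, ?_⟩
  · rw [Matrix.det_fin_two_of]; linarith
  · apply Complex.ext <;> simp [mobA]
  · apply Complex.ext <;> simp [mobB]

/-- Rotation by u has the coefficients α = v, β = 0 with v² = u, hence the half angle. -/
theorem exists_sl_rotate (u : Circle) : ∃ A : SL(2, ℝ), (∀ z : ℍ, cayley (A • z) = u * cayley z) ∧
    A • UpperHalfPlane.I = UpperHalfPlane.I := by
  obtain ⟨θ, hθ⟩ := Circle.exp_surjective u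
  set v : ℂ := (Circle.exp (θ / 2) : ℂ) with hv
  have hvv : v * conj v = 1 := by rw [Complex.mul_conj, Circle.normSq_coe]; simp
  have hv2 : v * v = u := by
    rw [hv, ← hθ, ← Circle.coe_mul, ← Circle.exp_add]; congr; ring
  obtain ⟨A, hA, hB⟩ := exists_mob v 0 (by simpa using hvv)
  have key : ∀ z : ℍ, cayley (A • z) = u * cayley z := by
    intro z
    have hv0 : conj v ≠ 0 := fun h => by rw [h] at hvv; simp at hvv
    rw [cayley_smul, hA, hB]
    simp only [map_zero, zero_mul, add_zero, zero_add]
    rw [div_eq_iff hv0]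
    linear_combination (-(v * cayley z)) * hvv + conj v * cayley z * hv2
  refine ⟨A, key, cayley_injective ?_⟩
  rw [key, cayley_I, mul_zero]

/-! ### Geodesics -/

/-- The point at signed distance `t` from `i` on the imaginary axis. -/
noncomputable def axis (t : ℝ) : ℍ := ⟨⟨0, Real.exp t⟩, Real.exp_pos t⟩

theorem isometry_axis : Isometry axis := UpperHalfPlane.isometry_vertical_line 0

theorem axis_zero : axis 0 = UpperHalfPlane.I := by
  ext; simp [axis, Complex.ext_iff]

theorem coe_axis (t : ℝ) : (axis t : ℂ) = (Real.exp t : ℝ) * Complex.I := by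
  apply Complex.ext <;> simp [axis, Complex.exp_ofReal_re]

theorem cayley_axis (t : ℝ) : cayley (axis t) = ((1 - 2 / (Real.exp t + 1) : ℝ) : ℂ) := by
  have : (Real.exp t + 1) ≠ 0 := by positivity
  have h2 : ((Real.exp t : ℂ) + 1) ≠ 0 := by exact_mod_cast this
  rw [cayley, coe_axis]
  have e1 : (Real.exp t : ℂ) * Complex.I - Complex.I = ((Real.exp t : ℂ) - 1) * Complex.I := by ring
  have e2 : (Real.exp t : ℂ) * Complex.I + Complex.I = ((Real.exp t : ℂ) + 1) * Complex.I := by ring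
  rw [e1, e2, mul_div_mul_right _ _ Complex.I_ne_zero]
  push_cast at h2 ⊢
  field_simp
  ring

theorem hasEndpoints_axis : HasEndpoints axis (-1) 1 := by
  constructor
  · have h : Tendsto (fun t : ℝ => (1 - 2 / (Real.exp t + 1) : ℝ)) atBot (𝓝 (1 - 2 / (0 + 1))) :=
      (tendsto_const_nhds).sub (Tendsto.div tendsto_const_nhds
        (Real.tendsto_exp_atBot.add_const 1) (by norm_num))
    have h2 := (Complex.continuous_ofReal.tendsto _).comp h
    norm_num at h2
    simpa [ConvergesToBoundary, cayley_axis, Function.comp_def] using h2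
  · have h : Tendsto (fun t : ℝ => (1 - 2 / (Real.exp t + 1) : ℝ)) atTop (𝓝 (1 - 0)) :=
      (tendsto_const_nhds).sub (Tendsto.div_atTop tendsto_const_nhds
        (tendsto_atTop_add_const_right _ _ Real.tendsto_exp_atTop))
    have h2 := (Complex.continuous_ofReal.tendsto _).comp h
    simpa [ConvergesToBoundary, cayley_axis, Function.comp_def] using h2

theorem exists_smul_eq_axis (x y : ℍ) : ∃ A : SL(2, ℝ), A • x = UpperHalfPlane.I ∧
    A • y = axis (dist x y) := by
  obtain ⟨B, hB⟩ := MulAction.exists_smul_eq SL(2, ℝ) x UpperHalfPlane.I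
  obtain ⟨u, hu⟩ : ∃ u : Circle, u * cayley (B • y) = (‖cayley (B • y)‖ : ℂ) := by
    by_cases h : cayley (B • y) = 0
    · exact ⟨1, by simp [h]⟩
    · have hn : (‖cayley (B • y)‖ : ℂ) ≠ 0 := by simpa using h
      refine ⟨⟨(‖cayley (B • y)‖ : ℂ) / cayley (B • y), mem_sphere_zero_iff_norm.2 ?_⟩, ?_⟩
      · simp [h]
      · exact div_mul_cancel₀ _ h
  obtain ⟨R, hR, hRI⟩ := exists_sl_rotate u
  refine ⟨R * B, by rw [mul_smul, hB, hRI], cayley_injective ?_⟩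
  rw [mul_smul, hR, hu, cayley_axis, norm_cayley]
  have : dist (B • y) UpperHalfPlane.I = dist x y := by
    rw [← hB, dist_smul, dist_comm]
  rw [this, Real.tanh_eq]
  congr 1
  have e1 : Real.exp (dist x y) = Real.exp (dist x y / 2) * Real.exp (dist x y / 2) := by
    rw [← Real.exp_add]; congr 1; ring
  have e2 : Real.exp (-(dist x y / 2)) * Real.exp (dist x y / 2) = 1 := by
    rw [← Real.exp_add]; simp
  have p1 := Real.exp_pos (dist x y / 2)
  have p2 := Real.exp_pos (-(dist x y / 2))
  rw [e1]
  generalize Real.exp (dist x y / 2) = a at *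
  generalize Real.exp (-(dist x y / 2)) = b at *
  rw [eq_comm, sub_div' (by positivity), div_eq_div_iff (by positivity) (by positivity)]
  linear_combination (2*a) * e2

/-- After c(0) and c(1) are moved to the axis, c(t) has the distances |t| and |t - 1| from two
points of it; the two cosh formulas then force real part 0 and imaginary part eᵗ. -/
theorem isometry_eq_smul_axis {c : ℝ → ℍ} (hc : Isometry c) :
    ∃ A : SL(2, ℝ), ∀ t, c t = A • axis t := by
  obtain ⟨A, h0, h1⟩ := exists_smul_eq_axis (c 0) (c 1)
  rw [hc.dist_eq] at h1
  have h1' : A • c 1 = axis 1 := by rw [h1]; norm_num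
  refine ⟨A⁻¹, fun t => ?_⟩
  rw [eq_inv_smul_iff]
  have d0 : dist (A • c t) (axis 0) = |t| := by
    rw [axis_zero, ← h0, dist_smul, hc.dist_eq, Real.dist_eq, sub_zero]
  have d1 : dist (A • c t) (axis 1) = |t - 1| := by
    rw [← h1', dist_smul, hc.dist_eq, Real.dist_eq]
  set z := A • c t with hz
  have c0 : Real.cosh (dist z (axis 0)) = 1 + (z.re ^ 2 + (z.im - 1) ^ 2) / (2 * z.im) := by
    rw [UpperHalfPlane.cosh_dist, Complex.dist_eq, Complex.sq_norm, Complex.normSq_apply]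
    simp [axis]; ring
  have c1 : Real.cosh (dist z (axis 1)) =
      1 + (z.re ^ 2 + (z.im - Real.exp 1) ^ 2) / (2 * z.im * Real.exp 1) := by
    rw [UpperHalfPlane.cosh_dist, Complex.dist_eq, Complex.sq_norm, Complex.normSq_apply]
    simp [axis]; ring
  rw [d0, Real.cosh_abs, Real.cosh_eq] at c0
  rw [d1, Real.cosh_abs, Real.cosh_eq] at c1
  have e1 : Real.exp (t - 1) = Real.exp t / Real.exp 1 := Real.exp_sub _ _
  have e2 : Real.exp (-(t - 1)) = Real.exp 1 / Real.exp t := by rw [← Real.exp_sub]; congr 1; ring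
  have e3 : Real.exp (-t) = 1 / Real.exp t := by rw [Real.exp_neg]; simp
  rw [e1, e2] at c1
  rw [e3] at c0
  have hy := z.im_pos
  have he : 1 < Real.exp 1 := by simp
  have hE := Real.exp_pos t
  set e := Real.exp 1
  set E := Real.exp t with hEdef
  field_simp at c0 c1
  have key : (z.im - E) * (e ^ 2 - 1) = 0 := by
    apply mul_left_cancel₀ hE.ne'
    nlinarith
  have him : z.im = E := by
    rcases mul_eq_zero.1 key with h | h
    · linarith
    · nlinarith
  rw [him] at c0
  have hre : z.re = 0 := by
    have : z.re ^ 2 = 0 := by nlinarith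
    simpa using this
  apply UpperHalfPlane.ext
  apply Complex.ext
  · simp [axis, hre]
  · simpa [axis] using him

/-- The set of points of the geodesic with the endpoints `p` and `q`; it is empty if `p = q`. -/
def gline (p q : Circle) : Set ℍ :=
  {z | ((p : ℂ) + q) * (1 + cayley z * conj (cayley z)) =
    2 * (cayley z + conj (cayley z) * (p * q))}

theorem gline_comm (p q : Circle) : gline p q = gline q p := by
  ext z; simp only [gline, mem_ofPred_eq, add_comm (p : ℂ), mul_comm (p : ℂ)]

theorem smul_mem_gline' (A : SL(2, ℝ)) {p q : Circle} {z : ℍ} (h : z ∈ gline p q) :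
    A • z ∈ gline (bdry A p) (bdry A q) := by
  simp only [gline, mem_ofPred_eq, coe_bdry, cayley_smul] at h ⊢
  have hP := mob_denom_ne_zero A (Circle.norm_coe p).le
  have hQ := mob_denom_ne_zero A (Circle.norm_coe q).le
  have hW := mob_denom_ne_zero A (norm_cayley_lt_one z).le
  have hW' : mobB A * conj (cayley z) + mobA A ≠ 0 := by
    intro h
    apply hW
    have := congr_arg conj h
    simpa using this
  have hd := mob_det A
  simp only [map_div₀, map_add, map_mul, Complex.conj_conj]
  generalize cayley z = w at *
  generalize conj w = w' at *
  generalize mobA A = a at *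
  generalize conj a = a' at *
  generalize mobB A = b at *
  generalize conj b = b' at *
  generalize (p : ℂ) = p at *
  generalize (q : ℂ) = q at *
  obtain ⟨P, eP⟩ : ∃ P, P = b' * p + a' := ⟨_, rfl⟩
  obtain ⟨Q, eQ⟩ : ∃ P, P = b' * q + a' := ⟨_, rfl⟩
  obtain ⟨W, eW⟩ : ∃ P, P = b' * w + a' := ⟨_, rfl⟩
  obtain ⟨W', eW'⟩ : ∃ P, P = b * w' + a := ⟨_, rfl⟩
  rw [← eP, ← eQ, ← eW, ← eW']
  rw [← eP] at hP
  rw [← eQ] at hQ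
  rw [← eW] at hW
  rw [← eW'] at hW'
  field_simp
  rw [eP, eQ, eW, eW']
  -- With the denominators cleared, the transformed equation is the original one times the square of
  -- the determinant.
  linear_combination (a * a' - b * b') ^ 2 * h

theorem smul_mem_gline (A : SL(2, ℝ)) {p q : Circle} {z : ℍ} :
    A • z ∈ gline (bdry A p) (bdry A q) ↔ z ∈ gline p q := by
  refine ⟨fun h => ?_, smul_mem_gline' A⟩
  have := smul_mem_gline' A⁻¹ h
  rwa [inv_smul_smul, bdry_inv_bdry, bdry_inv_bdry] at this

theorem range_axis : range axis = gline (-1) 1 := by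
  ext z
  have : z ∈ gline (-1) 1 ↔ cayley z = conj (cayley z) := by
    simp only [gline, mem_ofPred_eq, Circle.coe_neg, Circle.coe_one]
    constructor
    · intro h; linear_combination (-1/2) * h
    · intro h; linear_combination (-2) * h
  rw [this]
  constructor
  · rintro ⟨t, rfl⟩
    rw [cayley_axis, Complex.conj_ofReal]
  · intro h
    have h' : (cayley z).im = 0 := by rwa [eq_comm, Complex.conj_eq_iff_im] at h
    have hre : z.re = 0 := by
      rw [cayley, Complex.div_im] at h'
      have h0 := Complex.normSq_pos.2 (coe_add_I_ne_zero z)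
      field_simp at h'
      simp at h'
      linarith
    refine ⟨Real.log z.im, ?_⟩
    apply UpperHalfPlane.ext
    apply Complex.ext
    · simp [axis, hre]
    · simp [axis, Real.exp_log z.im_pos]

theorem range_smul_axis (A : SL(2, ℝ)) :
    range (fun t => A • axis t) = gline (bdry A (-1)) (bdry A 1) := by
  ext z
  have h1 : z ∈ gline (bdry A (-1)) (bdry A 1) ↔ A⁻¹ • z ∈ gline (-1) 1 := by
    have := smul_mem_gline A (p := -1) (q := 1) (z := A⁻¹ • z)
    rwa [smul_inv_smul] at this
  rw [h1, ← range_axis]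
  constructor
  · rintro ⟨t, rfl⟩
    exact ⟨t, by simp⟩
  · rintro ⟨t, ht⟩
    exact ⟨t, by simp [ht]⟩

theorem hasEndpoints_smul {c : ℝ → ℍ} {p q : Circle} (A : SL(2, ℝ)) (h : HasEndpoints c p q) :
    HasEndpoints (fun t => A • c t) (bdry A p) (bdry A q) :=
  ⟨tendsto_cayley_smul A h.1, tendsto_cayley_smul A h.2⟩

theorem HasEndpoints.unique {c : ℝ → ℍ} {p q p' q' : Circle} (h : HasEndpoints c p q)
    (h' : HasEndpoints c p' q') : p = p' ∧ q = q' :=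
  ⟨Circle.ext (tendsto_nhds_unique h.1 h'.1), Circle.ext (tendsto_nhds_unique h.2 h'.2)⟩

theorem isometry_smul_axis (A : SL(2, ℝ)) : Isometry fun t => A • axis t :=
  (isometry_smul ℍ A).comp isometry_axis

theorem range_eq_gline {c : ℝ → ℍ} (hc : Isometry c) {p q : Circle} (h : HasEndpoints c p q) :
    range c = gline p q := by
  obtain ⟨A, hA⟩ := isometry_eq_smul_axis hc
  obtain rfl : c = fun t => A • axis t := funext hA
  obtain ⟨rfl, rfl⟩ := h.unique (hasEndpoints_smul A hasEndpoints_axis)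
  exact range_smul_axis A

theorem exists_bdry_eq {p q : Circle} (h : p ≠ q) :
    ∃ A : SL(2, ℝ), bdry A (-1) = p ∧ bdry A 1 = q := by
  obtain ⟨a, ha⟩ := Circle.exp_surjective p
  obtain ⟨b, hb⟩ := Circle.exp_surjective q
  set u : ℂ := (Circle.exp (a / 2) : ℂ)
  set v : ℂ := (Circle.exp (b / 2) : ℂ)
  have huu : u * conj u = 1 := by rw [Complex.mul_conj, Circle.normSq_coe]; simp
  have hvv : v * conj v = 1 := by rw [Complex.mul_conj, Circle.normSq_coe]; simp
  have hu2 : u * u = p := by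
    rw [← ha, ← Circle.coe_mul, ← Circle.exp_add]; congr; ring
  have hv2 : v * v = q := by
    rw [← hb, ← Circle.coe_mul, ← Circle.exp_add]; congr; ring
  have hu0 : u ≠ 0 := Circle.coe_ne_zero _
  have hv0 : v ≠ 0 := Circle.coe_ne_zero _
  have hu0' : conj u ≠ 0 := fun h => by rw [h] at huu; simp at huu
  have hv0' : conj v ≠ 0 := fun h => by rw [h] at hvv; simp at hvv
  set m : ℝ := (v * conj u).im with hm
  have hm0 : m ≠ 0 := by
    intro h0
    apply h
    have h1 : conj (v * conj u) = v * conj u := Complex.conj_eq_iff_im.2 h0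
    rw [map_mul, Complex.conj_conj] at h1
    apply Circle.ext
    rw [← hu2, ← hv2]
    linear_combination (u * v) * h1 + (-u ^ 2) * hvv + v ^ 2 * huu
  have hm0' : (m : ℂ) ≠ 0 := by exact_mod_cast hm0
  have hm2 : v * conj u - u * conj v = 2 * m * Complex.I := by
    apply Complex.ext <;> simp [hm] <;> ring
  -- With α = (s + d)/2 and β = (s - d)/2 the point 1 goes to s/s̄ = v² and -1 goes to -d/d̄ = u².
  -- Dividing by m, the imaginary part of v ū, normalizes the determinant; m vanishes only if the
  -- two endpoints coincide.
  set s : ℂ := v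
  set d : ℂ := (Complex.I * u) / m
  have hdc : conj d = -(Complex.I * conj u) / m := by simp [d]
  obtain ⟨A, hA, hB⟩ := exists_mob ((s + d) / 2) ((s - d) / 2) (by
    simp only [map_div₀, map_add, map_sub, hdc, s, d, Complex.conj_ofNat]
    field_simp
    linear_combination (-2 * m * Complex.I) * hm2 + (- 4 * m ^ 2) * Complex.I_sq)
  refine ⟨A, ?_, ?_⟩
  · apply Circle.ext
    rw [coe_bdry, hA, hB]
    simp only [map_div₀, map_add, map_sub, hdc, s, d, Complex.conj_ofNat, Circle.coe_neg,
      Circle.coe_one, ← hu2]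
    have : (conj v - -(Complex.I * conj u) / m) / 2 * -1 + (conj v + -(Complex.I * conj u) / m) / 2
      = -(Complex.I * conj u) / m := by ring
    rw [this, div_eq_iff (by simp [hu0, hm0])]
    field_simp
    linear_combination (2 * Complex.I * u) * huu
  · apply Circle.ext
    rw [coe_bdry, hA, hB]
    simp only [map_div₀, map_add, map_sub, hdc, s, d, Complex.conj_ofNat,
      Circle.coe_one, ← hv2]
    have : (conj v - -(Complex.I * conj u) / m) / 2 * 1 + (conj v + -(Complex.I * conj u) / m) / 2
      = conj v := by ring
    rw [this, div_eq_iff hv0']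
    linear_combination -v * hvv

theorem exists_isometry_gline {p q : Circle} (h : p ≠ q) :
    ∃ c : ℝ → ℍ, Isometry c ∧ HasEndpoints c p q ∧ range c = gline p q := by
  obtain ⟨A, rfl, rfl⟩ := exists_bdry_eq h
  exact ⟨_, isometry_smul_axis A, hasEndpoints_smul A hasEndpoints_axis, range_smul_axis A⟩

theorem isGeodesicLine_gline {p q : Circle} (h : p ≠ q) : IsGeodesicLine (gline p q) := by
  obtain ⟨c, hc, -, hr⟩ := exists_isometry_gline h
  exact ⟨c, hc, hr⟩

theorem gline_nonempty {p q : Circle} (h : p ≠ q) : (gline p q).Nonempty := by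
  obtain ⟨c, -, -, hr⟩ := exists_isometry_gline h
  exact hr ▸ range_nonempty c

/-- Questions about a point of a geodesic are settled by moving the point to the centre of the disc,
where lying on the geodesic means that the endpoints are antipodal. -/
theorem I_mem_gline {p q : Circle} : UpperHalfPlane.I ∈ gline p q ↔ q = -p := by
  simp only [gline, mem_ofPred_eq, cayley_I]
  simp only [map_zero, mul_zero, zero_mul, add_zero, mul_one]
  constructor
  · intro h; apply Circle.ext; rw [Circle.coe_neg]; linear_combination h
  · rintro rfl; simp

/-! ### Discrete quasigeodesics -/

/-- A discrete `(K, c)`-quasigeodesic. -/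
def IsDiscreteQG (K c : ℝ) (z : ℤ → ℍ) : Prop :=
  ∀ k l : ℤ, K⁻¹ * |(k : ℝ) - l| - c ≤ dist (z k) (z l) ∧ dist (z k) (z l) ≤ K * |(k : ℝ) - l| + c

/-- In the disc a hyperbolic step of bounded length shrinks like exp(-d) at distance d from the
centre, as each of the two cosh factors is at least of the order exp(d/2). -/
theorem norm_cayley_sub_le {L : ℝ} {z w : ℍ} (h : dist z w ≤ L) :
    ‖cayley z - cayley w‖ ≤
      4 * Real.sinh (L / 2) * Real.exp (L / 2) * Real.exp (-dist z UpperHalfPlane.I) := by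
  set d1 := dist z UpperHalfPlane.I
  set d2 := dist w UpperHalfPlane.I
  have hd : d1 - L ≤ d2 := by
    have := dist_triangle z w UpperHalfPlane.I
    linarith
  have c1 : Real.exp (d1 / 2) / 2 ≤ Real.cosh (d1 / 2) := by
    rw [Real.cosh_eq]; linarith [Real.exp_pos (-(d1 / 2))]
  have c2 : Real.exp (d1 / 2 - L / 2) / 2 ≤ Real.cosh (d2 / 2) := by
    have : Real.exp (d1 / 2 - L / 2) ≤ Real.exp (d2 / 2) := Real.exp_le_exp.2 (by linarith)
    rw [Real.cosh_eq]; linarith [Real.exp_pos (-(d2 / 2))]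
  have s1 : Real.sinh (dist z w / 2) ≤ Real.sinh (L / 2) := Real.sinh_le_sinh.2 (by linarith)
  have s0 : 0 ≤ Real.sinh (dist z w / 2) := Real.sinh_nonneg_iff.2 (by positivity)
  have key : Real.exp (d1 / 2) / 2 * (Real.exp (d1 / 2 - L / 2) / 2) *
      (4 * Real.exp (L / 2) * Real.exp (-d1)) = 1 := by
    have : Real.exp (d1 / 2) * Real.exp (d1 / 2 - L / 2) * Real.exp (L / 2) * Real.exp (-d1) = 1 := by
      rw [← Real.exp_add, ← Real.exp_add, ← Real.exp_add, Real.exp_eq_one_iff]; ring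
    linear_combination this
  have hc : Real.exp (d1 / 2) / 2 * (Real.exp (d1 / 2 - L / 2) / 2) ≤
      Real.cosh (d1 / 2) * Real.cosh (d2 / 2) := by gcongr
  rw [norm_cayley_sub, div_le_iff₀ (by positivity)]
  have h4 : 0 ≤ 4 * Real.exp (L / 2) * Real.exp (-d1) := by positivity
  calc Real.sinh (dist z w / 2) ≤ Real.sinh (L / 2) * 1 := by linarith
    _ ≤ Real.sinh (L / 2) * (Real.cosh (d1 / 2) * Real.cosh (d2 / 2) *
        (4 * Real.exp (L / 2) * Real.exp (-d1))) := by
        gcongr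
        · linarith
        · rw [← key]; gcongr
    _ = _ := by ring

theorem summable_exp_abs {μ : ℝ} (hμ : 0 < μ) :
    Summable fun k : ℤ => Real.exp (-(μ * |(k : ℝ)|)) := by
  have h : Summable fun n : ℕ => Real.exp (-(μ * n)) := by
    have : ∀ n : ℕ, Real.exp (-(μ * n)) = Real.exp (-μ) ^ n := by
      intro n; rw [← Real.exp_nat_mul]; congr 1; ring
    simp only [this]
    exact summable_geometric_of_lt_one (Real.exp_pos _).le (Real.exp_lt_one_iff.2 (by linarith))
  refine Summable.of_nat_of_neg ?_ ?_ <;> simpa using h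

/-- The path of a quasigeodesic outside of the ball of radius `R` is short in the disc model. -/
theorem exists_norm_cayley_sub_le {K c : ℝ} (hK : 1 ≤ K) (hc : 0 ≤ c) :
    ∃ C : ℝ, 0 < C ∧ ∀ z, IsDiscreteQG K c z → ∀ (a b : ℤ), a ≤ b → ∀ R : ℝ,
      (∀ k ∈ Icc a b, R ≤ dist (z k) UpperHalfPlane.I) →
      ‖cayley (z a) - cayley (z b)‖ ≤ C * Real.exp (-R / 3) := by
  set L := K + c
  set M := 4 * Real.sinh (L / 2) * Real.exp (L / 2)
  have hL : 0 < L := by positivity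
  have hM : 0 < M := by
    have : 0 < Real.sinh (L / 2) := Real.sinh_pos_iff.2 (by positivity)
    positivity
  set μ := (3 * K)⁻¹
  have hμ : 0 < μ := by positivity
  set S := ∑' k : ℤ, Real.exp (-(μ * |(k : ℝ)|))
  have hS : 0 < S := (summable_exp_abs hμ).tsum_pos (fun _ => (Real.exp_pos _).le) 0 (Real.exp_pos _)
  refine ⟨M * (Real.exp (c / 3) * S), by positivity, fun z hz a b hab R hR => ?_⟩
  obtain ⟨k0, hk0, hmin⟩ := (Finset.Icc a b).exists_min_image
    (fun k => dist (z k) UpperHalfPlane.I) ⟨a, by simp [hab]⟩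
  -- Average of three bounds. Let d_k be the distance of `z k` from the centre, with k₀ nearest to
  -- it. Then K⁻¹|k - k₀| - c ≤ d_k + d_{k₀} ≤ 2 d_k, and R ≤ d_{k₀} ≤ d_k; the sum is at most 3
  -- d_k.
  have hlow : ∀ k ∈ Finset.Icc a b, R / 3 + μ * |(k : ℝ) - k0| - c / 3 ≤
      dist (z k) UpperHalfPlane.I := by
    intro k hk
    have h1 := hmin k hk
    have h2 := hR k0 (by simpa using hk0)
    have h3 := (hz k k0).1
    have h4 := dist_triangle_right (z k) (z k0) UpperHalfPlane.I
    have : μ * |(k : ℝ) - k0| = (K⁻¹ * |(k : ℝ) - k0|) / 3 := by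
      simp only [μ, mul_inv]; ring
    rw [this]
    linarith
  have step : ∀ k ∈ Finset.Ico a b, ‖cayley (z k) - cayley (z (k + 1))‖ ≤
      M * (Real.exp (c / 3) * Real.exp (-R / 3) * Real.exp (-(μ * |((k - k0 : ℤ) : ℝ)|))) := by
    intro k hk
    have h1 : dist (z k) (z (k + 1)) ≤ L := by
      have := (hz k (k + 1)).2
      simp only [Int.cast_add, Int.cast_one, sub_add_cancel_left, abs_neg, abs_one] at this
      linarith
    refine (norm_cayley_sub_le h1).trans ?_
    rw [← Real.exp_add, ← Real.exp_add]
    have := hlow k (by simp at hk ⊢; omega)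
    push_cast
    gcongr
    linarith
  have tele : ∀ n : ℕ, ‖cayley (z a) - cayley (z (a + n))‖ ≤
      ∑ k ∈ Finset.Ico a (a + n), ‖cayley (z k) - cayley (z (k + 1))‖ := by
    intro n
    induction n with
    | zero => simp
    | succ n ih =>
      have : Finset.Ico a (a + (n + 1 : ℕ)) = insert (a + n) (Finset.Ico a (a + n)) := by
        ext k; simp; omega
      rw [this, Finset.sum_insert (by simp)]
      have h := norm_sub_le_norm_sub_add_norm_sub (cayley (z a)) (cayley (z (a + n)))
        (cayley (z (a + (n + 1 : ℕ))))
      push_cast at h ⊢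
      rw [← add_assoc] at h ⊢
      linarith
  obtain ⟨n, rfl⟩ : ∃ n : ℕ, b = a + n := ⟨(b - a).toNat, by omega⟩
  refine (tele n).trans ((Finset.sum_le_sum step).trans ?_)
  rw [← Finset.mul_sum, ← Finset.mul_sum]
  have hs : Summable fun k : ℤ => Real.exp (-(μ * |((k - k0 : ℤ) : ℝ)|)) :=
    (Equiv.subRight k0).summable_iff.2 (summable_exp_abs hμ)
  have hsum : ∑ k ∈ Finset.Ico a (a + n), Real.exp (-(μ * |((k - k0 : ℤ) : ℝ)|)) ≤ S :=
    (hs.sum_le_tsum _ (fun _ _ => (Real.exp_pos _).le)).trans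
      ((Equiv.subRight k0).tsum_eq (fun k : ℤ => Real.exp (-(μ * |(k : ℝ)|)))).le
  calc _ ≤ M * (Real.exp (c / 3) * Real.exp (-R / 3) * S) := by gcongr
    _ = _ := by ring

theorem IsDiscreteQG.smul {K c : ℝ} {z : ℤ → ℍ} (hz : IsDiscreteQG K c z) (A : SL(2, ℝ)) :
    IsDiscreteQG K c fun k => A • z k := by
  intro k l
  simp only [dist_smul]
  exact hz k l

theorem IsDiscreteQG.neg {K c : ℝ} {z : ℤ → ℍ} (hz : IsDiscreteQG K c z) :
    IsDiscreteQG K c fun k => z (-k) := by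
  intro k l
  have := hz (-k) (-l)
  have h : |((-k : ℤ) : ℝ) - ((-l : ℤ) : ℝ)| = |(k : ℝ) - l| := by
    push_cast
    rw [← abs_neg]; congr 1; ring
  rwa [h] at this

theorem IsDiscreteQG.le_dist_I {K c : ℝ} {z : ℤ → ℍ} (hz : IsDiscreteQG K c z) (k : ℤ) :
    K⁻¹ * |(k : ℝ)| - c - dist (z 0) UpperHalfPlane.I ≤ dist (z k) UpperHalfPlane.I := by
  have h1 := (hz k 0).1
  have h2 := dist_triangle_right (z k) (z 0) UpperHalfPlane.I
  simp at h1
  linarith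

theorem tendsto_norm_cayley {ι : Type*} {l : Filter ι} {z : ι → ℍ}
    (h : Tendsto (fun n => dist (z n) UpperHalfPlane.I) l atTop) :
    Tendsto (fun n => ‖cayley (z n)‖) l (𝓝 1) := by
  have h1 : Tendsto (fun n => Real.cosh (dist (z n) UpperHalfPlane.I / 2)) l atTop := by
    refine tendsto_atTop_mono (fun n => ?_) (h.atTop_div_const (r := 2) (by norm_num))
    have := Real.add_one_le_exp (dist (z n) UpperHalfPlane.I / 2)
    have h0 : 0 ≤ dist (z n) UpperHalfPlane.I / 2 := by positivity
    exact (Real.self_le_sinh_iff.2 h0).trans (Real.sinh_lt_cosh _).le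
  have h2 : Tendsto (fun n => 1 / Real.cosh (dist (z n) UpperHalfPlane.I / 2) ^ 2) l (𝓝 0) :=
    Tendsto.div_atTop tendsto_const_nhds ((tendsto_pow_atTop two_ne_zero).comp h1)
  simp only [← one_sub_normSq_cayley'] at h2
  have h3 := ((tendsto_const_nhds (x := (1:ℝ))).sub h2).sqrt
  simpa using h3

/-- The endpoint of a quasigeodesic, with a uniform rate of convergence. -/
theorem exists_endpoint {K c : ℝ} (hK : 1 ≤ K) (hc : 0 ≤ c) :
    ∃ C : ℝ, 0 < C ∧ ∀ z, IsDiscreteQG K c z → ∃ q : Circle,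
      Tendsto (fun n : ℕ => cayley (z n)) atTop (𝓝 (q : ℂ)) ∧
      ∀ n : ℕ, ‖cayley (z n) - q‖ ≤
        C * Real.exp (-(K⁻¹ * n - c - dist (z 0) UpperHalfPlane.I) / 3) := by
  obtain ⟨C, hC, h⟩ := exists_norm_cayley_sub_le hK hc
  refine ⟨C, hC, fun z hz => ?_⟩
  have hK0 : 0 < K⁻¹ := by positivity
  set B : ℕ → ℝ := fun n => C * Real.exp (-(K⁻¹ * n - c - dist (z 0) UpperHalfPlane.I) / 3)
  have hB : ∀ n m : ℕ, n ≤ m → ‖cayley (z n) - cayley (z m)‖ ≤ B n := by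
    intro n m hnm
    refine h z hz n m (by exact_mod_cast hnm) _ (fun k hk => le_trans ?_ (hz.le_dist_I k))
    have : (n : ℝ) ≤ |(k : ℝ)| := by
      have : (n : ℝ) ≤ k := by exact_mod_cast hk.1
      exact this.trans (le_abs_self _)
    gcongr
  have hlin : Tendsto (fun n : ℕ => K⁻¹ * n - c - dist (z 0) UpperHalfPlane.I) atTop atTop :=
    tendsto_atTop_add_const_right _ _ (tendsto_atTop_add_const_right _ _
      (tendsto_natCast_atTop_atTop.const_mul_atTop hK0))
  have hB0 : Tendsto B atTop (𝓝 0) := by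
    have := (Real.tendsto_exp_neg_atTop_nhds_zero.comp
      (hlin.atTop_div_const (r := 3) (by norm_num))).const_mul C
    simp only [mul_zero, Function.comp_def, ← neg_div] at this
    exact this
  have hcau : CauchySeq fun n : ℕ => cayley (z n) :=
    cauchySeq_of_le_tendsto_0' B (fun n m hnm => by rw [dist_eq_norm]; exact hB n m hnm) hB0
  obtain ⟨q, hq⟩ := cauchySeq_tendsto_of_complete hcau
  have hd : Tendsto (fun n : ℕ => dist (z n) UpperHalfPlane.I) atTop atTop :=
    tendsto_atTop_mono (fun n => by simpa using hz.le_dist_I n) hlin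
  have hq1 : ‖q‖ = 1 := tendsto_nhds_unique hq.norm (tendsto_norm_cayley hd)
  refine ⟨⟨q, mem_sphere_zero_iff_norm.2 hq1⟩, hq, fun n => ?_⟩
  refine le_of_tendsto ((tendsto_const_nhds.sub hq).norm) ?_
  filter_upwards [eventually_ge_atTop n] with m hm using hB n m hm

theorem exists_radius {C ε : ℝ} (_ : 0 < C) (hε : 0 < ε) :
    ∃ R : ℝ, 2 ≤ R ∧ C * Real.exp (-R / 3) < ε := by
  have h := (Real.tendsto_exp_neg_atTop_nhds_zero.comp
      (tendsto_id.atTop_div_const (r := (3:ℝ)) (by norm_num))).const_mul C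
  simp only [Function.comp_def, id, mul_zero] at h
  obtain ⟨R, hR, h2⟩ := ((h.eventually (gt_mem_nhds hε)).and (eventually_ge_atTop 2)).exists
  exact ⟨R, h2, by simpa [neg_div] using hR⟩

/-- The geodesic with the endpoints of a quasigeodesic is close to the quasigeodesic. -/
theorem exists_dist_le_of_mem_gline {K c : ℝ} (hK : 1 ≤ K) (hc : 0 ≤ c) :
    ∃ R : ℝ, ∀ z, IsDiscreteQG K c z → ∀ p q : Circle,
      Tendsto (fun n : ℕ => cayley (z (-n))) atTop (𝓝 (p : ℂ)) →
      Tendsto (fun n : ℕ => cayley (z n)) atTop (𝓝 (q : ℂ)) →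
      ∀ x ∈ gline p q, ∃ k, dist (z k) x ≤ R := by
  obtain ⟨C, hC, h⟩ := exists_norm_cayley_sub_le hK hc
  obtain ⟨R, -, hR⟩ := exists_radius hC two_pos
  refine ⟨R, fun z hz p q hp hq x hx => ?_⟩
  obtain ⟨A, hA⟩ := MulAction.exists_smul_eq SL(2, ℝ) x UpperHalfPlane.I
  have hx' := smul_mem_gline' A hx
  rw [hA, I_mem_gline] at hx'
  -- With x at the centre the endpoints are antipodal, at Euclidean distance 2. A quasigeodesic that
  -- stays outside the ball of radius R would have ends closer than that.
  by_contra! hno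
  have hb : ∀ n : ℕ, ‖cayley (A • z (-n)) - cayley (A • z n)‖ ≤ C * Real.exp (-R / 3) := by
    intro n
    refine h _ (hz.smul A) (-n) n (by omega) R (fun k _ => ?_)
    rw [← hA, dist_smul]
    exact (hno k).le
  have hlim := le_of_tendsto (((tendsto_cayley_smul A hp).sub (tendsto_cayley_smul A hq)).norm)
    (Eventually.of_forall hb)
  rw [hx', Circle.coe_neg, sub_neg_eq_add, ← two_mul, norm_mul, Circle.norm_coe] at hlim
  norm_num at hlim
  linarith

theorem norm_cayley_axis_sub {s t : ℝ} (hs : 2 ≤ s) (ht : 2 ≤ t) :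
    1 ≤ ‖cayley (axis (-s)) - cayley (axis t)‖ := by
  rw [cayley_axis, cayley_axis, ← Complex.ofReal_sub, Complex.norm_real, Real.norm_eq_abs]
  have h1 : (3:ℝ) ≤ Real.exp t := by linarith [Real.add_one_le_exp t]
  have h2 : Real.exp (-s) ≤ 1 / 3 := by
    rw [Real.exp_neg, one_div]
    exact inv_anti₀ (by norm_num) (by linarith [Real.add_one_le_exp s])
  have h3 : 2 / (Real.exp t + 1) ≤ 1 / 2 := by
    rw [div_le_div_iff₀ (by positivity) (by positivity)]; linarith
  have h4 : 3 / 2 ≤ 2 / (Real.exp (-s) + 1) := by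
    rw [div_le_div_iff₀ (by positivity) (by positivity)]; linarith
  rw [abs_sub_comm]
  exact le_trans (by linarith) (le_abs_self _)

/-- A geodesic segment is close to every quasigeodesic with the same endpoints. -/
theorem exists_dist_segment_le {K c : ℝ} (hK : 1 ≤ K) (hc : 0 ≤ c) :
    ∃ R : ℝ, ∀ z, IsDiscreteQG K c z → ∀ a b : ℤ, a ≤ b → ∀ (A : SL(2, ℝ)) (s t r : ℝ),
      A • z a = axis s → A • z b = axis t → r ∈ Icc s t →
      ∃ k ∈ Icc a b, dist (z k) (A⁻¹ • axis r) ≤ R := by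
  obtain ⟨C, hC, h⟩ := exists_norm_cayley_sub_le hK hc
  obtain ⟨R, hR2, hR⟩ := exists_radius hC one_pos
  refine ⟨R, fun z hz a b hab A s t r ha hb hr => ?_⟩
  -- D translates along the axis so that the point with parameter r becomes the centre. The ends of
  -- the segment then lie on opposite sides of it, and R ≥ 2 keeps them at Euclidean distance at
  -- least 1.
  obtain ⟨D, hD⟩ : ∃ D : SL(2, ℝ), ∀ u, D • axis u = axis (u - r) := by
    obtain ⟨D, hD⟩ := isometry_eq_smul_axis
      (c := fun u => axis (u + r)) (isometry_axis.comp (isometry_add_right r))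
    exact ⟨D⁻¹, fun u => by rw [inv_smul_eq_iff, ← hD, sub_add_cancel]⟩
  have hda : (D * A) • z a = axis (-(r - s)) := by
    rw [mul_smul, ha, hD, neg_sub]
  have hdb : (D * A) • z b = axis (t - r) := by
    rw [mul_smul, hb, hD]
  have hdr : (D * A) • (A⁻¹ • axis r) = UpperHalfPlane.I := by
    rw [mul_smul, smul_inv_smul, hD, sub_self, axis_zero]
  by_contra! hno
  have hno' : ∀ k ∈ Icc a b, R < dist ((D * A) • z k) UpperHalfPlane.I := by
    intro k hk
    rw [← hdr, dist_smul]; exact hno k hk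
  have h1 := hno' a ⟨le_rfl, hab⟩
  have h2 := hno' b ⟨hab, le_rfl⟩
  rw [hda, ← axis_zero, isometry_axis.dist_eq, Real.dist_eq, sub_zero, abs_neg,
    abs_of_nonneg (by linarith [hr.1])] at h1
  rw [hdb, ← axis_zero, isometry_axis.dist_eq, Real.dist_eq, sub_zero,
    abs_of_nonneg (by linarith [hr.2])] at h2
  have h3 := norm_cayley_axis_sub (s := r - s) (t := t - r) (by linarith) (by linarith)
  have h4 := h _ (hz.smul (D * A)) a b hab R (fun k hk => (hno' k hk).le)
  simp only [hda, hdb] at h4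
  linarith

/-- Quasigeodesics are close to satisfying the reverse triangle inequality. -/
theorem exists_dist_add_dist_le {K c : ℝ} (hK : 1 ≤ K) (hc : 0 ≤ c) :
    ∃ R : ℝ, ∀ z, IsDiscreteQG K c z → ∀ a m b : ℤ, a ≤ m → m ≤ b →
      dist (z a) (z m) + dist (z m) (z b) ≤ dist (z a) (z b) + R := by
  obtain ⟨R, h⟩ := exists_dist_segment_le hK hc
  refine ⟨2 * (K * (K * (2 * R + c)) + c + R), fun z hz a m b ham hmb => ?_⟩
  obtain ⟨A, ha, hb⟩ := exists_smul_eq_axis (z a) (z b)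
  rw [← axis_zero] at ha
  set ℓ := dist (z a) (z b)
  have hℓ : 0 ≤ ℓ := dist_nonneg
  let y : ℝ → ℍ := fun r => A⁻¹ • axis r
  have hy : Continuous y := (isometry_smul_axis A⁻¹).continuous
  -- Parameters of points of the geodesic segment that are close to some `z k` with k ≤ m, and with
  -- k ≥ m in `S2`. These closed sets cover the interval, so by connectedness some point is close to
  -- both `z k1` and `z k2` with k1 ≤ m ≤ k2. Then k1 and k2 differ by a bounded amount, and `z m`
  -- is close to that point as well.
  let S1 : Set ℝ := ⋃ k ∈ Icc a m, {r | dist (z k) (y r) ≤ R}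
  let S2 : Set ℝ := ⋃ k ∈ Icc m b, {r | dist (z k) (y r) ≤ R}
  have hcl : ∀ k, IsClosed {r | dist (z k) (y r) ≤ R} := fun k =>
    isClosed_le (continuous_const.dist hy) continuous_const
  have c1 : IsClosed S1 := (finite_Icc a m).isClosed_biUnion fun k _ => hcl k
  have c2 : IsClosed S2 := (finite_Icc m b).isClosed_biUnion fun k _ => hcl k
  have hR0 : 0 ≤ R := by
    obtain ⟨k, -, hk⟩ := h z hz a b (ham.trans hmb) A 0 ℓ 0 ha hb ⟨le_rfl, hℓ⟩
    exact dist_nonneg.trans hk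
  have hya : y 0 = z a := by simp only [y]; rw [← ha, inv_smul_smul]
  have hyb : y ℓ = z b := by simp only [y]; rw [← hb, inv_smul_smul]
  have hcov : Icc 0 ℓ ⊆ S1 ∪ S2 := by
    intro r hr
    obtain ⟨k, hk, hd⟩ := h z hz a b (ham.trans hmb) A 0 ℓ r ha hb hr
    rcases le_total k m with hkm | hkm
    · exact Or.inl (mem_biUnion (show k ∈ Icc a m from ⟨hk.1, hkm⟩) hd)
    · exact Or.inr (mem_biUnion (show k ∈ Icc m b from ⟨hkm, hk.2⟩) hd)
  obtain ⟨r, hr, h1, h2⟩ := isPreconnected_closed_iff.1 isPreconnected_Icc S1 S2 c1 c2 hcov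
    ⟨0, ⟨le_rfl, hℓ⟩, mem_biUnion (show a ∈ Icc a m from ⟨le_rfl, ham⟩) (by simp [hya, hR0])⟩
    ⟨ℓ, ⟨hℓ, le_rfl⟩, mem_biUnion (show b ∈ Icc m b from ⟨hmb, le_rfl⟩) (by simp [hyb, hR0])⟩
  simp only [S1, S2, mem_iUnion, mem_ofPred_eq, exists_prop] at h1 h2
  obtain ⟨k1, hk1, hd1⟩ := h1
  obtain ⟨k2, hk2, hd2⟩ := h2
  have hK0 : 0 < K := by linarith
  have e1 : K⁻¹ * |(k1 : ℝ) - k2| - c ≤ 2 * R := by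
    have := dist_triangle_right (z k1) (z k2) (y r)
    linarith [(hz k1 k2).1]
  have e2 : |(k1 : ℝ) - k2| ≤ K * (2 * R + c) := by
    rw [inv_mul_eq_div, sub_le_iff_le_add, div_le_iff₀ hK0] at e1
    linarith
  have e3 : |(m : ℝ) - k1| ≤ |(k1 : ℝ) - k2| := by
    have a1 : (k1 : ℝ) ≤ m := by exact_mod_cast hk1.2
    have a2 : (m : ℝ) ≤ k2 := by exact_mod_cast hk2.1
    rw [abs_of_nonneg (by linarith), abs_of_nonpos (by linarith)]
    linarith
  have e4 : dist (z m) (y r) ≤ K * (K * (2 * R + c)) + c + R := by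
    have t1 := dist_triangle (z m) (z k1) (y r)
    have t2 := (hz m k1).2
    have : K * |(m : ℝ) - k1| ≤ K * (K * (2 * R + c)) := by gcongr; linarith
    linarith
  have f1 : dist (z a) (y r) = r := by
    rw [← hya, (isometry_smul_axis A⁻¹).dist_eq, Real.dist_eq, zero_sub, abs_neg,
      abs_of_nonneg hr.1]
  have f2 : dist (y r) (z b) = ℓ - r := by
    rw [← hyb, (isometry_smul_axis A⁻¹).dist_eq, Real.dist_eq, abs_sub_comm,
      abs_of_nonneg (by linarith [hr.2])]
  have t1 := dist_triangle_right (z a) (z m) (y r)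
  have t2 := dist_triangle (z m) (y r) (z b)
  linarith

/-- Put `z 0` at the centre. By the reverse triangle inequality the distance between `z (-n)` and `z
n` is at least the sum of their distances from the centre minus R, so in the disc they stay apart by
at least exp(-R/2)/4 for large n. -/
theorem endpoints_ne {K c : ℝ} (hK : 1 ≤ K) (hc : 0 ≤ c) {z : ℤ → ℍ} (hz : IsDiscreteQG K c z)
    {p q : Circle} (hp : Tendsto (fun n : ℕ => cayley (z (-n))) atTop (𝓝 (p : ℂ)))
    (hq : Tendsto (fun n : ℕ => cayley (z n)) atTop (𝓝 (q : ℂ))) : p ≠ q := by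
  obtain ⟨R, hR⟩ := exists_dist_add_dist_le hK hc
  obtain ⟨A, hA⟩ := MulAction.exists_smul_eq SL(2, ℝ) (z 0) UpperHalfPlane.I
  rintro rfl
  have hz' := hz.smul A
  have hlim := ((tendsto_cayley_smul A hp).sub (tendsto_cayley_smul A hq)).norm
  rw [sub_self, norm_zero] at hlim
  have hK0 : 0 < K⁻¹ := by positivity
  have hlin : Tendsto (fun n : ℕ => K⁻¹ * n - c) atTop atTop :=
    tendsto_atTop_add_const_right _ _ (tendsto_natCast_atTop_atTop.const_mul_atTop hK0)
  have hlow : ∀ᶠ n : ℕ in atTop, Real.exp (-R / 2) / 4 ≤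
      ‖cayley (A • z (-n)) - cayley (A • z n)‖ := by
    filter_upwards [hlin.eventually_ge_atTop (2 + |R|)] with n hn
    have h1 := hR _ hz' (-n) 0 n (by omega) (by omega)
    simp only [hA] at h1
    rw [norm_cayley_sub, dist_comm UpperHalfPlane.I] at *
    have h2 : K⁻¹ * n - c ≤ dist (A • z n) UpperHalfPlane.I := by
      have := hz'.le_dist_I n
      simpa [hA] using this
    set d := dist (A • z (-n)) (A • z n)
    set d1 := dist (A • z (-n)) UpperHalfPlane.I
    set d2 := dist (A • z n) UpperHalfPlane.I
    have hd1 : 0 ≤ d1 := dist_nonneg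
    have hd2 : 0 ≤ d2 := dist_nonneg
    have hd : 2 ≤ d := by linarith [le_abs_self R]
    have s1 : Real.exp (d / 2) / 4 ≤ Real.sinh (d / 2) := by
      rw [Real.sinh_eq]
      have e1 : (2:ℝ) ≤ Real.exp (d / 2) := by linarith [Real.add_one_le_exp (d / 2)]
      have e2 : Real.exp (-(d / 2)) ≤ 1 := Real.exp_le_one_iff.2 (by linarith)
      linarith
    have cc : ∀ x : ℝ, 0 ≤ x → Real.cosh x ≤ Real.exp x := by
      intro x hx
      rw [Real.cosh_eq]
      have : Real.exp (-x) ≤ Real.exp x := Real.exp_le_exp.2 (by linarith)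
      linarith
    have c1 := cc (d1 / 2) (by positivity)
    have c2 := cc (d2 / 2) (by positivity)
    rw [le_div_iff₀ (by positivity)]
    calc Real.exp (-R / 2) / 4 * (Real.cosh (d1 / 2) * Real.cosh (d2 / 2))
        ≤ Real.exp (-R / 2) / 4 * (Real.exp (d1 / 2) * Real.exp (d2 / 2)) := by gcongr
      _ = Real.exp (-R / 2 + d1 / 2 + d2 / 2) / 4 := by rw [Real.exp_add, Real.exp_add]; ring
      _ ≤ Real.exp (d / 2) / 4 := by gcongr; linarith
      _ ≤ _ := s1
  have := ge_of_tendsto hlim hlow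
  linarith [Real.exp_pos (-R / 2)]

/-- Paths at bounded distance have the same endpoints. -/
theorem tendsto_cayley_of_dist_le {ι : Type*} {l : Filter ι} {z w : ι → ℍ} {p : Circle} {L : ℝ}
    (h : ∀ n, dist (z n) (w n) ≤ L) (hz : Tendsto (fun n => cayley (z n)) l (𝓝 (p : ℂ))) :
    Tendsto (fun n => cayley (w n)) l (𝓝 (p : ℂ)) := by
  set C := 4 * Real.sinh (L / 2) * Real.exp (L / 2)
  rcases isEmpty_or_nonempty ι with hι | ⟨⟨i⟩⟩
  · rw [Filter.filter_eq_bot_of_isEmpty l]; exact tendsto_bot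
  have hL : 0 ≤ L := dist_nonneg.trans (h i)
  have hC : 0 ≤ C := by
    have : 0 ≤ Real.sinh (L / 2) := Real.sinh_nonneg_iff.2 (by positivity)
    positivity
  have hb : ∀ n, ‖cayley (w n) - cayley (z n)‖ ≤ C * (1 - ‖cayley (z n)‖ ^ 2) := by
    intro n
    rw [norm_sub_rev]
    refine (norm_cayley_sub_le (h n)).trans ?_
    rw [one_sub_normSq_cayley']
    gcongr
    set d := dist (z n) UpperHalfPlane.I
    have hd : 0 ≤ d := dist_nonneg
    rw [Real.exp_neg, one_div]
    gcongr
    have : Real.cosh (d / 2) ≤ Real.exp (d / 2) := by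
      rw [Real.cosh_eq]
      have : Real.exp (-(d / 2)) ≤ Real.exp (d / 2) := Real.exp_le_exp.2 (by linarith)
      linarith
    calc Real.cosh (d / 2) ^ 2 ≤ Real.exp (d / 2) ^ 2 := by gcongr
      _ = Real.exp d := by rw [← Real.exp_nat_mul]; congr 1; push_cast; ring
  have h0 : Tendsto (fun n => C * (1 - ‖cayley (z n)‖ ^ 2)) l (𝓝 0) := by
    have := ((tendsto_const_nhds (x := (1:ℝ))).sub (hz.norm.pow 2)).const_mul C
    simpa [Circle.norm_coe] using this
  have := (squeeze_zero_norm hb h0).add hz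
  simpa using this

/-! ### Dependence of geodesics on their endpoints -/

/-- The point of the geodesic from `p` to `q` that is closest to the centre of the disc. -/
noncomputable def midPoint (p q : ℂ) : ℂ := (p + q) / (2 + √(4 - ‖p + q‖ ^ 2))

theorem continuous_midPoint : Continuous fun x : Circle × Circle => midPoint x.1 x.2 := by
  unfold midPoint
  refine Continuous.div (by fun_prop) (by fun_prop) (fun x h => ?_)
  have h' : (2 + √(4 - ‖(x.1 : ℂ) + x.2‖ ^ 2) : ℝ) = 0 := by exact_mod_cast h
  have := Real.sqrt_nonneg (4 - ‖(x.1 : ℂ) + x.2‖ ^ 2)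
  linarith

theorem mem_gline_of_cayley_eq_midPoint {p q : Circle} {z : ℍ} (hz : cayley z = midPoint p q) :
    z ∈ gline p q := by
  set s : ℝ := √(4 - ‖(p : ℂ) + q‖ ^ 2) with hs
  have hle : ‖(p : ℂ) + q‖ ≤ 2 := by
    refine (norm_add_le _ _).trans ?_
    rw [Circle.norm_coe, Circle.norm_coe]; norm_num
  have hss : s ^ 2 = 4 - ‖(p : ℂ) + q‖ ^ 2 :=
    Real.sq_sqrt (by nlinarith [norm_nonneg ((p : ℂ) + q)])
  have hm : ((p : ℂ) + q) * (conj (p : ℂ) + conj (q : ℂ)) = 4 - s ^ 2 := by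
    rw [← map_add, Complex.mul_conj, Complex.normSq_eq_norm_sq]
    have : ‖(p : ℂ) + q‖ ^ 2 = 4 - s ^ 2 := by linarith
    rw [this]; push_cast; ring
  have hp : (p : ℂ) * conj (p : ℂ) = 1 := by rw [Complex.mul_conj, Circle.normSq_coe]; simp
  have hq : (q : ℂ) * conj (q : ℂ) = 1 := by rw [Complex.mul_conj, Circle.normSq_coe]; simp
  have hs0 : (2 + (s : ℂ)) ≠ 0 := by
    intro h
    have h' : 2 + s = 0 := by exact_mod_cast h
    linarith [Real.sqrt_nonneg (4 - ‖(p : ℂ) + q‖ ^ 2)]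
  have hc : conj (midPoint p q) = (conj (p : ℂ) + conj (q : ℂ)) / (2 + s) := by
    simp [midPoint, ← hs, Complex.conj_ofNat]
  rw [gline, mem_ofPred_eq, hz, hc, midPoint, ← hs]
  field_simp
  linear_combination ((p : ℂ) + q) * hm - 2 * (2 + s) * (q * hp + p * hq)

/-- Geodesics depend continuously on their endpoints. -/
theorem eventually_gline_inter_nonempty {p q : Circle} {z : ℍ} (hz : z ∈ gline p q) {V : Set ℍ}
    (hV : V ∈ 𝓝 z) : ∀ᶠ x : Circle × Circle in 𝓝 (p, q), (gline x.1 x.2 ∩ V).Nonempty := by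
  obtain ⟨A, hA⟩ := MulAction.exists_smul_eq SL(2, ℝ) z UpperHalfPlane.I
  have hz' := smul_mem_gline' A hz
  rw [hA, I_mem_gline] at hz'
  have hc : Continuous fun x : Circle × Circle => midPoint (bdry A x.1) (bdry A x.2) :=
    continuous_midPoint.comp (((continuous_bdry A).comp continuous_fst).prodMk
      ((continuous_bdry A).comp continuous_snd))
  have h0 : midPoint (bdry A p) (bdry A q) = 0 := by rw [hz']; simp [midPoint]
  -- The value `z` outside the disc is a dummy; only a neighbourhood of 0 matters.
  have hinv : ContinuousAt (fun w : ℂ => if h : ‖w‖ < 1 then A⁻¹ • invCayley w h else z) 0 := by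
    have hsub : ContinuousOn (fun w : ℂ => if h : ‖w‖ < 1 then A⁻¹ • invCayley w h else z)
        (Metric.ball 0 1) := by
      rw [continuousOn_iff_continuous_domRestrict]
      have : (Metric.ball (0:ℂ) 1).domRestrict
          (fun w : ℂ => if h : ‖w‖ < 1 then A⁻¹ • invCayley w h else z) =
          fun w => A⁻¹ • invCayley w.1 (mem_ball_zero_iff.1 w.2) := by
        ext w
        have hw : ‖(w : ℂ)‖ < 1 := mem_ball_zero_iff.1 w.2
        simp [Set.domRestrict, hw]
      rw [this]
      refine Continuous.const_smul ?_ _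
      refine Continuous.upperHalfPlaneMk ?_ _
      refine Continuous.div (by fun_prop) (by fun_prop) (fun w h => ?_)
      have hw : ‖(w : ℂ)‖ < 1 := mem_ball_zero_iff.1 w.2
      have : (w : ℂ) = 1 := by linear_combination -h
      rw [this] at hw; simp at hw
    exact hsub.continuousAt (Metric.ball_mem_nhds _ one_pos)
  have hval : (fun w : ℂ => if h : ‖w‖ < 1 then A⁻¹ • invCayley w h else z) 0 = z := by
    have : invCayley 0 (by simp) = UpperHalfPlane.I :=
      cayley_injective (by rw [cayley_invCayley, cayley_I])
    simp only [norm_zero, zero_lt_one, dif_pos, this]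
    rw [← hA, inv_smul_smul]
  have hcomp := ContinuousAt.comp (f := fun x : Circle × Circle =>
    midPoint (bdry A x.1) (bdry A x.2)) (x := (p, q)) (h0 ▸ hinv) hc.continuousAt
  have e1 := hcomp.preimage_mem_nhds (t := V) (by
    simp only [Function.comp_apply, h0, hval]; exact hV)
  have e2 : ∀ᶠ x : Circle × Circle in 𝓝 (p, q), ‖midPoint (bdry A x.1) (bdry A x.2)‖ < 1 :=
    hc.norm.continuousAt.eventually_lt continuousAt_const (by rw [h0]; simp)
  filter_upwards [e1, e2] with x hx1 hx2
  simp only [mem_preimage, Function.comp, hx2, dif_pos] at hx1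
  refine ⟨_, ?_, hx1⟩
  rw [← smul_mem_gline A, smul_inv_smul]
  exact mem_gline_of_cayley_eq_midPoint (cayley_invCayley _ _)

/-! ### Barycentric coordinates -/

theorem vert_apply_self {G : Type*} (g : G) : vert g g = 1 := by simp [vert]

theorem vert_apply_ne {G : Type*} {g h : G} (hh : h ≠ g) : vert g h = 0 := by simp [vert, hh]

theorem mem_simplex_iff {G : Type*} {τ : Set G} (hτ : τ.Finite) {x : G → ℝ} :
    x ∈ simplex τ ↔ (∀ g, 0 ≤ x g) ∧ (∀ g, g ∉ τ → x g = 0) ∧ ∑ᶠ g, x g = 1 := by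
  classical
  constructor
  · intro hx
    have key : simplex τ ⊆ {x | (∀ g, 0 ≤ x g) ∧ (∀ g, g ∉ τ → x g = 0) ∧
        ∑ g ∈ hτ.toFinset, x g = 1} := by
      apply convexHull_min
      · rintro _ ⟨g, hg, rfl⟩
        refine ⟨fun h => ?_, fun h hh => ?_, ?_⟩
        · by_cases hhg : h = g
          · rw [hhg, vert_apply_self]; norm_num
          · rw [vert_apply_ne hhg]
        · exact vert_apply_ne fun e => hh (e ▸ hg)
        · rw [Finset.sum_eq_single g]
          · exact vert_apply_self g
          · exact fun h _ hhg => vert_apply_ne hhg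
          · simp [hg]
      · rintro x ⟨h1, h2, h3⟩ y ⟨h1', h2', h3'⟩ a b ha hb hab
        refine ⟨fun g => ?_, fun g hg => ?_, ?_⟩
        · have := mul_nonneg ha (h1 g)
          have := mul_nonneg hb (h1' g)
          simp only [Pi.add_apply, Pi.smul_apply, smul_eq_mul]
          linarith
        · simp [h2 g hg, h2' g hg]
        · simp only [Pi.add_apply, Pi.smul_apply, smul_eq_mul, Finset.sum_add_distrib,
            ← Finset.mul_sum, h3, h3']
          linarith
    obtain ⟨h1, h2, h3⟩ := key hx
    refine ⟨h1, h2, ?_⟩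
    rw [finsum_eq_sum_of_support_subset _ (s := hτ.toFinset), h3]
    intro g hg
    by_contra hc
    exact hg (h2 g (by simpa using hc))
  · rintro ⟨h1, h2, h3⟩
    rw [finsum_eq_sum_of_support_subset _ (s := hτ.toFinset)] at h3
    · have : x = ∑ g ∈ hτ.toFinset, x g • vert g := by
        funext h
        simp only [Finset.sum_apply, Pi.smul_apply, smul_eq_mul]
        by_cases hh : h ∈ τ
        · rw [Finset.sum_eq_single h]
          · simp [vert_apply_self]
          · exact fun g _ hg => by rw [vert_apply_ne (Ne.symm hg), mul_zero]
          · simp [hh]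
        · rw [h2 h hh, Finset.sum_eq_zero]
          intro g hg
          rw [vert_apply_ne, mul_zero]
          rintro rfl
          exact hh (by simpa using hg)
      rw [this]
      refine (convex_convexHull ℝ _).sum_mem (fun g _ => h1 g) h3 fun g hg => ?_
      exact subset_convexHull ℝ _ ⟨g, by simpa using hg, rfl⟩
    · intro g hg
      by_contra hc
      exact hg (h2 g (by simpa using hc))

theorem isCompact_simplex {G : Type*} {τ : Set G} (hτ : τ.Finite) : IsCompact (simplex τ) :=
  (hτ.image _).isCompact_convexHull (𝕜 := ℝ)

theorem vert_mem_simplex {G : Type*} {τ : Set G} {g : G} (hg : g ∈ τ) : vert g ∈ simplex τ :=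
  subset_convexHull ℝ _ ⟨g, hg, rfl⟩

theorem lineMap_mem_simplex {G : Type*} {τ : Set G} {x y : G → ℝ} (hx : x ∈ simplex τ)
    (hy : y ∈ simplex τ) {r : ℝ} (h0 : 0 ≤ r) (h1 : r ≤ 1) :
    (1 - r) • x + r • y ∈ simplex τ :=
  convex_convexHull ℝ _ hx hy (by linarith) h0 (by ring)

theorem mem_simplex_triple {G : Type*} {a b c : G} (hab : a ≠ b) (hac : a ≠ c) (hbc : b ≠ c)
    {x : G → ℝ} : x ∈ simplex {a, b, c} ↔ 0 ≤ x a ∧ 0 ≤ x b ∧ 0 ≤ x c ∧ x a + x b + x c = 1 ∧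
      ∀ g, g ≠ a → g ≠ b → g ≠ c → x g = 0 := by
  classical
  rw [mem_simplex_iff (by simp)]
  have key : (∀ g, g ∉ ({a, b, c} : Set G) → x g = 0) → ∑ᶠ g, x g = x a + x b + x c := by
    intro h
    rw [finsum_eq_sum_of_support_subset _ (s := {a, b, c})]
    · rw [Finset.sum_insert (by simp [hab, hac]), Finset.sum_insert (by simp [hbc]),
        Finset.sum_singleton, add_assoc]
    · intro g hg
      by_contra hc
      exact hg (h g (by simpa using hc))
  constructor
  · rintro ⟨h1, h2, h3⟩
    exact ⟨h1 a, h1 b, h1 c, by rw [← key h2, h3], fun g h h' h'' => h2 g (by simp [h, h', h''])⟩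
  · rintro ⟨h1, h2, h3, h4, h5⟩
    have h6 : ∀ g, g ∉ ({a, b, c} : Set G) → x g = 0 := by
      intro g hg
      simp only [mem_insert_iff, mem_singleton_iff, not_or] at hg
      exact h5 g hg.1 hg.2.1 hg.2.2
    refine ⟨fun g => ?_, h6, by rw [key h6, h4]⟩
    by_cases hg : g ∈ ({a, b, c} : Set G)
    · rcases hg with rfl | rfl | rfl <;> assumption
    · rw [h6 g hg]

/-! ### The cells of the triangulation and barycentric coordinates on ℍ -/

section

variable {G : Type*} [Group G] [MulAction G ℍ] (T : OneVertexTriangulation G)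

theorem OneVertexTriangulation.finite_triangle {τ : Set G} (hτ : τ ∈ T.triangles) : τ.Finite :=
  Set.finite_of_ncard_ne_zero (by rw [T.ncard_triangle τ hτ]; norm_num)

theorem OneVertexTriangulation.eq_triple {τ : Set G} (hτ : τ ∈ T.triangles) :
    ∃ a b c, a ≠ b ∧ a ≠ c ∧ b ≠ c ∧ τ = {a, b, c} :=
  Set.ncard_eq_three.1 (T.ncard_triangle τ hτ)

theorem OneVertexTriangulation.eq_triple_of_mem {τ : Set G} (hτ : τ ∈ T.triangles) {a : G}
    (ha : a ∈ τ) : ∃ b c, a ≠ b ∧ a ≠ c ∧ b ≠ c ∧ τ = {a, b, c} := by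
  obtain ⟨x, y, z, h1, h2, h3, rfl⟩ := T.eq_triple hτ
  rcases ha with rfl | rfl | rfl
  · exact ⟨y, z, h1, h2, h3, rfl⟩
  · exact ⟨x, z, h1.symm, h3, h2, Set.insert_comm _ _ _⟩
  · refine ⟨x, y, h2.symm, h3.symm, h1, ?_⟩
    ext g; simp only [mem_insert_iff, mem_singleton_iff]; tauto

theorem OneVertexTriangulation.eq_triple_of_mem_mem {τ : Set G} (hτ : τ ∈ T.triangles) {a b : G}
    (ha : a ∈ τ) (hb : b ∈ τ) (hab : a ≠ b) : ∃ c, a ≠ c ∧ b ≠ c ∧ τ = {a, b, c} := by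
  obtain ⟨x, y, h1, h2, h3, rfl⟩ := T.eq_triple_of_mem hτ ha
  rcases hb with rfl | rfl | rfl
  · exact absurd rfl hab
  · exact ⟨y, h2, h3, rfl⟩
  · exact ⟨x, h1, h3.symm, by rw [Set.pair_comm]⟩

/-- The barycentric coordinates of a point of the plane. -/
noncomputable def OneVertexTriangulation.bary (z : ℍ) : G → ℝ :=
  Function.invFunOn T.toPlane (⋃ τ ∈ T.triangles, simplex τ) z

theorem OneVertexTriangulation.toPlane_bary (z : ℍ) : T.toPlane (T.bary z) = z :=
  Function.invFunOn_eq (T.bijOn.surjOn (mem_univ z))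

theorem OneVertexTriangulation.exists_bary_mem (z : ℍ) :
    ∃ τ ∈ T.triangles, T.bary z ∈ simplex τ := by
  simpa [OneVertexTriangulation.bary] using
    Function.invFunOn_mem (T.bijOn.surjOn (mem_univ z))

theorem OneVertexTriangulation.bary_toPlane {τ : Set G} (hτ : τ ∈ T.triangles) {x : G → ℝ}
    (hx : x ∈ simplex τ) : T.bary (T.toPlane x) = x :=
  T.bijOn.injOn.leftInvOn_invFunOn (mem_biUnion hτ hx)

theorem OneVertexTriangulation.bary_injective : Function.Injective T.bary := fun z w h => by
  rw [← T.toPlane_bary z, h, T.toPlane_bary]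

/-- The closed triangle in the plane. -/
def OneVertexTriangulation.cell (τ : Set G) : Set ℍ := T.toPlane '' simplex τ

theorem OneVertexTriangulation.bary_mem_simplex {τ : Set G} (hτ : τ ∈ T.triangles) {z : ℍ} :
    T.bary z ∈ simplex τ ↔ z ∈ T.cell τ := by
  constructor
  · exact fun h => ⟨_, h, T.toPlane_bary z⟩
  · rintro ⟨x, hx, rfl⟩
    rwa [T.bary_toPlane hτ hx]

theorem OneVertexTriangulation.bary_nonneg (z : ℍ) (g : G) : 0 ≤ T.bary z g := by
  obtain ⟨τ, hτ, h⟩ := T.exists_bary_mem z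
  exact ((mem_simplex_iff (T.finite_triangle hτ)).1 h).1 g

theorem OneVertexTriangulation.finsum_bary (z : ℍ) : ∑ᶠ g, T.bary z g = 1 := by
  obtain ⟨τ, hτ, h⟩ := T.exists_bary_mem z
  exact ((mem_simplex_iff (T.finite_triangle hτ)).1 h).2.2

theorem OneVertexTriangulation.mem_cell_iff {τ : Set G} (hτ : τ ∈ T.triangles) {z : ℍ} :
    z ∈ T.cell τ ↔ ∀ g, 0 < T.bary z g → g ∈ τ := by
  rw [← T.bary_mem_simplex hτ, mem_simplex_iff (T.finite_triangle hτ)]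
  constructor
  · rintro ⟨-, h, -⟩ g hg
    by_contra hc
    rw [h g hc] at hg
    exact lt_irrefl _ hg
  · intro h
    refine ⟨T.bary_nonneg z, fun g hg => ?_, T.finsum_bary z⟩
    by_contra hc
    exact hg (h g (lt_of_le_of_ne (T.bary_nonneg z g) (Ne.symm hc)))

theorem OneVertexTriangulation.exists_mem_cell (z : ℍ) : ∃ τ ∈ T.triangles, z ∈ T.cell τ := by
  obtain ⟨τ, hτ, h⟩ := T.exists_bary_mem z
  exact ⟨τ, hτ, (T.bary_mem_simplex hτ).1 h⟩

theorem OneVertexTriangulation.exists_bary_pos (z : ℍ) : ∃ g, 0 < T.bary z g := by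
  by_contra! h
  have h0 : ∀ g, T.bary z g = 0 := fun g => le_antisymm (h g) (T.bary_nonneg z g)
  have := T.finsum_bary z
  simp [h0] at this

theorem OneVertexTriangulation.isCompact_cell {τ : Set G} (hτ : τ ∈ T.triangles) :
    IsCompact (T.cell τ) :=
  (isCompact_simplex (T.finite_triangle hτ)).image_of_continuousOn (T.continuousOn_simplex τ hτ)

theorem translate_mem_simplex {G : Type*} [Group G] {τ : Set G} (hτ : τ.Finite) (g : G)
    {x : G → ℝ} (hx : x ∈ simplex τ) :
    (fun h => x (g⁻¹ * h)) ∈ simplex ((fun h => g * h) '' τ) := by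
  obtain ⟨h1, h2, h3⟩ := (mem_simplex_iff hτ).1 hx
  refine (mem_simplex_iff (hτ.image _)).2 ⟨fun h => h1 _, fun h hh => h2 _ fun hc => hh ?_, ?_⟩
  · exact ⟨_, hc, by simp⟩
  · rw [← h3]
    exact finsum_comp_equiv (Equiv.mulLeft g⁻¹)

theorem OneVertexTriangulation.bary_smul (g : G) (z : ℍ) (h : G) :
    T.bary (g • z) h = T.bary z (g⁻¹ * h) := by
  obtain ⟨τ, hτ, hz⟩ := T.exists_bary_mem z
  have h1 := T.equivariant g τ hτ _ hz
  rw [T.toPlane_bary] at h1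
  rw [← h1, T.bary_toPlane (T.translate_mem g τ hτ)
    (translate_mem_simplex (T.finite_triangle hτ) g hz)]

theorem OneVertexTriangulation.smul_mem_cell {τ : Set G} (hτ : τ ∈ T.triangles) (g : G) {z : ℍ}
    (hz : z ∈ T.cell τ) : g • z ∈ T.cell ((fun h => g * h) '' τ) := by
  rw [T.mem_cell_iff (T.translate_mem g τ hτ)]
  intro h hh
  rw [T.bary_smul] at hh
  exact ⟨_, (T.mem_cell_iff hτ).1 hz _ hh, by simp⟩

theorem OneVertexTriangulation.exists_translate {τ : Set G} (hτ : τ ∈ T.triangles) {g : G}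
    (hg : g ∈ τ) : ∃ σ ∈ {τ ∈ T.triangles | (1 : G) ∈ τ}, τ = (fun h => g * h) '' σ := by
  refine ⟨(fun h => g⁻¹ * h) '' τ, ⟨T.translate_mem _ τ hτ, g, hg, by simp⟩, ?_⟩
  rw [image_image]
  simp

theorem OneVertexTriangulation.finite_star_at (g : G) : {τ ∈ T.triangles | g ∈ τ}.Finite := by
  refine (T.finite_star.image fun σ => (fun h => g * h) '' σ).subset ?_
  rintro τ ⟨hτ, hg⟩
  obtain ⟨σ, hσ, rfl⟩ := T.exists_translate hτ hg
  exact ⟨σ, hσ, rfl⟩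

theorem OneVertexTriangulation.triangles_nonempty : T.triangles.Nonempty := by
  obtain ⟨τ, hτ, -⟩ := T.exists_mem_cell UpperHalfPlane.I
  exact ⟨τ, hτ⟩

theorem OneVertexTriangulation.exists_triangle_mem (g : G) : ∃ τ ∈ T.triangles, g ∈ τ := by
  obtain ⟨τ, hτ⟩ := T.triangles_nonempty
  obtain ⟨a, b, c, -, -, -, rfl⟩ := T.eq_triple hτ
  exact ⟨_, T.translate_mem (g * a⁻¹) _ hτ, a, by simp, by simp⟩

variable (hG : IsSurfaceGroup G)
include hG

/-- Every triangle is a translate of one of the finitely many at the vertex 1, and only finitely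
many translates of a compact cell meet a compact set. -/
theorem OneVertexTriangulation.finite_meeting {K : Set ℍ} (hK : IsCompact K) :
    {τ ∈ T.triangles | (T.cell τ ∩ K).Nonempty}.Finite := by
  have := hG.properlyDiscontinuous
  have h1 : ∀ σ ∈ {τ ∈ T.triangles | (1 : G) ∈ τ},
      {g : G | ((g • ·) '' T.cell σ ∩ K).Nonempty}.Finite := fun σ hσ =>
    finite_disjoint_inter_image (T.isCompact_cell hσ.1) hK
  refine (T.finite_star.biUnion fun σ hσ => (h1 σ hσ).image fun g => (fun h => g * h) '' σ).subset ?_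
  rintro τ ⟨hτ, z, hz, hzK⟩
  obtain ⟨g, hg⟩ : τ.Nonempty := by
    obtain ⟨a, b, c, -, -, -, rfl⟩ := T.eq_triple hτ
    exact ⟨a, by simp⟩
  obtain ⟨σ, hσ, rfl⟩ := T.exists_translate hτ hg
  refine mem_biUnion hσ ⟨g, ⟨z, ⟨g⁻¹ • z, ?_, by simp⟩, hzK⟩, rfl⟩
  have := T.smul_mem_cell hτ g⁻¹ hz
  rw [image_image] at this
  simpa using this

theorem OneVertexTriangulation.locallyFinite_cell :
    LocallyFinite fun τ : T.triangles => T.cell (τ : Set G) := by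
  intro z
  refine ⟨Metric.closedBall z 1, Metric.closedBall_mem_nhds z one_pos, ?_⟩
  have := T.finite_meeting hG (isCompact_closedBall z 1)
  refine Finite.of_finite_image (f := Subtype.val) (this.subset ?_) Subtype.val_injective.injOn
  rintro _ ⟨τ, h, rfl⟩
  exact ⟨τ.2, h⟩

/-- On each cell this is the inverse of a continuous bijection from a compact simplex, and the cells
form a locally finite closed cover. -/
theorem OneVertexTriangulation.continuous_bary : Continuous T.bary := by
  refine (T.locallyFinite_cell hG).continuous ?_ (fun τ => (T.isCompact_cell τ.2).isClosed) ?_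
  · rw [eq_univ_iff_forall]
    intro z
    obtain ⟨τ, hτ, hz⟩ := T.exists_mem_cell z
    exact mem_iUnion.2 ⟨⟨τ, hτ⟩, hz⟩
  · rintro ⟨τ, hτ⟩
    rw [continuousOn_iff_isClosed]
    intro F hF
    refine ⟨T.toPlane '' (F ∩ simplex τ), ?_, ?_⟩
    · refine IsCompact.isClosed (IsCompact.image_of_continuousOn ?_
        ((T.continuousOn_simplex τ hτ).mono inter_subset_right))
      exact (isCompact_simplex (T.finite_triangle hτ)).inter_left hF
    · ext z
      constructor
      · rintro ⟨h1, h2⟩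
        exact ⟨⟨T.bary z, ⟨h1, (T.bary_mem_simplex hτ).2 h2⟩, T.toPlane_bary z⟩, h2⟩
      · rintro ⟨⟨x, ⟨h1, h2⟩, rfl⟩, h3⟩
        refine ⟨?_, h3⟩
        rwa [mem_preimage, T.bary_toPlane hτ h2]

theorem OneVertexTriangulation.isClosed_biUnion_cell {P : Set (Set G)} (hP : P ⊆ T.triangles) :
    IsClosed (⋃ τ ∈ P, T.cell τ) := by
  have h := ((T.locallyFinite_cell hG).comp_injective
    (Set.inclusion_injective hP)).isClosed_iUnion fun τ => (T.isCompact_cell (hP τ.2)).isClosed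
  have e : (⋃ τ ∈ P, T.cell τ) = ⋃ τ : P, T.cell (τ : Set G) := by
    rw [biUnion_eq_iUnion]
  rw [e]
  exact h

theorem OneVertexTriangulation.isOpen_star (g : G) : IsOpen {z | 0 < T.bary z g} :=
  isOpen_lt continuous_const ((continuous_apply g).comp (T.continuous_bary hG))

end

/-! ### Local topology of the hyperbolic plane -/

theorem continuousAt_ofComplex {w : ℂ} (hw : 0 < w.im) :
    ContinuousAt UpperHalfPlane.ofComplex w := by
  apply UpperHalfPlane.ofComplex.continuousAt
  exact ⟨⟨w, hw⟩, trivial, rfl⟩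

theorem image_mem_nhds_of_injOn {V : Set ℍ} {φ : ℍ → ℂ} {z : ℍ} (hV : V ∈ 𝓝 z)
    (hc : ContinuousOn φ V) (hi : InjOn φ V) : φ '' V ∈ 𝓝 (φ z) := by
  have h1 : ((↑) : ℍ → ℂ) '' V ∈ 𝓝 (z : ℂ) :=
    UpperHalfPlane.isOpenEmbedding_coe.image_mem_nhds.2 hV
  obtain ⟨r, hr, hrV⟩ := Metric.nhds_basis_closedBall.mem_iff.1 h1
  have h2 : ∀ w ∈ Metric.closedBall (z : ℂ) r, UpperHalfPlane.ofComplex w ∈ V ∧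
      ((UpperHalfPlane.ofComplex w : ℍ) : ℂ) = w ∧ 0 < w.im := by
    intro w hw
    obtain ⟨v, hv, rfl⟩ := hrV hw
    rw [UpperHalfPlane.ofComplex_apply]
    exact ⟨hv, rfl, v.2⟩
  have h3 := image_closedBall_mem_nhds (f := fun w => φ (UpperHalfPlane.ofComplex w))
    (c := (z : ℂ)) hr ?_ ?_
  · rw [UpperHalfPlane.ofComplex_apply] at h3
    refine mem_of_superset h3 ?_
    rintro _ ⟨w, hw, rfl⟩
    exact ⟨_, (h2 w hw).1, rfl⟩
  · refine hc.comp (fun w hw => (continuousAt_ofComplex (h2 w hw).2.2).continuousWithinAt) ?_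
    exact fun w hw => (h2 w hw).1
  · intro w hw w' hw' h
    have := hi (h2 w hw).1 (h2 w' hw').1 h
    rw [← (h2 w hw).2.1, ← (h2 w' hw').2.1, this]

theorem image_closedBall_mem_nhds_upper {ψ : ℂ → ℍ} {c : ℂ} {r : ℝ} (hr : 0 < r)
    (hc : ContinuousOn ψ (Metric.closedBall c r)) (hi : InjOn ψ (Metric.closedBall c r)) :
    ψ '' Metric.closedBall c r ∈ 𝓝 (ψ c) := by
  have h := image_closedBall_mem_nhds (f := fun w => (ψ w : ℂ)) hr
    (UpperHalfPlane.continuous_coe.comp_continuousOn hc)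
    (fun w hw w' hw' h => hi hw hw' (UpperHalfPlane.ext h))
  rw [← image_image (fun z : ℍ => (z : ℂ))] at h
  exact UpperHalfPlane.isOpenEmbedding_coe.image_mem_nhds.1 h

/-- A punctured disc is connected as the image of a half plane under the exponential. -/
theorem exists_punctured_nhds {V : Set ℍ} {v : ℍ} (hV : V ∈ 𝓝 v) :
    ∃ B ⊆ V, v ∉ B ∧ IsPreconnected B ∧ insert v B ∈ 𝓝 v := by
  have h1 : ((↑) : ℍ → ℂ) '' V ∈ 𝓝 (v : ℂ) :=
    UpperHalfPlane.isOpenEmbedding_coe.image_mem_nhds.2 hV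
  obtain ⟨r, hr, hrV⟩ := Metric.nhds_basis_ball.mem_iff.1 h1
  have h2 : ∀ w ∈ Metric.ball (v : ℂ) r, UpperHalfPlane.ofComplex w ∈ V ∧
      ((UpperHalfPlane.ofComplex w : ℍ) : ℂ) = w ∧ 0 < w.im := by
    intro w hw
    obtain ⟨v, hv, rfl⟩ := hrV hw
    rw [UpperHalfPlane.ofComplex_apply]
    exact ⟨hv, rfl, v.2⟩
  have h3 : ∀ u : ℂ, u.re < Real.log r → (v : ℂ) + Complex.exp u ∈ Metric.ball (v : ℂ) r := by
    intro u hu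
    rw [mem_ball_iff_norm, add_sub_cancel_left, Complex.norm_exp]
    exact (Real.lt_log_iff_exp_lt hr).1 hu
  refine ⟨(fun u : ℂ => UpperHalfPlane.ofComplex (v + Complex.exp u)) ''
    {u : ℂ | u.re < Real.log r}, ?_, ?_, ?_, ?_⟩
  · rintro _ ⟨u, hu, rfl⟩
    exact (h2 _ (h3 u hu)).1
  · rintro ⟨u, hu, h⟩
    have := (h2 _ (h3 u hu)).2.1
    simp only at h
    rw [h] at this
    exact Complex.exp_ne_zero u (by linear_combination -this)
  · refine ((convex_halfSpace_re_lt _).isPreconnected).image _ fun u hu => ?_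
    refine ContinuousAt.continuousWithinAt ?_
    refine ContinuousAt.comp (f := fun u : ℂ => (v : ℂ) + Complex.exp u)
      (continuousAt_ofComplex (h2 _ (h3 u hu)).2.2) (by fun_prop)
  · rw [← UpperHalfPlane.isOpenEmbedding_coe.image_mem_nhds]
    refine mem_of_superset (Metric.ball_mem_nhds _ hr) fun w hw => ?_
    refine ⟨_, ?_, (h2 w hw).2.1⟩
    by_cases hwv : w = v
    · left; rw [hwv, UpperHalfPlane.ofComplex_apply]
    · right
      have h0 : w - v ≠ 0 := sub_ne_zero.2 hwv
      refine ⟨Complex.log (w - v), ?_, ?_⟩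
      · simp only [mem_ofPred_eq, Complex.log_re]
        exact Real.log_lt_log (norm_pos_iff.2 h0) (mem_ball_iff_norm.1 hw)
      · simp only [Complex.exp_log h0, add_sub_cancel]

/-! ### The dual graph of a triangulation -/

section

variable {G : Type*} [Group G] [MulAction G ℍ] (T : OneVertexTriangulation G)

theorem OneVertexTriangulation.continuousOn_segment {τ : Set G} (hτ : τ ∈ T.triangles)
    {x y : G → ℝ} (hx : x ∈ simplex τ) (hy : y ∈ simplex τ) :
    ContinuousOn (fun r : ℝ => T.toPlane ((1 - r) • x + r • y)) (Icc 0 1) := by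
  refine (T.continuousOn_simplex τ hτ).comp (by fun_prop) fun r hr => ?_
  exact lineMap_mem_simplex hx hy hr.1 hr.2

theorem OneVertexTriangulation.bary_vertex (g : G) : T.bary (T.vertex g) = vert g := by
  obtain ⟨τ, hτ, hg⟩ := T.exists_triangle_mem g
  exact T.bary_toPlane hτ (vert_mem_simplex hg)

theorem OneVertexTriangulation.vertex_mem_cell {τ : Set G} {g : G} (hg : g ∈ τ) :
    T.vertex g ∈ T.cell τ := ⟨_, vert_mem_simplex hg, rfl⟩

theorem OneVertexTriangulation.vertex_mem_cell_iff {τ : Set G} (hτ : τ ∈ T.triangles) {g : G} :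
    T.vertex g ∈ T.cell τ ↔ g ∈ τ := by
  refine ⟨fun h => ?_, T.vertex_mem_cell⟩
  refine (T.mem_cell_iff hτ).1 h g ?_
  rw [T.bary_vertex, vert_apply_self]; norm_num

variable (hG : IsSurfaceGroup G)
include hG

theorem OneVertexTriangulation.eventually_mem_cell {a b : G} (hab : a ≠ b) {τ : Set G}
    (hτ : τ ∈ T.triangles) (ha : a ∈ τ) (hb : b ∈ τ) :
    ∃ V, V ∈ 𝓝 (T.toPlane ((2 : ℝ)⁻¹ • vert a + (2 : ℝ)⁻¹ • vert b)) ∧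
      ∀ z ∈ V, 0 < T.bary z a ∧ 0 < T.bary z b := by
  refine ⟨{z | 0 < T.bary z a} ∩ {z | 0 < T.bary z b}, ?_, fun z hz => hz⟩
  refine ((T.isOpen_star hG a).inter (T.isOpen_star hG b)).mem_nhds ?_
  have h1 : (2 : ℝ)⁻¹ • vert a + (2 : ℝ)⁻¹ • vert b ∈ simplex τ := by
    have := lineMap_mem_simplex (vert_mem_simplex ha) (vert_mem_simplex hb) (r := 2⁻¹)
      (by norm_num) (by norm_num)
    norm_num at this ⊢
    exact this
  refine ⟨?_, ?_⟩
  · simp only [mem_ofPred_eq]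
    rw [T.bary_toPlane hτ h1]
    simp [vert_apply_self, vert_apply_ne hab]
  · simp only [mem_ofPred_eq]
    rw [T.bary_toPlane hτ h1]
    simp [vert_apply_self, vert_apply_ne hab.symm]

/-- If the triangle abc were the only one on the edge ab, the coordinates (a - b, c) would embed a
neighbourhood of the midpoint of the edge into a closed half plane with the midpoint on its
boundary, against invariance of domain. -/
theorem OneVertexTriangulation.exists_other_triangle {a b : G} (hab : a ≠ b) {τ : Set G}
    (hτ : τ ∈ T.triangles) (ha : a ∈ τ) (hb : b ∈ τ) :
    ∃ σ ∈ T.triangles, σ ≠ τ ∧ a ∈ σ ∧ b ∈ σ := by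
  by_contra! hno
  obtain ⟨V, hV, hVab⟩ := T.eventually_mem_cell hG hab hτ ha hb
  obtain ⟨c, hac, hbc, rfl⟩ := T.eq_triple_of_mem_mem hτ ha hb hab
  have hcell : ∀ z ∈ V, T.bary z ∈ simplex {a, b, c} := by
    intro z hz
    obtain ⟨σ, hσ, hzσ⟩ := T.exists_mem_cell z
    have h1 := (T.mem_cell_iff hσ).1 hzσ
    have : σ = {a, b, c} := by
      by_contra hne
      exact hno σ hσ hne (h1 a (hVab z hz).1) (h1 b (hVab z hz).2)
    rw [T.bary_mem_simplex hτ, ← this]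
    exact hzσ
  have hmem := image_mem_nhds_of_injOn
    (φ := fun z => ((T.bary z a - T.bary z b : ℝ) : ℂ) + ((T.bary z c : ℝ) : ℂ) * Complex.I) hV ?_ ?_
  · have h1 : (2 : ℝ)⁻¹ • vert a + (2 : ℝ)⁻¹ • vert b ∈ simplex {a, b, c} := by
      rw [mem_simplex_triple hab hac hbc]
      simp only [Pi.add_apply, Pi.smul_apply, smul_eq_mul, vert_apply_self, vert_apply_ne hab,
        vert_apply_ne hab.symm, vert_apply_ne hac.symm, vert_apply_ne hbc.symm]
      refine ⟨by norm_num, by norm_num, by norm_num, by norm_num, fun g h h' _ => ?_⟩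
      rw [vert_apply_ne h, vert_apply_ne h']; norm_num
    obtain ⟨r, hr, hrV⟩ := Metric.nhds_basis_closedBall.mem_iff.1 hmem
    -- A value just below the image of the midpoint, where the coordinate of c would be negative.
    have h2 := @hrV (((T.bary (T.toPlane ((2 : ℝ)⁻¹ • vert a + (2 : ℝ)⁻¹ • vert b)) a -
      T.bary (T.toPlane ((2 : ℝ)⁻¹ • vert a + (2 : ℝ)⁻¹ • vert b)) b : ℝ) : ℂ) +
      ((T.bary (T.toPlane ((2 : ℝ)⁻¹ • vert a + (2 : ℝ)⁻¹ • vert b)) c : ℝ) : ℂ) * Complex.I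
      - r * Complex.I) ?_
    · obtain ⟨z, hz, he⟩ := h2
      have h3 := congrArg Complex.im he
      rw [T.bary_toPlane hτ h1] at h3
      simp [vert_apply_ne hac.symm, vert_apply_ne hbc.symm] at h3
      have := T.bary_nonneg z c
      linarith
    · rw [mem_closedBall_iff_norm, sub_sub_cancel_left]
      simp [abs_of_pos hr]
  · have hcb := T.continuous_bary hG
    have h : ∀ g, Continuous fun z => T.bary z g := fun g => (continuous_apply g).comp hcb
    have ha := h a
    have hb := h b
    have hc := h c
    refine Continuous.continuousOn ?_
    fun_prop
  · intro z hz w hw h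
    have h1 := congrArg Complex.re h
    have h2 := congrArg Complex.im h
    simp at h1 h2
    obtain ⟨-, -, -, h3, h4⟩ := (mem_simplex_triple hab hac hbc).1 (hcell z hz)
    obtain ⟨-, -, -, h3', h4'⟩ := (mem_simplex_triple hab hac hbc).1 (hcell w hw)
    apply T.bary_injective
    funext g
    by_cases hga : g = a
    · subst hga; linarith
    by_cases hgb : g = b
    · subst hgb; linarith
    by_cases hgc : g = c
    · subst hgc; linarith
    rw [h4 g hga hgb hgc, h4' g hga hgb hgc]

omit hG in
-- Two triangles on an edge already fill a neighbourhood of its midpoint, again by invariance of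
-- domain, so a third one has no room. Together with `exists_other_triangle` an edge lies in exactly
-- two triangles.
theorem OneVertexTriangulation.third_vertex_eq {a b c₁ c₂ c₃ : G} (hab : a ≠ b)
    (ha₁ : a ≠ c₁) (hb₁ : b ≠ c₁) (ha₂ : a ≠ c₂) (hb₂ : b ≠ c₂) (ha₃ : a ≠ c₃) (hb₃ : b ≠ c₃)
    (h₁ : {a, b, c₁} ∈ T.triangles) (h₂ : {a, b, c₂} ∈ T.triangles)
    (h₃ : {a, b, c₃} ∈ T.triangles) (h₁₂ : c₁ ≠ c₂) : c₃ = c₁ ∨ c₃ = c₂ := by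
  by_contra! h3
  obtain ⟨h₃₁, h₃₂⟩ := h3
  -- Folds a small disc into the union of two triangles: the real part runs along the edge, the
  -- imaginary part towards c₁ or c₂ according to its sign.
  let P : ℂ → G → ℝ := fun w => (2⁻¹ + w.re - |w.im| / 2) • vert a +
    (2⁻¹ - w.re - |w.im| / 2) • vert b + max w.im 0 • vert c₁ + max (-w.im) 0 • vert c₂
  have hPc : Continuous P := by fun_prop
  have hPa : ∀ w, P w a = 2⁻¹ + w.re - |w.im| / 2 := fun w => by
    simp [P, vert_apply_self, vert_apply_ne hab, vert_apply_ne ha₁, vert_apply_ne ha₂]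
  have hPb : ∀ w, P w b = 2⁻¹ - w.re - |w.im| / 2 := fun w => by
    simp [P, vert_apply_self, vert_apply_ne hab.symm, vert_apply_ne hb₁, vert_apply_ne hb₂]
  have hP1 : ∀ w, P w c₁ = max w.im 0 := fun w => by
    simp [P, vert_apply_self, vert_apply_ne ha₁.symm, vert_apply_ne hb₁.symm, vert_apply_ne h₁₂]
  have hP2 : ∀ w, P w c₂ = max (-w.im) 0 := fun w => by
    simp [P, vert_apply_self, vert_apply_ne ha₂.symm, vert_apply_ne hb₂.symm,
      vert_apply_ne h₁₂.symm]
  have hP0 : ∀ w g, g ≠ a → g ≠ b → g ≠ c₁ → g ≠ c₂ → P w g = 0 := fun w g h h' h'' h''' => by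
    simp [P, vert_apply_ne h, vert_apply_ne h', vert_apply_ne h'', vert_apply_ne h''']
  have hbd : ∀ w ∈ Metric.closedBall (0 : ℂ) 4⁻¹, |w.re| ≤ 4⁻¹ ∧ |w.im| ≤ 4⁻¹ := fun w hw => by
    rw [mem_closedBall_zero_iff] at hw
    exact ⟨(Complex.abs_re_le_norm w).trans hw, (Complex.abs_im_le_norm w).trans hw⟩
  have hm1 : ∀ w ∈ Metric.closedBall (0 : ℂ) 4⁻¹, 0 ≤ w.im → P w ∈ simplex {a, b, c₁} := by
    intro w hw him
    obtain ⟨hr, hi⟩ := hbd w hw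
    obtain ⟨hr1, hr2⟩ := abs_le.1 hr
    rw [mem_simplex_triple hab ha₁ hb₁, hPa, hPb, hP1, max_eq_left him, abs_of_nonneg him]
    rw [abs_of_nonneg him] at hi
    refine ⟨by linarith, by linarith, him, by ring, fun g h h' h'' => ?_⟩
    by_cases hg : g = c₂
    · rw [hg, hP2]; exact max_eq_right (by linarith)
    · exact hP0 w g h h' h'' hg
  have hm2 : ∀ w ∈ Metric.closedBall (0 : ℂ) 4⁻¹, w.im ≤ 0 → P w ∈ simplex {a, b, c₂} := by
    intro w hw him
    obtain ⟨hr, hi⟩ := hbd w hw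
    obtain ⟨hr1, hr2⟩ := abs_le.1 hr
    rw [mem_simplex_triple hab ha₂ hb₂, hPa, hPb, hP2, max_eq_left (by linarith),
      abs_of_nonpos him]
    rw [abs_of_nonpos him] at hi
    refine ⟨by linarith, by linarith, by linarith, by ring, fun g h h' h'' => ?_⟩
    by_cases hg : g = c₁
    · rw [hg, hP1]; exact max_eq_right him
    · exact hP0 w g h h' hg h''
  have hbary : ∀ w ∈ Metric.closedBall (0 : ℂ) 4⁻¹, T.bary (T.toPlane (P w)) = P w := by
    intro w hw
    rcases le_total 0 w.im with h | h
    · exact T.bary_toPlane h₁ (hm1 w hw h)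
    · exact T.bary_toPlane h₂ (hm2 w hw h)
  have hnhds := image_closedBall_mem_nhds_upper (ψ := fun w => T.toPlane (P w)) (c := 0) (r := 4⁻¹)
    (by norm_num) ?_ ?_
  -- The segment from the midpoint towards c₃ starts in the neighbourhood that is filled by the two
  -- triangles, where the coordinate of c₃ vanishes.
  · have hseg : ContinuousOn (fun r : ℝ => T.toPlane ((1 - r) • P 0 + r • vert c₃)) (Icc 0 1) := by
      apply T.continuousOn_segment h₃ _ (vert_mem_simplex (by simp))
      rw [mem_simplex_triple hab ha₃ hb₃, hPa, hPb, hP0 0 c₃ ha₃.symm hb₃.symm h₃₁ h₃₂]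
      refine ⟨by norm_num, by norm_num, le_rfl, by norm_num, fun g h h' h'' => ?_⟩
      by_cases hg1 : g = c₁
      · rw [hg1, hP1]; simp
      by_cases hg2 : g = c₂
      · rw [hg2, hP2]; simp
      exact hP0 _ g h h' hg1 hg2
    have h0 := hseg 0 (by norm_num)
    have h1 : Tendsto (fun r : ℝ => T.toPlane ((1 - r) • P 0 + r • vert c₃)) (𝓝[>] 0)
        (𝓝 (T.toPlane (P 0))) := by
      have := h0.tendsto
      simp only [sub_zero, one_smul, zero_smul, add_zero] at this
      refine this.mono_left ?_
      rw [← nhdsWithin_Ioc_eq_nhdsGT (zero_lt_one' ℝ)]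
      exact nhdsWithin_mono _ Ioc_subset_Icc_self
    have h2 := (h1.eventually hnhds).and (Ioc_mem_nhdsGT (zero_lt_one' ℝ))
    obtain ⟨r, ⟨w, hw, he⟩, hr0, hr1⟩ := h2.exists
    have hmem3 : (1 - r) • P 0 + r • vert c₃ ∈ simplex {a, b, c₃} := by
      refine lineMap_mem_simplex ?_ (vert_mem_simplex (by simp)) hr0.le hr1
      rw [mem_simplex_triple hab ha₃ hb₃, hPa, hPb, hP0 0 c₃ ha₃.symm hb₃.symm h₃₁ h₃₂]
      refine ⟨by norm_num, by norm_num, le_rfl, by norm_num, fun g h h' h'' => ?_⟩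
      by_cases hg1 : g = c₁
      · rw [hg1, hP1]; simp
      by_cases hg2 : g = c₂
      · rw [hg2, hP2]; simp
      exact hP0 _ g h h' hg1 hg2
    have h3 := congrFun (congrArg T.bary he) c₃
    rw [hbary w hw, T.bary_toPlane h₃ hmem3, hP0 w c₃ ha₃.symm hb₃.symm h₃₁ h₃₂] at h3
    simp only [Pi.add_apply, Pi.smul_apply, smul_eq_mul, vert_apply_self,
      hP0 0 c₃ ha₃.symm hb₃.symm h₃₁ h₃₂] at h3
    linarith
  · have hU : ContinuousOn T.toPlane (simplex {a, b, c₁} ∪ simplex {a, b, c₂}) :=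
      (T.continuousOn_simplex _ h₁).union_of_isClosed (T.continuousOn_simplex _ h₂)
        (isCompact_simplex (T.finite_triangle h₁)).isClosed
        (isCompact_simplex (T.finite_triangle h₂)).isClosed
    refine hU.comp hPc.continuousOn fun w hw => ?_
    rcases le_total 0 w.im with h | h
    · exact Or.inl (hm1 w hw h)
    · exact Or.inr (hm2 w hw h)
  · intro w hw w' hw' h
    have h1 := congrArg T.bary h
    simp only at h1
    rw [hbary w hw, hbary w' hw'] at h1
    have e1 := congrFun h1 a
    have e2 := congrFun h1 b
    have e3 := congrFun h1 c₁
    have e4 := congrFun h1 c₂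
    rw [hPa, hPa] at e1
    rw [hPb, hPb] at e2
    rw [hP1, hP1] at e3
    rw [hP2, hP2] at e4
    apply Complex.ext
    · linarith
    · have h5 := max_zero_sub_max_neg_zero_eq_self w.im
      have h6 := max_zero_sub_max_neg_zero_eq_self w'.im
      linarith

end

/-- Closed discs about the centre do it: their complement is an annulus, which is the image of a
strip under the exponential. This is the topological source of one-endedness. -/
theorem exists_isCompact_isPreconnected_compl {K : Set ℍ} (hK : IsCompact K) :
    ∃ L, K ⊆ L ∧ IsCompact L ∧ IsPreconnected Lᶜ := by
  obtain ⟨r, hr1, hr⟩ : ∃ r < 1, ∀ z ∈ K, ‖cayley z‖ ≤ r := by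
    rcases K.eq_empty_or_nonempty with rfl | hne
    · exact ⟨0, by norm_num, by simp⟩
    · obtain ⟨z, hz, h⟩ := hK.exists_isMaxOn hne continuous_cayley.norm.continuousOn
      exact ⟨_, norm_cayley_lt_one z, fun w hw => h hw⟩
  set R := max r 2⁻¹
  have hR1 : R < 1 := max_lt hr1 (by norm_num)
  have hR0 : 0 < R := lt_max_of_lt_right (by norm_num)
  have hinv : ∀ w : ℂ, ‖w‖ < 1 → 0 < (Complex.I * (1 + w) / (1 - w)).im := fun w hw =>
    (invCayley w hw).2
  have hinv' : ∀ w : ℂ, ∀ hw : ‖w‖ < 1,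
      UpperHalfPlane.ofComplex (Complex.I * (1 + w) / (1 - w)) = invCayley w hw := by
    intro w hw
    rw [UpperHalfPlane.ofComplex_apply_of_im_pos (hinv w hw)]
    rfl
  have hcont : ContinuousOn
      (fun w : ℂ => UpperHalfPlane.ofComplex (Complex.I * (1 + w) / (1 - w))) {w | ‖w‖ < 1} := by
    intro w hw
    refine ContinuousAt.continuousWithinAt ?_
    refine ContinuousAt.comp (f := fun w : ℂ => Complex.I * (1 + w) / (1 - w))
      (continuousAt_ofComplex (hinv w hw)) ?_
    have : 1 - w ≠ 0 := by
      intro h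
      have : w = 1 := by linear_combination -h
      rw [mem_ofPred_eq, this] at hw; simp at hw
    fun_prop (disch := assumption)
  refine ⟨{z | ‖cayley z‖ ≤ R}, fun z hz => (hr z hz).trans (le_max_left _ _), ?_, ?_⟩
  · have : {z | ‖cayley z‖ ≤ R} = (fun w : ℂ =>
        UpperHalfPlane.ofComplex (Complex.I * (1 + w) / (1 - w))) '' Metric.closedBall 0 R := by
      ext z
      constructor
      · intro hz
        refine ⟨cayley z, by simpa using hz, ?_⟩
        simp only
        rw [hinv' _ (norm_cayley_lt_one z), invCayley_cayley]
      · rintro ⟨w, hw, rfl⟩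
        rw [mem_closedBall_zero_iff] at hw
        simp only
        rw [mem_ofPred_eq, hinv' w (hw.trans_lt hR1), cayley_invCayley]
        exact hw
    rw [this]
    refine (isCompact_closedBall _ _).image_of_continuousOn (hcont.mono fun w hw => ?_)
    exact (mem_closedBall_zero_iff.1 hw).trans_lt hR1
  · have : {z | ‖cayley z‖ ≤ R}ᶜ = (fun u : ℂ => UpperHalfPlane.ofComplex
        (Complex.I * (1 + Complex.exp u) / (1 - Complex.exp u))) ''
          ({u | Real.log R < u.re} ∩ {u | u.re < 0}) := by
      ext z
      constructor
      · intro hz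
        rw [mem_compl_iff, mem_ofPred_eq, not_le] at hz
        have h0 : cayley z ≠ 0 := norm_pos_iff.1 (hR0.trans hz)
        refine ⟨Complex.log (cayley z), ⟨?_, ?_⟩, ?_⟩
        · rw [mem_ofPred_eq, Complex.log_re]
          exact Real.log_lt_log hR0 hz
        · rw [mem_ofPred_eq, Complex.log_re]
          exact Real.log_neg (hR0.trans hz) (norm_cayley_lt_one z)
        · simp only [Complex.exp_log h0]
          rw [hinv' _ (norm_cayley_lt_one z), invCayley_cayley]
      · rintro ⟨u, ⟨h1, h2⟩, rfl⟩
        have h3 : ‖Complex.exp u‖ < 1 := by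
          rw [Complex.norm_exp]; exact Real.exp_lt_one_iff.2 h2
        simp only
        rw [mem_compl_iff, mem_ofPred_eq, not_le, hinv' _ h3, cayley_invCayley, Complex.norm_exp]
        exact (Real.log_lt_iff_lt_exp hR0).1 h1
    rw [this]
    refine ((convex_halfSpace_re_gt _).inter (convex_halfSpace_re_lt _)).isPreconnected.image _ ?_
    refine hcont.comp (f := Complex.exp) Complex.continuous_exp.continuousOn fun u hu => ?_
    rw [mem_ofPred_eq, Complex.norm_exp]
    exact Real.exp_lt_one_iff.2 hu.2

/-! ### Connectedness of the dual graph and of the link of a vertex -/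

section

variable {G : Type*} [Group G] [MulAction G ℍ] (T : OneVertexTriangulation G)

/-- Two triangles (possibly equal) with a common edge. -/
def OneVertexTriangulation.Adj (σ τ : Set G) : Prop :=
  σ ∈ T.triangles ∧ τ ∈ T.triangles ∧ ∃ a b, a ≠ b ∧ a ∈ σ ∧ b ∈ σ ∧ a ∈ τ ∧ b ∈ τ

/-- Two triangles with a common edge through the vertex `v`. -/
def OneVertexTriangulation.StarAdj (v : G) (σ τ : Set G) : Prop :=
  σ ∈ T.triangles ∧ τ ∈ T.triangles ∧ v ∈ σ ∧ v ∈ τ ∧ ∃ a, a ≠ v ∧ a ∈ σ ∧ a ∈ τ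

variable {T}

theorem OneVertexTriangulation.StarAdj.adj {v : G} {σ τ : Set G} (h : T.StarAdj v σ τ) :
    T.Adj σ τ := by
  obtain ⟨h1, h2, h3, h4, a, h5, h6, h7⟩ := h
  exact ⟨h1, h2, v, a, h5.symm, h3, h6, h4, h7⟩

theorem OneVertexTriangulation.Adj.symm {σ τ : Set G} (h : T.Adj σ τ) : T.Adj τ σ := by
  obtain ⟨h1, h2, a, b, h3, h4, h5, h6, h7⟩ := h
  exact ⟨h2, h1, a, b, h3, h6, h7, h4, h5⟩

variable (T) (hG : IsSurfaceGroup G)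
include hG

/-- The triangles at v that are reached from σ and those that are not cover a small connected
punctured neighbourhood of v by two closed sets. They share a point z ≠ v; a further vertex with
positive coordinate at z gives a common edge at v. -/
theorem OneVertexTriangulation.reflTransGen_starAdj {v : G} {σ τ : Set G} (hσ : σ ∈ T.triangles)
    (hτ : τ ∈ T.triangles) (hvσ : v ∈ σ) (hvτ : v ∈ τ) :
    Relation.ReflTransGen (T.StarAdj v) σ τ := by
  classical
  obtain ⟨B, hBV, hvB, hB, hBn⟩ := exists_punctured_nhds (v := T.vertex v)
    (V := {z | 0 < T.bary z v}) ((T.isOpen_star hG v).mem_nhds (by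
      rw [mem_ofPred_eq, T.bary_vertex, vert_apply_self]; norm_num))
  have hmeet : ∀ ρ ∈ T.triangles, v ∈ ρ → (B ∩ T.cell ρ).Nonempty := by
    intro ρ hρ hvρ
    obtain ⟨b, c, hab, -, -, rfl⟩ := T.eq_triple_of_mem hρ hvρ
    have hb : vert b ∈ simplex {v, b, c} := vert_mem_simplex (by simp)
    have hv : vert v ∈ simplex {v, b, c} := vert_mem_simplex hvρ
    have h1 := ((T.continuousOn_segment hρ hv hb) 0 (by norm_num)).tendsto
    simp only [sub_zero, one_smul, zero_smul, add_zero] at h1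
    have h2 := (h1.mono_left (nhdsWithin_mono _ Ioc_subset_Icc_self)).eventually hBn
    rw [nhdsWithin_Ioc_eq_nhdsGT (zero_lt_one' ℝ)] at h2
    obtain ⟨r, h3, hr0, hr1⟩ := (h2.and (Ioc_mem_nhdsGT (zero_lt_one' ℝ))).exists
    have hmem := lineMap_mem_simplex hv hb hr0.le hr1
    refine ⟨_, h3.resolve_left fun h => ?_, ⟨_, hmem, rfl⟩⟩
    have h4 := congrFun (congrArg T.bary h) b
    rw [T.bary_toPlane hρ hmem, T.bary_vertex] at h4
    simp [vert_apply_self, vert_apply_ne hab.symm] at h4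
    linarith
  by_contra hne
  set P : Set (Set G) := {ρ | ρ ∈ T.triangles ∧ v ∈ ρ ∧ Relation.ReflTransGen (T.StarAdj v) σ ρ}
  set Q : Set (Set G) := {ρ | ρ ∈ T.triangles ∧ v ∈ ρ ∧
    ¬ Relation.ReflTransGen (T.StarAdj v) σ ρ}
  obtain ⟨z, hzB, hzP, hzQ⟩ := isPreconnected_closed_iff.1 hB (⋃ ρ ∈ P, T.cell ρ)
    (⋃ ρ ∈ Q, T.cell ρ) (T.isClosed_biUnion_cell hG fun ρ h => h.1)
    (T.isClosed_biUnion_cell hG fun ρ h => h.1) (by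
      intro z hz
      obtain ⟨ρ, hρ, hzρ⟩ := T.exists_mem_cell z
      have hv : v ∈ ρ := (T.mem_cell_iff hρ).1 hzρ v (hBV hz)
      by_cases h : Relation.ReflTransGen (T.StarAdj v) σ ρ
      · exact Or.inl (mem_biUnion (show ρ ∈ P from ⟨hρ, hv, h⟩) hzρ)
      · exact Or.inr (mem_biUnion (show ρ ∈ Q from ⟨hρ, hv, h⟩) hzρ))
    ((hmeet σ hσ hvσ).mono (inter_subset_inter_right _ (subset_biUnion_of_mem (u := T.cell)
      (show σ ∈ P from ⟨hσ, hvσ, .refl⟩))))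
    ((hmeet τ hτ hvτ).mono (inter_subset_inter_right _ (subset_biUnion_of_mem (u := T.cell)
      (show τ ∈ Q from ⟨hτ, hvτ, hne⟩))))
  simp only [mem_iUnion] at hzP hzQ
  obtain ⟨ρ, ⟨hρ, hvρ, hρP⟩, hzρ⟩ := hzP
  obtain ⟨ρ', ⟨hρ', hvρ', hρQ⟩, hzρ'⟩ := hzQ
  obtain ⟨a, hav, ha⟩ : ∃ a, a ≠ v ∧ 0 < T.bary z a := by
    by_contra! h
    apply hvB
    convert hzB
    apply T.bary_injective
    have h0 : ∀ a, a ≠ v → T.bary z a = 0 := fun a ha => le_antisymm (h a ha) (T.bary_nonneg z a)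
    have h1 := T.finsum_bary z
    rw [finsum_eq_single _ v h0] at h1
    rw [T.bary_vertex]
    funext a
    by_cases hav : a = v
    · rw [hav, vert_apply_self, h1]
    · rw [vert_apply_ne hav, h0 a hav]
  exact hρQ (hρP.tail ⟨hρ, hρ', hvρ, hvρ', a, hav, (T.mem_cell_iff hρ).1 hzρ a ha,
    (T.mem_cell_iff hρ').1 hzρ' a ha⟩)

theorem OneVertexTriangulation.reflTransGen_adj_of_mem {v : G} {σ τ : Set G}
    (hσ : σ ∈ T.triangles) (hτ : τ ∈ T.triangles) (hvσ : v ∈ σ) (hvτ : v ∈ τ) :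
    Relation.ReflTransGen T.Adj σ τ :=
  (T.reflTransGen_starAdj hG hσ hτ hvσ hvτ).lift id fun _ _ h => h.adj

/-- The same argument in the connected plane yields two triangles with a common vertex only; the
passage around that vertex is the previous result. -/
theorem OneVertexTriangulation.reflTransGen_adj {σ τ : Set G} (hσ : σ ∈ T.triangles)
    (hτ : τ ∈ T.triangles) : Relation.ReflTransGen T.Adj σ τ := by
  classical
  have hne : ∀ ρ ∈ T.triangles, (T.cell ρ).Nonempty := by
    intro ρ hρ
    obtain ⟨a, b, c, -, -, -, rfl⟩ := T.eq_triple hρ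
    exact ⟨_, T.vertex_mem_cell (by simp : a ∈ ({a, b, c} : Set G))⟩
  by_contra h
  set P : Set (Set G) := {ρ | ρ ∈ T.triangles ∧ Relation.ReflTransGen T.Adj σ ρ}
  set Q : Set (Set G) := {ρ | ρ ∈ T.triangles ∧ ¬ Relation.ReflTransGen T.Adj σ ρ}
  obtain ⟨z, -, hzP, hzQ⟩ := isPreconnected_closed_iff.1 (isPreconnected_univ (α := ℍ))
    (⋃ ρ ∈ P, T.cell ρ)
    (⋃ ρ ∈ Q, T.cell ρ) (T.isClosed_biUnion_cell hG fun ρ h => h.1)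
    (T.isClosed_biUnion_cell hG fun ρ h => h.1) (by
      intro z _
      obtain ⟨ρ, hρ, hzρ⟩ := T.exists_mem_cell z
      by_cases h : Relation.ReflTransGen T.Adj σ ρ
      · exact Or.inl (mem_biUnion (show ρ ∈ P from ⟨hρ, h⟩) hzρ)
      · exact Or.inr (mem_biUnion (show ρ ∈ Q from ⟨hρ, h⟩) hzρ))
    (by
      obtain ⟨z, hz⟩ := hne σ hσ
      exact ⟨z, trivial, mem_biUnion (show σ ∈ P from ⟨hσ, .refl⟩) hz⟩)
    (by
      obtain ⟨z, hz⟩ := hne τ hτ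
      exact ⟨z, trivial, mem_biUnion (show τ ∈ Q from ⟨hτ, h⟩) hz⟩)
  simp only [mem_iUnion] at hzP hzQ
  obtain ⟨ρ, ⟨hρ, hρP⟩, hzρ⟩ := hzP
  obtain ⟨ρ', ⟨hρ', hρQ⟩, hzρ'⟩ := hzQ
  obtain ⟨v, hv⟩ := T.exists_bary_pos z
  exact hρQ (hρP.trans (T.reflTransGen_adj_of_mem hG hρ hρ' ((T.mem_cell_iff hρ).1 hzρ v hv)
    ((T.mem_cell_iff hρ').1 hzρ' v hv)))

/-! ### Cohomology of the plane modulo two -/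

omit hG in
theorem OneVertexTriangulation.isPreconnected_star (v : G) :
    IsPreconnected {z | 0 < T.bary z v} := by
  refine isPreconnected_of_forall (T.vertex v) fun z hz => ?_
  obtain ⟨τ, hτ, hzτ⟩ := T.exists_bary_mem z
  have hv : v ∈ τ := (T.mem_cell_iff hτ).1 ((T.bary_mem_simplex hτ).1 hzτ) v hz
  refine ⟨(fun r : ℝ => T.toPlane ((1 - r) • vert v + r • T.bary z)) '' Icc 0 1, ?_, ?_, ?_, ?_⟩
  · rintro _ ⟨r, hr, rfl⟩
    have hm := lineMap_mem_simplex (vert_mem_simplex hv) hzτ hr.1 hr.2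
    rw [mem_ofPred_eq, T.bary_toPlane hτ hm]
    simp only [Pi.add_apply, Pi.smul_apply, smul_eq_mul, vert_apply_self, mul_one]
    rcases eq_or_lt_of_le hr.1 with h | h
    · rw [← h]; norm_num
    · have := mul_pos h hz
      linarith [hr.2]
  · exact ⟨0, by norm_num, by simp [OneVertexTriangulation.vertex]⟩
  · exact ⟨1, by norm_num, by simp [T.toPlane_bary]⟩
  · exact isPreconnected_Icc.image _ (T.continuousOn_segment hτ (vert_mem_simplex hv) hzτ)

/-- Cocycles modulo two are coboundaries. -/
theorem OneVertexTriangulation.exists_coboundary (c : G → G → ZMod 2)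
    (hc : ∀ τ ∈ T.triangles, ∀ x ∈ τ, ∀ y ∈ τ, ∀ z ∈ τ, c x y + c y z = c x z) :
    ∃ f : G → ZMod 2, ∀ τ ∈ T.triangles, ∀ x ∈ τ, ∀ y ∈ τ, c x y = f x + f y := by
  classical
  choose idx hidx using T.exists_bary_pos
  have hcell : ∀ z : ℍ, ∃ τ ∈ T.triangles, ∀ g, 0 < T.bary z g → g ∈ τ := by
    intro z
    obtain ⟨τ, hτ, hz⟩ := T.exists_mem_cell z
    exact ⟨τ, hτ, (T.mem_cell_iff hτ).1 hz⟩
  -- The cocycle is the transition data of a double covering of ℍ that is trivial over the open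
  -- stars of the vertices. The plane is simply connected, so the covering has a section, and the
  -- values of the section at the vertices form the primitive f.
  let Z : FiberBundleCore G ℍ (ZMod 2) :=
    { baseSet := fun g => {z | 0 < T.bary z g}
      isOpen_baseSet := T.isOpen_star hG
      indexAt := idx
      mem_baseSet_at := hidx
      coordChange := fun g h _ v => v + c g h
      coordChange_self := by
        intro g z hz v
        obtain ⟨τ, hτ, h⟩ := hcell z
        have := hc τ hτ g (h g hz) g (h g hz) g (h g hz)
        simpa using this
      continuousOn_coordChange := by
        intro g h
        exact ((continuous_of_discreteTopology (f := fun v : ZMod 2 => v + c g h)).comp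
          continuous_snd).continuousOn
      coordChange_comp := by
        rintro g h k z ⟨⟨h1, h2⟩, h3⟩ v
        obtain ⟨τ, hτ, H⟩ := hcell z
        have := hc τ hτ g (H g h1) h (H h h2) k (H k h3)
        rw [add_assoc, this] }
  have hcov : IsCoveringMap (Bundle.TotalSpace.proj : Z.TotalSpace → ℍ) :=
    FiberBundle.isCoveringMap (F := ZMod 2) (E := Z.Fiber)
  obtain ⟨s, ⟨-, hs⟩, -⟩ := hcov.existsUnique_continuousMap_lifts (ContinuousMap.id ℍ)
    UpperHalfPlane.I ⟨UpperHalfPlane.I, (0 : ZMod 2)⟩ rfl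
  have hs' : ∀ z, (s z).1 = z := fun z => congrFun hs z
  have hcont : ∀ g, ContinuousOn (fun z => (Z.localTriv g (s z)).2) {z | 0 < T.bary z g} := by
    intro g
    refine continuous_snd.comp_continuousOn ((Z.localTriv g).continuousOn.comp
      s.continuous.continuousOn fun z hz => ?_)
    rw [FiberBundleCore.mem_localTriv_source, hs']
    exact hz
  let d : ℍ → ZMod 2 := fun z => (s z).2
  have hval : ∀ g z, (Z.localTriv g (s z)).2 = d z + c (idx z) g := by
    intro g z
    rw [FiberBundleCore.localTriv_apply]
    change d z + c (idx (s z).1) g = _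
    rw [hs']
  refine ⟨fun g => (Z.localTriv g (s (T.vertex g))).2, fun τ hτ x hx y hy => ?_⟩
  -- The midpoint of the edge lies in both stars. The section is constant in the trivialization over
  -- each star, so its values at the two vertices can be compared there.
  have hmid := lineMap_mem_simplex (vert_mem_simplex hx) (vert_mem_simplex hy) (r := 2⁻¹)
    (by norm_num) (by norm_num)
  set z := T.toPlane ((1 - (2 : ℝ)⁻¹) • vert x + (2 : ℝ)⁻¹ • vert y) with hz
  have hnn : ∀ a b : G, 0 ≤ vert a b := by
    intro a b
    by_cases h : b = a
    · rw [h, vert_apply_self]; norm_num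
    · rw [vert_apply_ne h]
  have hzx : 0 < T.bary z x := by
    rw [hz, T.bary_toPlane hτ hmid]
    have := hnn y x
    simp only [Pi.add_apply, Pi.smul_apply, smul_eq_mul, vert_apply_self]
    linarith
  have hzy : 0 < T.bary z y := by
    rw [hz, T.bary_toPlane hτ hmid]
    have := hnn x y
    simp only [Pi.add_apply, Pi.smul_apply, smul_eq_mul, vert_apply_self]
    linarith
  have hvx : ∀ x, T.vertex x ∈ {z | 0 < T.bary z x} := fun x => by
    rw [mem_ofPred_eq, T.bary_vertex, vert_apply_self]; norm_num
  have e1 := (T.isPreconnected_star x).constant_of_mapsTo (T := (univ : Set (ZMod 2)))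
    (isDiscrete_univ_iff.2 inferInstance) (hcont x) (mapsTo_univ _ _) (hvx x) hzx
  have e2 := (T.isPreconnected_star y).constant_of_mapsTo (T := (univ : Set (ZMod 2)))
    (isDiscrete_univ_iff.2 inferInstance) (hcont y) (mapsTo_univ _ _) (hvx y) hzy
  beta_reduce
  rw [e1, e2, hval, hval]
  obtain ⟨τ', hτ', H⟩ := hcell z
  have h1 := hc τ' hτ' _ (H _ (hidx z)) x (H x hzx) y (H y hzy)
  have h2 : ∀ a b d : ZMod 2, a + b + (a + d) = b + d := by decide
  rw [h2, ← h1]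
  have h3 : ∀ a b : ZMod 2, b = a + (a + b) := by decide
  exact h3 _ _

/-- The plane has one end. -/
theorem OneVertexTriangulation.finite_or_finite_compl {U : Set G} {F : Set G} (hF : F.Finite)
    (hU : ∀ τ ∈ T.triangles, ∀ x ∈ τ, ∀ y ∈ τ, x ∈ U → y ∉ U → x ∈ F) :
    U.Finite ∨ Uᶜ.Finite := by
  have hbad : {τ ∈ T.triangles | ∃ x ∈ τ, x ∈ F}.Finite := by
    refine (hF.biUnion fun x _ => T.finite_star_at x).subset ?_
    rintro τ ⟨hτ, x, hx, hxF⟩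
    exact mem_biUnion hxF ⟨hτ, hx⟩
  -- L contains all triangles with a vertex in F. A triangle that reaches outside of L has its
  -- vertices all in U or all outside of U, so if both kinds of vertices occurred outside of L they
  -- would disconnect its complement.
  obtain ⟨L, hKL, hL, hLc⟩ := exists_isCompact_isPreconnected_compl
   
    (hbad.isCompact_biUnion fun τ hτ => T.isCompact_cell hτ.1)
  have hfin : {v : G | T.vertex v ∈ L}.Finite := by
    refine ((T.finite_meeting hG hL).biUnion fun τ hτ => T.finite_triangle hτ.1).subset ?_
    intro v hv
    obtain ⟨τ, hτ, hvτ⟩ := T.exists_triangle_mem v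
    exact mem_biUnion (show τ ∈ {τ ∈ T.triangles | _} from
      ⟨hτ, _, T.vertex_mem_cell hvτ, hv⟩) hvτ
  have hdisj : ∀ z ∈ Lᶜ, z ∉ (⋃ τ ∈ {τ ∈ T.triangles | τ ⊆ U}, T.cell τ) ∩
      (⋃ τ ∈ {τ ∈ T.triangles | τ ⊆ Uᶜ}, T.cell τ) := by
    rintro z - ⟨h1, h2⟩
    simp only [mem_iUnion] at h1 h2
    obtain ⟨τ, ⟨hτ, hτU⟩, hz⟩ := h1
    obtain ⟨τ', ⟨hτ', hτU'⟩, hz'⟩ := h2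
    obtain ⟨v, hv⟩ := T.exists_bary_pos z
    exact hτU' ((T.mem_cell_iff hτ').1 hz' v hv) (hτU ((T.mem_cell_iff hτ).1 hz v hv))
  by_contra! hcon
  obtain ⟨x, hxU, hxL⟩ := (Set.Infinite.sdiff hcon.1 hfin).nonempty
  obtain ⟨y, hyU, hyL⟩ := (Set.Infinite.sdiff hcon.2 hfin).nonempty
  have hcov : ∀ z ∈ Lᶜ, ∀ τ ∈ T.triangles, z ∈ T.cell τ → τ ⊆ U ∨ τ ⊆ Uᶜ := by
    intro z hz τ hτ hzτ
    by_contra! h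
    obtain ⟨b, hb, hbU⟩ := not_subset.1 h.1
    obtain ⟨a, ha, haU⟩ := not_subset.1 h.2
    have := hU τ hτ a ha b hb (not_not.1 haU) hbU
    exact hz (hKL (mem_biUnion (show τ ∈ {τ ∈ T.triangles | _} from ⟨hτ, a, ha, this⟩) hzτ))
  obtain ⟨z, hz, hz'⟩ := isPreconnected_closed_iff.1 hLc
    (⋃ τ ∈ {τ ∈ T.triangles | τ ⊆ U}, T.cell τ)
    (⋃ τ ∈ {τ ∈ T.triangles | τ ⊆ Uᶜ}, T.cell τ)
    (T.isClosed_biUnion_cell hG fun ρ h => h.1)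
    (T.isClosed_biUnion_cell hG fun ρ h => h.1) (by
      intro z hz
      obtain ⟨τ, hτ, hzτ⟩ := T.exists_mem_cell z
      rcases hcov z hz τ hτ hzτ with h | h
      · exact Or.inl (mem_biUnion (show τ ∈ {τ ∈ T.triangles | _} from ⟨hτ, h⟩) hzτ)
      · exact Or.inr (mem_biUnion (show τ ∈ {τ ∈ T.triangles | _} from ⟨hτ, h⟩) hzτ))
    (by
      obtain ⟨τ, hτ, hvτ⟩ := T.exists_triangle_mem x
      have := T.vertex_mem_cell hvτ
      refine ⟨_, hxL, mem_biUnion (show τ ∈ {τ ∈ T.triangles | _} from ⟨hτ, ?_⟩) this⟩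
      exact (hcov _ hxL τ hτ this).resolve_right fun h => h hvτ hxU)
    (by
      obtain ⟨τ, hτ, hvτ⟩ := T.exists_triangle_mem y
      have := T.vertex_mem_cell hvτ
      refine ⟨_, hyL, mem_biUnion (show τ ∈ {τ ∈ T.triangles | _} from ⟨hτ, ?_⟩) this⟩
      exact (hcov _ hyL τ hτ this).resolve_left fun h => hyU (h hvτ))
  exact hdisj z hz hz'

end

/-! ### Flux of a left order through the boundary of a finite set -/

theorem LeftOrder.asymm {G : Type*} [Group G] (O : LeftOrder G) {a b : G} (h : O.lt a b) :
    ¬ O.lt b a := fun h' => O.irrefl a (O.trans a b a h h')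

theorem LeftOrder.ne {G : Type*} [Group G] (O : LeftOrder G) {a b : G} (h : O.lt a b) : a ≠ b := by
  rintro rfl
  exact O.irrefl a h

theorem LeftOrder.exists_min {G : Type*} [Group G] (O : LeftOrder G) {U : Set G} (hU : U.Finite)
    (hne : U.Nonempty) : ∃ m ∈ U, ∀ y ∈ U, ¬ O.lt y m := by
  induction U, hU using Set.Finite.induction_on with
  | empty => exact absurd hne (by simp)
  | @insert a s ha hs ih =>
    rcases s.eq_empty_or_nonempty with rfl | hs'
    · refine ⟨a, by simp, ?_⟩
      rintro y hy
      rw [insert_empty_eq, mem_singleton_iff] at hy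
      rw [hy]
      exact O.irrefl a
    · obtain ⟨m, hm, h⟩ := ih hs'
      by_cases hlt : O.lt a m
      · refine ⟨a, by simp, ?_⟩
        rintro y (rfl | hy) hya
        · exact O.irrefl _ hya
        · exact h y hy (O.trans _ _ _ hya hlt)
      · refine ⟨m, by simp [hm], ?_⟩
        rintro y (rfl | hy)
        · exact hlt
        · exact h y hy

theorem LeftOrder.exists_max {G : Type*} [Group G] (O : LeftOrder G) {U : Set G} (hU : U.Finite)
    (hne : U.Nonempty) : ∃ m ∈ U, ∀ y ∈ U, ¬ O.lt m y := by
  let O' : LeftOrder G := ⟨fun a b => O.lt b a, O.irrefl, fun a b c h h' => O.trans c b a h' h,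
    fun a b => by rcases O.total a b with h | h | h <;> simp [h], fun a b c h => O.left_inv _ _ _ h⟩
  exact O'.exists_min hU hne

section

variable {G : Type*} [Group G] [MulAction G ℍ] (T : OneVertexTriangulation G)

/-- Two vertices are neighbours if they span an edge. -/
def OneVertexTriangulation.Nbr (x y : G) : Prop := x ≠ y ∧ ∃ τ ∈ T.triangles, x ∈ τ ∧ y ∈ τ

variable {T}

theorem OneVertexTriangulation.Nbr.symm {x y : G} (h : T.Nbr x y) : T.Nbr y x :=
  ⟨h.1.symm, h.2.imp fun _ h => ⟨h.1, h.2.2, h.2.1⟩⟩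

theorem OneVertexTriangulation.Nbr.mul_left {x y : G} (h : T.Nbr x y) (g : G) :
    T.Nbr (g * x) (g * y) := by
  obtain ⟨hne, τ, hτ, hx, hy⟩ := h
  exact ⟨fun h => hne (mul_left_cancel h), _, T.translate_mem g τ hτ, ⟨x, hx, rfl⟩, ⟨y, hy, rfl⟩⟩

variable (T)

theorem OneVertexTriangulation.finite_nbr (x : G) : {y | T.Nbr x y}.Finite := by
  refine ((T.finite_star_at x).biUnion fun τ hτ => T.finite_triangle hτ.1).subset ?_
  rintro y ⟨-, τ, hτ, hx, hy⟩
  exact mem_biUnion (show τ ∈ {τ ∈ T.triangles | x ∈ τ} from ⟨hτ, hx⟩) hy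

theorem OneVertexTriangulation.exists_nbr (x : G) : ∃ y, T.Nbr x y := by
  obtain ⟨τ, hτ, hx⟩ := T.exists_triangle_mem x
  obtain ⟨b, c, h, -, -, rfl⟩ := T.eq_triple_of_mem hτ hx
  exact ⟨b, h, _, hτ, hx, by simp⟩

variable {T}

/-- Reflection of the neighbours of `x`. -/
theorem OneVertexTriangulation.Nbr.reflect {x y : G} (h : T.Nbr x y) : T.Nbr x (x * y⁻¹ * x) := by
  have := h.symm.mul_left (x * y⁻¹)
  rwa [inv_mul_cancel_right] at this

omit [MulAction G ℍ] in
-- Multiply on the left by x y⁻¹. This is where left invariance enters the geometry: reflection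
-- exchanges upper and lower neighbours.
theorem LeftOrder.reflect_lt {O : LeftOrder G} {x y : G} (h : O.lt x y) :
    O.lt (x * y⁻¹ * x) x := by
  have := O.left_inv _ _ (x * y⁻¹) h
  rwa [inv_mul_cancel_right] at this

omit [MulAction G ℍ] in
theorem LeftOrder.lt_reflect {O : LeftOrder G} {x y : G} (h : O.lt y x) :
    O.lt x (x * y⁻¹ * x) := by
  have := O.left_inv _ _ (x * y⁻¹) h
  rwa [inv_mul_cancel_right] at this

variable (T)

theorem OneVertexTriangulation.exists_nbr_lt (O : LeftOrder G) (x : G) :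
    ∃ y, T.Nbr x y ∧ O.lt y x := by
  obtain ⟨y, hy⟩ := T.exists_nbr x
  rcases O.total x y with h | h | h
  · exact ⟨_, hy.reflect, LeftOrder.reflect_lt h⟩
  · exact absurd h hy.1
  · exact ⟨y, hy, h⟩

theorem OneVertexTriangulation.exists_lt_nbr (O : LeftOrder G) (x : G) :
    ∃ y, T.Nbr x y ∧ O.lt x y := by
  obtain ⟨y, hy, h⟩ := T.exists_nbr_lt O x
  exact ⟨_, hy.reflect, LeftOrder.lt_reflect h⟩

theorem OneVertexTriangulation.finite_boundary {U : Set G} (hU : U.Finite) :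
    {p : G × G | p.1 ∈ U ∧ T.Nbr p.1 p.2}.Finite := by
  refine (hU.biUnion fun x _ => (T.finite_nbr x).image fun y => (x, y)).subset ?_
  rintro ⟨x, y⟩ ⟨hx, hy⟩
  exact mem_biUnion hx ⟨y, hy, rfl⟩

/-- As many edges leave a finite set of vertices upwards as downwards. -/
theorem OneVertexTriangulation.flux (O : LeftOrder G) {U : Set G} (hU : U.Finite) :
    {p : G × G | (p.1 ∈ U ∧ T.Nbr p.1 p.2) ∧ p.2 ∉ U ∧ O.lt p.1 p.2}.ncard =
      {p : G × G | (p.1 ∈ U ∧ T.Nbr p.1 p.2) ∧ p.2 ∉ U ∧ O.lt p.2 p.1}.ncard := by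
  have hfin := T.finite_boundary hU
  -- At every vertex of U, reflection matches the upward edges with the downward ones.
  have e1 : {p : G × G | (p.1 ∈ U ∧ T.Nbr p.1 p.2) ∧ O.lt p.1 p.2}.ncard =
      {p : G × G | (p.1 ∈ U ∧ T.Nbr p.1 p.2) ∧ O.lt p.2 p.1}.ncard := by
    refine Set.ncard_congr (fun p _ => (p.1, p.1 * p.2⁻¹ * p.1)) ?_ ?_ ?_
    · rintro ⟨x, y⟩ ⟨⟨hx, hn⟩, h⟩
      exact ⟨⟨hx, hn.reflect⟩, LeftOrder.reflect_lt h⟩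
    · rintro ⟨x, y⟩ ⟨x', y'⟩ - - h
      simp only [Prod.mk.injEq] at h
      obtain ⟨rfl, h⟩ := h
      simpa using h
    · rintro ⟨x, y⟩ ⟨⟨hx, hn⟩, h⟩
      refine ⟨(x, x * y⁻¹ * x), ⟨⟨hx, hn.reflect⟩, LeftOrder.lt_reflect h⟩, ?_⟩
      simp [mul_assoc]
  -- An edge with both ends in U is upward from one end and downward from the other.
  have e2 : {p : G × G | (p.1 ∈ U ∧ T.Nbr p.1 p.2) ∧ p.2 ∈ U ∧ O.lt p.1 p.2}.ncard =
      {p : G × G | (p.1 ∈ U ∧ T.Nbr p.1 p.2) ∧ p.2 ∈ U ∧ O.lt p.2 p.1}.ncard := by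
    refine Set.ncard_congr (fun p _ => (p.2, p.1)) ?_ ?_ ?_
    · rintro ⟨x, y⟩ ⟨⟨hx, hn⟩, hy, h⟩
      exact ⟨⟨hy, hn.symm⟩, hx, h⟩
    · rintro ⟨x, y⟩ ⟨x', y'⟩ - - h
      simp only [Prod.mk.injEq] at h ⊢
      exact h.symm
    · rintro ⟨x, y⟩ ⟨⟨hx, hn⟩, hy, h⟩
      exact ⟨(y, x), ⟨⟨hy, hn.symm⟩, hx, h⟩, rfl⟩
  have split : ∀ R : G → G → Prop, {p : G × G | (p.1 ∈ U ∧ T.Nbr p.1 p.2) ∧ R p.1 p.2}.ncard =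
      {p : G × G | (p.1 ∈ U ∧ T.Nbr p.1 p.2) ∧ p.2 ∈ U ∧ R p.1 p.2}.ncard +
      {p : G × G | (p.1 ∈ U ∧ T.Nbr p.1 p.2) ∧ p.2 ∉ U ∧ R p.1 p.2}.ncard := by
    intro R
    rw [← Set.ncard_union_eq ?_ (hfin.subset fun p h => h.1) (hfin.subset fun p h => h.1)]
    · congr 1
      ext p
      simp only [mem_ofPred_eq, mem_union]
      tauto
    · rw [Set.disjoint_left]
      rintro p ⟨-, h, -⟩ ⟨-, h', -⟩
      exact h' h
  have s1 := split O.lt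
  have s2 := split fun a b => O.lt b a
  omega

/-! ### The dual graph and its closed walks -/

/-- The dual graph of the triangulation. -/
def OneVertexTriangulation.dual : SimpleGraph (Set G) where
  Adj σ τ := T.Adj σ τ ∧ σ ≠ τ
  symm := ⟨fun _ _ h => ⟨h.1.symm, h.2.symm⟩⟩
  loopless := ⟨fun _ h => h.2 rfl⟩

open Classical in
/-- The number of times, modulo two, that `P 0, …, P n` crosses the edge from `x` to `y`. -/
noncomputable def crossing (P : ℕ → Set G) (n : ℕ) (x y : G) : ZMod 2 :=
  ∑ i ∈ Finset.range n, if x ≠ y ∧ (x ∈ P i ∧ y ∈ P i) ∧ x ∈ P (i + 1) ∧ y ∈ P (i + 1) then 1 else 0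

variable {T}

theorem OneVertexTriangulation.eq_of_three_mem {σ τ : Set G} (hσ : σ ∈ T.triangles)
    (hτ : τ ∈ T.triangles) {a b c : G} (hab : a ≠ b) (hac : a ≠ c) (hbc : b ≠ c) (haσ : a ∈ σ)
    (hbσ : b ∈ σ) (hcσ : c ∈ σ) (haτ : a ∈ τ) (hbτ : b ∈ τ) (hcτ : c ∈ τ) : σ = τ := by
  have key : ∀ ρ ∈ T.triangles, a ∈ ρ → b ∈ ρ → c ∈ ρ → ρ = {a, b, c} := by
    intro ρ hρ ha hb hc
    obtain ⟨d, h1, h2, rfl⟩ := T.eq_triple_of_mem_mem hρ ha hb hab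
    rcases hc with rfl | rfl | rfl
    · exact absurd rfl hac
    · exact absurd rfl hbc
    · rfl
  rw [key σ hσ haσ hbσ hcσ, key τ hτ haτ hbτ hcτ]

theorem OneVertexTriangulation.eq_of_ne_of_ne {ρ σ τ : Set G} (hρ : ρ ∈ T.triangles)
    (hσ : σ ∈ T.triangles) (hτ : τ ∈ T.triangles) {a b : G} (hab : a ≠ b) (haρ : a ∈ ρ)
    (hbρ : b ∈ ρ) (haσ : a ∈ σ) (hbσ : b ∈ σ) (haτ : a ∈ τ) (hbτ : b ∈ τ) (h1 : σ ≠ ρ)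
    (h2 : τ ≠ ρ) : σ = τ := by
  obtain ⟨c, hac, hbc, rfl⟩ := T.eq_triple_of_mem_mem hρ haρ hbρ hab
  obtain ⟨d, had, hbd, rfl⟩ := T.eq_triple_of_mem_mem hσ haσ hbσ hab
  obtain ⟨e, hae, hbe, rfl⟩ := T.eq_triple_of_mem_mem hτ haτ hbτ hab
  rcases T.third_vertex_eq hab hac hbc had hbd hae hbe hρ hσ hτ (fun h => h1 (by rw [h])) with h | h
  · exact absurd (by rw [h]) h2
  · rw [h]

omit [Group G] [MulAction G ℍ] in
theorem crossing_self (P : ℕ → Set G) (n : ℕ) (x : G) : crossing P n x x = 0 := by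
  simp [crossing]

omit [Group G] [MulAction G ℍ] in
theorem crossing_comm (P : ℕ → Set G) (n : ℕ) (x y : G) : crossing P n x y = crossing P n y x := by
  simp only [crossing]
  refine Finset.sum_congr rfl fun i _ => ?_
  congr 1
  rw [eq_iff_iff, ne_comm, and_comm (a := x ∈ P i), and_comm (a := x ∈ P (i + 1))]

omit [Group G] [MulAction G ℍ] in
theorem exists_of_crossing_ne_zero {P : ℕ → Set G} {n : ℕ} {x y : G} (h : crossing P n x y ≠ 0) :
    ∃ i < n, x ≠ y ∧ (x ∈ P i ∧ y ∈ P i) ∧ x ∈ P (i + 1) ∧ y ∈ P (i + 1) := by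
  by_contra! hno
  refine h (Finset.sum_eq_zero fun i hi => if_neg ?_)
  rintro ⟨h1, h2, h3, h4⟩
  exact hno i (Finset.mem_range.1 hi) h1 h2 h3 h4

open Classical in
-- A step into or out of τ crosses exactly one of its sides, and no other step crosses a side of τ
-- because an edge lies in only two triangles. Modulo two, only the ends of the walk are left.
theorem OneVertexTriangulation.crossing_triangle {P : ℕ → Set G} {n : ℕ}
    (hP : ∀ i < n, T.dual.Adj (P i) (P (i + 1))) {τ : Set G} (hτ : τ ∈ T.triangles) {x y z : G}
    (hxy : x ≠ y) (hxz : x ≠ z) (hyz : y ≠ z) (hx : x ∈ τ) (hy : y ∈ τ) (hz : z ∈ τ) :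
    crossing P n x y + crossing P n y z + crossing P n x z =
      (if P 0 = τ then 1 else 0) + if P n = τ then 1 else 0 := by
  induction n with
  | zero =>
    simp only [crossing, Finset.range_zero, Finset.sum_empty, add_zero]
    split_ifs <;> decide
  | succ n ih =>
    have ih := ih fun i hi => hP i (hi.trans (Nat.lt_succ_self n))
    obtain ⟨⟨h1, h2, a, b, hab, ha1, hb1, ha2, hb2⟩, hne⟩ := hP n (Nat.lt_succ_self n)
    have key : (if x ≠ y ∧ (x ∈ P n ∧ y ∈ P n) ∧ x ∈ P (n + 1) ∧ y ∈ P (n + 1) then (1 : ZMod 2)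
        else 0) + (if y ≠ z ∧ (y ∈ P n ∧ z ∈ P n) ∧ y ∈ P (n + 1) ∧ z ∈ P (n + 1) then 1 else 0) +
        (if x ≠ z ∧ (x ∈ P n ∧ z ∈ P n) ∧ x ∈ P (n + 1) ∧ z ∈ P (n + 1) then 1 else 0) =
        (if P n = τ then 1 else 0) + if P (n + 1) = τ then 1 else 0 := by
      have main : ∀ σ ∈ T.triangles, σ ≠ τ → (∃ a b, a ≠ b ∧ a ∈ τ ∧ b ∈ τ ∧ a ∈ σ ∧ b ∈ σ) →
          (x ∈ σ ∧ y ∈ σ ∧ z ∉ σ) ∨ (y ∈ σ ∧ z ∈ σ ∧ x ∉ σ) ∨ (x ∈ σ ∧ z ∈ σ ∧ y ∉ σ) := by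
        rintro σ hσ hστ ⟨a, b, hab, ha, hb, ha', hb'⟩
        have h3 : ¬ (x ∈ σ ∧ y ∈ σ ∧ z ∈ σ) := fun ⟨h, h', h''⟩ =>
          hστ (T.eq_of_three_mem hσ hτ hxy hxz hyz h h' h'' hx hy hz)
        obtain ⟨w, hw1, hw2, e⟩ := T.eq_triple_of_mem_mem hτ hx hy hxy
        have hzw : z = w := by
          rw [e] at hz
          rcases hz with rfl | rfl | rfl
          · exact absurd rfl hxz
          · exact absurd rfl hyz
          · rfl
        subst hzw
        rw [e] at ha hb
        rcases ha with rfl | rfl | rfl <;> rcases hb with rfl | rfl | rfl <;> tauto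
      by_cases e1 : P n = τ
      · have e2 : P (n + 1) ≠ τ := fun h => hne (e1.trans h.symm)
        rw [if_pos e1, if_neg e2]
        rw [e1] at ha1 hb1 ⊢
        rcases main _ h2 e2 ⟨a, b, hab, ha1, hb1, ha2, hb2⟩ with ⟨h, h', h''⟩ | ⟨h, h', h''⟩ |
          ⟨h, h', h''⟩ <;> simp [h, h', h'', hx, hy, hz, hxy, hxz, hyz]
      · rw [if_neg e1]
        by_cases e2 : P (n + 1) = τ
        · rw [if_pos e2]
          rw [e2] at ha2 hb2 ⊢
          rcases main _ h1 e1 ⟨a, b, hab, ha2, hb2, ha1, hb1⟩ with ⟨h, h', h''⟩ | ⟨h, h', h''⟩ |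
            ⟨h, h', h''⟩ <;> simp [h, h', h'', hx, hy, hz, hxy, hxz, hyz]
        · rw [if_neg e2]
          have h0 : ∀ u v : G, u ≠ v → u ∈ τ → v ∈ τ →
              ¬ (u ≠ v ∧ (u ∈ P n ∧ v ∈ P n) ∧ u ∈ P (n + 1) ∧ v ∈ P (n + 1)) := by
            rintro u v huv hu hv ⟨-, ⟨hu1, hv1⟩, hu2, hv2⟩
            exact hne (T.eq_of_ne_of_ne hτ h1 h2 huv hu hv hu1 hv1 hu2 hv2 e1 e2)
          rw [if_neg (h0 x y hxy hx hy), if_neg (h0 y z hyz hy hz), if_neg (h0 x z hxz hx hz)]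
          rfl
    simp only [crossing, Finset.sum_range_succ] at ih ⊢
    calc _ = _ := by
          have r : ∀ a b c d e f : ZMod 2, (a + b) + (c + d) + (e + f) = (a + c + e) + (b + d + f) := by
            intros; ring
          rw [r, ih, key]
      _ = _ := by
          generalize (if P 0 = τ then (1 : ZMod 2) else 0) = u
          generalize (if P n = τ then (1 : ZMod 2) else 0) = v
          generalize (if P (n + 1) = τ then (1 : ZMod 2) else 0) = w
          revert u v w
          decide

variable (T) (hG : IsSurfaceGroup G)
include hG

open Classical in
/-- Two walks in the dual graph with the same endpoints bound a finite set of vertices. -/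
theorem OneVertexTriangulation.exists_finite_of_walks {P Q : ℕ → Set G} {m n : ℕ}
    (hP : ∀ i < m, T.dual.Adj (P i) (P (i + 1))) (hQ : ∀ i < n, T.dual.Adj (Q i) (Q (i + 1)))
    (h0 : P 0 = Q 0) (h1 : P m = Q n) :
    ∃ U : Set G, U.Finite ∧ ∀ x y, T.Nbr x y →
      ((x ∈ U ↔ y ∈ U) ↔ crossing P m x y + crossing Q n x y = 0) := by
  -- Each crossing number alone fails to be a cocycle only at the end triangles. These are shared by
  -- the two walks, so the defects cancel in the sum.
  obtain ⟨f, hf⟩ := T.exists_coboundary hG (fun x y => crossing P m x y + crossing Q n x y) (by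
    intro τ hτ x hx y hy z hz
    have e2 : ∀ a : ZMod 2, a + a = 0 := by decide
    by_cases hxy : x = y
    · subst hxy; simp [crossing_self]
    by_cases hyz : y = z
    · subst hyz; simp [crossing_self]
    by_cases hxz : x = z
    · subst hxz
      simp only [crossing_self, crossing_comm P m y, crossing_comm Q n y]
      rw [e2]; rfl
    have k1 := T.crossing_triangle hP hτ hxy hxz hyz hx hy hz
    have k2 := T.crossing_triangle hQ hτ hxy hxz hyz hx hy hz
    rw [h0, h1, ← k2] at k1
    revert k1
    generalize crossing P m x y = a1
    generalize crossing P m y z = a2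
    generalize crossing P m x z = a3
    generalize crossing Q n x y = b1
    generalize crossing Q n y z = b2
    generalize crossing Q n x z = b3
    revert a1 a2 a3 b1 b2 b3
    decide)
  have hfin : {x : G | ∃ τ ∈ T.triangles, x ∈ τ ∧ ((∃ i < m, τ = P i) ∨ ∃ i < n, τ = Q i)}.Finite := by
    have h : {τ ∈ T.triangles | (∃ i < m, τ = P i) ∨ ∃ i < n, τ = Q i}.Finite := by
      refine (((Finset.range m).finite_toSet.image P).union
        ((Finset.range n).finite_toSet.image Q)).subset ?_
      rintro τ ⟨-, ⟨i, hi, rfl⟩ | ⟨i, hi, rfl⟩⟩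
      · exact Or.inl ⟨i, by simpa using hi, rfl⟩
      · exact Or.inr ⟨i, by simpa using hi, rfl⟩
    refine (h.biUnion fun τ hτ => T.finite_triangle hτ.1).subset ?_
    rintro x ⟨τ, hτ, hx, h⟩
    exact mem_biUnion (show τ ∈ {τ ∈ T.triangles | _} from ⟨hτ, h⟩) hx
  have e01 : ∀ a : ZMod 2, a = 0 ∨ a = 1 := by decide
  have hb : ∀ τ ∈ T.triangles, ∀ x ∈ τ, ∀ y ∈ τ, f x ≠ f y →
      x ∈ {x : G | ∃ τ ∈ T.triangles, x ∈ τ ∧ ((∃ i < m, τ = P i) ∨ ∃ i < n, τ = Q i)} := by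
    intro τ hτ x hx y hy hxy
    have h := hf τ hτ x hx y hy
    have hne : crossing P m x y ≠ 0 ∨ crossing Q n x y ≠ 0 := by
      by_contra! h0
      rw [h0.1, h0.2] at h
      revert h hxy
      generalize f x = a
      generalize f y = b
      revert a b
      decide
    rcases hne with h | h
    · obtain ⟨i, hi, -, ⟨hxi, -⟩, -⟩ := exists_of_crossing_ne_zero h
      exact ⟨P i, (hP i hi).1.1, hxi, Or.inl ⟨i, hi, rfl⟩⟩
    · obtain ⟨i, hi, -, ⟨hxi, -⟩, -⟩ := exists_of_crossing_ne_zero h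
      exact ⟨Q i, (hQ i hi).1.1, hxi, Or.inr ⟨i, hi, rfl⟩⟩
  have hU : ∀ x y, T.Nbr x y → ((f x = 0 ↔ f y = 0) ↔
      crossing P m x y + crossing Q n x y = 0) := by
    rintro x y ⟨-, τ, hτ, hx, hy⟩
    rw [hf τ hτ x hx y hy]
    generalize f x = a
    generalize f y = b
    revert a b
    decide
  -- Away from the two walks f is locally constant, so one of its two level sets is finite; either
  -- of them has the required boundary.
  rcases T.finite_or_finite_compl hG (U := {x | f x = 0}) hfin (by
    intro τ hτ x hx y hy hxU hyU
    exact hb τ hτ x hx y hy fun h => hyU (h.symm.trans hxU)) with h | h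
  · exact ⟨_, h, hU⟩
  · refine ⟨_, h, fun x y hxy => ?_⟩
    rw [← hU x y hxy, mem_compl_iff, mem_compl_iff, not_iff_not]
    rfl

end

/-! ### Lines of triangles that are crossed by a cut -/

/-- A triangle with a marked oriented edge, through which it is entered. -/
@[ext]
structure Flag (G : Type*) where
  /-- The endpoint of the edge on the lower side. -/
  lo : G
  /-- The endpoint of the edge on the upper side. -/
  hi : G
  /-- The triangle. -/
  tri : Set G

section

variable {G : Type*} [Group G] [MulAction G ℍ] (T : OneVertexTriangulation G)

/-- The marked edge of the flag leads out of `A`. -/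
def OneVertexTriangulation.IsFlag (A : Set G) (f : Flag G) : Prop :=
  f.tri ∈ T.triangles ∧ f.lo ∈ f.tri ∧ f.hi ∈ f.tri ∧ f.lo ∈ A ∧ f.hi ∉ A

/-- The flag `g` is entered after crossing the triangle of `f`. -/
def OneVertexTriangulation.Step (A : Set G) (f g : Flag G) : Prop :=
  T.IsFlag A f ∧ T.IsFlag A g ∧ g.lo ∈ f.tri ∧ g.hi ∈ f.tri ∧ g.tri ≠ f.tri ∧
    ((g.lo = f.lo ∧ g.hi ≠ f.hi) ∨ (g.lo ≠ f.lo ∧ g.hi = f.hi))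

open Classical in
/-- The triangle on the other side of the edge of a flag. -/
noncomputable def OneVertexTriangulation.rev (f : Flag G) : Flag G :=
  ⟨f.lo, f.hi, if h : ∃ σ ∈ T.triangles, σ ≠ f.tri ∧ f.lo ∈ σ ∧ f.hi ∈ σ then h.choose else f.tri⟩

/-- A bi-infinite line of flags for `A`. -/
def OneVertexTriangulation.IsLine (A : Set G) (x : ℤ → Flag G) : Prop :=
  ∀ k, T.Step A (x k) (x (k + 1))

variable {T} {A : Set G} {f g f' g' : Flag G} {x y : ℤ → Flag G}

theorem OneVertexTriangulation.IsFlag.ne (h : T.IsFlag A f) : f.lo ≠ f.hi := by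
  intro e
  exact h.2.2.2.2 (e ▸ h.2.2.2.1)

theorem OneVertexTriangulation.IsFlag.nbr (h : T.IsFlag A f) : T.Nbr f.lo f.hi :=
  ⟨h.ne, _, h.1, h.2.1, h.2.2.1⟩

theorem OneVertexTriangulation.IsFlag.eq_rev_of_ne (hf : T.IsFlag A f) (hg : T.IsFlag A g)
    (h1 : g.lo = f.lo) (h2 : g.hi = f.hi) (h3 : g.tri ≠ f.tri) : g = T.rev f := by
  have h : ∃ σ ∈ T.triangles, σ ≠ f.tri ∧ f.lo ∈ σ ∧ f.hi ∈ σ :=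
    ⟨g.tri, hg.1, h3, h1 ▸ hg.2.1, h2 ▸ hg.2.2.1⟩
  ext1
  · exact h1
  · exact h2
  · rw [OneVertexTriangulation.rev, dif_pos h]
    obtain ⟨k1, k2, k3, k4⟩ := h.choose_spec
    exact T.eq_of_ne_of_ne hf.1 hg.1 k1 hf.ne hf.2.1 hf.2.2.1 (h1 ▸ hg.2.1) (h2 ▸ hg.2.2.1) k3 k4
      h3 k2

/-- The third vertex of the triangle lies in A or not, and this decides through which of the two
other edges the cut leaves; the next triangle is the other one on that edge. -/
theorem OneVertexTriangulation.Step.unique (h : T.Step A f g) (h' : T.Step A f g') : g = g' := by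
  obtain ⟨hf, hg, h1, h2, h3, h4⟩ := h
  obtain ⟨-, hg', h1', h2', h3', h4'⟩ := h'
  obtain ⟨c, hac, hbc, e⟩ := T.eq_triple_of_mem_mem hf.1 hf.2.1 hf.2.2.1 hf.ne
  have hlo : g.lo = g'.lo ∧ g.hi = g'.hi := by
    have k1 := hg.2.2.2.1
    have k2 := hg.2.2.2.2
    have k3 := hg'.2.2.2.1
    have k4 := hg'.2.2.2.2
    have k5 := hf.2.2.2.1
    have k6 := hf.2.2.2.2
    rw [e] at h1 h2 h1' h2'
    simp only [mem_insert_iff, mem_singleton_iff] at h1 h2 h1' h2'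
    grind
  ext1
  · exact hlo.1
  · exact hlo.2
  · exact T.eq_of_ne_of_ne hf.1 hg.1 hg'.1 hg.ne h1 h2 hg.2.1 hg.2.2.1 (hlo.1 ▸ hg'.2.1)
      (hlo.2 ▸ hg'.2.2.1) h3 h3'

theorem OneVertexTriangulation.Step.congr {A' : Set G} (h : T.Step A f g)
    (hA : ∀ v ∈ f.tri, v ∈ A ↔ v ∈ A') : T.Step A' f g := by
  obtain ⟨hf, hg, h1, h2, h3, h4⟩ := h
  exact ⟨⟨hf.1, hf.2.1, hf.2.2.1, (hA _ hf.2.1).1 hf.2.2.2.1, fun h =>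
    hf.2.2.2.2 ((hA _ hf.2.2.1).2 h)⟩, ⟨hg.1, hg.2.1, hg.2.2.1, (hA _ h1).1 hg.2.2.2.1,
    fun h => hg.2.2.2.2 ((hA _ h2).2 h)⟩, h1, h2, h3, h4⟩

/-- The two flags of a triangle. -/
theorem OneVertexTriangulation.Step.eq_or_eq_rev (h : T.Step A f f') (hg : T.IsFlag A g)
    (e : f.tri = g.tri) : g = f ∨ g = T.rev f' := by
  obtain ⟨hf, hf', h1, h2, h3, h4⟩ := h
  obtain ⟨c, hac, hbc, ht⟩ := T.eq_triple_of_mem_mem hf.1 hf.2.1 hf.2.2.1 hf.ne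
  have key : (g.lo = f.lo ∧ g.hi = f.hi) ∨ (g.lo = f'.lo ∧ g.hi = f'.hi) := by
    have k1 := hg.2.2.2.1
    have k2 := hg.2.2.2.2
    have k3 := hf'.2.2.2.1
    have k4 := hf'.2.2.2.2
    have k5 := hf.2.2.2.1
    have k6 := hf.2.2.2.2
    have k7 := hg.2.1
    have k8 := hg.2.2.1
    rw [← e] at k7 k8
    rw [ht] at h1 h2 k7 k8
    simp only [mem_insert_iff, mem_singleton_iff] at h1 h2 k7 k8
    grind
  rcases key with ⟨k1, k2⟩ | ⟨k1, k2⟩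
  · left; ext1
    · exact k1
    · exact k2
    · exact e.symm
  · right
    exact hf'.eq_rev_of_ne hg k1 k2 (by rw [← e]; exact h3.symm)

theorem OneVertexTriangulation.Step.eq_lo (h : T.Step A f g) {v : G} (hv : v ∈ f.tri)
    (hv' : v ∈ g.tri) (hA : v ∈ A) : v = g.lo := by
  obtain ⟨hf, hg, h1, h2, h3, h4⟩ := h
  by_contra hne
  exact h3.symm (T.eq_of_three_mem hf.1 hg.1 hg.ne (Ne.symm hne)
    (fun e => hg.2.2.2.2 (by rwa [e])) h1 h2 hv hg.2.1 hg.2.2.1 hv')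

theorem OneVertexTriangulation.Step.eq_hi (h : T.Step A f g) {v : G} (hv : v ∈ f.tri)
    (hv' : v ∈ g.tri) (hA : v ∉ A) : v = g.hi := by
  obtain ⟨hf, hg, h1, h2, h3, h4⟩ := h
  by_contra hne
  exact h3.symm (T.eq_of_three_mem hf.1 hg.1 hg.ne
    (fun e => hA (by rw [← e]; exact hg.2.2.2.1)) (Ne.symm hne) h1 h2 hv hg.2.1 hg.2.2.1 hv')

theorem OneVertexTriangulation.Step.adj (h : T.Step A f g) : T.dual.Adj f.tri g.tri :=
  ⟨⟨h.1.1, h.2.1.1, _, _, h.2.1.ne, h.2.2.1, h.2.2.2.1, h.2.1.2.1, h.2.1.2.2.1⟩, h.2.2.2.2.1.symm⟩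

theorem OneVertexTriangulation.IsLine.isFlag (hx : T.IsLine A x) (k : ℤ) : T.IsFlag A (x k) :=
  (hx k).1

theorem OneVertexTriangulation.IsLine.shift (hx : T.IsLine A x) (m : ℤ) :
    T.IsLine A fun k => x (k + m) := fun k => by
  have := hx (k + m)
  rwa [add_right_comm] at this

variable (hG : IsSurfaceGroup G)
include hG

theorem OneVertexTriangulation.IsFlag.rev (h : T.IsFlag A f) :
    T.IsFlag A (T.rev f) ∧ (T.rev f).tri ≠ f.tri := by
  have he := T.exists_other_triangle hG h.ne h.1 h.2.1 h.2.2.1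
  obtain ⟨k1, k2, k3, k4⟩ := he.choose_spec
  unfold OneVertexTriangulation.rev
  rw [dif_pos he]
  exact ⟨⟨k1, k3, k4, h.2.2.2⟩, k2⟩

theorem OneVertexTriangulation.IsFlag.rev_rev (h : T.IsFlag A f) : T.rev (T.rev f) = f := by
  obtain ⟨h1, h2⟩ := h.rev hG
  exact (h1.eq_rev_of_ne h rfl rfl h2.symm).symm

theorem OneVertexTriangulation.IsFlag.exists_step (hf : T.IsFlag A f) : ∃ g, T.Step A f g := by
  obtain ⟨c, hac, hbc, ht⟩ := T.eq_triple_of_mem_mem hf.1 hf.2.1 hf.2.2.1 hf.ne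
  have hc : c ∈ f.tri := by rw [ht]; simp
  by_cases hcA : c ∈ A
  · obtain ⟨σ, h1, h2, h3, h4⟩ := T.exists_other_triangle hG hbc.symm hf.1 hc hf.2.2.1
    exact ⟨⟨c, f.hi, σ⟩, hf, ⟨h1, h3, h4, hcA, hf.2.2.2.2⟩, hc, hf.2.2.1, h2,
      Or.inr ⟨hac.symm, rfl⟩⟩
  · obtain ⟨σ, h1, h2, h3, h4⟩ := T.exists_other_triangle hG hac hf.1 hf.2.1 hc
    exact ⟨⟨f.lo, c, σ⟩, hf, ⟨h1, h3, h4, hf.2.2.2.1, hcA⟩, hf.2.1, hc, h2,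
      Or.inl ⟨rfl, hbc.symm⟩⟩

theorem OneVertexTriangulation.Step.rev (h : T.Step A f g) : T.Step A (T.rev g) (T.rev f) := by
  obtain ⟨hf, hg, h1, h2, h3, h4⟩ := h
  have e : (⟨g.lo, g.hi, f.tri⟩ : Flag G) = T.rev g :=
    hg.eq_rev_of_ne ⟨hf.1, h1, h2, hg.2.2.2⟩ rfl rfl h3.symm
  refine ⟨(hg.rev hG).1, (hf.rev hG).1, ?_, ?_, ?_, ?_⟩
  · rw [← e]; exact hf.2.1
  · rw [← e]; exact hf.2.2.1
  · rw [← e]; exact (hf.rev hG).2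
  · exact h4.imp (fun h => ⟨h.1.symm, h.2.symm⟩) fun h => ⟨h.1.symm, h.2.symm⟩

theorem OneVertexTriangulation.Step.unique_left (h : T.Step A f g) (h' : T.Step A f' g) :
    f = f' := by
  have := (h.rev hG).unique (h'.rev hG)
  rw [← h.1.rev_rev hG, this, h'.1.rev_rev hG]

/-- The step map on the flags of A is a bijection, because reversing flags turns it into its
inverse. The line is the orbit under its integer powers. -/
theorem OneVertexTriangulation.IsFlag.exists_line (hf : T.IsFlag A f) :
    ∃ x, T.IsLine A x ∧ x 0 = f := by
  choose n hn using fun f : {f // T.IsFlag A f} => f.2.exists_step hG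
  let e : {f // T.IsFlag A f} → {f // T.IsFlag A f} := fun f => ⟨n f, (hn f).2.1⟩
  have he : Function.Bijective e := by
    constructor
    · intro f f' h
      have h1 := hn f
      rw [show n f = n f' from congrArg Subtype.val h] at h1
      exact Subtype.ext (h1.unique_left hG (hn f'))
    · intro g
      obtain ⟨f, hf⟩ := (g.2.rev hG).1.exists_step hG
      have h1 := hf.rev hG
      rw [g.2.rev_rev hG] at h1
      exact ⟨⟨_, h1.1⟩, Subtype.ext ((hn ⟨_, h1.1⟩).unique h1)⟩
  refine ⟨fun k => ((Equiv.ofBijective e he ^ k) ⟨f, hf⟩).1, fun k => ?_, rfl⟩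
  have : (Equiv.ofBijective e he ^ (k + 1)) ⟨f, hf⟩ = e ((Equiv.ofBijective e he ^ k) ⟨f, hf⟩) := by
    rw [add_comm, zpow_add, zpow_one]
    rfl
  beta_reduce
  rw [this]
  exact hn _

theorem OneVertexTriangulation.IsLine.eq_add (hx : T.IsLine A x) (hy : T.IsLine A y) {k l : ℤ}
    (h : x k = y l) (n : ℤ) : x (k + n) = y (l + n) := by
  induction n using Int.induction_on with
  | zero => simpa using h
  | succ i ih =>
    have h1 := hx (k + i)
    rw [ih] at h1
    simpa [add_assoc] using h1.unique (hy (l + i))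
  | pred i ih =>
    have h1 := hx (k + (-i - 1))
    rw [show k + (-(i : ℤ) - 1) + 1 = k + -i by ring, ih] at h1
    have h2 := hy (l + (-i - 1))
    rw [show l + (-(i : ℤ) - 1) + 1 = l + -i by ring] at h2
    exact h1.unique_left hG h2

theorem OneVertexTriangulation.IsLine.reverse (hx : T.IsLine A x) :
    T.IsLine A fun k => T.rev (x (-k)) := fun k => by
  have := (hx (-(k + 1))).rev hG
  rwa [show -(k + 1) + 1 = -k by ring] at this

/-- Otherwise the line would run back over itself. Halfway between k and l it would have, depending
on the parity of k - l, a flag equal to its own reverse or two consecutive flags with the same edge;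
both are impossible. -/
theorem OneVertexTriangulation.IsLine.ne_rev (hx : T.IsLine A x) (k l : ℤ) :
    x l ≠ T.rev (x k) := by
  intro h
  have key : ∀ n, x (l + n) = T.rev (x (k - n)) := by
    intro n
    have := hx.eq_add hG (hx.reverse hG) (k := l) (l := -k) (by simpa using h) n
    rw [this]
    rw [show -(-k + n) = k - n by ring]
  rcases Int.even_or_odd (k - l) with ⟨n, hn⟩ | ⟨n, hn⟩
  · have h1 := key n
    rw [show k - n = l + n by omega] at h1
    exact ((hx.isFlag _).rev hG).2 (congrArg Flag.tri h1.symm)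
  · have h1 := key n
    rw [show k - n = l + n + 1 by omega] at h1
    have h2 := hx (l + n)
    have h3 := congrArg Flag.lo h1
    have h4 := congrArg Flag.hi h1
    rcases h2.2.2.2.2.2 with ⟨-, h5⟩ | ⟨h5, -⟩
    · exact h5 h4.symm
    · exact h5 h3.symm

theorem OneVertexTriangulation.IsLine.eq_of_tri_eq (hx : T.IsLine A x) {k l : ℤ}
    (h : (x k).tri = (x l).tri) : x k = x l :=
  (((hx k).eq_or_eq_rev (hx.isFlag l) h).resolve_right (hx.ne_rev hG _ _)).symm

theorem OneVertexTriangulation.IsLine.eq_of_edge_eq (hx : T.IsLine A x) {k l : ℤ}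
    (h1 : (x k).lo = (x l).lo) (h2 : (x k).hi = (x l).hi) : x k = x l := by
  by_contra hne
  refine hx.ne_rev hG l k ((hx.isFlag l).eq_rev_of_ne (hx.isFlag k) h1 h2 fun h => hne ?_)
  exact hx.eq_of_tri_eq hG h

/-! ### Lines minimize length in the dual graph -/

omit hG in
-- Consecutive triangles share only one edge, so a step of the walk determines the edge that it
-- crosses, and asymmetry of R determines its orientation.
theorem OneVertexTriangulation.ncard_crossing_le {Q : ℕ → Set G} {D : ℕ}
    (hQ : ∀ i < D, T.dual.Adj (Q i) (Q (i + 1))) {R : G → G → Prop}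
    (hR : ∀ a b, R a b → ¬ R b a) {S : Set (G × G)}
    (hS : ∀ p ∈ S, R p.1 p.2 ∧ crossing Q D p.1 p.2 ≠ 0) : S.ncard ≤ D := by
  have h : ∀ p : S, ∃ i < D, p.1.1 ≠ p.1.2 ∧ (p.1.1 ∈ Q i ∧ p.1.2 ∈ Q i) ∧
      p.1.1 ∈ Q (i + 1) ∧ p.1.2 ∈ Q (i + 1) := fun p =>
    exists_of_crossing_ne_zero (hS p.1 p.2).2
  choose i hi hne h1 h2 using h
  have hinj : Function.Injective i := by
    rintro ⟨⟨a, b⟩, hp⟩ ⟨⟨c, d⟩, hq⟩ e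
    have k1 := hne ⟨⟨a, b⟩, hp⟩
    have k2 := hne ⟨⟨c, d⟩, hq⟩
    have k3 := h1 ⟨⟨a, b⟩, hp⟩
    have k4 := h2 ⟨⟨a, b⟩, hp⟩
    have k5 := h1 ⟨⟨c, d⟩, hq⟩
    have k6 := h2 ⟨⟨c, d⟩, hq⟩
    rw [e] at k3 k4
    have k7 := hQ _ (hi ⟨⟨c, d⟩, hq⟩)
    have k8 : ∀ v, v ∈ Q (i ⟨(c, d), hq⟩) → v ∈ Q (i ⟨(c, d), hq⟩ + 1) → v = a ∨ v = b := by
      intro v hv hv'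
      by_contra! hno
      exact k7.2 (T.eq_of_three_mem k7.1.1 k7.1.2.1 k1 hno.1.symm hno.2.symm k3.1 k3.2 hv k4.1
        k4.2 hv')
    have k9 := (hS _ hp).1
    have k10 := (hS _ hq).1
    simp only at k9 k10 k2
    rcases k8 c k5.1 k6.1 with rfl | rfl <;> rcases k8 d k5.2 k6.2 with rfl | rfl
    · exact absurd rfl k2
    · rfl
    · exact absurd k9 (hR _ _ k10)
    · exact absurd rfl k2
  have : Nat.card S ≤ Nat.card (Fin D) :=
    Nat.card_le_card_of_injective (fun p => (⟨i p, hi p⟩ : Fin D)) fun p q h =>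
      hinj (congrArg Fin.val h)
  rwa [Nat.card_fin] at this

/-- A segment of a line and another walk with the same endpoints bound a finite set of vertices;
the lower and the upper vertices of the line lie on different sides. -/
theorem OneVertexTriangulation.IsLine.exists_sides (hx : T.IsLine A x) {m : ℤ} {N : ℕ}
    (hinj : ∀ i j : ℤ, m < i → i < j → j ≤ m + N → x i ≠ x j) {Q : ℕ → Set G} {D : ℕ}
    (hQ : ∀ i < D, T.dual.Adj (Q i) (Q (i + 1))) (hQ0 : Q 0 = (x m).tri)
    (hQD : Q D = (x (m + N)).tri)
    (hQ1 : ∀ j, m < j → j ≤ m + N → crossing Q D (x j).lo (x j).hi = 0)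
    (hQ2 : ∀ j, m < j → j < m + N → crossing Q D (x j).lo (x (j + 1)).lo = 0) :
    ∃ U : Set G, U.Finite ∧ (∀ j, m < j → j ≤ m + N → ((x j).lo ∈ U ↔ (x (m + 1)).lo ∈ U) ∧
      ((x j).hi ∈ U ↔ (x (m + 1)).lo ∉ U)) ∧ ∀ v w, T.Nbr v w → v ∈ U → w ∉ U →
        crossing Q D v w ≠ 0 ∨ ∃ j, m < j ∧ j ≤ m + N ∧
          ((v = (x j).lo ∧ w = (x j).hi) ∨ (v = (x j).hi ∧ w = (x j).lo)) := by
  set P : ℕ → Set G := fun i => (x (m + i)).tri with hPdef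
  have hP : ∀ i < N, T.dual.Adj (P i) (P (i + 1)) := fun i _ => by
    have := (hx (m + i)).adj
    simpa [hPdef, add_assoc] using this
  obtain ⟨U, hU, hUx⟩ := T.exists_finite_of_walks hG hP hQ (by simp [hPdef, hQ0])
    (by simp [hPdef, hQD])
  have hPcross : ∀ v w, crossing P N v w ≠ 0 → v ≠ w ∧ ∃ j, m < j ∧ j ≤ m + N ∧
      (v ∈ A → v = (x j).lo) ∧ (v ∉ A → v = (x j).hi) ∧ (w ∈ A → w = (x j).lo) ∧
      (w ∉ A → w = (x j).hi) := by
    intro v w h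
    obtain ⟨i, hi, h1, ⟨h2, h3⟩, h4, h5⟩ := exists_of_crossing_ne_zero h
    have hs := hx (m + i)
    simp only [hPdef, Nat.cast_add, Nat.cast_one, ← add_assoc] at h2 h3 h4 h5
    refine ⟨h1, m + i + 1, by omega, by omega, hs.eq_lo h2 h4, hs.eq_hi h2 h4, hs.eq_lo h3 h5,
      hs.eq_hi h3 h5⟩
  -- The segment crosses this edge exactly once, as a repeated edge would be a repeated flag, and
  -- the walk Q has even crossing number with it.
  have hedge : ∀ j, m < j → j ≤ m + N →
      crossing P N (x j).lo (x j).hi + crossing Q D (x j).lo (x j).hi ≠ 0 := by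
    intro j hj1 hj2
    obtain ⟨i, hi⟩ : ∃ i : ℕ, j = m + i + 1 := ⟨(j - m - 1).toNat, by omega⟩
    have h2 : crossing P N (x j).lo (x j).hi = 1 := by
      unfold crossing
      rw [Finset.sum_eq_single i, if_pos]
      · have hs := hx (m + i)
        rw [← hi] at hs
        refine ⟨(hx.isFlag j).ne, ⟨hs.2.2.1, hs.2.2.2.1⟩, ?_⟩
        simp only [hPdef, Nat.cast_add, Nat.cast_one, ← add_assoc, ← hi]
        exact ⟨(hx.isFlag j).2.1, (hx.isFlag j).2.2.1⟩
      · intro i' hi' hne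
        rw [if_neg]
        rintro ⟨-, ⟨h2, h3⟩, h4, h5⟩
        simp only [hPdef, Nat.cast_add, Nat.cast_one, ← add_assoc] at h2 h3 h4 h5
        have hs := hx (m + i')
        have e := hx.eq_of_edge_eq hG (hs.eq_lo h2 h4 (hx.isFlag j).2.2.2.1)
          (hs.eq_hi h3 h5 (hx.isFlag j).2.2.2.2)
        have hi'' := Finset.mem_range.1 hi'
        rcases lt_trichotomy j (m + i' + 1) with h | h | h
        · exact hinj _ _ hj1 h (by omega) e
        · omega
        · exact hinj _ _ (by omega) h (by omega) e.symm
      · intro h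
        rw [Finset.mem_range] at h
        omega
    rw [hQ1 j hj1 hj2, h2]
    decide
  have hxor : ∀ j, m < j → j ≤ m + N → ¬ ((x j).lo ∈ U ↔ (x j).hi ∈ U) := by
    intro j hj1 hj2 h
    exact hedge j hj1 hj2 ((hUx _ _ (hx.isFlag j).nbr).1 h)
  have hcons : ∀ j, m < j → j < m + N → ((x j).lo ∈ U ↔ (x (j + 1)).lo ∈ U) := by
    intro j hj1 hj2
    by_cases e : (x j).lo = (x (j + 1)).lo
    · rw [e]
    have hs := hx j
    rw [hUx _ _ ⟨e, _, (hx.isFlag j).1, (hx.isFlag j).2.1, hs.2.2.1⟩,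
      hQ2 j hj1 hj2, add_zero]
    by_contra hne
    obtain ⟨-, i, -, -, h1, -, h2, -⟩ := hPcross _ _ hne
    exact e ((h1 (hx.isFlag j).2.2.2.1).trans (h2 (hx.isFlag _).2.2.2.1).symm)
  have hall : ∀ i : ℕ, i < N → ((x (m + 1 + i)).lo ∈ U ↔ (x (m + 1)).lo ∈ U) := by
    intro i
    induction i with
    | zero => simp
    | succ i ih =>
      intro hi
      rw [← ih (by omega), hcons (m + 1 + i) (by omega) (by omega)]
      push_cast
      rw [add_assoc (m + 1)]
  have hlo : ∀ j, m < j → j ≤ m + N → ((x j).lo ∈ U ↔ (x (m + 1)).lo ∈ U) := by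
    intro j hj1 hj2
    obtain ⟨i, hi⟩ : ∃ i : ℕ, j = m + 1 + i := ⟨(j - m - 1).toNat, by omega⟩
    rw [hi, hall i (by omega)]
  refine ⟨U, hU, fun j hj1 hj2 => ⟨hlo j hj1 hj2, ?_⟩, fun v w hvw hv hw => ?_⟩
  · have h1 := hlo j hj1 hj2
    have h2 := hxor j hj1 hj2
    tauto
  · rw [or_iff_not_imp_left, not_not]
    intro h0
    have h1 : ¬ (v ∈ U ↔ w ∈ U) := by tauto
    rw [hUx v w hvw, h0, add_zero] at h1
    obtain ⟨hne, j, hj1, hj2, k1, k2, k3, k4⟩ := hPcross v w h1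
    refine ⟨j, hj1, hj2, ?_⟩
    by_cases hvA : v ∈ A <;> by_cases hwA : w ∈ A
    · exact absurd ((k1 hvA).trans (k3 hwA).symm) hne
    · exact Or.inl ⟨k1 hvA, k4 hwA⟩
    · exact Or.inr ⟨k2 hvA, k3 hwA⟩
    · exact absurd ((k2 hvA).trans (k4 hwA).symm) hne

/-- The flux argument. The lower vertices of the segment all lie on the same side of the boundary of
the finite set U and the upper ones on the other, so its N edges leave U all upwards or all
downwards. By `flux` at least N edges leave in the opposite direction; these are not edges of the
segment, so they are crossed by the walk, which has only D steps. -/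
theorem OneVertexTriangulation.IsLine.le_of_walk {O : LeftOrder G}
    (hA : ∀ a ∈ A, ∀ b ∉ A, O.lt a b) (hx : T.IsLine A x) {m : ℤ} {N : ℕ}
    (hinj : ∀ i j : ℤ, m < i → i < j → j ≤ m + N → x i ≠ x j) {Q : ℕ → Set G} {D : ℕ}
    (hQ : ∀ i < D, T.dual.Adj (Q i) (Q (i + 1))) (hQ0 : Q 0 = (x m).tri)
    (hQD : Q D = (x (m + N)).tri)
    (hint : ∀ i, 0 < i → i < D → ∀ l, Q i ≠ (x l).tri) : N ≤ D := by
  by_contra! hND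
  have hQcross : ∀ l : ℤ, m < l → l < m + N → ∀ v ∈ (x l).tri, ∀ w ∈ (x l).tri,
      crossing Q D v w = 0 := by
    intro l hl1 hl2 v hv w hw
    by_contra hne
    obtain ⟨i, hi, h1, ⟨h2, h3⟩, h4, h5⟩ := exists_of_crossing_ne_zero hne
    have h6 := hQ i hi
    have hend : ∀ j ≤ D, Q j ≠ (x l).tri := by
      intro j hj e
      rcases Nat.eq_zero_or_pos j with rfl | hj0
      · rw [hQ0] at e
        have := hx.eq_add hG hx (hx.eq_of_tri_eq hG e) 1
        exact hinj _ _ (by omega) (by omega) (by omega) this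
      · rcases hj.lt_or_eq with h | rfl
        · exact hint j hj0 h l e
        · rw [hQD] at e
          exact hinj _ _ hl1 hl2 le_rfl (hx.eq_of_tri_eq hG e).symm
    exact h6.2 (T.eq_of_ne_of_ne (hx.isFlag l).1 h6.1.1 h6.1.2.1 h1 hv hw h2 h3 h4 h5
      (hend i hi.le) (hend (i + 1) hi))
  have hQ1 : ∀ j, m < j → j ≤ m + N → crossing Q D (x j).lo (x j).hi = 0 := by
    intro j hj1 hj2
    have hs := hx (j - 1)
    rw [sub_add_cancel] at hs
    by_cases h : j < m + N
    · exact hQcross j hj1 h _ (hx.isFlag j).2.1 _ (hx.isFlag j).2.2.1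
    by_cases h' : m < j - 1
    · exact hQcross (j - 1) h' (by omega) _ hs.2.2.1 _ hs.2.2.2.1
    -- Here the segment has a single step, so D < N leaves only the constant walk.
    have : D = 0 := by omega
    rw [this]
    simp [crossing]
  obtain ⟨U, hU, hsides, hbd⟩ := hx.exists_sides hG hinj hQ hQ0 hQD hQ1 fun j hj1 hj2 =>
    hQcross j hj1 hj2 _ (hx.isFlag j).2.1 _ (hx j).2.2.1
  have hdist : ∀ i i' : ℕ, i < N → i' < N → (x (m + 1 + i)).lo = (x (m + 1 + i')).lo →
      (x (m + 1 + i)).hi = (x (m + 1 + i')).hi → i = i' := by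
    intro i i' hi hi' h1 h2
    have e := hx.eq_of_edge_eq hG h1 h2
    rcases lt_trichotomy i i' with h | h | h
    · exact absurd e (hinj _ _ (by omega) (by omega) (by omega))
    · exact h
    · exact absurd e.symm (hinj _ _ (by omega) (by omega) (by omega))
  have hfl := T.flux O hU
  have hfin := T.finite_boundary hU
  have hlt : ∀ k, O.lt (x k).lo (x k).hi := fun k =>
    hA _ (hx.isFlag k).2.2.2.1 _ (hx.isFlag k).2.2.2.2
  by_cases h0 : (x (m + 1)).lo ∈ U
  · have h1 : N ≤ {p : G × G | (p.1 ∈ U ∧ T.Nbr p.1 p.2) ∧ p.2 ∉ U ∧ O.lt p.1 p.2}.ncard := by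
      have : Finite {p : G × G | (p.1 ∈ U ∧ T.Nbr p.1 p.2) ∧ p.2 ∉ U ∧ O.lt p.1 p.2} :=
        (hfin.subset fun p h => h.1).to_subtype
      have := Nat.card_le_card_of_injective (α := Fin N)
        (β := {p : G × G | (p.1 ∈ U ∧ T.Nbr p.1 p.2) ∧ p.2 ∉ U ∧ O.lt p.1 p.2})
        (fun i => ⟨((x (m + 1 + (i : ℕ))).lo, (x (m + 1 + (i : ℕ))).hi), by
          have hi := i.2
          have hs := hsides (m + 1 + (i : ℕ)) (by omega) (by omega)
          exact ⟨⟨hs.1.2 h0, (hx.isFlag _).nbr⟩, by tauto, hlt _⟩⟩)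
        (fun i i' h => by
          simp only [Subtype.mk.injEq, Prod.mk.injEq] at h
          exact Fin.ext (hdist i i' i.2 i'.2 h.1 h.2))
      rwa [Nat.card_fin] at this
    have h2 : {p : G × G | (p.1 ∈ U ∧ T.Nbr p.1 p.2) ∧ p.2 ∉ U ∧ O.lt p.2 p.1}.ncard ≤ D := by
      refine T.ncard_crossing_le hQ (R := fun a b => O.lt b a) (fun a b h => O.asymm h) ?_
      rintro ⟨v, w⟩ ⟨⟨hv, hvw⟩, hw, hltv⟩
      refine ⟨hltv, (hbd v w hvw hv hw).resolve_right ?_⟩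
      rintro ⟨j, hj1, hj2, ⟨rfl, rfl⟩ | ⟨rfl, rfl⟩⟩
      · exact O.asymm (hlt j) hltv
      · exact (hsides j hj1 hj2).2.1 hv h0
    omega
  · have h1 : N ≤ {p : G × G | (p.1 ∈ U ∧ T.Nbr p.1 p.2) ∧ p.2 ∉ U ∧ O.lt p.2 p.1}.ncard := by
      have : Finite {p : G × G | (p.1 ∈ U ∧ T.Nbr p.1 p.2) ∧ p.2 ∉ U ∧ O.lt p.2 p.1} :=
        (hfin.subset fun p h => h.1).to_subtype
      have := Nat.card_le_card_of_injective (α := Fin N)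
        (β := {p : G × G | (p.1 ∈ U ∧ T.Nbr p.1 p.2) ∧ p.2 ∉ U ∧ O.lt p.2 p.1})
        (fun i => ⟨((x (m + 1 + (i : ℕ))).hi, (x (m + 1 + (i : ℕ))).lo), by
          have hi := i.2
          have hs := hsides (m + 1 + (i : ℕ)) (by omega) (by omega)
          exact ⟨⟨hs.2.2 h0, (hx.isFlag _).nbr.symm⟩, by tauto, hlt _⟩⟩)
        (fun i i' h => by
          simp only [Subtype.mk.injEq, Prod.mk.injEq] at h
          exact Fin.ext (hdist i i' i.2 i'.2 h.2 h.1))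
      rwa [Nat.card_fin] at this
    have h2 : {p : G × G | (p.1 ∈ U ∧ T.Nbr p.1 p.2) ∧ p.2 ∉ U ∧ O.lt p.1 p.2}.ncard ≤ D := by
      refine T.ncard_crossing_le hQ (R := fun a b => O.lt a b) (fun a b h => O.asymm h) ?_
      rintro ⟨v, w⟩ ⟨⟨hv, hvw⟩, hw, hltv⟩
      refine ⟨hltv, (hbd v w hvw hv hw).resolve_right ?_⟩
      rintro ⟨j, hj1, hj2, ⟨rfl, rfl⟩ | ⟨rfl, rfl⟩⟩
      · exact h0 ((hsides j hj1 hj2).1.1 hv)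
      · exact O.asymm (hlt j) hltv
    omega

/-- Lines are embedded. -/
theorem OneVertexTriangulation.IsLine.injective {O : LeftOrder G}
    (hA : ∀ a ∈ A, ∀ b ∉ A, O.lt a b) (hx : T.IsLine A x) : Function.Injective x := by
  classical
  by_contra hni
  have hex : ∃ N : ℕ, 0 < N ∧ ∃ m : ℤ, x m = x (m + N) := by
    rw [Function.not_injective_iff] at hni
    obtain ⟨k, l, h, hne⟩ := hni
    rcases lt_or_gt_of_ne hne with h' | h'
    · exact ⟨(l - k).toNat, by omega, k, by rw [h]; congr 1; omega⟩
    · exact ⟨(k - l).toNat, by omega, l, by rw [← h]; congr 1; omega⟩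
  obtain ⟨hN, m, hm⟩ := Nat.find_spec hex
  -- For a shortest return the constant walk closes up the segment, so its positive length would be
  -- at most 0.
  have := hx.le_of_walk hG hA (m := m) (N := Nat.find hex) ?_ (Q := fun _ => (x m).tri) (D := 0)
    (by simp) rfl (by rw [← hm]) (by simp)
  · omega
  · intro i j h1 h2 h3 e
    have := Nat.find_min hex (m := (j - i).toNat) (by omega)
    exact this ⟨by omega, i, by rw [e]; congr 1; omega⟩

theorem OneVertexTriangulation.IsLine.tri_injective {O : LeftOrder G}
    (hA : ∀ a ∈ A, ∀ b ∉ A, O.lt a b) (hx : T.IsLine A x) :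
    Function.Injective fun k => (x k).tri := fun _ _ h =>
  hx.injective hG hA (hx.eq_of_tri_eq hG h)

/-- Lines are geodesic in the dual graph. -/
theorem OneVertexTriangulation.IsLine.abs_sub_le {O : LeftOrder G}
    (hA : ∀ a ∈ A, ∀ b ∉ A, O.lt a b) (hx : T.IsLine A x) :
    ∀ (L : ℕ) (m n : ℤ) (w : T.dual.Walk (x m).tri (x n).tri), w.length = L → |n - m| ≤ L := by
  intro L
  induction L using Nat.strong_induction_on with
  | _ L ih =>
    have main : ∀ (m n : ℤ), m ≤ n → ∀ w : T.dual.Walk (x m).tri (x n).tri, w.length = L →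
        n - m ≤ L := by
      intro m n hmn w hw
      -- A walk that returns to the line in between is split there and handled by induction;
      -- otherwise the flux argument applies.
      by_cases hint : ∃ i, 0 < i ∧ i < L ∧ ∃ l, w.getVert i = (x l).tri
      · obtain ⟨i, h0, h1, l, hl⟩ := hint
        have a1 := ih i h1 m l ((w.take i).copy rfl hl) (by simp [SimpleGraph.Walk.take_length]; omega)
        have a2 := ih (L - i) (by omega) l n ((w.drop i).copy hl rfl)
          (by simp [SimpleGraph.Walk.drop_length]; omega)
        have b1 := le_abs_self (l - m)
        have b2 := le_abs_self (n - l)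
        have : ((L - i : ℕ) : ℤ) = L - i := by omega
        omega
      · push Not at hint
        have := hx.le_of_walk hG hA (m := m) (N := (n - m).toNat)
          (fun i j _ h _ e => h.ne (hx.injective hG hA e)) (Q := w.getVert) (D := L)
          (fun i hi => w.adj_getVert_succ (by omega)) (by simp)
          (by rw [← hw, w.getVert_length]; congr 2; omega) hint
        omega
    intro m n w hw
    rcases le_total m n with h | h
    · rw [abs_of_nonneg (by omega)]
      exact main m n h w hw
    · rw [abs_of_nonpos (by omega), neg_sub]
      exact main n m h w.reverse (by simpa using hw)

end

/-! ### Prongs at a vertex -/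

section

variable {G : Type*} [Group G] [MulAction G ℍ] (T : OneVertexTriangulation G)

/-- The vertex `v` is the middle vertex of the triangle `τ`. -/
def OneVertexTriangulation.IsMiddle (O : LeftOrder G) (v : G) (τ : Set G) : Prop :=
  τ ∈ T.triangles ∧ ∃ a c, O.lt a v ∧ O.lt v c ∧ τ = {a, v, c}

/-- The prong `r` leaves the triangle `τ` through the edge opposite to its middle vertex `v`, and
is a line, both for the cut just below `v` and for the cut just above `v`, that does not return to
the star of `v`. -/
structure OneVertexTriangulation.IsProng (O : LeftOrder G) (v : G) (τ : Set G) (r : ℕ → Flag G) :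
    Prop where
  isMiddle : T.IsMiddle O v τ
  lo_mem : (r 0).lo ∈ τ
  hi_mem : (r 0).hi ∈ τ
  lo_lt : O.lt (r 0).lo v
  lt_hi : O.lt v (r 0).hi
  notMem : ∀ n, v ∉ (r n).tri
  exists_below : ∃ x, T.IsLine {g | O.lt g v} x ∧ (∀ n : ℕ, x n = r n) ∧ (x (-1)).tri = τ
  exists_above : ∃ x, T.IsLine {g | O.lt g v ∨ g = v} x ∧ (∀ n : ℕ, x n = r n) ∧ (x (-1)).tri = τ

variable {T} {A : Set G} {x y : ℤ → Flag G} {O : LeftOrder G} {v : G} {τ τ' : Set G}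
  {r r' : ℕ → Flag G}

omit [MulAction G ℍ] in
theorem LeftOrder.isCut_below (O : LeftOrder G) (v : G) :
    ∀ a ∈ {g | O.lt g v}, ∀ b ∉ {g | O.lt g v}, O.lt a b := by
  intro a ha b hb
  rcases O.total v b with h | rfl | h
  · exact O.trans _ _ _ ha h
  · exact ha
  · exact absurd h hb

omit [MulAction G ℍ] in
theorem LeftOrder.isCut_above (O : LeftOrder G) (v : G) :
    ∀ a ∈ {g | O.lt g v ∨ g = v}, ∀ b ∉ {g | O.lt g v ∨ g = v}, O.lt a b := by
  intro a ha b hb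
  simp only [mem_ofPred_eq, not_or] at ha hb
  have hvb : O.lt v b := by
    rcases O.total v b with h | h | h
    · exact h
    · exact absurd h.symm hb.2
    · exact absurd h hb.1
  rcases ha with h | rfl
  · exact O.trans _ _ _ h hvb
  · exact hvb

variable (T) in
-- Left translations preserve the order, so any triangle can be moved to have its middle vertex at
-- v.
theorem OneVertexTriangulation.exists_isMiddle (O : LeftOrder G) (v : G) :
    ∃ τ, T.IsMiddle O v τ := by
  obtain ⟨σ, hσ⟩ := T.triangles_nonempty
  obtain ⟨a, m, c, hσ', ham, hmc⟩ : ∃ a m c, σ = {a, m, c} ∧ O.lt a m ∧ O.lt m c := by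
    obtain ⟨a, b, c, hab, hac, hbc, rfl⟩ := T.eq_triple hσ
    have e1 : ({a, b, c} : Set G) = {b, a, c} := Set.insert_comm _ _ _
    have e2 : ({a, b, c} : Set G) = {a, c, b} := by rw [Set.pair_comm]
    have e3 : ({a, b, c} : Set G) = {b, c, a} := by rw [e1, Set.pair_comm]
    have e4 : ({a, b, c} : Set G) = {c, a, b} := by rw [e2, Set.insert_comm]
    have e5 : ({a, b, c} : Set G) = {c, b, a} := by rw [e4, Set.pair_comm]
    rcases O.total a b with h1 | h1 | h1
    · rcases O.total b c with h2 | h2 | h2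
      · exact ⟨a, b, c, rfl, h1, h2⟩
      · exact absurd h2 hbc
      · rcases O.total a c with h3 | h3 | h3
        · exact ⟨a, c, b, e2, h3, h2⟩
        · exact absurd h3 hac
        · exact ⟨c, a, b, e4, h3, h1⟩
    · exact absurd h1 hab
    · rcases O.total a c with h2 | h2 | h2
      · exact ⟨b, a, c, e1, h1, h2⟩
      · exact absurd h2 hac
      · rcases O.total b c with h3 | h3 | h3
        · exact ⟨b, c, a, e3, h3, h2⟩
        · exact absurd h3 hbc
        · exact ⟨c, b, a, e5, h3, h1⟩
  refine ⟨_, T.translate_mem (v * m⁻¹) σ hσ, v * m⁻¹ * a, v * m⁻¹ * c, ?_, ?_, ?_⟩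
  · have := O.left_inv _ _ (v * m⁻¹) ham
    rwa [inv_mul_cancel_right] at this
  · have := O.left_inv _ _ (v * m⁻¹) hmc
    rwa [inv_mul_cancel_right] at this
  · rw [hσ', image_insert_eq, image_pair, inv_mul_cancel_right]

variable (hG : IsSurfaceGroup G)
include hG

variable (T) in
-- Count pairs of a triangle at v and a vertex of it below v, modulo two. Every lower neighbour lies
-- in two triangles at v, and a triangle has exactly one vertex below v iff v is its middle vertex.
-- So the number of middle triangles is even, and it is not zero.
theorem OneVertexTriangulation.two_le_ncard_isMiddle (O : LeftOrder G) (v : G) :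
    2 ≤ {τ | T.IsMiddle O v τ}.ncard := by
  classical
  have hfin := T.finite_star_at v
  have hfinM : {τ | T.IsMiddle O v τ}.Finite := by
    refine hfin.subset ?_
    rintro τ ⟨h, a, c, -, -, rfl⟩
    exact ⟨h, by simp⟩
  have hpos : 0 < {τ | T.IsMiddle O v τ}.ncard := by
    rw [Set.ncard_pos hfinM]
    exact T.exists_isMiddle O v
  have hnb : {y | T.Nbr v y ∧ O.lt y v}.Finite := (T.finite_nbr v).subset fun y h => h.1
  set S := hfin.toFinset with hS
  set L := hnb.toFinset with hL
  have hcount := Finset.sum_card_bipartiteAbove_eq_sum_card_bipartiteBelow (s := S) (t := L)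
    (fun (τ : Set G) (y : G) => y ∈ τ)
  have hright : ∀ y ∈ L, (Finset.bipartiteBelow (fun (τ : Set G) (y : G) => y ∈ τ) S y).card = 2 := by
    intro y hy
    obtain ⟨⟨hvy, τ, hτ, hvτ, hyτ⟩, hlt⟩ : T.Nbr v y ∧ O.lt y v := by simpa [hL] using hy
    obtain ⟨σ, hσ, hne, hvσ, hyσ⟩ := T.exists_other_triangle hG hvy hτ hvτ hyτ
    rw [Finset.card_eq_two]
    refine ⟨τ, σ, hne.symm, ?_⟩
    ext ρ
    simp only [Finset.mem_bipartiteBelow, hS, Set.Finite.mem_toFinset, mem_ofPred_eq,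
      Finset.mem_insert, Finset.mem_singleton]
    constructor
    · rintro ⟨⟨hρ, hvρ⟩, hyρ⟩
      by_contra! h
      exact h.2 (T.eq_of_ne_of_ne hτ hρ hσ hvy hvτ hyτ hvρ hyρ hvσ hyσ h.1 hne)
    · rintro (rfl | rfl)
      · exact ⟨⟨hτ, hvτ⟩, hyτ⟩
      · exact ⟨⟨hσ, hvσ⟩, hyσ⟩
  rw [Finset.sum_congr rfl hright] at hcount
  have hleft : ∀ τ ∈ S, ((Finset.bipartiteAbove (fun (τ : Set G) (y : G) => y ∈ τ) L τ).card : ZMod 2)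
      = if T.IsMiddle O v τ then 1 else 0 := by
    intro τ hτS
    obtain ⟨hτ, hvτ⟩ : τ ∈ T.triangles ∧ v ∈ τ := by simpa [hS] using hτS
    obtain ⟨b, c, hvb, hvc, hbc, rfl⟩ := T.eq_triple_of_mem hτ hvτ
    have hset : Finset.bipartiteAbove (fun (τ : Set G) (y : G) => y ∈ τ) L {v, b, c} =
        ({b, c} : Finset G).filter fun y => O.lt y v := by
      ext y
      simp only [Finset.mem_bipartiteAbove, hL, Set.Finite.mem_toFinset, mem_ofPred_eq,
        Finset.mem_filter, Finset.mem_insert, Finset.mem_singleton, mem_insert_iff,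
        mem_singleton_iff]
      constructor
      · rintro ⟨⟨hn, hlt⟩, h⟩
        exact ⟨h.resolve_left hn.1.symm, hlt⟩
      · rintro ⟨h, hlt⟩
        have hy : y ∈ ({v, b, c} : Set G) := by simp [h]
        exact ⟨⟨⟨(O.ne hlt).symm, _, hτ, hvτ, hy⟩, hlt⟩, Or.inr h⟩
    refine Eq.trans (by convert congrArg (fun s : Finset G => (s.card : ZMod 2)) hset) ?_
    rw [Finset.filter_insert, Finset.filter_singleton]
    have hmid : T.IsMiddle O v {v, b, c} ↔ (O.lt b v ∧ O.lt v c) ∨ (O.lt c v ∧ O.lt v b) := by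
      constructor
      · rintro ⟨-, d, e, h1, h2, h3⟩
        have hd : d ∈ ({v, b, c} : Set G) := by rw [h3]; simp
        have he : e ∈ ({v, b, c} : Set G) := by rw [h3]; simp
        have hdv := O.ne h1
        have hve := O.ne h2
        have hde := O.ne (O.trans _ _ _ h1 h2)
        rcases hd with rfl | rfl | rfl
        · exact absurd rfl hdv
        · rcases he with rfl | rfl | rfl
          · exact absurd rfl hve
          · exact absurd rfl hde
          · exact Or.inl ⟨h1, h2⟩
        · rcases he with rfl | rfl | rfl
          · exact absurd rfl hve
          · exact Or.inr ⟨h1, h2⟩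
          · exact absurd rfl hde
      · rintro (⟨h1, h2⟩ | ⟨h1, h2⟩)
        · exact ⟨hτ, b, c, h1, h2, Set.insert_comm _ _ _⟩
        · exact ⟨hτ, c, b, h1, h2, by rw [Set.pair_comm, Set.insert_comm]⟩
    have tb : O.lt b v ∨ O.lt v b := by
      rcases O.total b v with h | h | h
      · exact Or.inl h
      · exact absurd h.symm hvb
      · exact Or.inr h
    have tc : O.lt c v ∨ O.lt v c := by
      rcases O.total c v with h | h | h
      · exact Or.inl h
      · exact absurd h.symm hvc
      · exact Or.inr h
    rcases tb with h1 | h1 <;> rcases tc with h2 | h2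
    · have := O.asymm h1; have := O.asymm h2
      rw [if_pos h1, if_pos h2, if_neg (by tauto), Finset.card_pair hbc]
      rfl
    · have := O.asymm h1; have h3 := O.asymm h2
      rw [if_pos h1, if_neg h3, if_pos (by tauto)]
      simp
    · have h3 := O.asymm h1; have := O.asymm h2
      rw [if_neg h3, if_pos h2, if_pos (by tauto)]
      simp
    · have h3 := O.asymm h1; have h4 := O.asymm h2
      rw [if_neg h3, if_neg h4, if_neg (by tauto)]
      simp
  have hM : (({τ | T.IsMiddle O v τ}.ncard : ℕ) : ZMod 2) = 0 := by
    have h1 : {τ | T.IsMiddle O v τ} = ↑(S.filter fun τ => T.IsMiddle O v τ) := by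
      ext τ
      simp only [hS, Finset.coe_filter, Set.Finite.mem_toFinset, mem_ofPred_eq]
      constructor
      · rintro ⟨h, a, c, h1, h2, rfl⟩
        exact ⟨⟨h, by simp⟩, h, a, c, h1, h2, rfl⟩
      · exact fun h => h.2
    rw [h1, Set.ncard_coe_finset, Finset.card_filter, Nat.cast_sum]
    push_cast
    rw [← Finset.sum_congr rfl hleft, ← Nat.cast_sum, hcount]
    simp only [Finset.sum_const, smul_eq_mul, Nat.cast_mul]
    rw [show ((2 : ℕ) : ZMod 2) = 0 from rfl, mul_zero]
  rcases Nat.lt_or_ge {τ | T.IsMiddle O v τ}.ncard 2 with h | h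
  · have : {τ | T.IsMiddle O v τ}.ncard = 1 := by omega
    rw [this] at hM
    exact absurd hM (by decide)
  · exact h

/-- A walk in the star of a vertex. -/
theorem OneVertexTriangulation.exists_star_walk {σ τ : Set G} (hσ : σ ∈ T.triangles)
    (hτ : τ ∈ T.triangles) (hvσ : v ∈ σ) (hvτ : v ∈ τ) :
    ∃ (Q : ℕ → Set G) (D : ℕ), (∀ i < D, T.dual.Adj (Q i) (Q (i + 1))) ∧ Q 0 = σ ∧ Q D = τ ∧
      ∀ i ≤ D, v ∈ Q i := by
  have h := T.reflTransGen_starAdj hG hσ hτ hvσ hvτ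
  induction h using Relation.ReflTransGen.head_induction_on with
  | refl => exact ⟨fun _ => τ, 0, by simp, rfl, rfl, fun _ _ => hvτ⟩
  | @head a c h1 h2 ih =>
    obtain ⟨Q, D, h3, h4, h5, h6⟩ := ih h1.2.1 h1.2.2.2.1
    by_cases hac : a = c
    · exact ⟨Q, D, h3, h4.trans hac.symm, h5, h6⟩
    · refine ⟨fun i => if i = 0 then a else Q (i - 1), D + 1, ?_, by simp, by simp [h5], ?_⟩
      · intro i hi
        rcases Nat.eq_zero_or_pos i with rfl | h0
        · have : T.dual.Adj a c := ⟨h1.adj, hac⟩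
          simpa [h4] using this
        · have := h3 (i - 1) (by omega)
          simpa [h0.ne', Nat.sub_add_cancel h0] using this
      · intro i hi
        rcases Nat.eq_zero_or_pos i with rfl | h0
        · simpa using h1.2.2.1
        · simpa [h0.ne'] using h6 (i - 1) (by omega)

/-- At a first return to the star of v, a walk inside the star closes up the line and bounds a
finite set U; this walk crosses only edges at v. If a ∈ U, the minimum of U without v lies below v
and has a lower neighbour, which is outside of U. The edge between them does not contain v, so the
line would have to cross it, but the line leaves U upwards. If c ∈ U, the same holds with the
maximum and the opposite order. -/
theorem OneVertexTriangulation.IsMiddle.notMem_line {a c : G} (hτ : τ ∈ T.triangles)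
    (ha : O.lt a v) (hc : O.lt v c) (haτ : a ∈ τ) (hvτ : v ∈ τ)
    (hA : ∀ a ∈ A, ∀ b ∉ A, O.lt a b) (hx : T.IsLine A x)
    (hlo : (x 0).lo = a) (hhi : (x 0).hi = c) (hm : (x (-1)).tri = τ) (n : ℕ) :
    v ∉ (x n).tri := by
  induction n using Nat.strong_induction_on with
  | _ n ih =>
    intro hvn
    have hlt : ∀ k, O.lt (x k).lo (x k).hi := fun k =>
      hA _ (hx.isFlag k).2.2.2.1 _ (hx.isFlag k).2.2.2.2
    obtain ⟨Q, D, hQ, hQ0, hQD, hvQ⟩ := OneVertexTriangulation.exists_star_walk hG hτ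
      (hx.isFlag n).1 hvτ hvn
    have hcr : ∀ g h, crossing Q D g h ≠ 0 → g = v ∨ h = v := by
      intro g h hne
      obtain ⟨i, hi, h1, ⟨h2, h3⟩, h4, h5⟩ := exists_of_crossing_ne_zero hne
      by_contra! hno
      exact (hQ i hi).2 (T.eq_of_three_mem (hQ i hi).1.1 (hQ i hi).1.2.1 h1 hno.1 hno.2 h2 h3
        (hvQ i hi.le) h4 h5 (hvQ (i + 1) hi))
    have hev : ∀ j : ℤ, -1 < j → j ≤ n → (x j).lo ≠ v ∧ (x j).hi ≠ v := by
      intro j hj1 hj2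
      rcases (show 0 ≤ j by omega).eq_or_lt with rfl | h0
      · rw [hlo, hhi]
        exact ⟨O.ne ha, (O.ne hc).symm⟩
      · have hs := hx (j - 1)
        rw [sub_add_cancel] at hs
        have := ih (j - 1).toNat (by omega)
        rw [show (((j - 1).toNat : ℕ) : ℤ) = j - 1 by omega] at this
        exact ⟨fun h => this (h ▸ hs.2.2.1), fun h => this (h ▸ hs.2.2.2.1)⟩
    obtain ⟨U, hU, hsides, hbd⟩ := hx.exists_sides hG (m := -1) (N := n + 1)
      (fun i j _ h _ e => h.ne (hx.injective hG hA e)) hQ (hQ0.trans hm.symm)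
      (by rw [hQD]; congr 2; push_cast; ring)
      (fun j hj1 hj2 => by
        by_contra hne
        have := hev j hj1 (by push_cast at hj2; omega)
        exact (hcr _ _ hne).elim this.1 this.2)
      (fun j hj1 hj2 => by
        by_contra hne
        push_cast at hj2
        exact (hcr _ _ hne).elim (hev j hj1 (by omega)).1 (hev (j + 1) (by omega) (by omega)).1)
    rw [show (-1 : ℤ) + 1 = 0 by ring, hlo] at hsides
    have h0 := hsides 0 (by omega) (by push_cast; omega)
    rw [hhi] at h0
    by_cases haU : a ∈ U
    · obtain ⟨m, ⟨hmU, hmv⟩, hmin⟩ := O.exists_min (U := U \ {v}) (hU.subset sdiff_subset)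
        ⟨a, haU, O.ne ha⟩
      rw [mem_singleton_iff] at hmv
      obtain ⟨y, hmy, hym⟩ := T.exists_nbr_lt O m
      have hmlt : O.lt m v := by
        rcases O.total m a with h | rfl | h
        · exact O.trans _ _ _ h ha
        · exact ha
        · exact absurd h (hmin a ⟨haU, O.ne ha⟩)
      have hyv : y ≠ v := O.ne (O.trans _ _ _ hym hmlt)
      have hyU : y ∉ U := fun h => hmin y ⟨h, hyv⟩ hym
      rcases hbd m y hmy hmU hyU with h | ⟨j, hj1, hj2, ⟨rfl, rfl⟩ | ⟨rfl, rfl⟩⟩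
      · exact (hcr _ _ h).elim hmv hyv
      · exact O.asymm (hlt j) hym
      · exact (hsides j hj1 hj2).2.1 hmU haU
    · have hcU : c ∈ U := h0.2.2 haU
      obtain ⟨m, ⟨hmU, hmv⟩, hmax⟩ := O.exists_max (U := U \ {v}) (hU.subset sdiff_subset)
        ⟨c, hcU, (O.ne hc).symm⟩
      rw [mem_singleton_iff] at hmv
      obtain ⟨y, hmy, hym⟩ := T.exists_lt_nbr O m
      have hmlt : O.lt v m := by
        rcases O.total m c with h | rfl | h
        · exact absurd h (hmax c ⟨hcU, (O.ne hc).symm⟩)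
        · exact hc
        · exact O.trans _ _ _ hc h
      have hyv : y ≠ v := (O.ne (O.trans _ _ _ hmlt hym)).symm
      have hyU : y ∉ U := fun h => hmax y ⟨h, hyv⟩ hym
      rcases hbd m y hmy hmU hyU with h | ⟨j, hj1, hj2, ⟨rfl, rfl⟩ | ⟨rfl, rfl⟩⟩
      · exact (hcr _ _ h).elim hmv hyv
      · exact haU ((hsides j hj1 hj2).1.1 hmU)
      · exact O.asymm (hlt j) hym

/-- Start at the edge opposite to v. The line never meets v again, and the cuts just below and just
above v differ only in v, so both cuts produce the same flags. -/
theorem OneVertexTriangulation.IsMiddle.exists_isProng (h : T.IsMiddle O v τ) :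
    ∃ r, T.IsProng O v τ r := by
  obtain ⟨hτ, a, c, ha, hc, rfl⟩ := id h
  have hav := O.ne ha
  have hvc := O.ne hc
  have line : ∀ A : Set G, a ∈ A → c ∉ A → ∃ x, T.IsLine A x ∧
      x 0 = T.rev ⟨a, c, {a, v, c}⟩ ∧ (x (-1)).tri = {a, v, c} := by
    intro A haA hcA
    have hf : T.IsFlag A ⟨a, c, {a, v, c}⟩ := ⟨hτ, by simp, by simp, haA, hcA⟩
    obtain ⟨hf', hne⟩ := hf.rev hG
    obtain ⟨x, hx, h0⟩ := hf'.exists_line hG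
    refine ⟨x, hx, h0, ?_⟩
    have hs := hx (-1)
    rw [show (-1 : ℤ) + 1 = 0 by ring, h0] at hs
    exact T.eq_of_ne_of_ne hf'.1 hs.1.1 hf.1 hf'.ne hf'.2.1 hf'.2.2.1 hs.2.2.1 hs.2.2.2.1
      hf.2.1 hf.2.2.1 hs.2.2.2.2.1.symm hne.symm
  obtain ⟨x, hx, hx0, hx1⟩ := line {g | O.lt g v} ha (O.asymm hc)
  obtain ⟨y, hy, hy0, hy1⟩ := line {g | O.lt g v ∨ g = v} (Or.inl ha) (by
    rintro (h | h)
    · exact O.asymm hc h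
    · exact hvc h.symm)
  have hnx := OneVertexTriangulation.IsMiddle.notMem_line hG hτ ha hc (by simp) (by simp)
    (O.isCut_below v) hx (by rw [hx0]; rfl) (by rw [hx0]; rfl) hx1
  refine ⟨fun n => x n, h, ?_, ?_, ?_, ?_, hnx, ⟨x, hx, fun _ => rfl, hx1⟩, y, hy, ?_, hy1⟩
  · simp [hx0, OneVertexTriangulation.rev]
  · simp [hx0, OneVertexTriangulation.rev]
  · simpa [hx0, OneVertexTriangulation.rev] using ha
  · simpa [hx0, OneVertexTriangulation.rev] using hc
  · intro n
    induction n with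
    | zero => simp [hx0, hy0]
    | succ n ih =>
      have h1 := (hx n).congr (A' := {g | O.lt g v ∨ g = v}) fun g hg => by
        have : g ≠ v := fun e => hnx n (e ▸ hg)
        simp [this]
      have h2 := hy n
      rw [ih] at h2
      push_cast
      exact h2.unique h1

/-- The line separates the vertices into two sides. -/
theorem OneVertexTriangulation.IsLine.exists_side (hx : T.IsLine A x) :
    ∃ V : Set G, ∀ τ ∈ T.triangles, ∀ g ∈ τ, ∀ h ∈ τ,
      ((g ∈ V ↔ h ∈ V) ↔ ((∃ k, τ = (x k).tri) → (g ∈ A ↔ h ∈ A))) := by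
  classical
  -- The edges of the line form a cocycle: a triangle on the line has exactly two of them, any other
  -- triangle has none. A primitive of it is the indicator of a side.
  let c : G → G → ZMod 2 := fun g h =>
    if ∃ k, (g = (x k).lo ∧ h = (x k).hi) ∨ (g = (x k).hi ∧ h = (x k).lo) then 1 else 0
  have hc : ∀ τ ∈ T.triangles, ∀ g ∈ τ, ∀ h ∈ τ,
      c g h = if (∃ k, τ = (x k).tri) → (g ∈ A ↔ h ∈ A) then 0 else 1 := by
    intro τ hτ g hg h hh
    have key : (∃ k, (g = (x k).lo ∧ h = (x k).hi) ∨ (g = (x k).hi ∧ h = (x k).lo)) ↔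
        ¬ ((∃ k, τ = (x k).tri) → (g ∈ A ↔ h ∈ A)) := by
      constructor
      · rintro ⟨k, hk⟩ himp
        have hlo : (x k).lo ∈ τ := by rcases hk with ⟨rfl, rfl⟩ | ⟨rfl, rfl⟩ <;> assumption
        have hhi : (x k).hi ∈ τ := by rcases hk with ⟨rfl, rfl⟩ | ⟨rfl, rfl⟩ <;> assumption
        have hf := hx.isFlag k
        have hex : ∃ k, τ = (x k).tri := by
          by_cases e : τ = (x k).tri
          · exact ⟨k, e⟩
          · have hs := hx (k - 1)
            rw [sub_add_cancel] at hs
            exact ⟨k - 1, T.eq_of_ne_of_ne hf.1 hτ hs.1.1 hf.ne hf.2.1 hf.2.2.1 hlo hhi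
              hs.2.2.1 hs.2.2.2.1 e hs.2.2.2.2.1.symm⟩
        have h1 := himp hex
        have h2 := hf.2.2.2
        rcases hk with ⟨rfl, rfl⟩ | ⟨rfl, rfl⟩ <;> tauto
      · intro hn
        rw [Classical.not_imp] at hn
        obtain ⟨⟨k, rfl⟩, hn⟩ := hn
        have main : ∀ g ∈ (x k).tri, ∀ h ∈ (x k).tri, g ∈ A → h ∉ A →
            ∃ k, g = (x k).lo ∧ h = (x k).hi := by
          intro g hg h hh hgA hhA
          rcases (hx k).eq_or_eq_rev (g := ⟨g, h, (x k).tri⟩) ⟨hτ, hg, hh, hgA, hhA⟩ rfl with e | e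
          · exact ⟨k, congrArg Flag.lo e, congrArg Flag.hi e⟩
          · exact ⟨k + 1, congrArg Flag.lo e, congrArg Flag.hi e⟩
        by_cases hgA : g ∈ A
        · have hhA : h ∉ A := by tauto
          exact (main g hg h hh hgA hhA).imp fun _ h => Or.inl h
        · have hhA : h ∈ A := by tauto
          exact (main h hh g hg hhA hgA).imp fun _ h => Or.inr ⟨h.2, h.1⟩
    simp only [c, key]
    split_ifs <;> tauto
  obtain ⟨f, hf⟩ := T.exists_coboundary hG c (by
    intro τ hτ a ha b hb d hd
    rw [hc τ hτ a ha b hb, hc τ hτ b hb d hd, hc τ hτ a ha d hd]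
    by_cases hk : ∃ k, τ = (x k).tri
    · by_cases h1 : a ∈ A <;> by_cases h2 : b ∈ A <;> by_cases h3 : d ∈ A <;>
        simp [hk, h1, h2, h3] <;> rfl
    · simp [hk])
  refine ⟨{g | f g = 0}, fun τ hτ g hg h hh => ?_⟩
  have h1 := hf τ hτ g hg h hh
  rw [hc τ hτ g hg h hh] at h1
  change (f g = 0 ↔ f h = 0) ↔ _
  split_ifs at h1 with h2
  · refine iff_of_true ?_ h2
    revert h1
    generalize f g = a
    generalize f h = b
    revert a b
    decide
  · refine iff_of_false ?_ h2
    revert h1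
    generalize f g = a
    generalize f h = b
    revert a b
    decide

/-- Lines for the same cut with a common triangle pass through the same triangles. -/
theorem OneVertexTriangulation.IsLine.exists_tri_eq (hx : T.IsLine A x) (hy : T.IsLine A y)
    {k l : ℤ} (h : (x k).tri = (y l).tri) :
    (∀ n, x (k + n) = y (l + n)) ∨ ∀ n, (x (k + n)).tri = (y (l - n)).tri := by
  rcases (hy l).eq_or_eq_rev (hx.isFlag k) h.symm with e | e
  · exact Or.inl (hx.eq_add hG hy e)
  · right
    intro n
    have h1 := hx.eq_add hG (hy.reverse hG) (k := k) (l := -(l + 1)) (by simpa using e) n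
    rw [h1, show -(-(l + 1) + n) = l - n + 1 by ring]
    have hs := hy (l - n)
    have : (⟨(y (l - n + 1)).lo, (y (l - n + 1)).hi, (y (l - n)).tri⟩ : Flag G) =
        T.rev (y (l - n + 1)) :=
      hs.2.1.eq_rev_of_ne ⟨hs.1.1, hs.2.2.1, hs.2.2.2.1, hs.2.1.2.2.2⟩ rfl rfl hs.2.2.2.2.1.symm
    rw [← this]

/-- Both prongs extend to lines for the cut just below v. A common triangle makes these lines agree
up to a shift or a reversal, and the position -1, the first one going back whose triangle contains
v, tells where they start. -/
theorem OneVertexTriangulation.IsProng.tri_ne (h : T.IsProng O v τ r) (h' : T.IsProng O v τ' r')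
    (hne : τ ≠ τ') (n m : ℕ) : (r n).tri ≠ (r' m).tri := by
  intro e
  obtain ⟨x, hx, hxr, hx1⟩ := h.exists_below
  obtain ⟨y, hy, hyr, hy1⟩ := h'.exists_below
  have hvτ : v ∈ τ := by
    obtain ⟨-, a, c, -, -, rfl⟩ := h.isMiddle
    simp
  have hvτ' : v ∈ τ' := by
    obtain ⟨-, a, c, -, -, rfl⟩ := h'.isMiddle
    simp
  rw [← hxr, ← hyr] at e
  have hxn : ∀ k : ℤ, 0 ≤ k → v ∉ (x k).tri := fun k hk => by
    have := h.notMem k.toNat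
    rwa [← hxr, Int.toNat_of_nonneg hk] at this
  have hyn : ∀ k : ℤ, 0 ≤ k → v ∉ (y k).tri := fun k hk => by
    have := h'.notMem k.toNat
    rwa [← hyr, Int.toNat_of_nonneg hk] at this
  rcases hx.exists_tri_eq hG hy e with h1 | h1
  · rcases lt_trichotomy n m with h2 | h2 | h2
    · have := h1 (-n - 1)
      rw [show (n : ℤ) + (-n - 1) = -1 by ring] at this
      refine hyn (m + (-n - 1)) (by omega) ?_
      rw [← this, hx1]
      exact hvτ
    · have := h1 (-n - 1)
      rw [show (n : ℤ) + (-n - 1) = -1 by ring, ← h2,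
        show (n : ℤ) + (-n - 1) = -1 by ring] at this
      exact hne (by rw [← hx1, ← hy1, this])
    · have := h1 (-m - 1)
      rw [show (m : ℤ) + (-m - 1) = -1 by ring] at this
      refine hxn (n + (-m - 1)) (by omega) ?_
      rw [this, hy1]
      exact hvτ'
  · have := h1 (m + 1)
    rw [show (m : ℤ) - (m + 1) = -1 by ring, hy1] at this
    refine hxn (n + (m + 1)) (by omega) ?_
    rw [this]
    exact hvτ'

/-- Different prongs diverge. -/
theorem OneVertexTriangulation.IsProng.lt_length (h : T.IsProng O v τ r)
    (h' : T.IsProng O v τ' r') (hne : τ ≠ τ') (n m : ℕ)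
    (w : T.dual.Walk (r n).tri (r' m).tri) : n < w.length := by
  obtain ⟨x, hx, hxr, hx1⟩ := h.exists_below
  obtain ⟨y, hy, hyr, hy1⟩ := h.exists_above
  obtain ⟨x', hx', hxr', hx1'⟩ := h'.exists_below
  obtain ⟨y', hy', hyr', hy1'⟩ := h'.exists_above
  have hvτ : v ∈ τ := by
    obtain ⟨-, a, c, -, -, rfl⟩ := h.isMiddle
    simp
  have hvτ' : v ∈ τ' := by
    obtain ⟨-, a, c, -, -, rfl⟩ := h'.isMiddle
    simp
  have hτ := h.isMiddle.1
  -- Lines are geodesic, so a walk from `r n` to a triangle before the start of the prong has length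
  -- greater than n. A walk of length at most n can therefore meet the two lines only along the
  -- prong itself.
  have cut : ∀ (A : Set G) (z : ℤ → Flag G), (∀ a ∈ A, ∀ b ∉ A, O.lt a b) → T.IsLine A z →
      (∀ n : ℕ, z n = r n) → ∀ i ≤ w.length, ∀ k < 0, w.getVert i = (z k).tri → n < w.length := by
    intro A z hA hz hzr i hi k hk e
    have := hz.abs_sub_le hG hA i n k ((w.take i).copy (by rw [hzr]) e) (by
      simp [SimpleGraph.Walk.take_length, hi])
    have h2 := neg_abs_le (k - n)
    omega
  by_contra hlen
  have hoffx : ∀ i ≤ w.length, ∀ k < 0, w.getVert i ≠ (x k).tri := fun i hi k hk e =>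
    hlen (cut _ x (O.isCut_below v) hx hxr i hi k hk e)
  have hoffy : ∀ i ≤ w.length, ∀ k < 0, w.getVert i ≠ (y k).tri := fun i hi k hk e =>
    hlen (cut _ y (O.isCut_above v) hy hyr i hi k hk e)
  obtain ⟨V, hV⟩ := hx.exists_side hG
  obtain ⟨W, hW⟩ := hy.exists_side hG
  have hvV : ¬ ((r 0).lo ∈ V ↔ v ∈ V) := by
    rw [hV τ hτ _ h.lo_mem _ hvτ]
    intro hc
    exact O.irrefl v ((hc ⟨-1, hx1.symm⟩).1 h.lo_lt)
  have hvW : ¬ ((r 0).hi ∈ W ↔ v ∈ W) := by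
    rw [hW τ hτ _ h.hi_mem _ hvτ]
    intro hc
    rcases (hc ⟨-1, hy1.symm⟩).2 (Or.inr rfl) with h1 | h1
    · exact O.asymm h.lt_hi h1
    · exact O.ne h.lt_hi h1.symm
  have hfx : ∀ n, T.IsFlag {g | O.lt g v} (r n) := fun n => by rw [← hxr]; exact hx.isFlag n
  have hfy : ∀ n, T.IsFlag {g | O.lt g v ∨ g = v} (r n) := fun n => by rw [← hyr]; exact hy.isFlag n
  have hlo : ∀ n, ((r n).lo ∈ V ↔ (r 0).lo ∈ V) := by
    intro n
    induction n with
    | zero => rfl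
    | succ n ih =>
      rw [← ih]
      have hs := hx n
      rw [hxr, show (n : ℤ) + 1 = (n + 1 : ℕ) by push_cast; ring, hxr] at hs
      rw [hV _ (hfx n).1 _ hs.2.2.1 _ (hfx n).2.1]
      exact fun _ => iff_of_true hs.2.1.2.2.2.1 hs.1.2.2.2.1
  have hhi : ∀ n, ((r n).hi ∈ W ↔ (r 0).hi ∈ W) := by
    intro n
    induction n with
    | zero => rfl
    | succ n ih =>
      rw [← ih]
      have hs := hy n
      rw [hyr, show (n : ℤ) + 1 = (n + 1 : ℕ) by push_cast; ring, hyr] at hs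
      rw [hW _ (hfy n).1 _ hs.2.2.2.1 _ (hfy n).2.2.1]
      exact fun _ => iff_of_false hs.2.1.2.2.2.2 hs.1.2.2.2.2
  -- The region to be confined to: the side of the prong's lower vertices for the line below v, or
  -- the side of its upper vertices for the line above v. It contains every vertex of the prong's
  -- triangles but not v.
  have hprong : ∀ n, ∀ g ∈ (r n).tri, (g ∈ V ↔ (r 0).lo ∈ V) ∨ (g ∈ W ↔ (r 0).hi ∈ W) := by
    intro n g hg
    by_cases hgv : O.lt g v
    · left
      rw [← hlo n, hV _ (hfx n).1 _ hg _ (hfx n).2.1]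
      exact fun _ => iff_of_true hgv (hfx n).2.2.2.1
    · right
      rw [← hhi n, hW _ (hfy n).1 _ hg _ (hfy n).2.2.1]
      refine fun _ => iff_of_false ?_ (hfy n).2.2.2.2
      rintro (h1 | rfl)
      · exact hgv h1
      · exact h.notMem n hg
  have hoff : ∀ i ≤ w.length, (∀ k, w.getVert i ≠ (r k).tri) →
      (¬ ∃ k, w.getVert i = (x k).tri) ∧ ¬ ∃ k, w.getVert i = (y k).tri := by
    intro i hi hr
    constructor
    · rintro ⟨k, hk⟩
      rcases lt_or_ge k 0 with h0 | h0
      · exact hoffx i hi k h0 hk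
      · refine hr k.toNat ?_
        rw [hk, ← hxr, Int.toNat_of_nonneg h0]
    · rintro ⟨k, hk⟩
      rcases lt_or_ge k 0 with h0 | h0
      · exact hoffy i hi k h0 hk
      · refine hr k.toNat ?_
        rw [hk, ← hyr, Int.toNat_of_nonneg h0]
  -- A triangle of the walk off the prong is off both lines, so all its vertices lie on the same
  -- sides as the one that it shares with its predecessor. The walk stays in the region.
  have hN : ∀ i ≤ w.length, ∀ g ∈ w.getVert i,
      (g ∈ V ↔ (r 0).lo ∈ V) ∨ (g ∈ W ↔ (r 0).hi ∈ W) := by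
    intro i
    induction i with
    | zero =>
      intro _ g hg
      rw [SimpleGraph.Walk.getVert_zero] at hg
      exact hprong n g hg
    | succ i ih =>
      intro hi g hg
      by_cases hr : ∃ k, w.getVert (i + 1) = (r k).tri
      · obtain ⟨k, hk⟩ := hr
        rw [hk] at hg
        exact hprong k g hg
      · push Not at hr
        obtain ⟨h1, h2⟩ := hoff (i + 1) hi hr
        obtain ⟨⟨-, h3, a, b, -, h4, -, h5, -⟩, -⟩ := w.adj_getVert_succ (show i < w.length by omega)
        have h6 := hV _ h3 g hg a h5
        have h7 := hW _ h3 g hg a h5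
        simp only [h1, h2, false_imp_iff, iff_true] at h6 h7
        rw [h6, h7]
        exact ih (by omega) a h4
  have hlast := hN w.length le_rfl
  rw [SimpleGraph.Walk.getVert_length] at hlast
  obtain ⟨hnx, hny⟩ := hoff w.length le_rfl (fun k e => by
    rw [SimpleGraph.Walk.getVert_length] at e
    exact h.tri_ne hG h' hne k m e.symm)
  rw [SimpleGraph.Walk.getVert_length] at hnx hny
  -- The other prong never meets these lines, so for both of them it lies on the side of v, outside
  -- of the region.
  have const : ∀ (A : Set G) (z z' : ℤ → Flag G) (V : Set G), T.IsLine A z → T.IsLine A z' →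
      (∀ n : ℕ, z' n = r' n) → (z' (-1)).tri = τ' → (¬ ∃ k, (r' m).tri = (z k).tri) →
      (∀ τ ∈ T.triangles, ∀ g ∈ τ, ∀ h ∈ τ,
        ((g ∈ V ↔ h ∈ V) ↔ ((∃ k, τ = (z k).tri) → (g ∈ A ↔ h ∈ A)))) →
      ∀ g ∈ (r' m).tri, (g ∈ V ↔ v ∈ V) := by
    intro A z z' V hz hz' hzr hz1 hno hV g hg
    have h1 : ∀ k l, (z' k).tri ≠ (z l).tri := by
      intro k l e
      rcases hz'.exists_tri_eq hG hz e with h2 | h2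
      · have := h2 (m - k)
        rw [add_sub_cancel, hzr] at this
        exact hno ⟨_, congrArg Flag.tri this⟩
      · have := h2 (m - k)
        rw [add_sub_cancel, hzr] at this
        exact hno ⟨_, this⟩
    have h3 : ∀ n : ℕ, ∀ g ∈ (z' (-1 + n)).tri, (g ∈ V ↔ v ∈ V) := by
      intro n
      induction n with
      | zero =>
        intro g hg
        simp only [Nat.cast_zero, add_zero] at hg
        rw [hV _ (hz'.isFlag (-1)).1 _ hg _ (by rw [hz1]; exact hvτ')]
        rintro ⟨k, hk⟩
        exact absurd hk (h1 _ _)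
      | succ n ih =>
        intro g hg
        have hs := hz' (-1 + n)
        rw [← ih _ hs.2.2.1]
        rw [Nat.cast_succ, ← add_assoc] at hg
        rw [hV _ hs.2.1.1 _ hg _ hs.2.1.2.1]
        rintro ⟨k, hk⟩
        exact absurd hk (h1 _ _)
    refine h3 (m + 1) g ?_
    rw [Nat.cast_succ, show (-1 : ℤ) + (m + 1) = m by ring, hzr]
    exact hg
  have hfm : T.IsFlag {g | O.lt g v} (r' m) := by rw [← hxr']; exact hx'.isFlag m
  have c1 := const _ x x' V hx hx' hxr' hx1' hnx hV _ hfm.2.1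
  have c2 := const _ y y' W hy hy' hyr' hy1' hny hW _ hfm.2.1
  rcases hlast _ hfm.2.1 with h1 | h1
  · exact hvV (h1.symm.trans c1)
  · exact hvW (h1.symm.trans c2)

end

/-! ### The dual graph is quasi-isometric to the plane -/

section

variable {G : Type*} [Group G] [MulAction G ℍ] (T : OneVertexTriangulation G)
  (hG : IsSurfaceGroup G)

/-- Left multiplication as an automorphism of the dual graph. -/
def OneVertexTriangulation.dualHom (g : G) : T.dual →g T.dual where
  toFun τ := (fun h => g * h) '' τ
  map_rel' := by
    rintro σ τ ⟨⟨h1, h2, a, b, hab, h3, h4, h5, h6⟩, hne⟩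
    refine ⟨⟨T.translate_mem g σ h1, T.translate_mem g τ h2, g * a, g * b,
      fun h => hab (mul_left_cancel h), ⟨a, h3, rfl⟩, ⟨b, h4, rfl⟩, ⟨a, h5, rfl⟩, ⟨b, h6, rfl⟩⟩, ?_⟩
    exact fun h => hne ((mul_right_injective g).image_injective h)

theorem OneVertexTriangulation.exists_smul_walk {σ τ : Set G} (w : T.dual.Walk σ τ) (g : G) :
    ∃ w' : T.dual.Walk ((fun h => g * h) '' σ) ((fun h => g * h) '' τ), w'.length = w.length :=
  ⟨w.map (T.dualHom g), SimpleGraph.Walk.length_map _ _⟩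

include hG

theorem IsSurfaceGroup.dist_smul (g : G) (z w : ℍ) : dist (g • z) (g • w) = dist z w := by
  obtain ⟨A, hA⟩ := hG.orientationPreserving g
  rw [hA, hA, _root_.dist_smul]

theorem OneVertexTriangulation.exists_diam :
    ∃ d : ℝ, 0 ≤ d ∧ ∀ τ ∈ T.triangles, ∀ z ∈ T.cell τ, ∀ w ∈ T.cell τ, dist z w ≤ d := by
  have hb : Bornology.IsBounded (⋃ τ ∈ {τ ∈ T.triangles | (1 : G) ∈ τ}, T.cell τ) :=
    (T.finite_star.isCompact_biUnion fun τ hτ => T.isCompact_cell hτ.1).isBounded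
  obtain ⟨d, hd⟩ := Metric.isBounded_iff.1 hb
  refine ⟨max d 0, le_max_right _ _, fun τ hτ z hz w hw => ?_⟩
  obtain ⟨a, b, c, -, -, -, e⟩ := T.eq_triple hτ
  have ha : a ∈ τ := by rw [e]; simp
  obtain ⟨σ, hσ, hστ⟩ := T.exists_translate hτ ha
  have key : ∀ z ∈ T.cell τ, a⁻¹ • z ∈ T.cell σ := by
    intro z hz
    have := T.smul_mem_cell hτ a⁻¹ hz
    rw [hστ, image_image] at this
    simpa using this
  rw [← hG.dist_smul a⁻¹]
  exact (hd (mem_biUnion hσ (key z hz)) (mem_biUnion hσ (key w hw))).trans (le_max_left _ _)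

theorem OneVertexTriangulation.reachable {σ τ : Set G} (hσ : σ ∈ T.triangles)
    (hτ : τ ∈ T.triangles) : T.dual.Reachable σ τ := by
  have h := T.reflTransGen_adj hG hσ hτ
  induction h with
  | refl => exact SimpleGraph.Reachable.refl _
  | @tail b c h1 h2 ih =>
    refine (ih h2.1).trans ?_
    by_cases e : b = c
    · rw [e]
    · exact SimpleGraph.Adj.reachable ⟨h2, e⟩

/-- Up to translation the first triangle contains the vertex 1 and the second meets a fixed compact
set, which leaves finitely many pairs. -/
theorem OneVertexTriangulation.exists_walk_le_of_dist_le_one :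
    ∃ N : ℕ, ∀ σ ∈ T.triangles, ∀ τ ∈ T.triangles, ∀ z ∈ T.cell σ, ∀ w ∈ T.cell τ,
      dist z w ≤ 1 → ∃ p : T.dual.Walk σ τ, p.length ≤ N := by
  have h1 : IsCompact (⋃ τ ∈ {τ ∈ T.triangles | (1 : G) ∈ τ}, T.cell τ) :=
    T.finite_star.isCompact_biUnion fun τ hτ => T.isCompact_cell hτ.1
  have h2 := T.finite_meeting hG (h1.cthickening (r := 1))
  have h3 := T.finite_star.prod h2
  choose! p hp using fun (x : Set G × Set G) (hx : x.1 ∈ T.triangles ∧ x.2 ∈ T.triangles) =>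
    show ∃ n, ∃ p : T.dual.Walk x.1 x.2, p.length = n by
      obtain ⟨p⟩ := T.reachable hG hx.1 hx.2
      exact ⟨_, p, rfl⟩
  obtain ⟨N, hN⟩ := (h3.image p).bddAbove
  refine ⟨N, fun σ hσ τ hτ z hz w hw hzw => ?_⟩
  obtain ⟨a, b, c, -, -, -, e⟩ := T.eq_triple hσ
  have ha : a ∈ σ := by rw [e]; simp
  obtain ⟨σ', hσ', hσ'e⟩ := T.exists_translate hσ ha
  have hz' : a⁻¹ • z ∈ T.cell σ' := by
    have := T.smul_mem_cell hσ a⁻¹ hz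
    rw [hσ'e, image_image] at this
    simpa using this
  have hw' := T.smul_mem_cell hτ a⁻¹ hw
  have hτ' := T.translate_mem a⁻¹ τ hτ
  obtain ⟨q, hq⟩ := hp (σ', (fun h => a⁻¹ * h) '' τ) ⟨hσ'.1, hτ'⟩
  obtain ⟨q', hq'⟩ := T.exists_smul_walk q a
  refine ⟨q'.copy hσ'e.symm (by rw [image_image]; simp), ?_⟩
  rw [SimpleGraph.Walk.length_copy, hq', hq]
  refine hN ⟨_, ⟨hσ', hτ', a⁻¹ • w, hw', ?_⟩, rfl⟩
  refine Metric.mem_cthickening_of_dist_le _ (a⁻¹ • z) _ _ (mem_biUnion hσ' hz') ?_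
  rw [hG.dist_smul, dist_comm]
  exact hzw

/-- Go along the geodesic from z to w in steps of length 1 and concatenate the short walks. -/
theorem OneVertexTriangulation.exists_walk_le :
    ∃ N : ℕ, 0 < N ∧ ∀ σ ∈ T.triangles, ∀ τ ∈ T.triangles, ∀ z ∈ T.cell σ, ∀ w ∈ T.cell τ,
      ∃ p : T.dual.Walk σ τ, (p.length : ℝ) ≤ N * (dist z w + 2) := by
  obtain ⟨N, hN⟩ := T.exists_walk_le_of_dist_le_one hG
  have key : ∀ n : ℕ, ∀ σ ∈ T.triangles, ∀ τ ∈ T.triangles, ∀ z ∈ T.cell σ, ∀ w ∈ T.cell τ,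
      dist z w ≤ n + 1 → ∃ p : T.dual.Walk σ τ, p.length ≤ N * (n + 1) := by
    intro n
    induction n with
    | zero =>
      intro σ hσ τ hτ z hz w hw h
      simpa using hN σ hσ τ hτ z hz w hw (by simpa using h)
    | succ n ih =>
      intro σ hσ τ hτ z hz w hw h
      by_cases h1 : dist z w ≤ n + 1
      · obtain ⟨p, hp⟩ := ih σ hσ τ hτ z hz w hw h1
        exact ⟨p, hp.trans (by gcongr; omega)⟩
      obtain ⟨A, hA, hA'⟩ := exists_smul_eq_axis z w
      have hu1 : dist z (A⁻¹ • axis (dist z w - 1)) ≤ n + 1 := by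
        rw [← _root_.dist_smul A, hA, smul_inv_smul, ← axis_zero, isometry_axis.dist_eq,
          Real.dist_eq, zero_sub, abs_neg, abs_of_nonneg]
        · push_cast at h; linarith
        · push Not at h1; linarith [(Nat.cast_nonneg n : (0 : ℝ) ≤ n)]
      have hu2 : dist (A⁻¹ • axis (dist z w - 1)) w ≤ 1 := by
        rw [← _root_.dist_smul A, hA', smul_inv_smul, isometry_axis.dist_eq, Real.dist_eq]
        norm_num
      obtain ⟨ρ, hρ, hu⟩ := T.exists_mem_cell (A⁻¹ • axis (dist z w - 1))
      obtain ⟨p, hp⟩ := ih σ hσ ρ hρ z hz _ hu hu1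
      obtain ⟨q, hq⟩ := hN ρ hρ τ hτ _ hu w hw hu2
      refine ⟨p.append q, ?_⟩
      rw [SimpleGraph.Walk.length_append]
      linarith [mul_add N (n + 1) 1]
  refine ⟨N + 1, Nat.succ_pos _, fun σ hσ τ hτ z hz w hw => ?_⟩
  obtain ⟨p, hp⟩ := key ⌈dist z w⌉₊ σ hσ τ hτ z hz w hw ((Nat.le_ceil _).trans (by linarith))
  refine ⟨p, ?_⟩
  have h1 : (p.length : ℝ) ≤ N * (⌈dist z w⌉₊ + 1) := by exact_mod_cast hp
  have h2 := Nat.ceil_lt_add_one (dist_nonneg (x := z) (y := w))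
  have h3 : (0 : ℝ) ≤ N := Nat.cast_nonneg N
  have h4 := mul_le_mul_of_nonneg_left (show (⌈dist z w⌉₊ : ℝ) + 1 ≤ dist z w + 2 by linarith) h3
  push_cast
  have h5 := dist_nonneg (x := z) (y := w)
  nlinarith

/-! ### Piecewise linear curves -/

omit hG

/-- The data of a piecewise linear curve through the points with barycentric coordinates `Y k`;
it crosses the triangle `σ k` between `Y k` and `Y (k + 1)`. -/
structure OneVertexTriangulation.IsChain (σ : ℤ → Set G) (Y : ℤ → G → ℝ) : Prop where
  mem : ∀ k, σ k ∈ T.triangles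
  left : ∀ k, Y k ∈ simplex (σ k)
  right : ∀ k, Y (k + 1) ∈ simplex (σ k)
  full : ∀ k, ∀ g ∈ σ k, 0 < Y k g ∨ 0 < Y (k + 1) g
  notFull : ∀ k, ∀ τ ∈ T.triangles, ∃ g ∈ τ, Y k g = 0
  injective_tri : Function.Injective σ
  injective : Function.Injective Y
  far : ∀ k l (w : T.dual.Walk (σ k) (σ l)), |k - l| ≤ 2 * (w.length : ℤ) + 5

/-- The piecewise linear curve through the points with barycentric coordinates `Y k`. -/
noncomputable def OneVertexTriangulation.chainCurve (Y : ℤ → G → ℝ) (s : ℝ) : ℍ :=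
  T.toPlane ((1 - Int.fract s) • Y ⌊s⌋ + Int.fract s • Y (⌊s⌋ + 1))

variable {T} {σ : ℤ → Set G} {Y : ℤ → G → ℝ}

theorem OneVertexTriangulation.chainCurve_intCast (k : ℤ) :
    T.chainCurve Y k = T.toPlane (Y k) := by
  simp [OneVertexTriangulation.chainCurve]

theorem OneVertexTriangulation.chainCurve_of_mem_Icc {k : ℤ} {s : ℝ} (hs : s ∈ Icc (k : ℝ) (k + 1)) :
    T.chainCurve Y s = T.toPlane ((1 - (s - k)) • Y k + (s - k) • Y (k + 1)) := by
  rcases hs.2.eq_or_lt with h | h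
  · have : s = ((k + 1 : ℤ) : ℝ) := by rw [h]; push_cast; ring
    rw [this, OneVertexTriangulation.chainCurve_intCast]
    congr 1
    push_cast
    simp
  · have hk : ⌊s⌋ = k := Int.floor_eq_iff.2 ⟨hs.1, h⟩
    rw [OneVertexTriangulation.chainCurve, Int.fract, hk]

namespace OneVertexTriangulation.IsChain

variable (hY : T.IsChain σ Y)
include hY

theorem mem_simplex {k : ℤ} {r : ℝ} (hr : r ∈ Icc (0 : ℝ) 1) :
    (1 - r) • Y k + r • Y (k + 1) ∈ simplex (σ k) :=
  lineMap_mem_simplex (hY.left k) (hY.right k) hr.1 hr.2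

theorem chainCurve_mem_cell (s : ℝ) : T.chainCurve Y s ∈ T.cell (σ ⌊s⌋) :=
  ⟨_, hY.mem_simplex ⟨Int.fract_nonneg s, (Int.fract_lt_one s).le⟩, rfl⟩

omit hY in
theorem range_chainCurve : range (T.chainCurve Y) =
    ⋃ k, (fun r : ℝ => T.toPlane ((1 - r) • Y k + r • Y (k + 1))) '' Icc 0 1 := by
  ext z
  simp only [mem_range, mem_iUnion]
  constructor
  · rintro ⟨s, rfl⟩
    exact ⟨⌊s⌋, Int.fract s, ⟨Int.fract_nonneg s, (Int.fract_lt_one s).le⟩, rfl⟩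
  · rintro ⟨k, r, hr, rfl⟩
    refine ⟨k + r, ?_⟩
    rw [OneVertexTriangulation.chainCurve_of_mem_Icc (k := k) ⟨by linarith [hr.1], by linarith [hr.2]⟩,
      add_sub_cancel_left]

theorem continuous_chainCurve : Continuous (T.chainCurve Y) := by
  have hseg : ∀ k : ℤ, ContinuousOn (T.chainCurve Y) (Icc (k : ℝ) (k + 1)) := by
    intro k
    have h1 := (T.continuousOn_segment (hY.mem k) (hY.left k) (hY.right k)).comp
      (f := fun s : ℝ => s - k) (s := Icc (k : ℝ) (k + 1)) (by fun_prop)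
      (fun s hs => ⟨by linarith [hs.1], by linarith [hs.2]⟩)
    exact h1.congr fun s hs => OneVertexTriangulation.chainCurve_of_mem_Icc hs
  rw [continuous_iff_continuousAt]
  intro s
  have h2 := (hseg (⌊s⌋ - 1)).union_of_isClosed (hseg ⌊s⌋) isClosed_Icc isClosed_Icc
  refine h2.continuousAt (mem_of_superset (Ioo_mem_nhds (a := (⌊s⌋ : ℝ) - 1) (b := ⌊s⌋ + 1) ?_ ?_) ?_)
  · linarith [Int.floor_le s]
  · exact Int.lt_floor_add_one s
  · intro t ht
    push_cast
    rcases le_total t ⌊s⌋ with h | h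
    · exact Or.inl ⟨ht.1.le, by linarith⟩
    · exact Or.inr ⟨h, ht.2.le⟩

theorem pos_of_mem {k : ℤ} {r : ℝ} (hr : r ∈ Ioo (0 : ℝ) 1) {g : G} (hg : g ∈ σ k) :
    0 < ((1 - r) • Y k + r • Y (k + 1)) g := by
  have h1 := ((mem_simplex_iff (T.finite_triangle (hY.mem k))).1 (hY.left k)).1 g
  have h2 := ((mem_simplex_iff (T.finite_triangle (hY.mem k))).1 (hY.right k)).1 g
  have hr' : 0 < 1 - r := by linarith [hr.2]
  have h4 := mul_nonneg hr'.le h1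
  have h5 := mul_nonneg hr.1.le h2
  simp only [Pi.add_apply, Pi.smul_apply, smul_eq_mul]
  rcases hY.full k g hg with h | h
  · have := mul_pos hr' h
    linarith
  · have := mul_pos hr.1 h
    linarith

theorem bary_chainCurve (s : ℝ) : T.bary (T.chainCurve Y s) =
    (1 - Int.fract s) • Y ⌊s⌋ + Int.fract s • Y (⌊s⌋ + 1) :=
  T.bary_toPlane (hY.mem ⌊s⌋) (hY.mem_simplex ⟨Int.fract_nonneg s, (Int.fract_lt_one s).le⟩)

/-- Inside a segment all three coordinates of its triangle are positive, whereas a break point has a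
zero coordinate in every triangle. The barycentric coordinates thus recover the triangle, hence the
segment, and then the parameter. -/
theorem injective_chainCurve : Function.Injective (T.chainCurve Y) := by
  intro s t h
  have hb := congrArg T.bary h
  rw [hY.bary_chainCurve, hY.bary_chainCurve] at hb
  have hzero : ∀ s : ℝ, Int.fract s = 0 →
      (1 - Int.fract s) • Y ⌊s⌋ + Int.fract s • Y (⌊s⌋ + 1) = Y ⌊s⌋ := by
    intro s hs
    rw [hs]; simp
  have hpos : ∀ s : ℝ, Int.fract s ≠ 0 → ∀ g ∈ σ ⌊s⌋,
      0 < ((1 - Int.fract s) • Y ⌊s⌋ + Int.fract s • Y (⌊s⌋ + 1)) g := by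
    intro s hs g hg
    exact hY.pos_of_mem ⟨lt_of_le_of_ne (Int.fract_nonneg s) (Ne.symm hs), Int.fract_lt_one s⟩ hg
  by_cases hs : Int.fract s = 0 <;> by_cases ht : Int.fract t = 0
  · rw [hzero s hs, hzero t ht] at hb
    rw [← Int.floor_add_fract s, ← Int.floor_add_fract t, hs, ht, hY.injective hb]
  · rw [hzero s hs] at hb
    obtain ⟨g, hg, hg0⟩ := hY.notFull ⌊s⌋ _ (hY.mem ⌊t⌋)
    have := hpos t ht g hg
    rw [← hb, hg0] at this
    exact absurd this (lt_irrefl _)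
  · rw [hzero t ht] at hb
    obtain ⟨g, hg, hg0⟩ := hY.notFull ⌊t⌋ _ (hY.mem ⌊s⌋)
    have := hpos s hs g hg
    rw [hb, hg0] at this
    exact absurd this (lt_irrefl _)
  · have hfl : ⌊s⌋ = ⌊t⌋ := by
      apply hY.injective_tri
      obtain ⟨a, b, c, hab, hac, hbc, e⟩ := T.eq_triple (hY.mem ⌊s⌋)
      have hmem : ∀ g ∈ σ ⌊s⌋, g ∈ σ ⌊t⌋ := by
        intro g hg
        by_contra hg'
        have h1 := hpos s hs g hg
        rw [hb] at h1
        have h2 := (mem_simplex_iff (T.finite_triangle (hY.mem ⌊t⌋))).1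
          (hY.mem_simplex (k := ⌊t⌋) ⟨Int.fract_nonneg t, (Int.fract_lt_one t).le⟩)
        rw [h2.2.1 g hg'] at h1
        exact lt_irrefl _ h1
      have ha : a ∈ σ ⌊s⌋ := by rw [e]; simp
      have hb : b ∈ σ ⌊s⌋ := by rw [e]; simp
      have hc : c ∈ σ ⌊s⌋ := by rw [e]; simp
      exact T.eq_of_three_mem (hY.mem _) (hY.mem _) hab hac hbc ha hb hc (hmem a ha) (hmem b hb)
        (hmem c hc)
    have hfr : Int.fract s = Int.fract t := by
      rw [← hfl] at hb
      obtain ⟨g, hg⟩ : ∃ g, Y ⌊s⌋ g ≠ Y (⌊s⌋ + 1) g := by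
        by_contra! hno
        have := hY.injective (funext hno)
        omega
      have h1 := congrFun hb g
      simp only [Pi.add_apply, Pi.smul_apply, smul_eq_mul] at h1
      have h2 : (Int.fract s - Int.fract t) * (Y (⌊s⌋ + 1) g - Y ⌊s⌋ g) = 0 := by
        linear_combination h1
      rcases mul_eq_zero.1 h2 with h3 | h3
      · linarith
      · exact absurd (by linarith) hg
    rw [← Int.floor_add_fract s, ← Int.floor_add_fract t, hfr, hfl]

end OneVertexTriangulation.IsChain

include hG

variable (T) in
-- Each unit of the parameter moves by at most a cell diameter d. Conversely, points at small
-- distance lie in cells joined by a short walk, and `far` bounds the difference of their indices;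
-- this costs the slope 2N and the additive constants.
theorem OneVertexTriangulation.exists_isQuasigeodesic :
    ∃ K c : ℝ, 1 ≤ K ∧ 0 ≤ c ∧ ∀ σ Y, T.IsChain σ Y → IsQuasigeodesic K c (T.chainCurve Y) := by
  obtain ⟨d, hd0, hd⟩ := T.exists_diam hG
  obtain ⟨N, hN0, hN⟩ := T.exists_walk_le hG
  have hN1 : (1 : ℝ) ≤ N := by exact_mod_cast hN0
  refine ⟨d + 2 * N, 3 * d + 4 * N + 6, by linarith, by linarith, fun σ Y hY => ?_⟩
  have hcells : ∀ (n : ℕ) (k : ℤ), dist (T.toPlane (Y k)) (T.toPlane (Y (k + n))) ≤ d * n := by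
    intro n k
    induction n with
    | zero => simp
    | succ n ih =>
      have h1 := hd _ (hY.mem (k + n)) _ ⟨_, hY.left _, rfl⟩ _ ⟨_, hY.right _, rfl⟩
      have h2 := dist_triangle (T.toPlane (Y k)) (T.toPlane (Y (k + n))) (T.toPlane (Y (k + n + 1)))
      push_cast
      rw [← add_assoc]
      linarith
  have hint : ∀ k l : ℤ, dist (T.toPlane (Y k)) (T.toPlane (Y l)) ≤ d * |(k : ℝ) - l| := by
    intro k l
    rcases le_total k l with h | h
    · have := hcells (l - k).toNat k
      rw [show k + ((l - k).toNat : ℤ) = l by omega] at this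
      have e : (((l - k).toNat : ℕ) : ℝ) = |(k : ℝ) - l| := by
        rw [abs_sub_comm, abs_of_nonneg (sub_nonneg.2 (by exact_mod_cast h))]
        have : (((l - k).toNat : ℕ) : ℤ) = l - k := by omega
        exact_mod_cast this
      rwa [e] at this
    · have := hcells (k - l).toNat l
      rw [show l + ((k - l).toNat : ℤ) = k by omega, dist_comm] at this
      have e : (((k - l).toNat : ℕ) : ℝ) = |(k : ℝ) - l| := by
        rw [abs_of_nonneg (sub_nonneg.2 (by exact_mod_cast h))]
        have : (((k - l).toNat : ℕ) : ℤ) = k - l := by omega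
        exact_mod_cast this
      rwa [e] at this
  intro s t
  have hfl : |(⌊s⌋ : ℝ) - ⌊t⌋| ≤ |s - t| + 1 ∧ |s - t| ≤ |(⌊s⌋ : ℝ) - ⌊t⌋| + 1 := by
    have h1 := Int.floor_le s
    have h2 := Int.lt_floor_add_one s
    have h3 := Int.floor_le t
    have h4 := Int.lt_floor_add_one t
    constructor
    · rw [abs_le]
      have := neg_abs_le (s - t)
      have := le_abs_self (s - t)
      constructor <;> linarith
    · rw [abs_le]
      have := neg_abs_le ((⌊s⌋ : ℝ) - ⌊t⌋)
      have := le_abs_self ((⌊s⌋ : ℝ) - ⌊t⌋)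
      constructor <;> linarith
  constructor
  · obtain ⟨p, hp⟩ := hN _ (hY.mem ⌊s⌋) _ (hY.mem ⌊t⌋) _ (hY.chainCurve_mem_cell s) _
      (hY.chainCurve_mem_cell t)
    have h1 : |(⌊s⌋ : ℝ) - ⌊t⌋| ≤ 2 * p.length + 5 := by exact_mod_cast hY.far _ _ p
    have h2 : |s - t| ≤ 2 * N * (dist (T.chainCurve Y s) (T.chainCurve Y t) + 2) + 6 := by
      linarith [hfl.2]
    have h3 := dist_nonneg (x := T.chainCurve Y s) (y := T.chainCurve Y t)
    rw [sub_le_iff_le_add, inv_mul_le_iff₀ (by linarith)]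
    refine h2.trans ?_
    have h4 : 2 * (N : ℝ) ≤ d + 2 * N := by linarith
    have h5 := mul_le_mul_of_nonneg_right h4 (by linarith :
      0 ≤ dist (T.chainCurve Y s) (T.chainCurve Y t) + 2)
    have h6 : 0 ≤ (d + 2 * N - 1) * (3 * d + 4 * N + 6) := by
      apply mul_nonneg <;> linarith
    nlinarith
  · have h1 := hd _ (hY.mem ⌊s⌋) _ (hY.chainCurve_mem_cell s) _ ⟨_, hY.left _, rfl⟩
    have h2 := hd _ (hY.mem ⌊t⌋) _ ⟨_, hY.left _, rfl⟩ _ (hY.chainCurve_mem_cell t)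
    have h3 := dist_triangle4 (T.chainCurve Y s) (T.toPlane (Y ⌊s⌋)) (T.toPlane (Y ⌊t⌋))
      (T.chainCurve Y t)
    have h4 := hint ⌊s⌋ ⌊t⌋
    have h5 := mul_le_mul_of_nonneg_left hfl.1 hd0
    have h6 : 0 ≤ 2 * (N : ℝ) * |s - t| := by positivity
    nlinarith

variable (T) in
-- The endpoints are those of the discrete quasigeodesic of break points, from which the curve has
-- bounded distance.
theorem OneVertexTriangulation.exists_isGoodLine :
    ∃ K c : ℝ, 1 ≤ K ∧ 0 ≤ c ∧ ∀ σ Y, T.IsChain σ Y → IsGoodLine K c (T.chainCurve Y) ∧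
      IsDiscreteQG K c fun k => T.toPlane (Y k) := by
  obtain ⟨K, c, hK, hc, h⟩ := T.exists_isQuasigeodesic hG
  refine ⟨K, c, hK, hc, fun σ Y hY => ?_⟩
  have hq := h σ Y hY
  have hd : IsDiscreteQG K c fun k => T.toPlane (Y k) := by
    intro k l
    have := hq k l
    rwa [OneVertexTriangulation.chainCurve_intCast,
      OneVertexTriangulation.chainCurve_intCast] at this
  refine ⟨⟨hY.continuous_chainCurve, hY.injective_chainCurve, hq, ?_⟩, hd⟩
  obtain ⟨C, -, hC⟩ := exists_endpoint hK hc
  obtain ⟨q, hq1, -⟩ := hC _ hd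
  obtain ⟨p, hp1, -⟩ := hC _ hd.neg
  refine ⟨p, q, endpoints_ne hK hc hd hp1 hq1, ?_, ?_⟩
  · have h1 : Tendsto (fun t : ℝ => ⌊-t⌋₊) atBot atTop :=
      tendsto_nat_floor_atTop.comp tendsto_neg_atBot_atTop
    have h2 := hp1.comp h1
    have h3 : ∀ᶠ t : ℝ in atBot, dist (T.toPlane (Y (-(⌊-t⌋₊ : ℕ)))) (T.chainCurve Y t) ≤ K + c := by
      filter_upwards [eventually_le_atBot 0] with t ht
      rw [← OneVertexTriangulation.chainCurve_intCast]
      refine (hq _ _).2.trans ?_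
      have h4 := Nat.floor_le (show 0 ≤ -t by linarith)
      have h5 := Nat.lt_floor_add_one (-t)
      have : |(((-(⌊-t⌋₊ : ℕ) : ℤ)) : ℝ) - t| ≤ 1 := by
        push_cast
        rw [abs_le]
        constructor <;> linarith
      nlinarith
    -- The comparison path is set equal to the curve on the other half line, since the distance
    -- bound is required for all parameters.
    refine (tendsto_cayley_of_dist_le (z := fun t : ℝ => if t ≤ 0 then
      T.toPlane (Y (-(⌊-t⌋₊ : ℕ))) else T.chainCurve Y t) (L := K + c) ?_ ?_)
    · intro t
      split_ifs with ht
      · rw [← OneVertexTriangulation.chainCurve_intCast]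
        refine (hq _ _).2.trans ?_
        have h4 := Nat.floor_le (show 0 ≤ -t by linarith)
        have h5 := Nat.lt_floor_add_one (-t)
        have : |(((-(⌊-t⌋₊ : ℕ) : ℤ)) : ℝ) - t| ≤ 1 := by
          push_cast
          rw [abs_le]
          constructor <;> linarith
        nlinarith
      · rw [dist_self]; linarith
    · refine h2.congr' ?_
      filter_upwards [eventually_le_atBot 0] with t ht
      simp [ht]
  · have h1 : Tendsto (fun t : ℝ => ⌊t⌋₊) atTop atTop := tendsto_nat_floor_atTop
    have h2 := hq1.comp h1
    refine (tendsto_cayley_of_dist_le (z := fun t : ℝ => if 0 ≤ t then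
      T.toPlane (Y (⌊t⌋₊ : ℕ)) else T.chainCurve Y t) (L := K + c) ?_ ?_)
    · intro t
      split_ifs with ht
      · rw [← OneVertexTriangulation.chainCurve_intCast]
        refine (hq _ _).2.trans ?_
        have h4 := Nat.floor_le ht
        have h5 := Nat.lt_floor_add_one t
        have : |(((⌊t⌋₊ : ℕ) : ℤ) : ℝ) - t| ≤ 1 := by
          push_cast
          rw [abs_le]
          constructor <;> linarith
        nlinarith
      · rw [dist_self]; linarith
    · refine h2.congr' ?_
      filter_upwards [eventually_ge_atTop 0] with t ht
      simp [ht]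

end

/-! ### Chains along lines and pairs of prongs -/

/-- The point of the marked edge of a flag with parameter `r`. -/
noncomputable def edgePoint {G : Type*} (f : Flag G) (r : ℝ) : G → ℝ :=
  (1 - r) • vert f.lo + r • vert f.hi

theorem edgePoint_pos_iff {G : Type*} {f : Flag G} {r : ℝ} (hf : f.lo ≠ f.hi)
    (hr : r ∈ Ioo (0 : ℝ) 1) {g : G} : 0 < edgePoint f r g ↔ g = f.lo ∨ g = f.hi := by
  have h1 := hr.1
  have h2 := hr.2
  simp only [edgePoint, Pi.add_apply, Pi.smul_apply, smul_eq_mul]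
  by_cases hlo : g = f.lo
  · rw [hlo, vert_apply_self, vert_apply_ne hf]
    simp [h2]
  · by_cases hhi : g = f.hi
    · rw [hhi, vert_apply_self, vert_apply_ne hf.symm]
      simp [h1]
    · rw [vert_apply_ne hlo, vert_apply_ne hhi]
      simp [hlo, hhi]

theorem edgePoint_nonneg {G : Type*} {f : Flag G} {r : ℝ} (hr : r ∈ Ioo (0 : ℝ) 1) (g : G) :
    0 ≤ edgePoint f r g := by
  have h1 := hr.1
  have h2 := hr.2
  simp only [edgePoint, Pi.add_apply, Pi.smul_apply, smul_eq_mul, vert, indicator]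
  split_ifs <;> linarith

theorem edgePoint_mem_simplex {G : Type*} {f : Flag G} {r : ℝ} {τ : Set G} (h1 : f.lo ∈ τ)
    (h2 : f.hi ∈ τ) (hr : r ∈ Ioo (0 : ℝ) 1) : edgePoint f r ∈ simplex τ :=
  lineMap_mem_simplex (vert_mem_simplex h1) (vert_mem_simplex h2) hr.1.le hr.2.le

theorem edgePoint_edge_eq {G : Type*} {A : Set G} {f f' : Flag G} {r r' : ℝ}
    (hf : f.lo ∈ A ∧ f.hi ∉ A) (hf' : f'.lo ∈ A ∧ f'.hi ∉ A)
    (hr : r ∈ Ioo (0 : ℝ) 1) (hr' : r' ∈ Ioo (0 : ℝ) 1) (h : edgePoint f r = edgePoint f' r') :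
    f.lo = f'.lo ∧ f.hi = f'.hi := by
  have hne : f.lo ≠ f.hi := fun e => hf.2 (e ▸ hf.1)
  have hne' : f'.lo ≠ f'.hi := fun e => hf'.2 (e ▸ hf'.1)
  have h1 := (edgePoint_pos_iff hne hr (g := f.lo)).2 (Or.inl rfl)
  have h2 := (edgePoint_pos_iff hne hr (g := f.hi)).2 (Or.inr rfl)
  rw [h, edgePoint_pos_iff hne' hr'] at h1 h2
  constructor
  · exact h1.resolve_right fun e => hf'.2 (e ▸ hf.1)
  · exact h2.resolve_left fun e => hf.2 (e ▸ hf'.1)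

section

variable {G : Type*} [Group G] [MulAction G ℍ] {T : OneVertexTriangulation G}
  {A : Set G} {x y : ℤ → Flag G} {O : LeftOrder G} {v : G} {τ τ' : Set G} {r r' : ℕ → Flag G}

theorem OneVertexTriangulation.exists_edgePoint_eq_zero (hτ : τ ∈ T.triangles) {f : Flag G}
    (hf : f.lo ≠ f.hi) {r : ℝ} (hr : r ∈ Ioo (0 : ℝ) 1) : ∃ g ∈ τ, edgePoint f r g = 0 := by
  obtain ⟨a, b, c, hab, hac, hbc, rfl⟩ := T.eq_triple hτ
  by_contra! hno
  have h : ∀ g ∈ ({a, b, c} : Set G), g = f.lo ∨ g = f.hi := fun g hg =>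
    (edgePoint_pos_iff hf hr).1 (lt_of_le_of_ne (edgePoint_nonneg hr g) (hno g hg).symm)
  have ha := h a (by simp)
  have hb := h b (by simp)
  have hc := h c (by simp)
  grind

theorem OneVertexTriangulation.Step.full {f g : Flag G} (h : T.Step A f g) {r s : ℝ}
    (hr : r ∈ Ioo (0 : ℝ) 1) (hs : s ∈ Ioo (0 : ℝ) 1) {v : G} (hv : v ∈ f.tri) :
    0 < edgePoint f r v ∨ 0 < edgePoint g s v := by
  obtain ⟨hf, hg, h1, h2, h3, h4⟩ := h
  rw [edgePoint_pos_iff hf.ne hr, edgePoint_pos_iff hg.ne hs]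
  obtain ⟨c, hac, hbc, e⟩ := T.eq_triple_of_mem_mem hf.1 hf.2.1 hf.2.2.1 hf.ne
  have k1 := hf.2.2.2.1
  have k2 := hf.2.2.2.2
  have k3 := hg.2.2.2.1
  have k4 := hg.2.2.2.2
  rw [e] at hv h1 h2
  simp only [mem_insert_iff, mem_singleton_iff] at hv h1 h2
  grind

theorem OneVertexTriangulation.Step.rev_tri {f g : Flag G} (h : T.Step A f g) :
    (T.rev g).tri = f.tri := by
  obtain ⟨hf, hg, h1, h2, h3, -⟩ := h
  exact (congrArg Flag.tri
    (hg.eq_rev_of_ne (g := ⟨g.lo, g.hi, f.tri⟩) ⟨hf.1, h1, h2, hg.2.2.2⟩ rfl rfl h3.symm)).symm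

/-- The triangles along a prong. -/
def rayTri (τ : Set G) (r : ℕ → Flag G) : ℕ → Set G
  | 0 => τ
  | n + 1 => (r n).tri

/-- The points along a prong. -/
noncomputable def rayPoint (v : G) (r : ℕ → Flag G) (s : ℕ → ℝ) : ℕ → G → ℝ
  | 0 => vert v
  | n + 1 => edgePoint (r n) (s n)

/-- A bi-infinite sequence from two infinite sequences. -/
def glueTri (R R' : ℕ → Set G) : ℤ → Set G
  | Int.ofNat n => R' n
  | Int.negSucc n => R n

/-- A bi-infinite sequence from two infinite sequences with the same initial term. -/
def gluePoint (Z Z' : ℕ → G → ℝ) : ℤ → G → ℝ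
  | Int.ofNat n => Z' n
  | Int.negSucc n => Z (n + 1)

/-- The piecewise linear curve through the points with barycentric coordinates `Z n`. -/
noncomputable def OneVertexTriangulation.rayCurve (T : OneVertexTriangulation G) (Z : ℕ → G → ℝ)
    (s : ℝ) : ℍ :=
  T.toPlane ((1 - Int.fract s) • Z ⌊s⌋₊ + Int.fract s • Z (⌊s⌋₊ + 1))

theorem OneVertexTriangulation.rayCurve_of_mem_Icc {Z : ℕ → G → ℝ} {n : ℕ} {s : ℝ}
    (hs : s ∈ Icc (n : ℝ) (n + 1)) :
    T.rayCurve Z s = T.toPlane ((1 - (s - n)) • Z n + (s - n) • Z (n + 1)) := by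
  rcases hs.2.eq_or_lt with h | h
  · have e : s = ((n + 1 : ℕ) : ℝ) := by rw [h]; push_cast; ring
    rw [OneVertexTriangulation.rayCurve, e, Nat.floor_natCast, Int.fract_natCast]
    congr 1
    push_cast
    simp
  · have hn : ⌊s⌋₊ = n := (Nat.floor_eq_iff ((Nat.cast_nonneg n).trans hs.1)).2 ⟨hs.1, h⟩
    have hf : Int.fract s = s - n := by
      rw [Int.fract, show ⌊s⌋ = (n : ℤ) from Int.floor_eq_iff.2 ⟨by exact_mod_cast hs.1, by exact_mod_cast h⟩]
      simp
    rw [OneVertexTriangulation.rayCurve, hn, hf]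

theorem OneVertexTriangulation.chainCurve_gluePoint {Z Z' : ℕ → G → ℝ} (h0 : Z 0 = Z' 0) (t : ℝ) :
    T.chainCurve (gluePoint Z Z') t = if t ≤ 0 then T.rayCurve Z (-t) else T.rayCurve Z' t := by
  split_ifs with ht
  · have ht' : 0 ≤ -t := by linarith
    have h1 := Nat.floor_le ht'
    have h2 := (Nat.lt_floor_add_one (-t)).le
    set n := ⌊-t⌋₊ with hn
    rw [OneVertexTriangulation.rayCurve_of_mem_Icc (n := n) ⟨h1, h2⟩,
      OneVertexTriangulation.chainCurve_of_mem_Icc (k := Int.negSucc n)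
        ⟨by rw [Int.cast_negSucc]; push_cast; linarith, by rw [Int.cast_negSucc]; push_cast; linarith⟩]
    have e1 : gluePoint Z Z' (Int.negSucc n) = Z (n + 1) := rfl
    have e2 : gluePoint Z Z' (Int.negSucc n + 1) = Z n := by
      cases n with
      | zero => exact h0.symm
      | succ n => rfl
    rw [e1, e2, Int.cast_negSucc, add_comm]
    congr 2
    · congr 1; push_cast; ring
    · congr 1; push_cast; ring
  · push Not at ht
    have h1 := Nat.floor_le ht.le
    have h2 := (Nat.lt_floor_add_one t).le
    rw [OneVertexTriangulation.rayCurve_of_mem_Icc (n := ⌊t⌋₊) ⟨h1, h2⟩,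
      OneVertexTriangulation.chainCurve_of_mem_Icc (k := Int.ofNat ⌊t⌋₊) ⟨by simpa using h1, by simpa using h2⟩]
    rfl

theorem OneVertexTriangulation.image_rayCurve {Z : ℕ → G → ℝ} : T.rayCurve Z '' Ici 0 =
    ⋃ n, (fun r : ℝ => T.toPlane ((1 - r) • Z n + r • Z (n + 1))) '' Icc 0 1 := by
  ext z
  simp only [mem_iUnion]
  constructor
  · rintro ⟨s, hs, rfl⟩
    have h1 := Nat.floor_le (mem_Ici.1 hs)
    have h2 := (Nat.lt_floor_add_one s).le
    exact ⟨⌊s⌋₊, s - ⌊s⌋₊, ⟨by linarith, by linarith⟩,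
      (OneVertexTriangulation.rayCurve_of_mem_Icc ⟨h1, h2⟩).symm⟩
  · rintro ⟨n, r, hr, rfl⟩
    refine ⟨n + r, add_nonneg (Nat.cast_nonneg n) hr.1, ?_⟩
    rw [OneVertexTriangulation.rayCurve_of_mem_Icc (n := n) ⟨by linarith [hr.1], by linarith [hr.2]⟩,
      add_sub_cancel_left]

theorem OneVertexTriangulation.IsProng.mem_tri (h : T.IsProng O v τ r) : v ∈ τ := by
  obtain ⟨-, a, c, -, -, rfl⟩ := h.isMiddle
  simp

theorem OneVertexTriangulation.IsProng.isFlag (h : T.IsProng O v τ r) (n : ℕ) :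
    T.IsFlag {g | O.lt g v} (r n) := by
  obtain ⟨x, hx, hxr, -⟩ := h.exists_below
  rw [← hxr]
  exact hx.isFlag n

theorem OneVertexTriangulation.IsProng.step (h : T.IsProng O v τ r) (n : ℕ) :
    T.Step {g | O.lt g v} (r n) (r (n + 1)) := by
  obtain ⟨x, hx, hxr, -⟩ := h.exists_below
  have := hx n
  rw [hxr, show (n : ℤ) + 1 = (n + 1 : ℕ) by push_cast; ring, hxr] at this
  exact this

theorem OneVertexTriangulation.IsProng.exists_rayTri (h : T.IsProng O v τ r) :
    ∃ x, T.IsLine {g | O.lt g v} x ∧ (∀ n : ℕ, x n = r n) ∧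
      ∀ n : ℕ, rayTri τ r n = (x (n - 1)).tri := by
  obtain ⟨x, hx, hxr, h1⟩ := h.exists_below
  refine ⟨x, hx, hxr, fun n => ?_⟩
  cases n with
  | zero => exact h1.symm
  | succ n => simp [rayTri, hxr]

theorem OneVertexTriangulation.IsProng.rayTri_mem (h : T.IsProng O v τ r) (n : ℕ) :
    rayTri τ r n ∈ T.triangles := by
  obtain ⟨x, hx, -, h1⟩ := h.exists_rayTri
  rw [h1]
  exact (hx.isFlag _).1

theorem OneVertexTriangulation.IsProng.adj (h : T.IsProng O v τ r) (n : ℕ) :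
    T.dual.Adj (rayTri τ r n) (rayTri τ r (n + 1)) := by
  obtain ⟨x, hx, -, h1⟩ := h.exists_rayTri
  rw [h1, h1]
  have := (hx (n - 1)).adj
  rwa [show (n : ℤ) - 1 + 1 = ((n + 1 : ℕ) : ℤ) - 1 by push_cast; ring] at this

variable {s s' : ℕ → ℝ}

theorem OneVertexTriangulation.IsProng.rayPoint_mem (h : T.IsProng O v τ r)
    (hs : ∀ n, s n ∈ Ioo (0 : ℝ) 1) (n : ℕ) : rayPoint v r s n ∈ simplex (rayTri τ r n) := by
  cases n with
  | zero => exact vert_mem_simplex h.mem_tri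
  | succ n => exact edgePoint_mem_simplex (h.isFlag n).2.1 (h.isFlag n).2.2.1 (hs n)

theorem OneVertexTriangulation.IsProng.rayPoint_succ_mem (h : T.IsProng O v τ r)
    (hs : ∀ n, s n ∈ Ioo (0 : ℝ) 1) (n : ℕ) : rayPoint v r s (n + 1) ∈ simplex (rayTri τ r n) := by
  cases n with
  | zero => exact edgePoint_mem_simplex h.lo_mem h.hi_mem (hs 0)
  | succ n => exact edgePoint_mem_simplex (h.step n).2.2.1 (h.step n).2.2.2.1 (hs _)

theorem OneVertexTriangulation.IsProng.rayPoint_full (h : T.IsProng O v τ r)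
    (hs : ∀ n, s n ∈ Ioo (0 : ℝ) 1) (n : ℕ) {g : G} (hg : g ∈ rayTri τ r n) :
    0 < rayPoint v r s n g ∨ 0 < rayPoint v r s (n + 1) g := by
  cases n with
  | zero =>
    have h1 := h.lo_mem
    have h2 := h.hi_mem
    have h3 := O.ne h.lo_lt
    have h4 := O.ne h.lt_hi
    have h5 := (h.isFlag 0).ne
    change 0 < vert v g ∨ 0 < edgePoint (r 0) (s 0) g
    rw [edgePoint_pos_iff h5 (hs 0)]
    change g ∈ τ at hg
    obtain ⟨b, c, -, -, -, rfl⟩ := T.eq_triple_of_mem h.isMiddle.1 h.mem_tri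
    by_cases e : g = v
    · left; rw [e, vert_apply_self]; exact one_pos
    · right
      simp only [mem_insert_iff, mem_singleton_iff] at hg h1 h2
      grind
  | succ n => exact (h.step n).full (hs _) (hs _) hg

theorem OneVertexTriangulation.IsProng.rayPoint_notFull (h : T.IsProng O v τ r)
    (hs : ∀ n, s n ∈ Ioo (0 : ℝ) 1) (n : ℕ) {σ : Set G} (hσ : σ ∈ T.triangles) :
    ∃ g ∈ σ, rayPoint v r s n g = 0 := by
  cases n with
  | zero =>
    obtain ⟨a, b, c, hab, -, -, rfl⟩ := T.eq_triple hσ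
    by_cases e : a = v
    · exact ⟨b, by simp, vert_apply_ne fun e' => hab (e.trans e'.symm)⟩
    · exact ⟨a, by simp, vert_apply_ne e⟩
  | succ n => exact T.exists_edgePoint_eq_zero hσ (h.isFlag n).ne (hs n)

variable (hG : IsSurfaceGroup G)
include hG

theorem OneVertexTriangulation.IsProng.rayTri_ne (h : T.IsProng O v τ r)
    (h' : T.IsProng O v τ' r') (hne : τ ≠ τ') (n m : ℕ) : rayTri τ r n ≠ rayTri τ' r' m := by
  intro e
  cases n with
  | zero =>
    cases m with
    | zero => exact hne e
    | succ m => exact h'.notMem m (e.subset h.mem_tri)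
  | succ n =>
    cases m with
    | zero => exact h.notMem n (e.symm.subset h'.mem_tri)
    | succ m => exact h.tri_ne hG h' hne n m e

theorem OneVertexTriangulation.IsProng.rayTri_injective (h : T.IsProng O v τ r) :
    Function.Injective (rayTri τ r) := by
  obtain ⟨x, hx, -, h1⟩ := h.exists_rayTri
  intro n m e
  rw [h1, h1] at e
  have := hx.tri_injective hG (O.isCut_below v) e
  omega

theorem OneVertexTriangulation.IsProng.rayPoint_injective (h : T.IsProng O v τ r)
    (hs : ∀ n, s n ∈ Ioo (0 : ℝ) 1) : Function.Injective (rayPoint v r s) := by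
  have h0 : ∀ n, vert v ≠ edgePoint (r n) (s n) := by
    intro n e
    have h1 : 0 < edgePoint (r n) (s n) v := by rw [← e, vert_apply_self]; exact one_pos
    rw [edgePoint_pos_iff (h.isFlag n).ne (hs n)] at h1
    rcases h1 with h1 | h1
    · exact h.notMem n (h1 ▸ (h.isFlag n).2.1)
    · exact h.notMem n (h1 ▸ (h.isFlag n).2.2.1)
  intro n m e
  cases n with
  | zero =>
    cases m with
    | zero => rfl
    | succ m => exact absurd e (h0 m)
  | succ n =>
    cases m with
    | zero => exact absurd e.symm (h0 n)
    | succ m =>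
      obtain ⟨k1, k2⟩ := edgePoint_edge_eq (h.isFlag n).2.2.2 (h.isFlag m).2.2.2 (hs n) (hs m) e
      obtain ⟨x, hx, hxr, -⟩ := h.exists_rayTri
      rw [← hxr, ← hxr] at k1 k2
      have := hx.injective hG (O.isCut_below v) (hx.eq_of_edge_eq hG k1 k2)
      omega

/-- Two prongs through the same edge, with no triangle in common, would run through it in opposite
directions; then the triangle of one behind that edge is a triangle of the other. -/
theorem OneVertexTriangulation.IsProng.rayPoint_ne (h : T.IsProng O v τ r)
    (h' : T.IsProng O v τ' r') (hne : τ ≠ τ') (hs : ∀ n, s n ∈ Ioo (0 : ℝ) 1)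
    (hs' : ∀ n, s' n ∈ Ioo (0 : ℝ) 1) (n m : ℕ) : rayPoint v r s (n + 1) ≠ rayPoint v r' s' m := by
  intro e
  cases m with
  | zero =>
    have := h.rayPoint_injective hG hs (a₁ := n + 1) (a₂ := 0) e
    omega
  | succ m =>
    obtain ⟨k1, k2⟩ := edgePoint_edge_eq (h.isFlag n).2.2.2 (h'.isFlag m).2.2.2 (hs n) (hs' m) e
    have hrev := (h'.isFlag m).eq_rev_of_ne (h.isFlag n) k1 k2 (h.tri_ne hG h' hne n m)
    obtain ⟨x, hx, hxr, hxt⟩ := h'.exists_rayTri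
    have h1 := (hx (m - 1)).rev_tri
    rw [sub_add_cancel, hxr, ← hxt, ← hrev] at h1
    exact h.rayTri_ne hG h' hne (n + 1) m h1

/-- Adapts `lt_length` to the numbering that counts the middle triangle as the term 0. A walk that
ends in the middle triangle of the second prong is first prolonged by one step, whence the 1. -/
theorem OneVertexTriangulation.IsProng.le_length (h : T.IsProng O v τ r)
    (h' : T.IsProng O v τ' r') (hne : τ ≠ τ') (n m : ℕ)
    (w : T.dual.Walk (rayTri τ r n) (rayTri τ' r' m)) {L : ℕ} (hL : w.length = L) :
    n ≤ L + 1 := by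
  cases n with
  | zero => omega
  | succ n =>
    cases m with
    | zero =>
      have := h.lt_length hG h' hne n 0 (w.concat (h'.adj 0))
      have e := SimpleGraph.Walk.length_concat w (h'.adj 0)
      have : n < (w.concat (h'.adj 0)).length := this
      omega
    | succ m =>
      have := h.lt_length hG h' hne n m w
      have : n < L := by rw [← hL]; exact this
      omega

/-- Two different prongs at a vertex form a chain. -/
theorem OneVertexTriangulation.IsProng.isChain (h : T.IsProng O v τ r)
    (h' : T.IsProng O v τ' r') (hne : τ ≠ τ') (hs : ∀ n, s n ∈ Ioo (0 : ℝ) 1)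
    (hs' : ∀ n, s' n ∈ Ioo (0 : ℝ) 1) :
    T.IsChain (glueTri (rayTri τ r) (rayTri τ' r'))
      (gluePoint (rayPoint v r s) (rayPoint v r' s')) := by
  -- `Int.negSucc n + 1` is the index -n. For n = 0 it belongs to the second prong, but both prongs
  -- have the vertex v there.
  have hsucc : ∀ n, gluePoint (rayPoint v r s) (rayPoint v r' s') (Int.negSucc n + 1) =
      rayPoint v r s n := by
    intro n
    cases n <;> rfl
  have far : ∀ {τ : Set G} {r : ℕ → Flag G}, T.IsProng O v τ r → ∀ (n m : ℕ)
      (w : T.dual.Walk (rayTri τ r n) (rayTri τ r m)) (L : ℕ), w.length = L →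
      |(n : ℤ) - m| ≤ L := by
    intro τ r h n m w L hL
    obtain ⟨x, hx, -, hxt⟩ := h.exists_rayTri
    have := hx.abs_sub_le hG (O.isCut_below v) L (n - 1) (m - 1)
      (w.copy (hxt n) (hxt m)) ((SimpleGraph.Walk.length_copy ..).trans hL)
    rw [abs_sub_comm]
    simpa using this
  constructor
  · rintro (n | n)
    · exact h'.rayTri_mem n
    · exact h.rayTri_mem n
  · rintro (n | n)
    · exact h'.rayPoint_mem hs' n
    · exact h.rayPoint_succ_mem hs n
  · rintro (n | n)
    · exact h'.rayPoint_succ_mem hs' n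
    · rw [hsucc]; exact h.rayPoint_mem hs n
  · rintro (n | n) g hg
    · exact h'.rayPoint_full hs' n hg
    · rw [hsucc]; exact (h.rayPoint_full hs n hg).symm
  · rintro (n | n) σ hσ
    · exact h'.rayPoint_notFull hs' n hσ
    · exact h.rayPoint_notFull hs (n + 1) hσ
  · rintro (n | n) (m | m) e
    · rw [h'.rayTri_injective hG e]
    · exact absurd e.symm (h.rayTri_ne hG h' hne m n)
    · exact absurd e (h.rayTri_ne hG h' hne n m)
    · rw [h.rayTri_injective hG e]
  · rintro (n | n) (m | m) e
    · rw [h'.rayPoint_injective hG hs' e]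
    · exact absurd e.symm (h.rayPoint_ne hG h' hne hs hs' m n)
    · exact absurd e (h.rayPoint_ne hG h' hne hs hs' n m)
    · have := h.rayPoint_injective hG hs (a₁ := n + 1) (a₂ := m + 1) e
      rw [show n = m by omega]
  · intro k l w
    obtain ⟨L, hL⟩ : ∃ L, w.length = L := ⟨_, rfl⟩
    have hL' := (SimpleGraph.Walk.length_reverse w).trans hL
    rw [hL]
    -- On the same prong the index difference is at most L. On different prongs each of the two
    -- positions is at most L + 1, which is the source of the factor 2 in `far`.
    rcases k with n | n <;> rcases l with m | m <;>
      simp only [Int.ofNat_eq_natCast, Int.negSucc_eq]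
    · have := far h' n m w L hL
      omega
    · have h1 := h'.le_length hG h hne.symm n m w hL
      have h2 := h.le_length hG h' hne m n w.reverse hL'
      rw [abs_le]
      omega
    · have h1 := h.le_length hG h' hne n m w hL
      have h2 := h'.le_length hG h hne.symm m n w.reverse hL'
      rw [abs_le]
      omega
    · have := far h n m w L hL
      rw [abs_le] at this ⊢
      omega

/-- A line forms a chain. -/
theorem OneVertexTriangulation.IsLine.isChain (hA : ∀ a ∈ A, ∀ b ∉ A, O.lt a b)
    (hx : T.IsLine A x) {s : ℤ → ℝ} (hs : ∀ k, s k ∈ Ioo (0 : ℝ) 1) :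
    T.IsChain (fun k => (x k).tri) fun k => edgePoint (x k) (s k) where
  mem k := (hx.isFlag k).1
  left k := edgePoint_mem_simplex (hx.isFlag k).2.1 (hx.isFlag k).2.2.1 (hs k)
  right k := edgePoint_mem_simplex (hx k).2.2.1 (hx k).2.2.2.1 (hs _)
  full k _ hg := (hx k).full (hs _) (hs _) hg
  notFull k _ hτ := T.exists_edgePoint_eq_zero hτ (hx.isFlag k).ne (hs k)
  injective_tri := hx.tri_injective hG hA
  injective k l e := by
    obtain ⟨k1, k2⟩ := edgePoint_edge_eq (hx.isFlag k).2.2.2 (hx.isFlag l).2.2.2 (hs k) (hs l) e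
    exact hx.injective hG hA (hx.eq_of_edge_eq hG k1 k2)
  far k l w := by
    have := hx.abs_sub_le hG hA w.length k l w rfl
    rw [abs_sub_comm] at this
    omega

end

/-! ### Level sets in triangles -/

namespace AllowedRep

variable {G : Type*} [Group G] (ρ : AllowedRep G)

theorem hom_mul_apply (g h : G) (x : ℝ) : ρ.hom (g * h) x = ρ.hom g (ρ.hom h x) := by
  rw [map_mul]; rfl

theorem hom_one_apply (x : ℝ) : ρ.hom 1 x = x := by
  rw [map_one]; rfl

theorem injective_orbit' {a b : G} (h : ρ.hom a 0 = ρ.hom b 0) : a = b := ρ.injective_orbit h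

/-- The left order that is defined by the orbit of `0`. -/
def order : LeftOrder G where
  lt a b := ρ.hom a 0 < ρ.hom b 0
  irrefl _ := lt_irrefl _
  trans _ _ _ := lt_trans
  total a b := (lt_trichotomy _ _).imp_right fun h => h.imp_left ρ.injective_orbit'
  left_inv a b c h := by
    rw [hom_mul_apply, hom_mul_apply]
    exact (ρ.hom c).strictMono h

theorem order_lt {a b : G} : ρ.order.lt a b ↔ ρ.hom a 0 < ρ.hom b 0 := Iff.rfl

/-- The parameter at which the height function takes the value `t` on the edge of a flag. -/
noncomputable def edgeParam (t : ℝ) (f : Flag G) : ℝ :=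
  1 - (ρ.hom f.hi).symm t / ρ.hom (f.hi⁻¹ * f.lo) 0

/-- The point of the edge of a flag at which the height function takes the value `t`. -/
noncomputable def levelPoint (t : ℝ) (f : Flag G) : G → ℝ := edgePoint f (ρ.edgeParam t f)

variable {ρ}

theorem hom_inv_mul_neg {h g : G} (hlt : ρ.hom h 0 < ρ.hom g 0) : ρ.hom (g⁻¹ * h) 0 < 0 := by
  have := ρ.order.left_inv h g g⁻¹ hlt
  rw [order_lt, inv_mul_cancel, hom_one_apply] at this
  exact this

theorem edgeHeight_eq_iff {t r : ℝ} {f : Flag G} (hlt : ρ.hom f.lo 0 < ρ.hom f.hi 0) :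
    edgeHeight ρ f.lo f.hi r = t ↔ r = ρ.edgeParam t f := by
  have hN := hom_inv_mul_neg hlt
  have hN' := hN.ne
  have h1 : edgeHeight ρ f.lo f.hi r = t ↔
      (ρ.hom f.hi).symm t = (1 - r) * ρ.hom (f.hi⁻¹ * f.lo) 0 := by
    rw [OrderIso.symm_apply_eq, edgeHeight, mul_zero, add_zero, eq_comm]
  rw [h1, edgeParam, ← div_eq_iff hN']
  constructor <;> intro h <;> linarith

theorem edgeParam_lo {f : Flag G} (hlt : ρ.hom f.lo 0 < ρ.hom f.hi 0) :
    ρ.edgeParam (ρ.hom f.lo 0) f = 0 := by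
  rw [eq_comm, ← edgeHeight_eq_iff hlt, edgeHeight, sub_zero, one_mul, zero_mul, add_zero,
    ← hom_mul_apply, mul_inv_cancel_left]

theorem edgeParam_hi {f : Flag G} (hlt : ρ.hom f.lo 0 < ρ.hom f.hi 0) :
    ρ.edgeParam (ρ.hom f.hi 0) f = 1 := by
  rw [eq_comm, ← edgeHeight_eq_iff hlt, edgeHeight, sub_self, zero_mul, one_mul, add_zero]

theorem edgeParam_strictMono {f : Flag G} (hlt : ρ.hom f.lo 0 < ρ.hom f.hi 0) :
    StrictMono fun t => ρ.edgeParam t f := by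
  intro s t hst
  have h1 := (ρ.hom f.hi).symm.strictMono hst
  have h2 := div_lt_div_of_neg_of_lt (hom_inv_mul_neg hlt) h1
  simp only [edgeParam]
  linarith

theorem edgeParam_mem_Ioo {t : ℝ} {f : Flag G} (h1 : ρ.hom f.lo 0 < t) (h2 : t < ρ.hom f.hi 0) :
    ρ.edgeParam t f ∈ Ioo (0 : ℝ) 1 := by
  have hlt := h1.trans h2
  refine ⟨?_, ?_⟩
  · rw [← edgeParam_lo hlt]; exact edgeParam_strictMono hlt h1
  · rw [← edgeParam_hi hlt]; exact edgeParam_strictMono hlt h2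

end AllowedRep

section

variable {G : Type*} [Group G] [MulAction G ℍ] {T : OneVertexTriangulation G}
  {ρ : AllowedRep G} {t : ℝ} {τ τ' : Set G} {f g : Flag G}

/-- The height is strictly monotone along an edge, so the level meets the edge in an endpoint or in
one interior point. The two cases behave differently when passing to neighbouring triangles. -/
theorem OneVertexTriangulation.mem_boundaryLevel (hτ : τ ∈ T.triangles) {x : G → ℝ} :
    x ∈ boundaryLevel ρ t τ ↔ (∃ v ∈ τ, ρ.hom v 0 = t ∧ x = vert v) ∨
      ∃ f : Flag G, f.tri = τ ∧ f.lo ∈ τ ∧ f.hi ∈ τ ∧ ρ.hom f.lo 0 < t ∧ t < ρ.hom f.hi 0 ∧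
        x = ρ.levelPoint t f := by
  constructor
  · rintro ⟨h, hh, g, hg, hlt, r, hr, hrt, rfl⟩
    have hrp := (AllowedRep.edgeHeight_eq_iff (f := ⟨h, g, τ⟩) hlt).1 hrt
    have mono := AllowedRep.edgeParam_strictMono (f := ⟨h, g, τ⟩) hlt
    have hlo := AllowedRep.edgeParam_lo (f := ⟨h, g, τ⟩) hlt
    have hhi := AllowedRep.edgeParam_hi (f := ⟨h, g, τ⟩) hlt
    rcases hr.1.eq_or_lt with e | h0
    · refine Or.inl ⟨h, hh, mono.injective ?_, by simp [← e]⟩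
      rw [hlo, ← hrp, e]
    rcases hr.2.eq_or_lt with e | h1
    · refine Or.inl ⟨g, hg, mono.injective ?_, by simp [e]⟩
      rw [hhi, ← hrp, e]
    · refine Or.inr ⟨⟨h, g, τ⟩, rfl, hh, hg, ?_, ?_, ?_⟩
      · rw [← mono.lt_iff_lt]; rw [hlo, ← hrp]; exact h0
      · rw [← mono.lt_iff_lt]; rw [hhi, ← hrp]; exact h1
      · rw [AllowedRep.levelPoint, ← hrp]; rfl
  · rintro (⟨v, hv, rfl, rfl⟩ | ⟨f, -, hlo, hhi, h1, h2, rfl⟩)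
    · obtain ⟨b, c, hvb, -, -, rfl⟩ := T.eq_triple_of_mem hτ hv
      rcases lt_trichotomy (ρ.hom v 0) (ρ.hom b 0) with h | h | h
      · exact ⟨v, hv, b, by simp, h, 0, by simp,
          (AllowedRep.edgeHeight_eq_iff (f := ⟨v, b, ∅⟩) h).2 (AllowedRep.edgeParam_lo h).symm, by simp⟩
      · exact absurd (ρ.injective_orbit' h) hvb
      · exact ⟨b, by simp, v, hv, h, 1, by simp,
          (AllowedRep.edgeHeight_eq_iff (f := ⟨b, v, ∅⟩) h).2 (AllowedRep.edgeParam_hi h).symm, by simp⟩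
    · have := AllowedRep.edgeParam_mem_Ioo h1 h2
      exact ⟨f.lo, hlo, f.hi, hhi, h1.trans h2, ρ.edgeParam t f, ⟨this.1.le, this.2.le⟩,
        (AllowedRep.edgeHeight_eq_iff (h1.trans h2)).2 rfl, rfl⟩

theorem OneVertexTriangulation.Step.boundaryLevel_eq (h : T.Step {g | ρ.hom g 0 < t} f g)
    (ht : ∀ v ∈ f.tri, ρ.hom v 0 ≠ t) :
    boundaryLevel ρ t f.tri = {ρ.levelPoint t f, ρ.levelPoint t g} := by
  ext x
  rw [OneVertexTriangulation.mem_boundaryLevel h.1.1]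
  have up : ∀ v ∈ f.tri, v ∉ {g | ρ.hom g 0 < t} → t < ρ.hom v 0 := fun v hv hv' =>
    lt_of_le_of_ne (not_lt.1 hv') (ht v hv).symm
  constructor
  · rintro (⟨v, hv, hv', -⟩ | ⟨e, he, hlo, hhi, h1, h2, rfl⟩)
    · exact absurd hv' (ht v hv)
    · rcases h.eq_or_eq_rev (g := e) ⟨he ▸ h.1.1, he ▸ hlo, he ▸ hhi, h1, not_lt.2 h2.le⟩ he.symm
        with rfl | rfl
      · exact Or.inl rfl
      · exact Or.inr rfl
  · rintro (rfl | rfl)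
    · exact Or.inr ⟨f, rfl, h.1.2.1, h.1.2.2.1, h.1.2.2.2.1, up _ h.1.2.2.1 h.1.2.2.2.2, rfl⟩
    · exact Or.inr ⟨⟨g.lo, g.hi, f.tri⟩, rfl, h.2.2.1, h.2.2.2.1, h.2.1.2.2.2.1,
        up _ h.2.2.2.1 h.2.1.2.2.2.2, rfl⟩

theorem OneVertexTriangulation.boundaryLevel_middle {v : G} (hτ : τ ∈ T.triangles) (hv : v ∈ τ)
    (hlo : f.lo ∈ τ) (hhi : f.hi ∈ τ) (h1 : ρ.hom f.lo 0 < ρ.hom v 0)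
    (h2 : ρ.hom v 0 < ρ.hom f.hi 0) :
    boundaryLevel ρ (ρ.hom v 0) τ = {vert v, ρ.levelPoint (ρ.hom v 0) f} := by
  ext x
  rw [OneVertexTriangulation.mem_boundaryLevel hτ]
  constructor
  · rintro (⟨w, hw, hwv, rfl⟩ | ⟨e, -, k1, k2, k3, k4, rfl⟩)
    · rw [ρ.injective_orbit' hwv]; exact Or.inl rfl
    · right
      have : e.lo = f.lo ∧ e.hi = f.hi := by
        obtain ⟨b, c, -, -, -, rfl⟩ := T.eq_triple_of_mem hτ hv
        simp only [mem_insert_iff, mem_singleton_iff] at hlo hhi k1 k2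
        have a1 : e.lo ≠ v := fun e' => by rw [e'] at k3; exact lt_irrefl _ k3
        have a2 : e.hi ≠ v := fun e' => by rw [e'] at k4; exact lt_irrefl _ k4
        have a3 : f.lo ≠ v := fun e' => by rw [e'] at h1; exact lt_irrefl _ h1
        have a4 : f.hi ≠ v := fun e' => by rw [e'] at h2; exact lt_irrefl _ h2
        have a5 : f.lo ≠ f.hi := fun e' => by rw [e'] at h1; exact lt_asymm h1 h2
        have a6 : e.lo ≠ f.hi := fun e' => by rw [e'] at k3; exact lt_asymm k3 h2
        have a7 : e.hi ≠ f.lo := fun e' => by rw [e'] at k4; exact lt_asymm k4 h1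
        grind
      rw [mem_singleton_iff]
      simp only [AllowedRep.levelPoint, AllowedRep.edgeParam, edgePoint, this.1, this.2]
  · rintro (rfl | rfl)
    · exact Or.inl ⟨v, hv, rfl, rfl⟩
    · exact Or.inr ⟨⟨f.lo, f.hi, τ⟩, rfl, hlo, hhi, h1, h2, rfl⟩

variable (hG : IsSurfaceGroup G)
include hG

/-- In a triangle, a level set is empty, a point, or a segment whose interior lies in the interior
of the triangle. -/
theorem OneVertexTriangulation.exists_boundaryLevel_eq (hτ : τ ∈ T.triangles)
    (hne : (boundaryLevel ρ t τ).Nonempty) :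
    ∃ p q, boundaryLevel ρ t τ = {p, q} ∧ (p = q ∨ ∀ g ∈ τ, 0 < p g ∨ 0 < q g) := by
  by_cases hv : ∃ v ∈ τ, ρ.hom v 0 = t
  · obtain ⟨v, hv, rfl⟩ := hv
    by_cases hf : ∃ f : Flag G, f.lo ∈ τ ∧ f.hi ∈ τ ∧ ρ.hom f.lo 0 < ρ.hom v 0 ∧
        ρ.hom v 0 < ρ.hom f.hi 0
    · obtain ⟨f, hlo, hhi, h1, h2⟩ := hf
      refine ⟨_, _, T.boundaryLevel_middle hτ hv hlo hhi h1 h2, Or.inr fun g hg => ?_⟩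
      have hne : f.lo ≠ f.hi := fun e => by rw [e] at h1; exact lt_asymm h1 h2
      rw [AllowedRep.levelPoint, edgePoint_pos_iff hne (AllowedRep.edgeParam_mem_Ioo h1 h2)]
      by_cases e : g = v
      · left; rw [e, vert_apply_self]; exact one_pos
      · right
        have a3 : f.lo ≠ v := fun e' => by rw [e'] at h1; exact lt_irrefl _ h1
        have a4 : f.hi ≠ v := fun e' => by rw [e'] at h2; exact lt_irrefl _ h2
        obtain ⟨b, c, -, -, -, rfl⟩ := T.eq_triple_of_mem hτ hv
        simp only [mem_insert_iff, mem_singleton_iff] at hlo hhi hg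
        grind
    · refine ⟨vert v, vert v, ?_, Or.inl rfl⟩
      ext x
      rw [T.mem_boundaryLevel hτ]
      constructor
      · rintro (⟨w, hw, hwv, rfl⟩ | ⟨e, -, k1, k2, k3, k4, rfl⟩)
        · rw [ρ.injective_orbit' hwv]; exact Or.inl rfl
        · exact absurd ⟨e, k1, k2, k3, k4⟩ hf
      · rintro (rfl | rfl)
        · exact Or.inl ⟨v, hv, rfl, rfl⟩
        · exact Or.inl ⟨v, hv, rfl, rfl⟩
  · push Not at hv
    obtain ⟨x, hx⟩ := hne
    rw [T.mem_boundaryLevel hτ] at hx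
    rcases hx with ⟨v, hv1, hv2, -⟩ | ⟨f, rfl, h1, h2, h3, h4, -⟩
    · exact absurd hv2 (hv v hv1)
    · obtain ⟨g, hs⟩ := OneVertexTriangulation.IsFlag.exists_step (A := {g | ρ.hom g 0 < t}) hG
        (f := f) ⟨hτ, h1, h2, h3, not_lt.2 h4.le⟩
      refine ⟨_, _, hs.boundaryLevel_eq hv, Or.inr fun v hv' => ?_⟩
      refine hs.full (AllowedRep.edgeParam_mem_Ioo h3 h4) (AllowedRep.edgeParam_mem_Ioo hs.2.1.2.2.2.1 ?_) hv'
      exact lt_of_le_of_ne (not_lt.1 hs.2.1.2.2.2.2) (hv _ hs.2.2.2.1).symm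

/-- A nondegenerate level segment runs through the interior of the triangle, so a point of it with a
zero coordinate is one of its ends. -/
theorem OneVertexTriangulation.mem_boundaryLevel_of_eq_zero (hτ : τ ∈ T.triangles) {x : G → ℝ}
    (hx : x ∈ convexHull ℝ (boundaryLevel ρ t τ)) (h0 : ∃ g ∈ τ, x g = 0) :
    x ∈ boundaryLevel ρ t τ := by
  have hne : (boundaryLevel ρ t τ).Nonempty := by
    rw [nonempty_iff_ne_empty]
    intro e
    rw [e, convexHull_empty] at hx
    exact hx
  obtain ⟨p, q, e, h⟩ := T.exists_boundaryLevel_eq hG hτ hne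
  have hnn : ∀ y ∈ boundaryLevel ρ t τ, ∀ g, 0 ≤ y g := by
    intro y hy g
    rw [T.mem_boundaryLevel hτ] at hy
    rcases hy with ⟨v, -, -, rfl⟩ | ⟨f, -, -, -, h3, h4, rfl⟩
    · simp only [vert, indicator]; split_ifs <;> norm_num
    · exact edgePoint_nonneg (AllowedRep.edgeParam_mem_Ioo h3 h4) g
  have hp : p ∈ boundaryLevel ρ t τ := by rw [e]; simp
  have hq : q ∈ boundaryLevel ρ t τ := by rw [e]; simp
  rw [e, convexHull_pair, segment_eq_image] at hx
  obtain ⟨θ, hθ, rfl⟩ := hx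
  beta_reduce at h0 ⊢
  rcases h with rfl | h
  · rw [← add_smul, sub_add_cancel, one_smul]
    exact hp
  rcases hθ.1.eq_or_lt with e0 | h1
  · simpa [← e0] using hp
  rcases hθ.2.eq_or_lt with e1 | h2
  · simpa [e1] using hq
  obtain ⟨g, hg, h3⟩ := h0
  simp only [Pi.add_apply, Pi.smul_apply, smul_eq_mul] at h3
  have h4 := hnn p hp g
  have h5 := hnn q hq g
  have h2' : 0 < 1 - θ := by linarith
  have h6 := mul_nonneg h2'.le h4
  have h7 := mul_nonneg h1.le h5
  rcases h g hg with h8 | h8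
  · have := mul_pos h2' h8
    linarith
  · have := mul_pos h1 h8
    linarith

omit hG [MulAction G ℍ] in
theorem convexHull_boundaryLevel_subset :
    convexHull ℝ (boundaryLevel ρ t τ) ⊆ simplex τ := by
  refine convexHull_min ?_ (convex_convexHull ℝ _)
  rintro x ⟨h, hh, g, hg, -, r, hr, -, rfl⟩
  exact lineMap_mem_simplex (vert_mem_simplex hh) (vert_mem_simplex hg) hr.1 hr.2

/-- The part of a level set in the triangles of `P`. -/
def OneVertexTriangulation.levelPart (T : OneVertexTriangulation G) (ρ : AllowedRep G) (t : ℝ)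
    (P : Set (Set G)) : Set ℍ :=
  ⋃ τ ∈ P, T.toPlane '' convexHull ℝ (boundaryLevel ρ t τ)

variable {P : Set (Set G)}

theorem OneVertexTriangulation.isClosed_levelPart (hP : P ⊆ T.triangles) :
    IsClosed (T.levelPart ρ t P) := by
  have hlf : LocallyFinite fun τ : P => T.toPlane '' convexHull ℝ (boundaryLevel ρ t (τ : Set G)) :=
    ((T.locallyFinite_cell hG).comp_injective (Set.inclusion_injective hP)).subset fun τ =>
      image_mono convexHull_boundaryLevel_subset
  have h := hlf.isClosed_iUnion fun τ => by
    by_cases hne : (boundaryLevel ρ t (τ : Set G)).Nonempty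
    · obtain ⟨p, q, e, -⟩ := T.exists_boundaryLevel_eq hG (hP τ.2) hne
      have hc : IsCompact (convexHull ℝ (boundaryLevel ρ t (τ : Set G))) := by
        rw [e]; exact (Set.toFinite {p, q}).isCompact_convexHull (𝕜 := ℝ)
      exact (hc.image_of_continuousOn ((T.continuousOn_simplex _ (hP τ.2)).mono
        convexHull_boundaryLevel_subset)).isClosed
    · rw [not_nonempty_iff_eq_empty.1 hne]
      simp
  rw [OneVertexTriangulation.levelPart, biUnion_eq_iUnion]
  exact h

/-- A set of triangles is saturated if it is closed under passing to another triangle at a point of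
the level set. -/
def OneVertexTriangulation.IsSaturated (T : OneVertexTriangulation G) (ρ : AllowedRep G) (t : ℝ)
    (P : Set (Set G)) : Prop :=
  P ⊆ T.triangles ∧ ∀ τ ∈ P, ∀ τ' ∈ T.triangles,
    (∀ v ∈ τ, v ∈ τ' → ρ.hom v 0 = t → τ' ∈ P) ∧
    ∀ h ∈ τ, ∀ g ∈ τ, h ∈ τ' → g ∈ τ' → ρ.hom h 0 < t → t < ρ.hom g 0 → τ' ∈ P

/-- A common point would lie on the boundary of a triangle of P, either at a vertex of height t or
inside an edge that passes height t; saturation then puts the other triangle into P. -/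
theorem OneVertexTriangulation.IsSaturated.disjoint (hP : T.IsSaturated ρ t P) :
    Disjoint (T.levelPart ρ t P) (T.levelPart ρ t (T.triangles \ P)) := by
  rw [Set.disjoint_left]
  intro z hz hz'
  simp only [OneVertexTriangulation.levelPart, mem_iUnion] at hz hz'
  obtain ⟨τ, hτ, x, hx, rfl⟩ := hz
  obtain ⟨τ', ⟨hτ', hτ'P⟩, y, hy, hxy⟩ := hz'
  have hxs := convexHull_boundaryLevel_subset hx
  have hys := convexHull_boundaryLevel_subset hy
  have e : y = x := by rw [← T.bary_toPlane (hP.1 hτ) hxs, ← hxy, T.bary_toPlane hτ' hys]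
  subst e
  have hsupp : ∀ g, y g ≠ 0 → g ∈ τ' := by
    intro g hg
    by_contra hc
    exact hg (((mem_simplex_iff (T.finite_triangle hτ')).1 hys).2.1 g hc)
  have h0 : ∃ g ∈ τ, y g = 0 := by
    by_contra! hno
    obtain ⟨a, b, c, hab, hac, hbc, e⟩ := T.eq_triple (hP.1 hτ)
    have ha : a ∈ τ := by rw [e]; simp
    have hb : b ∈ τ := by rw [e]; simp
    have hc : c ∈ τ := by rw [e]; simp
    have := T.eq_of_three_mem (hP.1 hτ) hτ' hab hac hbc ha hb hc (hsupp a (hno a ha))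
      (hsupp b (hno b hb)) (hsupp c (hno c hc))
    exact hτ'P (this ▸ hτ)
  have hbl := T.mem_boundaryLevel_of_eq_zero hG (hP.1 hτ) hx h0
  rw [T.mem_boundaryLevel (hP.1 hτ)] at hbl
  rcases hbl with ⟨v, hv, hvt, rfl⟩ | ⟨f, -, h1, h2, h3, h4, rfl⟩
  · exact hτ'P ((hP.2 τ hτ τ' hτ').1 v hv (hsupp v (by rw [vert_apply_self]; exact one_ne_zero)) hvt)
  · have hne : f.lo ≠ f.hi := fun e => by rw [e] at h3; exact lt_asymm h3 h4
    have hp := fun g => edgePoint_pos_iff hne (AllowedRep.edgeParam_mem_Ioo h3 h4) (g := g)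
    exact hτ'P ((hP.2 τ hτ τ' hτ').2 f.lo h1 f.hi h2
      (hsupp _ ((hp _).2 (Or.inl rfl)).ne') (hsupp _ ((hp _).2 (Or.inr rfl)).ne') h3 h4)

/-- The part in P and the rest are closed and disjoint, so a connected component cannot meet both.
This reduces the determination of leaves to combinatorics. -/
theorem OneVertexTriangulation.IsSaturated.connectedComponentIn_eq (hP : T.IsSaturated ρ t P)
    (hc : IsPreconnected (T.levelPart ρ t P)) {z : ℍ} (hz : z ∈ T.levelPart ρ t P) :
    connectedComponentIn (T.levelSet ρ t) z = T.levelPart ρ t P := by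
  have hsub : T.levelPart ρ t P ⊆ T.levelSet ρ t := biUnion_subset_biUnion_left hP.1
  apply Subset.antisymm
  · have hun : T.levelSet ρ t ⊆ T.levelPart ρ t P ∪ T.levelPart ρ t (T.triangles \ P) := by
      intro w hw
      simp only [OneVertexTriangulation.levelSet, mem_iUnion] at hw
      obtain ⟨τ, hτ, hw⟩ := hw
      by_cases h : τ ∈ P
      · exact Or.inl (mem_biUnion h hw)
      · exact Or.inr (mem_biUnion ⟨hτ, h⟩ hw)
    have hpre := isPreconnected_connectedComponentIn (x := z) (F := T.levelSet ρ t)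
    have hin := (connectedComponentIn_subset (T.levelSet ρ t) z).trans hun
    by_contra hno
    obtain ⟨w, hw, hwP⟩ := not_subset.1 hno
    obtain ⟨u, -, hu1, hu2⟩ := isPreconnected_closed_iff.1 hpre _ _
      (T.isClosed_levelPart hG hP.1) (T.isClosed_levelPart hG sdiff_subset) hin
      ⟨z, mem_connectedComponentIn (hsub hz), hz⟩ ⟨w, hw, (hin hw).resolve_left hwP⟩
    exact Set.disjoint_left.1 (hP.disjoint hG) hu1 hu2
  · exact hc.subset_connectedComponentIn hz hsub

theorem OneVertexTriangulation.vertex_mem_levelSet {v : G} (h : T.vertex v ∈ T.levelSet ρ t) :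
    ρ.hom v 0 = t := by
  simp only [OneVertexTriangulation.levelSet, mem_iUnion] at h
  obtain ⟨τ, hτ, x, hx, hxv⟩ := h
  have hxs := convexHull_boundaryLevel_subset hx
  obtain ⟨σ, hσ, hvσ⟩ := T.exists_triangle_mem v
  have e : x = vert v := by
    rw [← T.bary_toPlane hτ hxs, hxv]
    exact T.bary_toPlane hσ (vert_mem_simplex hvσ)
  subst e
  have h0 : ∃ g ∈ τ, vert v g = 0 := by
    obtain ⟨a, b, c, hab, -, -, rfl⟩ := T.eq_triple hτ
    by_cases e : a = v
    · exact ⟨b, by simp, vert_apply_ne fun e' => hab (e.trans e'.symm)⟩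
    · exact ⟨a, by simp, vert_apply_ne e⟩
  have hbl := T.mem_boundaryLevel_of_eq_zero hG hτ hx h0
  rw [T.mem_boundaryLevel hτ] at hbl
  rcases hbl with ⟨w, -, hwt, e⟩ | ⟨f, -, -, -, h3, h4, e⟩
  · have : v = w := by
      by_contra hne
      have h1 := congrFun e v
      rw [vert_apply_self, vert_apply_ne hne] at h1
      exact one_ne_zero h1
    rw [this, hwt]
  · have hne : f.lo ≠ f.hi := fun e => by rw [e] at h3; exact lt_asymm h3 h4
    have hp := fun g => edgePoint_pos_iff hne (AllowedRep.edgeParam_mem_Ioo h3 h4) (g := g)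
    rw [AllowedRep.levelPoint] at e
    rw [← e] at hp
    have hv : ∀ g, 0 < vert v g → g = v := by
      intro g hg
      by_contra hne
      rw [vert_apply_ne hne] at hg
      exact lt_irrefl _ hg
    exact absurd ((hv _ ((hp _).2 (Or.inl rfl))).trans (hv _ ((hp _).2 (Or.inr rfl))).symm) hne

end

/-! ### The leaves of the foliation -/

section

variable {G : Type*} [Group G] [MulAction G ℍ] {T : OneVertexTriangulation G}
  {A : Set G} {x : ℤ → Flag G} {O : LeftOrder G} {ρ : AllowedRep G} {t : ℝ} {v : G} {τ τ' : Set G}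

theorem OneVertexTriangulation.IsLine.tri_eq_of_edge (hx : T.IsLine A x) (k : ℤ)
    (hτ' : τ' ∈ T.triangles) (h1 : (x k).lo ∈ τ') (h2 : (x k).hi ∈ τ') :
    τ' = (x (k - 1)).tri ∨ τ' = (x k).tri := by
  by_cases e : τ' = (x k).tri
  · exact Or.inr e
  · left
    have hs := hx (k - 1)
    rw [sub_add_cancel] at hs
    have := (hx.isFlag k).eq_rev_of_ne (g := ⟨(x k).lo, (x k).hi, τ'⟩)
      ⟨hτ', h1, h2, (hx.isFlag k).2.2.2⟩ rfl rfl e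
    rw [← hs.rev_tri, ← this]

theorem OneVertexTriangulation.IsLine.tri_eq_of_mem (hx : T.IsLine A x) (k : ℤ) {h g : G}
    (hh : h ∈ (x k).tri) (hg : g ∈ (x k).tri) (hhA : h ∈ A) (hgA : g ∉ A)
    (hτ' : τ' ∈ T.triangles) (h1 : h ∈ τ') (h2 : g ∈ τ') :
    (τ' = (x (k - 1)).tri ∧ h = (x k).lo ∧ g = (x k).hi) ∨ τ' = (x k).tri ∨
      τ' = (x (k + 1)).tri := by
  rcases (hx k).eq_or_eq_rev (g := ⟨h, g, (x k).tri⟩) ⟨(hx.isFlag k).1, hh, hg, hhA, hgA⟩ rfl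
    with e | e
  · have e1 := congrArg Flag.lo e
    have e2 := congrArg Flag.hi e
    simp only at e1 e2
    rcases hx.tri_eq_of_edge k hτ' (e1 ▸ h1) (e2 ▸ h2) with e3 | e3
    · exact Or.inl ⟨e3, e1, e2⟩
    · exact Or.inr (Or.inl e3)
  · have e1 : h = (x (k + 1)).lo := congrArg Flag.lo e
    have e2 : g = (x (k + 1)).hi := congrArg Flag.hi e
    have := hx.tri_eq_of_edge (k + 1) hτ' (e1 ▸ h1) (e2 ▸ h2)
    rw [add_sub_cancel_right] at this
    exact Or.inr this

theorem OneVertexTriangulation.IsLine.edgeParam_mem (hx : T.IsLine {g | ρ.hom g 0 < t} x) {k : ℤ}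
    (ht : ∀ v ∈ (x k).tri, ρ.hom v 0 ≠ t) : ρ.edgeParam t (x k) ∈ Ioo (0 : ℝ) 1 := by
  have hf := hx.isFlag k
  exact AllowedRep.edgeParam_mem_Ioo hf.2.2.2.1
    (lt_of_le_of_ne (not_lt.1 hf.2.2.2.2) (ht _ hf.2.2.1).symm)

theorem OneVertexTriangulation.IsLine.isSaturated (hx : T.IsLine {g | ρ.hom g 0 < t} x)
    (ht : ∀ k, ∀ v ∈ (x k).tri, ρ.hom v 0 ≠ t) :
    T.IsSaturated ρ t (range fun k => (x k).tri) := by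
  refine ⟨?_, ?_⟩
  · rintro _ ⟨k, rfl⟩
    exact (hx.isFlag k).1
  · rintro _ ⟨k, rfl⟩ τ' hτ'
    refine ⟨fun v hv _ hvt => absurd hvt (ht k v hv), fun h hh g hg h1 h2 h3 h4 => ?_⟩
    rcases hx.tri_eq_of_mem k hh hg h3 (not_lt.2 h4.le) hτ' h1 h2 with ⟨e, -⟩ | e | e
    · exact ⟨_, e.symm⟩
    · exact ⟨_, e.symm⟩
    · exact ⟨_, e.symm⟩

theorem OneVertexTriangulation.Step.image_convexHull {f g : Flag G}
    (h : T.Step {g | ρ.hom g 0 < t} f g) (ht : ∀ v ∈ f.tri, ρ.hom v 0 ≠ t) :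
    T.toPlane '' convexHull ℝ (boundaryLevel ρ t f.tri) =
      (fun r : ℝ => T.toPlane ((1 - r) • ρ.levelPoint t f + r • ρ.levelPoint t g)) '' Icc 0 1 := by
  rw [h.boundaryLevel_eq ht, convexHull_pair, segment_eq_image, image_image]

theorem OneVertexTriangulation.IsLine.levelPart_eq (hx : T.IsLine {g | ρ.hom g 0 < t} x)
    (ht : ∀ k, ∀ v ∈ (x k).tri, ρ.hom v 0 ≠ t) :
    T.levelPart ρ t (range fun k => (x k).tri) =
      range (T.chainCurve fun k => ρ.levelPoint t (x k)) := by
  rw [OneVertexTriangulation.IsChain.range_chainCurve, OneVertexTriangulation.levelPart,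
    biUnion_range]
  exact iUnion_congr fun k => (hx k).image_convexHull (ht k)

theorem OneVertexTriangulation.IsProng.edgeParam_mem {r : ℕ → Flag G}
    (h : T.IsProng ρ.order v τ r) (n : ℕ) : ρ.edgeParam (ρ.hom v 0) (r n) ∈ Ioo (0 : ℝ) 1 := by
  have hf := h.isFlag n
  refine AllowedRep.edgeParam_mem_Ioo hf.2.2.2.1
    (lt_of_le_of_ne (not_lt.1 hf.2.2.2.2) fun e => h.notMem n ?_)
  rw [ρ.injective_orbit' e]
  exact hf.2.2.1

/-- The triangles that contain `v` or are crossed by a prong at `v`. -/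
def OneVertexTriangulation.starTriangles (T : OneVertexTriangulation G) (O : LeftOrder G) (v : G)
    (r : Set G → ℕ → Flag G) : Set (Set G) :=
  {τ ∈ T.triangles | v ∈ τ} ∪ {σ | ∃ τ, T.IsMiddle O v τ ∧ ∃ n, σ = (r τ n).tri}

/-- The points at which a prong crosses the edges. -/
noncomputable def AllowedRep.prongPoint (ρ : AllowedRep G) (v : G) (r : ℕ → Flag G) : ℕ → G → ℝ :=
  rayPoint v r fun n => ρ.edgeParam (ρ.hom v 0) (r n)

variable {r : Set G → ℕ → Flag G}

/-- Besides passing through v, the level can leave the star of v only through the edge opposite to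
v, in a triangle with middle vertex v; there the prong takes over. -/
theorem OneVertexTriangulation.isSaturated_starTriangles
    (hr : ∀ τ, T.IsMiddle ρ.order v τ → T.IsProng ρ.order v τ (r τ)) :
    T.IsSaturated ρ (ρ.hom v 0) (T.starTriangles ρ.order v r) := by
  have hsub : T.starTriangles ρ.order v r ⊆ T.triangles := by
    rintro σ (h | ⟨τ, hτ, n, rfl⟩)
    · exact h.1
    · exact ((hr τ hτ).isFlag n).1
  refine ⟨hsub, fun τ hτ τ' hτ' => ⟨fun w _ hw' hwt => ?_, ?_⟩⟩
  · rw [ρ.injective_orbit' hwt] at hw'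
    exact Or.inl ⟨hτ', hw'⟩
  · intro h hh g hg h1 h2 h3 h4
    by_cases hvτ' : v ∈ τ'
    · exact Or.inl ⟨hτ', hvτ'⟩
    right
    rcases hτ with ⟨hτ, hvτ⟩ | ⟨σ, hσ, n, rfl⟩
    · have hτe : τ = {h, v, g} := by
        have n1 : h ≠ v := fun e => by rw [e] at h3; exact lt_irrefl _ h3
        have n2 : g ≠ v := fun e => by rw [e] at h4; exact lt_irrefl _ h4
        have n3 : h ≠ g := fun e => by rw [e] at h3; exact lt_asymm h3 h4
        obtain ⟨c, -, -, e⟩ := T.eq_triple_of_mem_mem hτ hh hg n3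
        rw [e] at hvτ ⊢
        simp only [mem_insert_iff, mem_singleton_iff] at hvτ
        rcases hvτ with e' | e' | e'
        · exact absurd e'.symm n1
        · exact absurd e'.symm n2
        · rw [e', Set.pair_comm]
      have hm : T.IsMiddle ρ.order v τ := ⟨hτ, h, g, h3, h4, hτe⟩
      have hp := hr τ hm
      refine ⟨τ, hm, 0, ?_⟩
      have hlo : (r τ 0).lo = h := by
        have k1 := hτe.subset hp.lo_mem
        have k2 := hp.lo_lt
        rcases k1 with e | e | e
        · exact e
        · rw [e] at k2; exact absurd k2 (ρ.order.irrefl _)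
        · rw [mem_singleton_iff.1 e] at k2; exact absurd k2 (ρ.order.asymm h4)
      have hhi : (r τ 0).hi = g := by
        have k1 := hτe.subset hp.hi_mem
        have k2 := hp.lt_hi
        rcases k1 with e | e | e
        · rw [e] at k2; exact absurd k2 (ρ.order.asymm h3)
        · rw [e] at k2; exact absurd k2 (ρ.order.irrefl _)
        · exact e
      obtain ⟨x, hx, hxr, hxt⟩ := hp.exists_rayTri
      have h5 := hxr 0
      rw [Nat.cast_zero] at h5
      rcases hx.tri_eq_of_edge 0 hτ' (by rw [h5, hlo]; exact h1) (by rw [h5, hhi]; exact h2)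
        with e | e
      · have h6 := hxt 0
        rw [Nat.cast_zero, ← e] at h6
        exact absurd (h6 ▸ hvτ : v ∈ τ') hvτ'
      · rw [e, h5]
    · have hp := hr σ hσ
      refine ⟨σ, hσ, ?_⟩
      obtain ⟨x, hx, hxr, hxt⟩ := hp.exists_rayTri
      have h5 := hx.tri_eq_of_mem n (τ' := τ') (h := h) (g := g) (by rw [hxr]; exact hh)
        (by rw [hxr]; exact hg) h3 (ρ.order.asymm h4) hτ' h1 h2
      rcases h5 with ⟨e, -⟩ | e | e
      · rw [← hxt] at e
        cases n with
        | zero => exact absurd (by rw [e]; exact hp.mem_tri) hvτ'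
        | succ n => exact ⟨n, e⟩
      · exact ⟨n, by rw [e, hxr]⟩
      · exact ⟨n + 1, by rw [e, ← hxr]; push_cast; rfl⟩

theorem OneVertexTriangulation.IsProng.image_rayCurve_eq {r : ℕ → Flag G}
    (h : T.IsProng ρ.order v τ r) : T.rayCurve (ρ.prongPoint v r) '' Ici 0 =
      (T.toPlane '' convexHull ℝ (boundaryLevel ρ (ρ.hom v 0) τ)) ∪
        ⋃ n, T.toPlane '' convexHull ℝ (boundaryLevel ρ (ρ.hom v 0) (r n).tri) := by
  rw [OneVertexTriangulation.image_rayCurve]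
  have h0 : T.toPlane '' convexHull ℝ (boundaryLevel ρ (ρ.hom v 0) τ) =
      (fun s : ℝ => T.toPlane ((1 - s) • ρ.prongPoint v r 0 + s • ρ.prongPoint v r 1)) ''
        Icc 0 1 := by
    rw [OneVertexTriangulation.boundaryLevel_middle h.isMiddle.1 h.mem_tri h.lo_mem h.hi_mem
      h.lo_lt h.lt_hi, convexHull_pair, segment_eq_image, image_image]
    rfl
  have h1 : ∀ n, T.toPlane '' convexHull ℝ (boundaryLevel ρ (ρ.hom v 0) (r n).tri) =
      (fun s : ℝ => T.toPlane ((1 - s) • ρ.prongPoint v r (n + 1) +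
        s • ρ.prongPoint v r (n + 1 + 1))) '' Icc 0 1 := by
    intro n
    refine OneVertexTriangulation.Step.image_convexHull (h.step n) fun w hw e => h.notMem n ?_
    rwa [← ρ.injective_orbit' e]
  rw [h0]
  simp_rw [h1]
  ext z
  simp only [mem_iUnion, mem_union]
  constructor
  · rintro ⟨n, hn⟩
    cases n with
    | zero => exact Or.inl hn
    | succ n => exact Or.inr ⟨n, hn⟩
  · rintro (hn | ⟨n, hn⟩)
    · exact ⟨0, hn⟩
    · exact ⟨n + 1, hn⟩

theorem OneVertexTriangulation.rayCurve_zero {Z : ℕ → G → ℝ} : T.rayCurve Z 0 = T.toPlane (Z 0) := by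
  simp [OneVertexTriangulation.rayCurve]

theorem OneVertexTriangulation.levelPart_starTriangles
    (hr : ∀ τ, T.IsMiddle ρ.order v τ → T.IsProng ρ.order v τ (r τ)) :
    T.levelPart ρ (ρ.hom v 0) (T.starTriangles ρ.order v r) =
      ⋃ τ ∈ {τ | T.IsMiddle ρ.order v τ}, T.rayCurve (ρ.prongPoint v (r τ)) '' Ici 0 := by
  ext z
  simp only [OneVertexTriangulation.levelPart, mem_iUnion]
  constructor
  · rintro ⟨σ, (⟨hσ, hvσ⟩ | ⟨τ, hτ, n, rfl⟩), hz⟩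
    · by_cases hm : T.IsMiddle ρ.order v σ
      · refine ⟨σ, hm, ?_⟩
        rw [(hr σ hm).image_rayCurve_eq]
        exact Or.inl hz
      · obtain ⟨τ, hτ⟩ := T.exists_isMiddle ρ.order v
        refine ⟨τ, hτ, 0, self_mem_Ici, ?_⟩
        rw [OneVertexTriangulation.rayCurve_zero]
        -- A triangle at v in which v is not the middle vertex meets the level in v alone.
        have hbl : boundaryLevel ρ (ρ.hom v 0) σ ⊆ {vert v} := by
          intro x hx
          rw [OneVertexTriangulation.mem_boundaryLevel hσ] at hx
          rcases hx with ⟨w, hw, hwv, rfl⟩ | ⟨e, -, k1, k2, k3, k4, rfl⟩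
          · rw [ρ.injective_orbit' hwv]; rfl
          · refine absurd ⟨hσ, e.lo, e.hi, k3, k4, ?_⟩ hm
            have n1 : e.lo ≠ v := fun e' => by rw [e'] at k3; exact lt_irrefl _ k3
            have n2 : e.hi ≠ v := fun e' => by rw [e'] at k4; exact lt_irrefl _ k4
            have n3 : e.lo ≠ e.hi := fun e' => by rw [e'] at k3; exact lt_asymm k3 k4
            obtain ⟨c, -, -, e0⟩ := T.eq_triple_of_mem_mem hσ k1 k2 n3
            rw [e0] at hvσ ⊢
            simp only [mem_insert_iff, mem_singleton_iff] at hvσ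
            rcases hvσ with e' | e' | e'
            · exact absurd e'.symm n1
            · exact absurd e'.symm n2
            · rw [e', Set.pair_comm]
        obtain ⟨x, hx, rfl⟩ := hz
        have := convexHull_min hbl (convex_singleton _) hx
        rw [mem_singleton_iff.1 this]
        rfl
    · refine ⟨τ, hτ, ?_⟩
      rw [(hr τ hτ).image_rayCurve_eq]
      exact Or.inr (mem_iUnion.2 ⟨n, hz⟩)
  · rintro ⟨τ, hτ, hz⟩
    rw [(hr τ hτ).image_rayCurve_eq] at hz
    rcases hz with hz | hz
    · exact ⟨τ, Or.inl ⟨hτ.1, (hr τ hτ).mem_tri⟩, hz⟩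
    · obtain ⟨n, hn⟩ := mem_iUnion.1 hz
      exact ⟨_, Or.inr ⟨τ, hτ, n, rfl⟩, hn⟩

variable (hG : IsSurfaceGroup G)
include hG

theorem OneVertexTriangulation.isPreconnected_levelPart_starTriangles
    (hr : ∀ τ, T.IsMiddle ρ.order v τ → T.IsProng ρ.order v τ (r τ)) :
    IsPreconnected (T.levelPart ρ (ρ.hom v 0) (T.starTriangles ρ.order v r)) := by
  rw [T.levelPart_starTriangles hr, biUnion_eq_iUnion]
  refine isPreconnected_iUnion ⟨T.toPlane (vert v), mem_iInter.2 fun τ =>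
    ⟨0, self_mem_Ici, T.rayCurve_zero⟩⟩ fun τ => ?_
  -- A second prong completes the ray to a chain, whose curve is known to be continuous.
  obtain ⟨τ', hτ', hne⟩ := Set.exists_ne_of_one_lt_ncard
    (lt_of_lt_of_le one_lt_two (T.two_le_ncard_isMiddle hG ρ.order v)) (τ : Set G)
  have hc := (hr τ' hτ').isChain hG (hr τ τ.2) hne (hr τ' hτ').edgeParam_mem (hr τ τ.2).edgeParam_mem
  have himg : T.rayCurve (ρ.prongPoint v (r τ)) '' Ici 0 =
      T.chainCurve (gluePoint (ρ.prongPoint v (r τ')) (ρ.prongPoint v (r τ))) '' Ici 0 := by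
    refine image_congr fun s hs => ?_
    rw [OneVertexTriangulation.chainCurve_gluePoint (Z := ρ.prongPoint v (r τ'))
      (Z' := ρ.prongPoint v (r τ)) rfl]
    split_ifs with h
    · rw [le_antisymm h hs, neg_zero, T.rayCurve_zero, T.rayCurve_zero]
      rfl
    · rfl
  rw [himg]
  exact isPreconnected_Ici.image _ hc.continuous_chainCurve.continuousOn

/-- The leaves of the foliation are lines of flags and stars of prongs. -/
theorem OneVertexTriangulation.IsLeaf.cases {C : Set ℍ} (hC : T.IsLeaf ρ C) :
    (∃ t x, T.IsLine {g | ρ.hom g 0 < t} x ∧ (∀ k, ∀ v ∈ (x k).tri, ρ.hom v 0 ≠ t) ∧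
      C = range (T.chainCurve fun k => ρ.levelPoint t (x k))) ∨
    ∃ (v : G) (r : Set G → ℕ → Flag G), (∀ τ, T.IsMiddle ρ.order v τ → T.IsProng ρ.order v τ (r τ)) ∧
      C ⊆ T.levelSet ρ (ρ.hom v 0) ∧
      C = ⋃ τ ∈ {τ | T.IsMiddle ρ.order v τ}, T.rayCurve (ρ.prongPoint v (r τ)) '' Ici 0 := by
  obtain ⟨t, z, hz, rfl⟩ := hC
  -- P is the singular part of the level: the star and the prongs of the vertex at height t if there
  -- is one, and empty otherwise. There is at most one such vertex because the orbit map is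
  -- injective.
  obtain ⟨P, hP, hPv, hPs⟩ : ∃ P, T.IsSaturated ρ t P ∧
      (∀ v τ, ρ.hom v 0 = t → τ ∈ T.triangles → v ∈ τ → τ ∈ P) ∧
      (z ∈ T.levelPart ρ t P → ∃ (v : G) (r : Set G → ℕ → Flag G), t = ρ.hom v 0 ∧
        (∀ τ, T.IsMiddle ρ.order v τ → T.IsProng ρ.order v τ (r τ)) ∧
        P = T.starTriangles ρ.order v r) := by
    by_cases hv : ∃ v, ρ.hom v 0 = t
    · obtain ⟨v, rfl⟩ := hv
      have : Nonempty (ℕ → Flag G) := ⟨fun _ => ⟨1, 1, ∅⟩⟩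
      choose! r hr using fun τ (h : T.IsMiddle ρ.order v τ) => h.exists_isProng hG
      refine ⟨_, T.isSaturated_starTriangles hr, ?_, fun _ => ⟨v, r, rfl, hr, rfl⟩⟩
      intro w τ hw hτ hwτ
      rw [ρ.injective_orbit' hw] at hwτ
      exact Or.inl ⟨hτ, hwτ⟩
    · push Not at hv
      exact ⟨∅, ⟨empty_subset _, fun τ hτ => absurd hτ (notMem_empty _)⟩,
        fun v _ hvt => absurd hvt (hv v), fun h => by simp [OneVertexTriangulation.levelPart] at h⟩
  by_cases hzP : z ∈ T.levelPart ρ t P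
  · right
    obtain ⟨v, r, rfl, hr, rfl⟩ := hPs hzP
    refine ⟨v, r, hr, connectedComponentIn_subset _ _, ?_⟩
    rw [← T.levelPart_starTriangles hr]
    exact hP.connectedComponentIn_eq hG (T.isPreconnected_levelPart_starTriangles hG hr) hzP
  · left
    have hz' := hz
    simp only [OneVertexTriangulation.levelSet, mem_iUnion] at hz'
    obtain ⟨τ, hτ, hzτ⟩ := hz'
    have hτP : τ ∉ P := fun h => hzP (mem_biUnion h hzτ)
    have hne : (boundaryLevel ρ t τ).Nonempty := by
      rw [nonempty_iff_ne_empty]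
      intro e
      simp [e] at hzτ
    obtain ⟨p, hp⟩ := hne
    rw [T.mem_boundaryLevel hτ] at hp
    rcases hp with ⟨v, hv, hvt, -⟩ | ⟨f, rfl, h1, h2, h3, h4, -⟩
    · exact absurd (hPv v τ hvt hτ hv) hτP
    have hf : T.IsFlag {g | ρ.hom g 0 < t} f := ⟨hτ, h1, h2, h3, not_lt.2 h4.le⟩
    obtain ⟨x, hx, hx0⟩ := hf.exists_line hG
    -- Saturation makes the triangles of the line belong to P all or none. The line starts outside
    -- of P, so none of its triangles has a vertex at height t.
    have hadj : ∀ k, (x k).tri ∈ P ↔ (x (k + 1)).tri ∈ P := by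
      intro k
      have hs := hx k
      have hf' := hx.isFlag (k + 1)
      have hf2 : ¬ ρ.hom (x (k + 1)).hi 0 < t := hf'.2.2.2.2
      rcases (not_lt.1 hf2).eq_or_lt with e | e
      · exact ⟨fun h => (hP.2 _ h _ hf'.1).1 _ hs.2.2.2.1 hf'.2.2.1 e.symm,
          fun h => (hP.2 _ h _ hs.1.1).1 _ hf'.2.2.1 hs.2.2.2.1 e.symm⟩
      · exact ⟨fun h => (hP.2 _ h _ hf'.1).2 _ hs.2.2.1 _ hs.2.2.2.1 hf'.2.1 hf'.2.2.1
            hf'.2.2.2.1 e,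
          fun h => (hP.2 _ h _ hs.1.1).2 _ hf'.2.1 _ hf'.2.2.1 hs.2.2.1 hs.2.2.2.1 hf'.2.2.2.1 e⟩
    have hnot : ∀ k, (x k).tri ∉ P := by
      intro k
      induction k using Int.induction_on with
      | zero => rwa [hx0]
      | succ i ih => rwa [← hadj]
      | pred i ih => rwa [hadj, sub_add_cancel]
    have ht : ∀ k, ∀ v ∈ (x k).tri, ρ.hom v 0 ≠ t := fun k v hv hvt =>
      hnot k (hPv v _ hvt (hx.isFlag k).1 hv)
    refine ⟨t, x, hx, ht, ?_⟩
    have hc := hx.isChain (O := ρ.order) hG (fun a ha b hb => lt_of_lt_of_le ha (not_lt.1 hb))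
      (s := fun k => ρ.edgeParam t (x k)) fun k => hx.edgeParam_mem (ht k)
    rw [← hx.levelPart_eq ht]
    refine (hx.isSaturated ht).connectedComponentIn_eq hG ?_ ?_
    · rw [hx.levelPart_eq ht]
      exact isPreconnected_range hc.continuous_chainCurve
    · exact mem_biUnion ⟨0, congrArg Flag.tri hx0⟩ hzτ

theorem OneVertexTriangulation.IsLine.vertex_notMem (hx : T.IsLine {g | ρ.hom g 0 < t} x)
    (ht : ∀ k, ∀ v ∈ (x k).tri, ρ.hom v 0 ≠ t) (g : G) :
    T.vertex g ∉ range (T.chainCurve fun k => ρ.levelPoint t (x k)) := by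
  intro h
  rw [← hx.levelPart_eq ht] at h
  have h1 := T.vertex_mem_levelSet hG (biUnion_subset_biUnion_left (hx.isSaturated ht).1 h)
  simp only [OneVertexTriangulation.levelPart, mem_iUnion] at h
  obtain ⟨_, ⟨k, rfl⟩, y, hy, hyg⟩ := h
  refine ht k g ?_ h1
  rw [← T.vertex_mem_cell_iff (hx.isFlag k).1, ← hyg]
  exact ⟨y, convexHull_boundaryLevel_subset hy, rfl⟩

theorem OneVertexTriangulation.IsNonsingularLeaf.exists_isLine {C : Set ℍ}
    (hC : T.IsNonsingularLeaf ρ C) :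
    ∃ t x, T.IsLine {g | ρ.hom g 0 < t} x ∧ (∀ k, ∀ v ∈ (x k).tri, ρ.hom v 0 ≠ t) ∧
      C = range (T.chainCurve fun k => ρ.levelPoint t (x k)) := by
  rcases hC.1.cases hG with h | ⟨v, r, hr, -, rfl⟩
  · exact h
  · obtain ⟨τ, hτ⟩ := T.exists_isMiddle ρ.order v
    refine absurd (mem_biUnion (x := τ) hτ ?_) (hC.2 v)
    exact ⟨0, self_mem_Ici, T.rayCurve_zero⟩

theorem OneVertexTriangulation.IsLine.isNonsingularLeaf (hx : T.IsLine {g | ρ.hom g 0 < t} x)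
    (ht : ∀ k, ∀ v ∈ (x k).tri, ρ.hom v 0 ≠ t) :
    T.IsNonsingularLeaf ρ (range (T.chainCurve fun k => ρ.levelPoint t (x k))) := by
  refine ⟨⟨t, T.chainCurve (fun k => ρ.levelPoint t (x k)) 0, ?_, ?_⟩, hx.vertex_notMem hG ht⟩
  · have h : T.chainCurve (fun k => ρ.levelPoint t (x k)) 0 ∈
        range (T.chainCurve fun k => ρ.levelPoint t (x k)) := ⟨0, rfl⟩
    rw [← hx.levelPart_eq ht] at h
    exact biUnion_subset_biUnion_left (hx.isSaturated ht).1 h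
  · have hc := hx.isChain (O := ρ.order) hG (fun a ha b hb => lt_of_lt_of_le ha (not_lt.1 hb))
      (s := fun k => ρ.edgeParam t (x k)) fun k => hx.edgeParam_mem (ht k)
    have hpre := isPreconnected_range hc.continuous_chainCurve
    change IsPreconnected (range (T.chainCurve fun k => ρ.levelPoint t (x k))) at hpre
    rw [← hx.levelPart_eq ht] at hpre
    rw [← hx.levelPart_eq ht]
    refine ((hx.isSaturated ht).connectedComponentIn_eq hG hpre ?_).symm
    rw [hx.levelPart_eq ht]
    exact ⟨0, rfl⟩

variable (T) in
/-- Leaves are quasigeodesics and stars of quasigeodesic prongs, with uniform constants. -/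
theorem OneVertexTriangulation.exists_isGoodLine_of_isLeaf :
    ∃ K c : ℝ, 1 ≤ K ∧ 0 ≤ c ∧ ∀ (ρ : AllowedRep G) (C : Set ℍ), T.IsLeaf ρ C →
      ((∀ g, T.vertex g ∉ C) → ∃ γ : ℝ → ℍ, range γ = C ∧ IsGoodLine K c γ) ∧
      (∀ g, T.vertex g ∈ C → ∃ n, 2 ≤ n ∧ IsGoodStar K c C (T.vertex g) n) := by
  obtain ⟨K, c, hK, hc, h⟩ := T.exists_isGoodLine hG
  refine ⟨K, c, hK, hc, fun ρ C hC => ?_⟩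
  rcases hC.cases hG with ⟨t, x, hx, ht, rfl⟩ | ⟨v, r, hr, hsub, hCe⟩
  · have hch := hx.isChain (O := ρ.order) hG (fun a ha b hb => lt_of_lt_of_le ha (not_lt.1 hb))
      (s := fun k => ρ.edgeParam t (x k)) fun k => hx.edgeParam_mem (ht k)
    exact ⟨fun _ => ⟨_, rfl, (h _ _ hch).1⟩, fun g hg => absurd hg (hx.vertex_notMem hG ht g)⟩
  · have hvC : T.vertex v ∈ C := by
      obtain ⟨τ, hτ⟩ := T.exists_isMiddle ρ.order v
      rw [hCe]
      exact mem_biUnion (x := τ) hτ ⟨0, self_mem_Ici, T.rayCurve_zero⟩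
    refine ⟨fun hno => absurd hvC (hno v), fun g hg => ?_⟩
    have hgv := ρ.injective_orbit' (T.vertex_mem_levelSet hG (hsub hg))
    subst hgv
    have h2 := T.two_le_ncard_isMiddle hG ρ.order g
    refine ⟨_, h2, ?_⟩
    have : Finite {τ | T.IsMiddle ρ.order g τ} := Set.finite_of_ncard_pos (by omega)
    let e := Finite.equivFinOfCardEq (Nat.card_coe_set_eq {τ | T.IsMiddle ρ.order g τ})
    refine ⟨fun i => T.rayCurve (ρ.prongPoint g (r (e.symm i))), fun i => T.rayCurve_zero, ?_, ?_⟩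
    · rw [hCe, biUnion_eq_iUnion]
      exact (e.symm.surjective.iUnion_comp (fun τ : {τ | T.IsMiddle ρ.order g τ} =>
        T.rayCurve (ρ.prongPoint g (r τ)) '' Ici 0)).symm
    · intro i j hij
      have hne : ((e.symm i : {τ | T.IsMiddle ρ.order g τ}) : Set G) ≠ e.symm j := fun e' =>
        hij (e.symm.injective (Subtype.ext e'))
      have hi := hr _ (e.symm i).2
      have hj := hr _ (e.symm j).2
      have hch := hi.isChain hG hj hne hi.edgeParam_mem hj.edgeParam_mem
      have := (h _ _ hch).1
      exact (funext (OneVertexTriangulation.chainCurve_gluePoint (T := T)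
        (Z := ρ.prongPoint g (r (e.symm i))) (Z' := ρ.prongPoint g (r (e.symm j))) rfl)) ▸ this

end

/-! ### The geodesics of a left order -/

section

variable {G : Type*} [Group G] [MulAction G ℍ] (T : OneVertexTriangulation G)
  {A A' : Set G} {x y : ℤ → Flag G} {O O' : LeftOrder G} {p q : Circle}

/-- `A` is a lower set for the left order `O`. -/
def LeftOrder.IsCut {G : Type*} [Group G] (O : LeftOrder G) (A : Set G) : Prop :=
  ∀ a ∈ A, ∀ b ∉ A, O.lt a b

/-- The midpoints of the edges that are crossed by a line. -/
noncomputable def OneVertexTriangulation.midpts (x : ℤ → Flag G) (k : ℤ) : ℍ :=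
  T.toPlane (edgePoint (x k) (1 / 2))

/-- The endpoints in the circle at infinity of a line. -/
def OneVertexTriangulation.HasEnds (x : ℤ → Flag G) (p q : Circle) : Prop :=
  Tendsto (fun n : ℕ => cayley (T.midpts x (-n))) atTop (𝓝 (p : ℂ)) ∧
    Tendsto (fun n : ℕ => cayley (T.midpts x n)) atTop (𝓝 (q : ℂ))

/-- The geodesics with the same endpoints as a line of the left order `O`. -/
def OneVertexTriangulation.geodesics (O : LeftOrder G) : Set (Set ℍ) :=
  {ℓ | ∃ A x p q, O.IsCut A ∧ T.IsLine A x ∧ T.HasEnds x p q ∧ ℓ = gline p q}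

variable (hG : IsSurfaceGroup G)
include hG

theorem OneVertexTriangulation.exists_isGoodLine_of_isLine :
    ∃ K c : ℝ, 1 ≤ K ∧ 0 ≤ c ∧ ∀ (O : LeftOrder G) (A : Set G) (x : ℤ → Flag G) (s : ℤ → ℝ),
      O.IsCut A → T.IsLine A x → (∀ k, s k ∈ Ioo (0 : ℝ) 1) →
      IsGoodLine K c (T.chainCurve fun k => edgePoint (x k) (s k)) ∧
      IsDiscreteQG K c fun k => T.toPlane (edgePoint (x k) (s k)) := by
  obtain ⟨K, c, hK, hc, h⟩ := T.exists_isGoodLine hG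
  exact ⟨K, c, hK, hc, fun O A x s hA hx hs => h _ _ (hx.isChain hG hA hs)⟩

theorem OneVertexTriangulation.exists_isDiscreteQG :
    ∃ K c : ℝ, 1 ≤ K ∧ 0 ≤ c ∧ ∀ (O : LeftOrder G) (A : Set G) (x : ℤ → Flag G),
      O.IsCut A → T.IsLine A x → IsDiscreteQG K c (T.midpts x) := by
  obtain ⟨K, c, hK, hc, h⟩ := T.exists_isGoodLine_of_isLine hG
  exact ⟨K, c, hK, hc, fun O A x hA hx =>
    (h O A x (fun _ => 1 / 2) hA hx fun _ => ⟨by norm_num, by norm_num⟩).2⟩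

variable {T}

theorem LeftOrder.IsCut.exists_hasEnds (hA : O.IsCut A) (hx : T.IsLine A x) :
    ∃ p q, T.HasEnds x p q := by
  obtain ⟨K, c, hK, hc, h⟩ := T.exists_isDiscreteQG hG
  obtain ⟨C, -, hC⟩ := exists_endpoint hK hc
  obtain ⟨q, hq, -⟩ := hC _ (h O A x hA hx)
  obtain ⟨p, hp, -⟩ := hC _ (h O A x hA hx).neg
  exact ⟨p, q, hp, hq⟩

theorem LeftOrder.IsCut.ends_ne (hA : O.IsCut A) (hx : T.IsLine A x) (h : T.HasEnds x p q) :
    p ≠ q := by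
  obtain ⟨K, c, hK, hc, hQ⟩ := T.exists_isDiscreteQG hG
  exact endpoints_ne hK hc (hQ O A x hA hx) h.1 h.2

theorem LeftOrder.IsCut.hasEnds_shift (hA : O.IsCut A) (hx : T.IsLine A x) (h : T.HasEnds x p q)
    (m : ℤ) : T.HasEnds (fun k => x (k + m)) p q := by
  obtain ⟨K, c, hK, hc, hQ⟩ := T.exists_isDiscreteQG hG
  have hd := hQ O A x hA hx
  constructor
  · refine tendsto_cayley_of_dist_le (L := K * |(m : ℝ)| + c) (fun n => ?_) h.1
    refine (hd (-n) (-n + m)).2.trans (le_of_eq ?_)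
    push_cast
    rw [sub_add_cancel_left, abs_neg]
  · refine tendsto_cayley_of_dist_le (L := K * |(m : ℝ)| + c) (fun n => ?_) h.2
    refine (hd n (n + m)).2.trans (le_of_eq ?_)
    push_cast
    rw [sub_add_cancel_left, abs_neg]

/-- Moving the points along their edges changes them by at most the cell diameter, so the endpoints
do not depend on the chosen parameters. -/
theorem LeftOrder.IsCut.hasEndpoints (hA : O.IsCut A) (hx : T.IsLine A x) (h : T.HasEnds x p q)
    {s : ℤ → ℝ} (hs : ∀ k, s k ∈ Ioo (0 : ℝ) 1) :
    HasEndpoints (T.chainCurve fun k => edgePoint (x k) (s k)) p q := by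
  obtain ⟨K, c, hK, hc, hQ⟩ := T.exists_isGoodLine_of_isLine hG
  obtain ⟨d, -, hd⟩ := T.exists_diam hG
  obtain ⟨⟨-, -, -, p', q', -, hpq⟩, -⟩ := hQ O A x s hA hx hs
  have hdist : ∀ k, dist (T.midpts x k) (T.chainCurve (fun k => edgePoint (x k) (s k)) (k : ℝ)) ≤ d := by
    intro k
    have hf := hx.isFlag k
    rw [OneVertexTriangulation.chainCurve_intCast]
    exact hd _ hf.1 _ ⟨_, edgePoint_mem_simplex hf.2.1 hf.2.2.1 ⟨by norm_num, by norm_num⟩, rfl⟩ _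
      ⟨_, edgePoint_mem_simplex hf.2.1 hf.2.2.1 (hs k), rfl⟩
  have e1 : q' = q := by
    have h1 := tendsto_cayley_of_dist_le (fun n : ℕ => hdist n) h.2
    have h2 := hpq.2.comp tendsto_natCast_atTop_atTop
    refine Circle.ext (tendsto_nhds_unique h2 (h1.congr fun n => ?_))
    simp
  have e2 : p' = p := by
    have h1 := tendsto_cayley_of_dist_le (fun n : ℕ => hdist (-n)) h.1
    have h2 := hpq.1.comp (tendsto_neg_atTop_atBot.comp tendsto_natCast_atTop_atTop)
    refine Circle.ext (tendsto_nhds_unique h2 (h1.congr fun n => ?_))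
    simp
  rwa [← e1, ← e2]

/-- A step depends only on which vertices of the current triangle lie in the cut, forwards and
backwards. All continuity in the cut and in the order rests on this. -/
theorem OneVertexTriangulation.IsLine.eq_of_agree (hx : T.IsLine A x) (hy : T.IsLine A' y)
    (h0 : y 0 = x 0) {N : ℕ} (h : ∀ k : ℤ, |k| ≤ N → ∀ v ∈ (x k).tri, (v ∈ A ↔ v ∈ A')) :
    ∀ k : ℤ, |k| ≤ N → y k = x k := by
  have key : ∀ n : ℕ, n ≤ N → y n = x n ∧ y (-n) = x (-n) := by
    intro n
    induction n with
    | zero => intro _; simpa using h0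
    | succ n ih =>
      intro hn
      obtain ⟨h1, h2⟩ := ih (by omega)
      constructor
      · have hs := (hx n).congr (h n (by rw [abs_le]; omega))
        rw [← h1] at hs
        exact_mod_cast (hy n).unique hs
      · have hs := (hx (-n - 1)).congr (h (-n - 1) (by rw [abs_le]; omega))
        have hs' := hy (-n - 1)
        rw [sub_add_cancel, h2] at hs'
        rw [sub_add_cancel] at hs
        have := hs'.unique_left hG hs
        rwa [show -((n + 1 : ℕ) : ℤ) = -n - 1 by push_cast; ring]
  intro k hk
  rcases le_total 0 k with h1 | h1
  · have := (key k.toNat (by rw [abs_le] at hk; omega)).1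
    rwa [Int.toNat_of_nonneg h1] at this
  · have := (key (-k).toNat (by rw [abs_le] at hk; omega)).2
    rwa [Int.toNat_of_nonneg (by omega), neg_neg] at this

variable (T) in
/-- The points of a line converge to its endpoints at a uniform rate. -/
theorem OneVertexTriangulation.exists_tail_bound : ∃ B : ℝ → ℕ → ℝ,
    (∀ D, Tendsto (B D) atTop (𝓝 0)) ∧
    ∀ (O : LeftOrder G) (A : Set G) (x : ℤ → Flag G) (p q : Circle), O.IsCut A → T.IsLine A x →
      T.HasEnds x p q → ∀ n : ℕ,
        ‖cayley (T.midpts x (-n)) - p‖ ≤ B (dist (T.midpts x 0) UpperHalfPlane.I) n ∧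
        ‖cayley (T.midpts x n) - q‖ ≤ B (dist (T.midpts x 0) UpperHalfPlane.I) n := by
  obtain ⟨K, c, hK, hc, hQ⟩ := T.exists_isDiscreteQG hG
  obtain ⟨C, -, hC⟩ := exists_endpoint hK hc
  refine ⟨fun D n => C * Real.exp (-(K⁻¹ * n - c - D) / 3), fun D => ?_, ?_⟩
  · have h1 : Tendsto (fun n : ℕ => K⁻¹ * (n : ℝ) - c - D) atTop atTop := by
      have := (tendsto_natCast_atTop_atTop (R := ℝ)).const_mul_atTop (show 0 < K⁻¹ by positivity)
      exact tendsto_atTop_add_const_right _ (-D) (tendsto_atTop_add_const_right _ (-c) this)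
    have h2 := (Real.tendsto_exp_neg_atTop_nhds_zero.comp
      (h1.atTop_div_const (r := (3 : ℝ)) (by norm_num))).const_mul C
    simp only [Function.comp_def, mul_zero] at h2
    exact h2.congr fun n => by beta_reduce; rw [neg_div]
  · intro O A x p q hA hx h n
    have hd := hQ O A x hA hx
    obtain ⟨q', hq, hq'⟩ := hC _ hd
    obtain ⟨p', hp, hp'⟩ := hC _ hd.neg
    have e1 : q' = q := Circle.ext (tendsto_nhds_unique hq h.2)
    have e2 : p' = p := Circle.ext (tendsto_nhds_unique hp h.1)
    rw [← e1, ← e2]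
    have h3 := hp' n
    simp only [neg_zero] at h3
    exact ⟨h3, hq' n⟩

/-- Lines that agree for a long time have close endpoints. -/
theorem LeftOrder.IsCut.exists_close (hA : O.IsCut A) (hx : T.IsLine A x) (h : T.HasEnds x p q)
    {W : Set (Circle × Circle)} (hW : W ∈ 𝓝 (p, q)) :
    ∃ N : ℕ, ∀ (O' : LeftOrder G) (A' : Set G) (y : ℤ → Flag G) (p' q' : Circle), O'.IsCut A' →
      T.IsLine A' y → T.HasEnds y p' q' → (∀ k : ℤ, |k| ≤ N → y k = x k) → (p', q') ∈ W := by
  obtain ⟨B, hB, hBx⟩ := T.exists_tail_bound hG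
  obtain ⟨ε, hε, hεW⟩ := Metric.mem_nhds_iff.1 hW
  obtain ⟨N, hN⟩ := ((hB (dist (T.midpts x 0) UpperHalfPlane.I)).eventually
    (gt_mem_nhds (half_pos hε))).exists
  refine ⟨N, fun O' A' y p' q' hA' hy hy' hxy => hεW ?_⟩
  have hm : ∀ k : ℤ, |k| ≤ N → T.midpts y k = T.midpts x k := fun k hk => by
    rw [OneVertexTriangulation.midpts, hxy k hk]; rfl
  have h1 := hBx O A x p q hA hx h N
  have h2 := hBx O' A' y p' q' hA' hy hy' N
  rw [hm 0 (by simp), hm N (by simp), hm (-N) (by simp)] at h2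
  have key : ∀ (w : ℂ) (a b : Circle), ‖w - a‖ ≤ B (dist (T.midpts x 0) UpperHalfPlane.I) N →
      ‖w - b‖ ≤ B (dist (T.midpts x 0) UpperHalfPlane.I) N → dist b a < ε := by
    intro w a b ha hb
    change dist (b : ℂ) a < ε
    rw [dist_eq_norm]
    have := norm_sub_le_norm_sub_add_norm_sub (b : ℂ) w a
    rw [norm_sub_rev (b : ℂ) w] at this
    linarith
  rw [Metric.mem_ball, Prod.dist_eq]
  exact max_lt (key _ _ _ h1.1 h2.1) (key _ _ _ h1.2 h2.2)

omit [MulAction G ℍ] hG in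
theorem LeftOrder.isOpen_lt (a b : G) : IsOpen {O : LeftOrder G | O.lt a b} :=
  TopologicalSpace.isOpen_generateFrom_of_mem ⟨a, b, rfl⟩

omit [MulAction G ℍ] hG in
-- By totality the sets `{O | O.lt a b}` are closed as well as open, so inequalities pass to limits
-- of orders.
theorem LeftOrder.lt_of_eventually {ι : Type*} {l : Filter ι} [l.NeBot] {f : ι → LeftOrder G}
    (hf : Tendsto f l (𝓝 O)) {a b : G} (h : ∀ᶠ i in l, (f i).lt a b) : O.lt a b := by
  rcases O.total a b with h1 | rfl | h1
  · exact h1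
  · obtain ⟨i, hi⟩ := h.exists
    exact absurd hi ((f i).irrefl _)
  · have := hf.eventually ((LeftOrder.isOpen_lt b a).mem_nhds h1)
    obtain ⟨i, h2, h3⟩ := (h.and this).exists
    exact absurd h3 ((f i).asymm h2)

variable (T) in
theorem OneVertexTriangulation.finite_flags {K : Set ℍ} (hK : IsCompact K) :
    {f : Flag G | f.tri ∈ T.triangles ∧ f.lo ∈ f.tri ∧ f.hi ∈ f.tri ∧
      (T.cell f.tri ∩ K).Nonempty}.Finite := by
  have h1 := T.finite_meeting hG hK
  have h2 : (⋃ τ ∈ {τ ∈ T.triangles | (T.cell τ ∩ K).Nonempty}, τ).Finite :=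
    h1.biUnion fun τ hτ => T.finite_triangle hτ.1
  refine Finite.of_finite_image (f := fun f : Flag G => (f.lo, f.hi, f.tri))
    ((h2.prod (h2.prod h1)).subset ?_) ?_
  · rintro _ ⟨f, ⟨h3, h4, h5, h6⟩, rfl⟩
    exact ⟨mem_biUnion (show f.tri ∈ _ from ⟨h3, h6⟩) h4,
      mem_biUnion (show f.tri ∈ _ from ⟨h3, h6⟩) h5, h3, h6⟩
  · intro f _ g _ e
    simp only [Prod.mk.injEq] at e
    exact Flag.ext e.1 e.2.1 e.2.2

variable (T) in
/-- The union of the geodesics of a left order depends upper semicontinuously on it. -/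
theorem OneVertexTriangulation.isClosed_graph :
    IsClosed {y : LeftOrder G × ℍ | y.2 ∈ ⋃₀ T.geodesics y.1} := by
  obtain ⟨K, c, hK, hc, hQ⟩ := T.exists_isDiscreteQG hG
  obtain ⟨R, hR⟩ := exists_dist_le_of_mem_gline hK hc
  obtain ⟨B, hB, hBx⟩ := T.exists_tail_bound hG
  rw [isClosed_iff_ultrafilter]
  rintro ⟨O, z⟩ u hu hmem
  -- The geodesic stays close to its line, so after a shift of the index the line starts within R of
  -- the given point.
  have key : ∀ y : LeftOrder G × ℍ, y.2 ∈ ⋃₀ T.geodesics y.1 →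
      ∃ A x p q, y.1.IsCut A ∧ T.IsLine A x ∧ T.HasEnds x p q ∧ y.2 ∈ gline p q ∧
        dist (T.midpts x 0) y.2 ≤ R := by
    rintro ⟨O, w⟩ ⟨ℓ, ⟨A, x, p, q, hA, hx, hpq, rfl⟩, hw⟩
    obtain ⟨k, hk⟩ := hR _ (hQ O A x hA hx) p q hpq.1 hpq.2 w hw
    refine ⟨A, fun n => x (n + k), p, q, hA, hx.shift k, hA.hasEnds_shift hG hx hpq k, hw, ?_⟩
    rwa [OneVertexTriangulation.midpts, zero_add]
  have : Nonempty (ℤ → Flag G) := ⟨fun _ => ⟨1, 1, ∅⟩⟩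
  choose! A x p q hA hx hpq hgl hdist using key
  have hu1 : Tendsto Prod.fst (u : Filter (LeftOrder G × ℍ)) (𝓝 O) :=
    (continuous_fst.tendsto (O, z)).mono_left hu
  have hu2 : Tendsto Prod.snd (u : Filter (LeftOrder G × ℍ)) (𝓝 z) :=
    (continuous_snd.tendsto (O, z)).mono_left hu
  have hfin := T.finite_flags hG (isCompact_closedBall z (R + 1))
  -- The initial flags lie near z, so there are finitely many of them and the ultrafilter selects
  -- one.
  obtain ⟨f, -, hf⟩ : ∃ f ∈ {f : Flag G | f.tri ∈ T.triangles ∧ f.lo ∈ f.tri ∧ f.hi ∈ f.tri ∧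
      (T.cell f.tri ∩ Metric.closedBall z (R + 1)).Nonempty}, {y | x y 0 = f} ∈ u := by
    rw [← Ultrafilter.finite_biUnion_mem_iff hfin]
    filter_upwards [hmem, hu2 (Metric.closedBall_mem_nhds z one_pos)] with y hy hyz
    have hfl := (hx y hy).isFlag 0
    refine mem_biUnion (x := x y 0) ⟨hfl.1, hfl.2.1, hfl.2.2.1, T.midpts (x y) 0, ?_, ?_⟩ rfl
    · exact ⟨_, edgePoint_mem_simplex hfl.2.1 hfl.2.2.1 ⟨by norm_num, by norm_num⟩, rfl⟩
    · rw [Metric.mem_closedBall]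
      exact (dist_triangle _ y.2 _).trans (add_le_add (hdist y hy) hyz)
  -- The limit of the cuts along the ultrafilter; on every finite set it agrees with almost all of
  -- them.
  set A₀ : Set G := {g | ∀ᶠ y in u, g ∈ A y} with hA₀
  have hA₀n : ∀ g, g ∉ A₀ → ∀ᶠ y in u, g ∉ A y := fun g hg => Ultrafilter.eventually_not.2 hg
  have hagree : ∀ g, ∀ᶠ y in u, (g ∈ A₀ ↔ g ∈ A y) := by
    intro g
    by_cases h : g ∈ A₀
    · have h' : ∀ᶠ y in u, g ∈ A y := h
      filter_upwards [h'] with y hy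
      exact iff_of_true h hy
    · filter_upwards [hA₀n g h] with y hy
      exact iff_of_false h hy
  have hcut : O.IsCut A₀ := by
    intro a ha b hb
    refine LeftOrder.lt_of_eventually hu1 ?_
    have ha' : ∀ᶠ y in u, a ∈ A y := ha
    filter_upwards [hmem, ha', hA₀n b hb] with y hy h1 h2
    exact hA y hy a h1 b h2
  have hflag : T.IsFlag A₀ f := by
    obtain ⟨y, ⟨hy, hyf⟩, h1, h2⟩ := ((Filter.Eventually.and hmem hf).and
      ((hagree f.lo).and (hagree f.hi))).exists
    have hfl := (hx y hy).isFlag 0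
    rw [show x y 0 = f from hyf] at hfl
    exact ⟨hfl.1, hfl.2.1, hfl.2.2.1, h1.2 hfl.2.2.2.1, fun h => hfl.2.2.2.2 (h2.1 h)⟩
  obtain ⟨x₀, hx₀, hx₀f⟩ := hflag.exists_line hG
  -- The limit line agrees with almost all of the given lines for any prescribed number of steps.
  have hev : ∀ N : ℕ, ∀ᶠ y in u, ∀ k : ℤ, |k| ≤ N → x y k = x₀ k := by
    intro N
    have hS : (⋃ k ∈ Icc (-N : ℤ) N, (x₀ k).tri).Finite :=
      (finite_Icc _ _).biUnion fun k _ => T.finite_triangle (hx₀.isFlag k).1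
    filter_upwards [hmem, hf, (eventually_all_finite hS).2 fun g _ => hagree g] with y hy hyf hyS
    refine hx₀.eq_of_agree hG (hx y hy) (by rw [hx₀f]; exact hyf) fun k hk v hv => ?_
    exact hyS v (mem_biUnion (abs_le.1 hk) hv)
  have hp := (u.map p).le_nhds_lim
  have hq := (u.map q).le_nhds_lim
  set P := (u.map p).lim
  set Q := (u.map q).lim
  replace hp : Tendsto p u (𝓝 P) := hp
  replace hq : Tendsto q u (𝓝 Q) := hq
  have hp' : Tendsto (fun y => (p y : ℂ)) u (𝓝 (P : ℂ)) := (continuous_subtype_val.tendsto _).comp hp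
  have hq' : Tendsto (fun y => (q y : ℂ)) u (𝓝 (Q : ℂ)) := (continuous_subtype_val.tendsto _).comp hq
  have hbd : ∀ n : ℕ,
      ‖cayley (T.midpts x₀ (-n)) - P‖ ≤ B (dist (T.midpts x₀ 0) UpperHalfPlane.I) n ∧
      ‖cayley (T.midpts x₀ n) - Q‖ ≤ B (dist (T.midpts x₀ 0) UpperHalfPlane.I) n := by
    intro n
    have h1 : ∀ᶠ y in u, ‖cayley (T.midpts x₀ (-n)) - p y‖ ≤
        B (dist (T.midpts x₀ 0) UpperHalfPlane.I) n ∧ ‖cayley (T.midpts x₀ n) - q y‖ ≤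
        B (dist (T.midpts x₀ 0) UpperHalfPlane.I) n := by
      filter_upwards [hmem, hev n] with y hy hyn
      have hm : ∀ k : ℤ, |k| ≤ n → T.midpts (x y) k = T.midpts x₀ k := fun k hk => by
        rw [OneVertexTriangulation.midpts, hyn k hk]; rfl
      have h2 := hBx _ _ _ _ _ (hA y hy) (hx y hy) (hpq y hy) n
      rwa [hm 0 (by simp), hm n (by simp), hm (-n) (by simp)] at h2
    exact ⟨le_of_tendsto (hp'.const_sub _).norm (h1.mono fun y h => h.1),
      le_of_tendsto (hq'.const_sub _).norm (h1.mono fun y h => h.2)⟩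
  have hends : T.HasEnds x₀ P Q := by
    constructor
    · rw [tendsto_iff_norm_sub_tendsto_zero]
      exact squeeze_zero (fun n => norm_nonneg _) (fun n => (hbd n).1) (hB _)
    · rw [tendsto_iff_norm_sub_tendsto_zero]
      exact squeeze_zero (fun n => norm_nonneg _) (fun n => (hbd n).2) (hB _)
  refine ⟨gline P Q, ⟨A₀, x₀, P, Q, hcut, hx₀, hends, rfl⟩, ?_⟩
  -- The endpoints converge by compactness of the circle, and the uniform tail bound shows that
  -- their limits are the ends of the limit line. It remains to pass to the limit in the equation of
  -- the geodesic.
  have hz : Tendsto (fun y : LeftOrder G × ℍ => cayley y.2) u (𝓝 (cayley z)) :=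
    (continuous_cayley.tendsto z).comp hu2
  have hz' : Tendsto (fun y : LeftOrder G × ℍ => conj (cayley y.2)) u (𝓝 (conj (cayley z))) :=
    (Complex.continuous_conj.tendsto _).comp hz
  have h1 := (hp'.add hq').mul ((hz.mul hz').const_add 1)
  have h2 := (hz.add (hz'.mul (hp'.mul hq'))).const_mul 2
  refine tendsto_nhds_unique h1 (h2.congr' ?_)
  filter_upwards [hmem] with y hy
  exact (hgl y hy).symm

end

/-! ### The lamination of a left order -/

theorem finite_support_edgePoint {G : Type*} (f : Flag G) (s : ℝ) :
    (Function.support (edgePoint f s)).Finite := by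
  refine (Set.toFinite {f.lo, f.hi}).subset fun g hg => ?_
  by_contra h
  simp only [mem_insert_iff, mem_singleton_iff, not_or] at h
  exact hg (by simp [edgePoint, vert_apply_ne h.1, vert_apply_ne h.2])

/-- The total weight outside of the cut serves as a height function: it recovers the parameter of a
point on a crossed edge. -/
theorem finsum_indicator_edgePoint {G : Type*} {A : Set G} {f : Flag G} (h1 : f.lo ∈ A)
    (h2 : f.hi ∉ A) (s : ℝ) : ∑ᶠ g, Aᶜ.indicator (edgePoint f s) g = s := by
  have hne : f.hi ≠ f.lo := fun e => h2 (e ▸ h1)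
  rw [finsum_eq_single _ f.hi]
  · rw [indicator_of_mem (show f.hi ∈ Aᶜ from h2)]
    simp [edgePoint, vert_apply_self, vert_apply_ne hne]
  · intro g hg
    by_cases hgA : g ∈ A
    · exact indicator_of_notMem (notMem_compl_iff.2 hgA) _
    · rw [indicator_of_mem (show g ∈ Aᶜ from hgA)]
      have : g ≠ f.lo := fun e => hgA (e ▸ h1)
      simp [edgePoint, vert_apply_ne hg, vert_apply_ne this]

section

variable {G : Type*} [Group G] [MulAction G ℍ] {T : OneVertexTriangulation G}
  {A A' : Set G} {x x' : ℤ → Flag G} {O : LeftOrder G} {p q p' q' : Circle}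

omit [MulAction G ℍ] in
theorem LeftOrder.IsCut.subset_or_subset (hA : O.IsCut A) (hA' : O.IsCut A') : A ⊆ A' ∨ A' ⊆ A := by
  by_contra! h
  obtain ⟨a, ha, ha'⟩ := not_subset.1 h.1
  obtain ⟨b, hb, hb'⟩ := not_subset.1 h.2
  exact O.asymm (hA a ha b hb') (hA' b hb a ha')

/-- The translate of a flag. -/
def Flag.smul (g : G) (f : Flag G) : Flag G := ⟨g * f.lo, g * f.hi, (fun h => g * h) '' f.tri⟩

omit [MulAction G ℍ] in
theorem vert_mul (g a h : G) : vert (g * a) h = vert a (g⁻¹ * h) := by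
  by_cases e : h = g * a
  · rw [e, vert_apply_self, inv_mul_cancel_left, vert_apply_self]
  · rw [vert_apply_ne e, vert_apply_ne]
    rintro rfl
    exact e (mul_inv_cancel_left g h).symm

theorem OneVertexTriangulation.IsFlag.smul {f : Flag G} (h : T.IsFlag A f) (g : G) :
    T.IsFlag ((fun h => g * h) '' A) (f.smul g) :=
  ⟨T.translate_mem g _ h.1, ⟨_, h.2.1, rfl⟩, ⟨_, h.2.2.1, rfl⟩, ⟨_, h.2.2.2.1, rfl⟩,
    fun ⟨_, ha, e⟩ => h.2.2.2.2 (mul_left_cancel e ▸ ha)⟩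

theorem OneVertexTriangulation.Step.smul {f f' : Flag G} (h : T.Step A f f') (g : G) :
    T.Step ((fun h => g * h) '' A) (f.smul g) (f'.smul g) := by
  obtain ⟨hf, hg, h1, h2, h3, h4⟩ := h
  refine ⟨hf.smul g, hg.smul g, ⟨_, h1, rfl⟩, ⟨_, h2, rfl⟩,
    fun e => h3 ((mul_right_injective g).image_injective e), ?_⟩
  simpa [Flag.smul] using h4

theorem OneVertexTriangulation.midpts_smul (hx : T.IsLine A x) (g : G) (k : ℤ) :
    T.midpts (fun k => (x k).smul g) k = g • T.midpts x k := by
  have hf := hx.isFlag k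
  rw [OneVertexTriangulation.midpts, OneVertexTriangulation.midpts, ← T.equivariant g _ hf.1 _
    (edgePoint_mem_simplex hf.2.1 hf.2.2.1 ⟨by norm_num, by norm_num⟩)]
  congr 1
  ext h
  simp [edgePoint, Flag.smul, vert_mul]

/-- This weight is affine on each segment of the curve and equals s at the break points, so it is
constant. -/
theorem OneVertexTriangulation.finsum_indicator_bary_chainCurve {σ : ℤ → Set G} {s : ℝ}
    (hx : T.IsLine A x) (hY : T.IsChain σ fun k => edgePoint (x k) s) (t : ℝ) :
    ∑ᶠ g, Aᶜ.indicator (T.bary (T.chainCurve (fun k => edgePoint (x k) s) t)) g = s := by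
  rw [hY.bary_chainCurve]
  have h1 := (hx.isFlag ⌊t⌋).2.2.2
  have h2 := (hx.isFlag (⌊t⌋ + 1)).2.2.2
  have e : ∀ g, Aᶜ.indicator ((1 - Int.fract t) • edgePoint (x ⌊t⌋) s +
      Int.fract t • edgePoint (x (⌊t⌋ + 1)) s) g =
      (1 - Int.fract t) * Aᶜ.indicator (edgePoint (x ⌊t⌋) s) g +
      Int.fract t * Aᶜ.indicator (edgePoint (x (⌊t⌋ + 1)) s) g := by
    intro g
    by_cases hg : g ∈ Aᶜ <;> simp [hg]
  have hfin : ∀ (f : Flag G) (c : ℝ),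
      (Function.support fun g => c * Aᶜ.indicator (edgePoint f s) g).Finite := fun f c =>
    (finite_support_edgePoint f s).subset fun g hg => by
      intro h0
      apply hg
      by_cases hgA : g ∈ Aᶜ <;> simp [hgA, h0]
  rw [finsum_congr e, finsum_add_distrib (hfin _ _) (hfin _ _), ← mul_finsum, ← mul_finsum,
    finsum_indicator_edgePoint h1.1 h1.2, finsum_indicator_edgePoint h2.1 h2.2]
  ring

theorem OneVertexTriangulation.finite_support_bary (z : ℍ) :
    (Function.support (T.bary z)).Finite := by
  obtain ⟨τ, hτ, hz⟩ := T.exists_mem_cell z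
  refine (T.finite_triangle hτ).subset fun g hg => ?_
  exact (T.mem_cell_iff hτ).1 hz g (lt_of_le_of_ne (T.bary_nonneg z g) (Ne.symm hg))

variable (hG : IsSurfaceGroup G)
include hG

/-- The geodesics of nested cuts do not cross. -/
theorem LeftOrder.IsCut.gline_eq (hA : O.IsCut A) (hx : T.IsLine A x) (h : T.HasEnds x p q)
    (hA' : O.IsCut A') (hx' : T.IsLine A' x') (h' : T.HasEnds x' p' q') (hsub : A ⊆ A')
    {z : ℍ} (hz : z ∈ gline p q) (hz' : z ∈ gline p' q') : gline p q = gline p' q' := by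
  -- The curves for A and A' are drawn at the weights 1/3 and 2/3. At a common point the weight
  -- outside of A' would be 2/3 and the weight outside of the smaller set A only 1/3, which is
  -- absurd. Different parameters keep the curves disjoint even if the cuts coincide.
  have hs : (1 / 3 : ℝ) ∈ Ioo (0 : ℝ) 1 := ⟨by norm_num, by norm_num⟩
  have hs' : (2 / 3 : ℝ) ∈ Ioo (0 : ℝ) 1 := ⟨by norm_num, by norm_num⟩
  have hY := hx.isChain (O := O) hG hA (s := fun _ => 1 / 3) fun _ => hs
  have hY' := hx'.isChain (O := O) hG hA' (s := fun _ => 2 / 3) fun _ => hs'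
  have hE := hA.hasEndpoints hG hx h (s := fun _ => 1 / 3) fun _ => hs
  have hE' := hA'.hasEndpoints hG hx' h' (s := fun _ => 2 / 3) fun _ => hs'
  have hdis : ∀ s t, T.chainCurve (fun k => edgePoint (x k) (1 / 3)) s ≠
      T.chainCurve (fun k => edgePoint (x' k) (2 / 3)) t := by
    intro s t e
    have h1 := T.finsum_indicator_bary_chainCurve hx hY s
    have h2 := T.finsum_indicator_bary_chainCurve hx' hY' t
    rw [← e] at h2
    have hfin := T.finite_support_bary (T.chainCurve (fun k => edgePoint (x k) (1 / 3)) s)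
    have hle : ∀ g, A'ᶜ.indicator (T.bary (T.chainCurve (fun k => edgePoint (x k) (1 / 3)) s)) g ≤
        Aᶜ.indicator (T.bary (T.chainCurve (fun k => edgePoint (x k) (1 / 3)) s)) g := fun g =>
      indicator_le_indicator_of_subset (compl_subset_compl.2 hsub) (fun g => T.bary_nonneg _ g) g
    have hsupp : ∀ B : Set G, (Function.support (B.indicator
        (T.bary (T.chainCurve (fun k => edgePoint (x k) (1 / 3)) s)))).Finite := fun B =>
      hfin.subset (by rw [support_indicator]; exact inter_subset_right)
    have := finsum_le_finsum' (hsupp _) (hsupp _) hle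
    rw [h1, h2] at this
    norm_num at this
  -- With the common point at the centre both geodesics are diameters, and different diameters have
  -- linked endpoints.
  obtain ⟨B, hB⟩ := MulAction.exists_smul_eq SL(2, ℝ) z UpperHalfPlane.I
  have hI := smul_mem_gline' B hz
  have hI' := smul_mem_gline' B hz'
  rw [hB, I_mem_gline] at hI hI'
  have key : gline (bdry B p) (bdry B q) = gline (bdry B p') (bdry B q') := by
    by_cases h1 : bdry B p = bdry B p'
    · rw [hI, hI', h1]
    by_cases h2 : bdry B p = -bdry B p'
    · rw [hI, hI', h2, neg_neg, gline_comm]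
    exfalso
    have g1 : (bdry B p : ℂ) ≠ bdry B p' := fun e => h1 (Circle.ext e)
    have g2 : (bdry B p : ℂ) ≠ -bdry B p' := fun e =>
      h2 (Circle.ext (by rw [Circle.coe_neg]; exact e))
    have hEB := hasEndpoints_smul B hE
    have hEB' := hasEndpoints_smul B hE'
    rw [hI] at hEB
    rw [hI'] at hEB'
    refine linkAngle_antipodal_ne (Circle.norm_coe _) (Circle.norm_coe _) g1 g2 ?_
    have := linkAngle_add_linkAngle
      (γ := fun t => cayley (B • T.chainCurve (fun k => edgePoint (x k) (1 / 3)) t))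
      (γ' := fun t => cayley (B • T.chainCurve (fun k => edgePoint (x' k) (2 / 3)) t))
      (continuous_cayley.comp (hY.continuous_chainCurve.const_smul B))
      (continuous_cayley.comp (hY'.continuous_chainCurve.const_smul B))
      (fun s => norm_cayley_lt_one _) (fun s => norm_cayley_lt_one _)
      hEB.1 hEB.2 hEB'.1 hEB'.2 (Circle.norm_coe _) (Circle.norm_coe _) (Circle.norm_coe _)
      (Circle.norm_coe _) g1 ?_ ?_ ?_ ?_
    · simpa only [Circle.coe_neg] using this
    · rw [Circle.coe_neg]; exact g2
    · rw [Circle.coe_neg]; exact fun e => g2 (by rw [← e, neg_neg])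
    · rw [Circle.coe_neg, Circle.coe_neg]; exact fun e => g1 (neg_injective e)
    · exact fun s t e => hdis s t (MulAction.injective B (cayley_injective e))
  ext w
  rw [← smul_mem_gline B, key, smul_mem_gline]

variable (T) (O)

theorem OneVertexTriangulation.pairwiseDisjoint_geodesics :
    (T.geodesics O).PairwiseDisjoint id := by
  rintro _ ⟨A, x, p, q, hA, hx, h, rfl⟩ _ ⟨A', x', p', q', hA', hx', h', rfl⟩ hne
  refine Set.disjoint_left.2 fun z hz hz' => hne ?_
  rcases hA.subset_or_subset hA' with hsub | hsub
  · exact hA.gline_eq hG hx h hA' hx' h' hsub hz hz'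
  · exact (hA'.gline_eq hG hx' h' hA hx h hsub hz' hz).symm

theorem OneVertexTriangulation.isGeodesicLine_of_mem_geodesics {ℓ : Set ℍ}
    (hℓ : ℓ ∈ T.geodesics O) : IsGeodesicLine ℓ := by
  obtain ⟨A, x, p, q, hA, hx, h, rfl⟩ := hℓ
  exact isGeodesicLine_gline (hA.ends_ne hG hx h)

theorem OneVertexTriangulation.image_mem_geodesics (g : G) {ℓ : Set ℍ} (hℓ : ℓ ∈ T.geodesics O) :
    (fun z => g • z) '' ℓ ∈ T.geodesics O := by
  obtain ⟨A, x, p, q, hA, hx, h, rfl⟩ := hℓ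
  obtain ⟨B, hB⟩ := hG.orientationPreserving g
  refine ⟨(fun h => g * h) '' A, fun k => (x k).smul g, bdry B p, bdry B q, ?_,
    fun k => (hx k).smul g, ?_, ?_⟩
  · rintro _ ⟨a, ha, rfl⟩ b hb
    have := O.left_inv _ _ g (hA a ha (g⁻¹ * b) fun hc => hb ⟨_, hc, mul_inv_cancel_left g b⟩)
    rwa [mul_inv_cancel_left] at this
  · constructor
    · simp only [T.midpts_smul hx, hB]
      exact tendsto_cayley_smul B h.1
    · simp only [T.midpts_smul hx, hB]
      exact tendsto_cayley_smul B h.2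
  · ext z
    constructor
    · rintro ⟨w, hw, rfl⟩
      beta_reduce
      rw [hB]
      exact smul_mem_gline' B hw
    · intro hz
      refine ⟨B⁻¹ • z, ?_, ?_⟩
      · rwa [← smul_mem_gline B, smul_inv_smul]
      · beta_reduce
        rw [hB, smul_inv_smul]

theorem OneVertexTriangulation.geodesics_nonempty : ∃ z, z ∈ ⋃₀ T.geodesics O := by
  obtain ⟨τ, hτ⟩ := T.exists_isMiddle O 1
  obtain ⟨r, hr⟩ := hτ.exists_isProng hG
  obtain ⟨x, hx, -⟩ := hr.exists_below
  have hA : O.IsCut {g | O.lt g 1} := O.isCut_below 1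
  obtain ⟨p, q, h⟩ := hA.exists_hasEnds hG hx
  obtain ⟨z, hz⟩ := gline_nonempty (hA.ends_ne hG hx h)
  exact ⟨z, _, ⟨_, x, p, q, hA, hx, h, rfl⟩, hz⟩

theorem OneVertexTriangulation.isClosed_sUnion_geodesics : IsClosed (⋃₀ T.geodesics O) :=
  (T.isClosed_graph hG).preimage (f := fun z : ℍ => (O, z)) (by fun_prop)

theorem OneVertexTriangulation.preimage_proj_geodesics :
    proj G ⁻¹' (proj G '' ⋃₀ T.geodesics O) = ⋃₀ T.geodesics O := by
  refine Subset.antisymm ?_ (subset_preimage_image _ _)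
  rintro z ⟨w, ⟨ℓ, hℓ, hw⟩, hwz⟩
  obtain ⟨g, rfl⟩ := MulAction.orbitRel_apply.1 (Quotient.exact hwz)
  refine ⟨_, T.image_mem_geodesics O hG g⁻¹ hℓ, ⟨g • z, hw, ?_⟩⟩
  exact inv_smul_smul g z

omit hG in
theorem isClosed_of_isClosed_preimage_proj {s : Set (Surface G)} (h : IsClosed (proj G ⁻¹' s)) :
    IsClosed s := (isQuotientMap_quotient_mk' (s := MulAction.orbitRel G ℍ)).isClosed_preimage.1 h

theorem OneVertexTriangulation.isLamination :
    IsLamination (proj G '' ⋃₀ T.geodesics O) (T.geodesics O) where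
  isClosed := by
    apply isClosed_of_isClosed_preimage_proj
    rw [T.preimage_proj_geodesics O hG]
    exact T.isClosed_sUnion_geodesics O hG
  nonempty := by
    obtain ⟨z, hz⟩ := T.geodesics_nonempty O hG
    exact ⟨_, z, hz, rfl⟩
  isGeodesic ℓ hℓ := T.isGeodesicLine_of_mem_geodesics O hG hℓ
  pairwiseDisjoint := T.pairwiseDisjoint_geodesics O hG
  invariant g ℓ hℓ := T.image_mem_geodesics O hG g hℓ
  preimage_eq := T.preimage_proj_geodesics O hG

/-- The geodesic lamination of a left order. -/
def OneVertexTriangulation.lamination : GeodesicLamination G :=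
  ⟨⟨⟨proj G '' ⋃₀ T.geodesics O, haveI := hG.cocompact; (T.isLamination O hG).isClosed.isCompact⟩,
    (T.isLamination O hG).nonempty⟩, _, T.isLamination O hG⟩

end

/-! ### Straightening and continuity -/

/-- The lower quasigeodesic bound makes the curve proper. This is what allows two parametrizations
of a leaf to be compared. -/
theorem IsGoodLine.isClosedEmbedding {K c : ℝ} (hK : 1 ≤ K) {γ : ℝ → ℍ} (h : IsGoodLine K c γ) :
    IsClosedEmbedding γ := by
  obtain ⟨hcont, hinj, hq, -⟩ := h
  refine .of_continuous_injective_isClosedMap hcont hinj ?_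
  refine (isProperMap_iff_tendsto_cocompact.2 ⟨hcont, ?_⟩).isClosedMap
  refine tendsto_cocompact_of_tendsto_dist_comp_atTop (γ 0) ?_
  have h1 : Tendsto (fun s : ℝ => K⁻¹ * |s - 0| - c) (cocompact ℝ) atTop := by
    simp only [sub_zero]
    exact tendsto_atTop_add_const_right _ (-c)
      ((tendsto_norm_cocompact_atTop (E := ℝ)).const_mul_atTop (show 0 < K⁻¹ by positivity))
  exact tendsto_atTop_mono (fun s => (hq s 0).1) h1

/-- Injective parametrizations of a proper line have the same endpoints. -/
theorem HasEndpoints.eq_or_eq_of_range_eq {γ γ' : ℝ → ℍ} {p q p' q' : Circle}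
    (hγ : IsClosedEmbedding γ) (hγ' : Continuous γ') (hinj : Function.Injective γ')
    (hr : range γ' = range γ) (h : HasEndpoints γ p q) (h' : HasEndpoints γ' p' q') :
    (p' = p ∧ q' = q) ∨ (p' = q ∧ q' = p) := by
  choose φ hφ using fun t => (hr ▸ mem_range_self t : γ' t ∈ range γ)
  have hcomp : γ ∘ φ = γ' := funext hφ
  have hcont : Continuous φ := by
    rw [hγ.isEmbedding.continuous_iff, hcomp]
    exact hγ'
  have hφinj : Function.Injective φ := fun s t e => hinj (by rw [← hφ, ← hφ, e])
  have hsurj : Function.Surjective φ := by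
    intro s
    obtain ⟨t, ht⟩ : γ s ∈ range γ' := hr ▸ mem_range_self s
    exact ⟨t, hγ.injective (by rw [hφ, ht])⟩
  obtain ⟨h1, h2⟩ := h
  obtain ⟨h1', h2'⟩ := h'
  have e : (fun t => cayley (γ' t)) = (fun s => cayley (γ s)) ∘ φ := by
    rw [← hcomp]; rfl
  unfold ConvergesToBoundary at h1' h2'
  rw [e] at h1' h2'
  rcases hcont.strictMono_of_inj hφinj with hm | hm
  · left
    have k1 : Tendsto φ atBot atBot :=
      tendsto_atBot_atBot_of_monotone hm.monotone fun b => (hsurj b).imp fun _ h => h.le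
    have k2 : Tendsto φ atTop atTop :=
      tendsto_atTop_atTop_of_monotone hm.monotone fun b => (hsurj b).imp fun _ h => h.ge
    exact ⟨Circle.ext (tendsto_nhds_unique h1' (Tendsto.comp h1 k1)),
      Circle.ext (tendsto_nhds_unique h2' (Tendsto.comp h2 k2))⟩
  · right
    have k1 : Tendsto φ atBot atTop :=
      tendsto_atBot_atTop_of_antitone hm.antitone fun b => (hsurj b).imp fun _ h => h.ge
    have k2 : Tendsto φ atTop atBot :=
      tendsto_atTop_atBot_of_antitone hm.antitone fun b => (hsurj b).imp fun _ h => h.le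
    exact ⟨Circle.ext (tendsto_nhds_unique h1' (Tendsto.comp h2 k1)),
      Circle.ext (tendsto_nhds_unique h2' (Tendsto.comp h1 k2))⟩

section

variable {G : Type*} [Group G] [MulAction G ℍ] {T : OneVertexTriangulation G}
  {A A' : Set G} {x : ℤ → Flag G} {O : LeftOrder G} {p q : Circle} {ρ : AllowedRep G}

omit [MulAction G ℍ] in
theorem AllowedRep.isCut_level (ρ : AllowedRep G) (t : ℝ) :
    ρ.order.IsCut {g | ρ.hom g 0 < t} := fun _ ha _ hb => lt_of_lt_of_le ha (not_lt.1 hb)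

variable (hG : IsSurfaceGroup G)
include hG

/-- A nonsingular leaf is the curve of a line for a level cut, and any other injective
parametrization of it has the same endpoints up to order. -/
theorem OneVertexTriangulation.straightenedLeaves_subset :
    T.straightenedLeaves ρ ⊆ T.geodesics ρ.order := by
  rintro ℓ ⟨C, hC, γ, hγ, hinj, rfl, c, hc, rfl, p, q, hpq, hcpq⟩
  obtain ⟨t, x, hx, ht, hr⟩ := hC.exists_isLine hG
  have hA := ρ.isCut_level t
  obtain ⟨K, c', hK, -, hgood⟩ := T.exists_isGoodLine_of_isLine hG
  have hs := fun k => hx.edgeParam_mem (ht k)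
  have hg := (hgood _ _ _ _ hA hx hs).1
  obtain ⟨p', q', h⟩ := hA.exists_hasEnds hG hx
  have hE := hA.hasEndpoints hG hx h hs
  rw [range_eq_gline hc hcpq]
  refine ⟨_, x, p', q', hA, hx, h, ?_⟩
  rcases HasEndpoints.eq_or_eq_of_range_eq (hg.isClosedEmbedding hK) hγ hinj hr hE hpq with
    ⟨rfl, rfl⟩ | ⟨rfl, rfl⟩
  · rfl
  · exact gline_comm _ _

theorem OneVertexTriangulation.IsLine.exists_agree (hx : T.IsLine A x) {N : ℕ}
    (h : ∀ k : ℤ, |k| ≤ N → ∀ v ∈ (x k).tri, (v ∈ A ↔ v ∈ A')) :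
    ∃ y, T.IsLine A' y ∧ ∀ k : ℤ, |k| ≤ N → y k = x k := by
  have hf := hx.isFlag 0
  have h0 := h 0 (by simp)
  have hf' : T.IsFlag A' (x 0) := ⟨hf.1, hf.2.1, hf.2.2.1, (h0 _ hf.2.1).1 hf.2.2.2.1,
    fun hc => hf.2.2.2.2 ((h0 _ hf.2.2.1).2 hc)⟩
  obtain ⟨y, hy, hy0⟩ := hf'.exists_line hG
  exact ⟨y, hy, hx.eq_of_agree hG hy hy0 h⟩

theorem OneVertexTriangulation.countable (T : OneVertexTriangulation G) : Countable G := by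
  have h : (⋃ n : ℕ, ⋃ τ ∈ {τ ∈ T.triangles |
      (T.cell τ ∩ Metric.closedBall UpperHalfPlane.I (n : ℝ)).Nonempty}, τ).Countable :=
    countable_iUnion fun n => ((T.finite_meeting hG (isCompact_closedBall _ _)).countable).biUnion
      fun τ hτ => (T.finite_triangle hτ.1).countable
  refine countable_univ_iff.1 (h.mono fun g _ => ?_)
  obtain ⟨τ, hτ, hg⟩ := T.exists_triangle_mem g
  obtain ⟨n, hn⟩ := exists_nat_ge (dist (T.vertex g) UpperHalfPlane.I)
  exact mem_iUnion.2 ⟨n, mem_biUnion ⟨hτ, T.vertex g, T.vertex_mem_cell hg, hn⟩ hg⟩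

/-- For N steps a line sees only a finite set F of vertices. A height t strictly between the highest
vertex of F in A and the lowest one outside of A, off the countable orbit of 0, gives a nonsingular
leaf that follows the line for these N steps; its geodesic has nearby endpoints. -/
theorem OneVertexTriangulation.exists_straightenedLeaf_inter {z : ℍ}
    (hz : z ∈ ⋃₀ T.geodesics ρ.order) {V : Set ℍ} (hV : V ∈ 𝓝 z) :
    (⋃₀ T.straightenedLeaves ρ ∩ V).Nonempty := by
  obtain ⟨_, ⟨A, x, p, q, hA, hx, h, rfl⟩, hz⟩ := hz
  obtain ⟨N, hN⟩ := hA.exists_close hG hx h (eventually_gline_inter_nonempty hz hV)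
  set F : Set G := ⋃ k ∈ Icc (-N : ℤ) N, (x k).tri with hF
  have hFfin : F.Finite := (finite_Icc _ _).biUnion fun k _ => T.finite_triangle (hx.isFlag k).1
  have hmemF : ∀ k : ℤ, |k| ≤ N → ∀ v ∈ (x k).tri, v ∈ F := fun k hk v hv =>
    mem_biUnion (abs_le.1 hk) hv
  have hf := hx.isFlag 0
  obtain ⟨a, ha, hamax⟩ := (hFfin.inter_of_left A).exists_maximalFor (fun g => ρ.hom g 0) _
    ⟨(x 0).lo, hmemF 0 (by simp) _ hf.2.1, hf.2.2.2.1⟩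
  obtain ⟨b, hb, hbmin⟩ := (hFfin.inter_of_left Aᶜ).exists_minimalFor (fun g => ρ.hom g 0) _
    ⟨(x 0).hi, hmemF 0 (by simp) _ hf.2.2.1, hf.2.2.2.2⟩
  have hab : ρ.hom a 0 < ρ.hom b 0 := hA a ha.2 b hb.2
  have := T.countable hG
  obtain ⟨t, ht, hat, htb⟩ :=
    ((countable_range fun g => ρ.hom g 0).dense_compl ℝ).exists_between hab
  obtain ⟨y, hy, hyx⟩ := hx.exists_agree (A' := {g | ρ.hom g 0 < t}) hG (N := N) (by
    intro k hk v hv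
    have hvF := hmemF k hk v hv
    constructor
    · intro hvA
      refine lt_of_le_of_lt ?_ hat
      exact (le_total _ _).elim (fun h => h) fun h => hamax ⟨hvF, hvA⟩ h
    · intro hvt
      by_contra hvA
      refine lt_irrefl t (htb.trans_le (le_trans ?_ (le_of_lt hvt)))
      exact (le_total _ _).elim (fun h => h) fun h => hbmin ⟨hvF, hvA⟩ h)
  have hyt : ∀ k, ∀ v ∈ (y k).tri, ρ.hom v 0 ≠ t := fun k v _ e => ht ⟨v, e⟩
  have hA' := ρ.isCut_level t
  obtain ⟨p', q', h'⟩ := hA'.exists_hasEnds hG hy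
  obtain ⟨w, hw, hwV⟩ := hN _ _ y p' q' hA' hy h' hyx
  refine ⟨w, ⟨gline p' q', ?_, hw⟩, hwV⟩
  obtain ⟨K, c', hK, -, hgood⟩ := T.exists_isGoodLine_of_isLine hG
  have hs := fun k => hy.edgeParam_mem (hyt k)
  have hg := (hgood _ _ _ _ hA' hy hs).1
  obtain ⟨c, hc, hcE, hcr⟩ := exists_isometry_gline (hA'.ends_ne hG hy h')
  exact ⟨_, hy.isNonsingularLeaf hG hyt, _, hg.1, hg.2.1, rfl, c, hc, hcr, p', q',
    hA'.hasEndpoints hG hy h' hs, hcE⟩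

/-- The straightening of the foliation of an allowed representation is the lamination of its
order. -/
theorem OneVertexTriangulation.straightening_eq :
    T.straightening ρ = proj G '' ⋃₀ T.geodesics ρ.order := by
  apply Subset.antisymm
  · exact closure_minimal (image_mono (sUnion_subset_sUnion (T.straightenedLeaves_subset hG)))
      (T.isLamination ρ.order hG).isClosed
  · have h : ⋃₀ T.geodesics ρ.order ⊆ closure (⋃₀ T.straightenedLeaves ρ) := fun z hz =>
      mem_closure_iff_nhds.2 fun V hV => by
        rw [inter_comm]; exact T.exists_straightenedLeaf_inter hG hz hV
    exact (image_mono h).trans (image_closure_subset_closure_image continuous_quotient_mk')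

/-- Lower semicontinuity: N steps of a line involve finitely many inequalities between elements of
G, and these hold for all orders close to O. -/
theorem OneVertexTriangulation.eventually_geodesics_inter {z : ℍ} (hz : z ∈ ⋃₀ T.geodesics O)
    {V : Set ℍ} (hV : V ∈ 𝓝 z) : ∀ᶠ O' in 𝓝 O, (⋃₀ T.geodesics O' ∩ V).Nonempty := by
  obtain ⟨_, ⟨A, x, p, q, hA, hx, h, rfl⟩, hz⟩ := hz
  obtain ⟨N, hN⟩ := hA.exists_close hG hx h (eventually_gline_inter_nonempty hz hV)
  set F : Set G := ⋃ k ∈ Icc (-N : ℤ) N, (x k).tri with hF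
  have hFfin : F.Finite := (finite_Icc _ _).biUnion fun k _ => T.finite_triangle (hx.isFlag k).1
  have hev : ∀ᶠ O' in 𝓝 O, ∀ a ∈ F ∩ A, ∀ b ∈ F ∩ Aᶜ, O'.lt a b :=
    (eventually_all_finite (hFfin.inter_of_left A)).2 fun a ha =>
      (eventually_all_finite (hFfin.inter_of_left Aᶜ)).2 fun b hb =>
        (LeftOrder.isOpen_lt a b).mem_nhds (hA a ha.2 b hb.2)
  filter_upwards [hev] with O' hO'
  -- The set A need not be a cut for O'. Its finite part is completed downwards instead, which
  -- changes nothing on F.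
  have hA' : O'.IsCut {g | ∃ a ∈ F ∩ A, O'.lt g a ∨ g = a} := by
    rintro g ⟨a, ha, hga⟩ b hb
    rcases O'.total a b with h1 | rfl | h1
    · rcases hga with h2 | rfl
      · exact O'.trans _ _ _ h2 h1
      · exact h1
    · exact absurd ⟨_, ha, Or.inr rfl⟩ hb
    · exact absurd ⟨_, ha, Or.inl h1⟩ hb
  obtain ⟨y, hy, hyx⟩ := hx.exists_agree hG (N := N)
    (A' := {g | ∃ a ∈ F ∩ A, O'.lt g a ∨ g = a}) (by
      intro k hk v hv
      have hvF : v ∈ F := mem_biUnion (abs_le.1 hk) hv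
      refine ⟨fun hvA => ⟨v, ⟨hvF, hvA⟩, Or.inr rfl⟩, ?_⟩
      rintro ⟨a, ha, hva⟩
      by_contra hvA
      have h1 := hO' a ha v ⟨hvF, hvA⟩
      rcases hva with h2 | rfl
      · exact O'.asymm h1 h2
      · exact hvA ha.2)
  obtain ⟨p', q', h'⟩ := hA'.exists_hasEnds hG hy
  obtain ⟨w, hw, hwV⟩ := hN _ _ y p' q' hA' hy h' hyx
  exact ⟨w, ⟨gline p' q', ⟨_, y, p', q', hA', hy, h', rfl⟩, hw⟩, hwV⟩

omit hG in
theorem OneVertexTriangulation.exists_isCompact_proj (T : OneVertexTriangulation G) :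
    ∃ K : Set ℍ, IsCompact K ∧ ∀ z : ℍ, ∃ g : G, g • z ∈ K := by
  refine ⟨⋃ τ ∈ {τ ∈ T.triangles | (1 : G) ∈ τ}, T.cell τ,
    T.finite_star.isCompact_biUnion fun τ hτ => T.isCompact_cell hτ.1, fun z => ?_⟩
  obtain ⟨τ, hτ, hz⟩ := T.exists_mem_cell z
  obtain ⟨a, b, c, -, -, -, e⟩ := T.eq_triple hτ
  have ha : a ∈ τ := by rw [e]; simp
  exact ⟨a⁻¹, mem_biUnion ⟨T.translate_mem _ _ hτ, a, ha, inv_mul_cancel a⟩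
    (T.smul_mem_cell hτ a⁻¹ hz)⟩

omit hG in
theorem proj_smul (g : G) (z : ℍ) : proj G (g • z) = proj G z :=
  Quotient.sound (MulAction.orbitRel_apply.2 ⟨g, rfl⟩)

variable (T) in
-- The two kinds of subbasic open sets of the Vietoris topology, contained in U and meeting V,
-- correspond to the closed graph and to lower semicontinuity.
theorem OneVertexTriangulation.continuous_lamination :
    Continuous fun O => T.lamination O hG := by
  refine Continuous.subtype_mk ?_ _
  let _ := TopologicalSpace.vietoris (Surface G)
  rw [TopologicalSpace.NonemptyCompacts.isEmbedding_coe.continuous_iff]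
  have hproj : Continuous (proj G) := continuous_quotient_mk'
  refine continuous_generateFrom_iff.2 ?_
  rintro _ (⟨U, hU, rfl⟩ | ⟨V, hV, rfl⟩)
  · obtain ⟨K, hK, hKz⟩ := T.exists_isCompact_proj
    have hU' : IsOpen U := hU
    have hKU : IsCompact (K ∩ proj G ⁻¹' Uᶜ) :=
      hK.inter_right (IsClosed.preimage hproj (isClosed_compl_iff.2 hU'))
    have := isCompact_iff_compactSpace.1 hKU
    -- By invariance under G it suffices to look for bad points in a compact set that meets every
    -- orbit, and the projection along a compact factor is closed.
    have hcl : IsClosed {y : LeftOrder G × ↥(K ∩ proj G ⁻¹' Uᶜ) |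
        (y.2 : ℍ) ∈ ⋃₀ T.geodesics y.1} :=
      (T.isClosed_graph hG).preimage
        (f := fun y : LeftOrder G × ↥(K ∩ proj G ⁻¹' Uᶜ) => (y.1, (y.2 : ℍ))) (by fun_prop)
    have := isClosedMap_fst_of_compactSpace _ hcl
    rw [← isClosed_compl_iff]
    convert this using 1
    ext O
    simp only [mem_compl_iff, mem_preimage, Function.comp_apply, mem_powerset_iff, mem_image,
      Prod.exists, exists_and_right, exists_eq_right]
    constructor
    · intro h
      obtain ⟨_, ⟨z, ⟨ℓ, hℓ, hz⟩, rfl⟩, hzU⟩ := not_subset.1 h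
      obtain ⟨g, hg⟩ := hKz z
      refine ⟨⟨g • z, hg, ?_⟩, _, T.image_mem_geodesics O hG g hℓ, z, hz, rfl⟩
      rwa [mem_preimage, proj_smul]
    · rintro ⟨⟨z, hzK, hzU⟩, hz⟩ hsub
      exact hzU (hsub ⟨z, hz, rfl⟩)
  · rw [isOpen_iff_mem_nhds]
    rintro O ⟨_, ⟨z, hz, rfl⟩, hzV⟩
    have hV' : IsOpen (proj G ⁻¹' V) := IsOpen.preimage hproj hV
    filter_upwards [T.eventually_geodesics_inter hG hz (hV'.mem_nhds hzV)] with O' hO'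
    obtain ⟨w, hw, hwV⟩ := hO'
    exact ⟨proj G w, ⟨w, hw, rfl⟩, hwV⟩

omit [MulAction G ℍ] hG in
-- A comparison of a and b involves only the two values at 0, which depend continuously on ρ.
theorem AllowedRep.continuous_order : Continuous (AllowedRep.order : AllowedRep G → LeftOrder G) := by
  refine continuous_generateFrom_iff.2 ?_
  rintro _ ⟨a, b, rfl⟩
  have h : ∀ g : G, Continuous fun ρ : AllowedRep G => ρ.hom g 0 := fun g =>
    (continuous_apply_apply g (0 : ℝ)).comp (continuous_induced_dom
      (f := fun (ρ : AllowedRep G) (g : G) (x : ℝ) => ρ.hom g x))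
  exact isOpen_lt (h a) (h b)

end

/-! ### The minimal embedding -/

section

variable {G : Type*} [Group G] {O : LeftOrder G} {s : ℕ → G}

/-- The values of the minimal embedding at the elements above `s n` that precede it. -/
def upperValues (O : LeftOrder G) (s : ℕ → G) (n : ℕ) : Set ℝ :=
  {x | ∃ p, ∃ _ : p < n, O.lt (s n) (s p) ∧ x = minimalEmbedding O s p}

/-- The values of the minimal embedding at the elements below `s n` that precede it. -/
def lowerValues (O : LeftOrder G) (s : ℕ → G) (n : ℕ) : Set ℝ :=
  {x | ∃ p, ∃ _ : p < n, O.lt (s p) (s n) ∧ x = minimalEmbedding O s p}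

theorem minimalEmbedding_zero : minimalEmbedding O s 0 = 0 := by
  rw [minimalEmbedding]; simp

open Classical in
theorem minimalEmbedding_of_ne_zero {n : ℕ} (hn : n ≠ 0) : minimalEmbedding O s n =
    if upperValues O s n = ∅ then sSup (lowerValues O s n) + 1
    else if lowerValues O s n = ∅ then sInf (upperValues O s n) - 1
    else (sSup (lowerValues O s n) + sInf (upperValues O s n)) / 2 := by
  rw [minimalEmbedding]
  simp only [hn, if_false]
  rfl

theorem finite_upperValues (n : ℕ) : (upperValues O s n).Finite := by
  refine ((finite_Iio n).image (minimalEmbedding O s)).subset ?_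
  rintro x ⟨p, hp, -, rfl⟩
  exact ⟨p, hp, rfl⟩

theorem finite_lowerValues (n : ℕ) : (lowerValues O s n).Finite := by
  refine ((finite_Iio n).image (minimalEmbedding O s)).subset ?_
  rintro x ⟨p, hp, -, rfl⟩
  exact ⟨p, hp, rfl⟩

theorem minimalEmbedding_lt_of_lt_bound (n : ℕ) : ∀ p < n, ∀ q < n, O.lt (s p) (s q) →
    minimalEmbedding O s p < minimalEmbedding O s q := by
  induction n with
  | zero => intro p hp; omega
  | succ n ih =>
    have hA := finite_upperValues (O := O) (s := s) n
    have hB := finite_lowerValues (O := O) (s := s) n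
    have key : (∀ p < n, O.lt (s p) (s n) → minimalEmbedding O s p < minimalEmbedding O s n) ∧
        ∀ p < n, O.lt (s n) (s p) → minimalEmbedding O s n < minimalEmbedding O s p := by
      rcases Nat.eq_zero_or_pos n with rfl | hn
      · exact ⟨fun p hp => absurd hp (Nat.not_lt_zero p), fun p hp => absurd hp (Nat.not_lt_zero p)⟩
      rw [minimalEmbedding_of_ne_zero hn.ne']
      have hBle : ∀ p < n, O.lt (s p) (s n) →
          minimalEmbedding O s p ≤ sSup (lowerValues O s n) := fun p hp h =>
        le_csSup hB.bddAbove ⟨p, hp, h, rfl⟩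
      have hAle : ∀ p < n, O.lt (s n) (s p) →
          sInf (upperValues O s n) ≤ minimalEmbedding O s p := fun p hp h =>
        csInf_le hA.bddBelow ⟨p, hp, h, rfl⟩
      split_ifs with h1 h2
      · refine ⟨fun p hp h => by linarith [hBle p hp h], fun p hp h => ?_⟩
        exact absurd (show minimalEmbedding O s p ∈ upperValues O s n from ⟨p, hp, h, rfl⟩) (by simp [h1])
      · refine ⟨fun p hp h => ?_, fun p hp h => by linarith [hAle p hp h]⟩
        exact absurd (show minimalEmbedding O s p ∈ lowerValues O s n from ⟨p, hp, h, rfl⟩) (by simp [h2])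
      · obtain ⟨a, ha, ha', e1⟩ := (nonempty_iff_ne_empty.2 h1).csInf_mem hA
        obtain ⟨b, hb, hb', e2⟩ := (nonempty_iff_ne_empty.2 h2).csSup_mem hB
        have := ih b hb a ha (O.trans _ _ _ hb' ha')
        rw [← e1, ← e2] at this
        exact ⟨fun p hp h => by linarith [hBle p hp h], fun p hp h => by linarith [hAle p hp h]⟩
    intro p hp q hq h
    rcases (Nat.lt_succ_iff.1 hp).eq_or_lt with rfl | hp'
    · rcases (Nat.lt_succ_iff.1 hq).eq_or_lt with rfl | hq'
      · exact absurd h (O.irrefl _)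
      · exact key.2 q hq' h
    · rcases (Nat.lt_succ_iff.1 hq).eq_or_lt with rfl | hq'
      · exact key.1 p hp' h
      · exact ih p hp' q hq' h

theorem minimalEmbedding_lt {p q : ℕ} (h : O.lt (s p) (s q)) :
    minimalEmbedding O s p < minimalEmbedding O s q :=
  minimalEmbedding_lt_of_lt_bound (max p q + 1) p (by omega) q (by omega) h

theorem minimalEmbedding_lt_iff (hs : Function.Injective s) {p q : ℕ} :
    minimalEmbedding O s p < minimalEmbedding O s q ↔ O.lt (s p) (s q) := by
  refine ⟨fun h => ?_, minimalEmbedding_lt⟩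
  rcases O.total (s p) (s q) with h1 | h1 | h1
  · exact h1
  · rw [hs h1] at h; exact absurd h (lt_irrefl _)
  · exact absurd h (minimalEmbedding_lt h1).not_gt

/-- No earlier value lies between those of a and b, so these two are the closest neighbours of the
new element at the moment when it is placed. -/
theorem minimalEmbedding_midpoint (hs : Function.Injective s) {a b p : ℕ} (ha : a < p) (hb : b < p)
    (h1 : minimalEmbedding O s a < minimalEmbedding O s p)
    (h2 : minimalEmbedding O s p < minimalEmbedding O s b)
    (h : ∀ q < p, minimalEmbedding O s q ∉
      Ioo (minimalEmbedding O s a) (minimalEmbedding O s b)) :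
    minimalEmbedding O s p = (minimalEmbedding O s a + minimalEmbedding O s b) / 2 := by
  have hB : IsGreatest (lowerValues O s p) (minimalEmbedding O s a) := by
    refine ⟨⟨a, ha, (minimalEmbedding_lt_iff hs).1 h1, rfl⟩, ?_⟩
    rintro _ ⟨q, hq, hlt, rfl⟩
    by_contra! hc
    exact h q hq ⟨hc, (minimalEmbedding_lt hlt).trans h2⟩
  have hA : IsLeast (upperValues O s p) (minimalEmbedding O s b) := by
    refine ⟨⟨b, hb, (minimalEmbedding_lt_iff hs).1 h2, rfl⟩, ?_⟩
    rintro _ ⟨q, hq, hlt, rfl⟩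
    by_contra! hc
    exact h q hq ⟨h1.trans (minimalEmbedding_lt hlt), hc⟩
  rw [minimalEmbedding_of_ne_zero (by omega), if_neg hA.nonempty.ne_empty,
    if_neg hB.nonempty.ne_empty, hB.csSup_eq, hA.csInf_eq]

end

/-! ### The image of the minimal embedding: unboundedness and gaps -/

section

variable {G : Type*} [Group G] (O : LeftOrder G) (s : ℕ ≃ G)

include s in
theorem LeftOrder.exists_one_lt : ∃ a, O.lt 1 a := by
  obtain ⟨a, ha⟩ : ∃ a : G, a ≠ 1 := by
    by_contra! h
    have := s.injective ((h (s 0)).trans (h (s 1)).symm)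
    omega
  rcases O.total 1 a with h | h | h
  · exact ⟨a, h⟩
  · exact absurd h.symm ha
  · refine ⟨a⁻¹, ?_⟩
    have := O.left_inv _ _ a⁻¹ h
    rwa [inv_mul_cancel, mul_one] at this

/-- The order has no greatest element. The first element of the enumeration above `s 0, …, s n` is a
maximum at the moment when it is placed, so its value exceeds all theirs by at least 1. -/
theorem exists_minimalEmbedding_add_one_le (n : ℕ) :
    ∃ m, ∀ p ≤ n, minimalEmbedding O s p + 1 ≤ minimalEmbedding O s m := by
  classical
  have hex : ∃ m, ∀ p ≤ n, O.lt (s p) (s m) := by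
    obtain ⟨a, ha⟩ := O.exists_one_lt s
    obtain ⟨g, -, hg⟩ := O.exists_max (U := s '' Iic n) ((finite_Iic n).image _) ⟨_, 0, by simp, rfl⟩
    refine ⟨s.symm (g * a), fun p hp => ?_⟩
    rw [Equiv.apply_symm_apply]
    have h1 := O.left_inv _ _ g ha
    rw [mul_one] at h1
    rcases O.total (s p) g with h | h | h
    · exact O.trans _ _ _ h h1
    · rw [h]; exact h1
    · exact absurd h (hg _ ⟨p, hp, rfl⟩)
  have hm := Nat.find_spec hex
  have hmin := fun q (hq : q < Nat.find hex) => Nat.find_min hex hq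
  set m := Nat.find hex
  have hnm : n < m := by
    by_contra! hc
    exact O.irrefl _ (hm m hc)
  have hA : upperValues O s m = ∅ := by
    rw [eq_empty_iff_forall_notMem]
    rintro _ ⟨q, hq, hlt, -⟩
    have := hmin q hq
    push Not at this
    obtain ⟨p, hp, hpq⟩ := this
    exact hpq (O.trans _ _ _ (hm p hp) hlt)
  refine ⟨m, fun p hp => ?_⟩
  rw [minimalEmbedding_of_ne_zero (n := m) (by omega), if_pos hA]
  have := le_csSup (finite_lowerValues (O := O) (s := s) m).bddAbove
    (show minimalEmbedding O s p ∈ lowerValues O s m from ⟨p, by omega, hm p hp, rfl⟩)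
  linarith

theorem exists_minimalEmbedding_le_sub_one (n : ℕ) :
    ∃ m, ∀ p ≤ n, minimalEmbedding O s m ≤ minimalEmbedding O s p - 1 := by
  classical
  have hex : ∃ m, ∀ p ≤ n, O.lt (s m) (s p) := by
    obtain ⟨a, ha⟩ := O.exists_one_lt s
    obtain ⟨g, -, hg⟩ := O.exists_min (U := s '' Iic n) ((finite_Iic n).image _) ⟨_, 0, by simp, rfl⟩
    refine ⟨s.symm (g * a⁻¹), fun p hp => ?_⟩
    rw [Equiv.apply_symm_apply]
    have h1 := O.left_inv _ _ (g * a⁻¹) ha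
    rw [mul_one, inv_mul_cancel_right] at h1
    rcases O.total (s p) g with h | h | h
    · exact absurd h (hg _ ⟨p, hp, rfl⟩)
    · rw [h]; exact h1
    · exact O.trans _ _ _ h1 h
  have hm := Nat.find_spec hex
  have hmin := fun q (hq : q < Nat.find hex) => Nat.find_min hex hq
  set m := Nat.find hex
  have hnm : n < m := by
    by_contra! hc
    exact O.irrefl _ (hm m hc)
  have hB : lowerValues O s m = ∅ := by
    rw [eq_empty_iff_forall_notMem]
    rintro _ ⟨q, hq, hlt, -⟩
    have := hmin q hq
    push Not at this
    obtain ⟨p, hp, hpq⟩ := this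
    exact hpq (O.trans _ _ _ hlt (hm p hp))
  have hmem : ∀ p ≤ n, minimalEmbedding O s p ∈ upperValues O s m := fun p hp =>
    ⟨p, by omega, hm p hp, rfl⟩
  refine ⟨m, fun p hp => ?_⟩
  rw [minimalEmbedding_of_ne_zero (n := m) (by omega), if_neg (Nonempty.ne_empty ⟨_, hmem p hp⟩),
    if_pos hB]
  have := csInf_le (finite_upperValues (O := O) (s := s) m).bddBelow (hmem p hp)
  linarith

theorem exists_le_minimalEmbedding (x : ℝ) : ∃ n, x ≤ minimalEmbedding O s n := by
  have key : ∀ k : ℕ, ∃ n, (k : ℝ) ≤ minimalEmbedding O s n := by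
    intro k
    induction k with
    | zero => exact ⟨0, by rw [minimalEmbedding_zero]; simp⟩
    | succ k ih =>
      obtain ⟨n, hn⟩ := ih
      obtain ⟨m, hm⟩ := exists_minimalEmbedding_add_one_le O s n
      exact ⟨m, by push_cast; linarith [hm n le_rfl]⟩
  obtain ⟨k, hk⟩ := exists_nat_ge x
  obtain ⟨n, hn⟩ := key k
  exact ⟨n, hk.trans hn⟩

theorem exists_minimalEmbedding_le (x : ℝ) : ∃ n, minimalEmbedding O s n ≤ x := by
  have key : ∀ k : ℕ, ∃ n, minimalEmbedding O s n ≤ -(k : ℝ) := by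
    intro k
    induction k with
    | zero => exact ⟨0, by rw [minimalEmbedding_zero]; simp⟩
    | succ k ih =>
      obtain ⟨n, hn⟩ := ih
      obtain ⟨m, hm⟩ := exists_minimalEmbedding_le_sub_one O s n
      exact ⟨m, by push_cast; linarith [hm n le_rfl]⟩
  obtain ⟨k, hk⟩ := exists_nat_ge (-x)
  obtain ⟨n, hn⟩ := key k
  exact ⟨n, hn.trans (by linarith)⟩

/-- The intervals that are complementary to the image of the minimal embedding are contained in
bounded ones with endpoints in this image. -/
theorem exists_gap {u v : ℝ} (huv : u < v) (h : ∀ n, minimalEmbedding O s n ∉ Ioo u v) :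
    ∃ a b, minimalEmbedding O s a ≤ u ∧ v ≤ minimalEmbedding O s b ∧
      ∀ n, minimalEmbedding O s n ∉ Ioo (minimalEmbedding O s a) (minimalEmbedding O s b) := by
  classical
  by_contra! hno
  -- If the current interval still receives an element, the first one lands at the midpoint. Not
  -- lying in (u, v), it leaves one half that contains (u, v). Repeated halving would bring the
  -- length below v - u.
  have step : ∀ n a b, a < n → b < n → minimalEmbedding O s a ≤ u → v ≤ minimalEmbedding O s b →
      (∀ q < n, minimalEmbedding O s q ∉ Ioo (minimalEmbedding O s a) (minimalEmbedding O s b)) →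
      ∃ n' a' b', a' < n' ∧ b' < n' ∧ minimalEmbedding O s a' ≤ u ∧ v ≤ minimalEmbedding O s b' ∧
        (∀ q < n', minimalEmbedding O s q ∉
          Ioo (minimalEmbedding O s a') (minimalEmbedding O s b')) ∧
        minimalEmbedding O s b' - minimalEmbedding O s a' =
          (minimalEmbedding O s b - minimalEmbedding O s a) / 2 := by
    intro n a b han hbn hau hvb hab
    have hex := hno a b hau hvb
    have hp := Nat.find_spec hex
    have hmin := fun q (hq : q < Nat.find hex) => Nat.find_min hex hq
    set p := Nat.find hex
    have hnp : n ≤ p := by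
      by_contra! hc
      exact hab p hc hp
    have hmid := minimalEmbedding_midpoint s.injective (by omega) (by omega) hp.1 hp.2 hmin
    rcases le_or_gt (minimalEmbedding O s p) u with h1 | h1
    · refine ⟨p + 1, p, b, by omega, by omega, h1, hvb, fun q hq hqm => ?_, by rw [hmid]; ring⟩
      rcases (Nat.lt_succ_iff.1 hq).eq_or_lt with rfl | hq'
      · exact lt_irrefl _ hqm.1
      · exact hmin q hq' ⟨hp.1.trans hqm.1, hqm.2⟩
    · have h2 : v ≤ minimalEmbedding O s p := by
        by_contra! hc
        exact h p ⟨h1, hc⟩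
      refine ⟨p + 1, a, p, by omega, by omega, hau, h2, fun q hq hqm => ?_, by rw [hmid]; ring⟩
      rcases (Nat.lt_succ_iff.1 hq).eq_or_lt with rfl | hq'
      · exact lt_irrefl _ hqm.2
      · exact hmin q hq' ⟨hqm.1, hqm.2.trans hp.2⟩
  obtain ⟨a₀, ha₀⟩ := exists_minimalEmbedding_le O s u
  obtain ⟨b₀, hb₀⟩ := exists_le_minimalEmbedding O s v
  obtain ⟨n₀, a₁, b₁, h1, h2, h3, h4, h5⟩ : ∃ n a b, a < n ∧ b < n ∧
      minimalEmbedding O s a ≤ u ∧ v ≤ minimalEmbedding O s b ∧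
      ∀ q < n, minimalEmbedding O s q ∉
        Ioo (minimalEmbedding O s a) (minimalEmbedding O s b) := by
    obtain ⟨a, ⟨ha, hau⟩, hamax⟩ := ((finite_Iio (max a₀ b₀ + 1)).inter_of_left
      {q | minimalEmbedding O s q ≤ u}).exists_maximalFor (minimalEmbedding O s) _
      ⟨a₀, by simp only [mem_Iio]; omega, ha₀⟩
    obtain ⟨b, ⟨hb, hvb⟩, hbmin⟩ := ((finite_Iio (max a₀ b₀ + 1)).inter_of_left
      {q | v ≤ minimalEmbedding O s q}).exists_minimalFor (minimalEmbedding O s) _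
      ⟨b₀, by simp only [mem_Iio]; omega, hb₀⟩
    refine ⟨_, a, b, ha, hb, hau, hvb, fun q hq hqm => ?_⟩
    rcases le_or_gt (minimalEmbedding O s q) u with k1 | k1
    · exact absurd (hamax ⟨hq, k1⟩ hqm.1.le) (not_le.2 hqm.1)
    · rcases le_or_gt v (minimalEmbedding O s q) with k2 | k2
      · exact absurd (hbmin ⟨hq, k2⟩ hqm.2.le) (not_le.2 hqm.2)
      · exact h q ⟨k1, k2⟩
  have key : ∀ k : ℕ, ∃ n a b, a < n ∧ b < n ∧ minimalEmbedding O s a ≤ u ∧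
      v ≤ minimalEmbedding O s b ∧
      (∀ q < n, minimalEmbedding O s q ∉
        Ioo (minimalEmbedding O s a) (minimalEmbedding O s b)) ∧
      minimalEmbedding O s b - minimalEmbedding O s a =
        (minimalEmbedding O s b₁ - minimalEmbedding O s a₁) * (1 / 2) ^ k := by
    intro k
    induction k with
    | zero => exact ⟨n₀, a₁, b₁, h1, h2, h3, h4, h5, by simp⟩
    | succ k ih =>
      obtain ⟨n, a, b, k1, k2, k3, k4, k5, k6⟩ := ih
      obtain ⟨n', a', b', l1, l2, l3, l4, l5, l6⟩ := step n a b k1 k2 k3 k4 k5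
      exact ⟨n', a', b', l1, l2, l3, l4, l5, by rw [l6, k6]; ring⟩
  have hlim : Tendsto (fun k : ℕ => (minimalEmbedding O s b₁ - minimalEmbedding O s a₁) *
      (1 / 2 : ℝ) ^ k) atTop (𝓝 0) := by
    simpa using (tendsto_pow_atTop_nhds_zero_of_lt_one (r := (1 / 2 : ℝ)) (by norm_num)
      (by norm_num)).const_mul (minimalEmbedding O s b₁ - minimalEmbedding O s a₁)
  obtain ⟨k, hk⟩ := (hlim.eventually (gt_mem_nhds (sub_pos.2 huv))).exists
  obtain ⟨n, a, b, -, -, k3, k4, -, k6⟩ := key k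
  rw [← k6] at hk
  linarith

end

/-! ### The canonical action -/

section

variable {G : Type*} [Group G] (O : LeftOrder G) (s : ℕ ≃ G)

/-- The pair `a ≤ b` has no element of `G` strictly between its members. -/
def LeftOrder.IsCell (a b : G) : Prop := ¬ O.lt b a ∧ ∀ h, ¬ (O.lt a h ∧ O.lt h b)

/-- The affine parametrization of the interval between the images of `a` and `b` under the minimal
embedding. -/
noncomputable def cellPoint (a b : G) (r : ℝ) : ℝ :=
  (1 - r) * minimalEmbedding O s (s.symm a) + r * minimalEmbedding O s (s.symm b)

variable {O s}

theorem LeftOrder.mul_lt_mul_left_iff {a b : G} (g : G) : O.lt (g * a) (g * b) ↔ O.lt a b := by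
  refine ⟨fun h => ?_, O.left_inv a b g⟩
  have := O.left_inv _ _ g⁻¹ h
  rwa [inv_mul_cancel_left, inv_mul_cancel_left] at this

theorem LeftOrder.IsCell.mul_left {a b : G} (h : O.IsCell a b) (g : G) :
    O.IsCell (g * a) (g * b) := by
  refine ⟨fun h' => h.1 ((O.mul_lt_mul_left_iff g).1 h'), fun k hk => h.2 (g⁻¹ * k) ⟨?_, ?_⟩⟩
  · rw [← O.mul_lt_mul_left_iff g, mul_inv_cancel_left]; exact hk.1
  · rw [← O.mul_lt_mul_left_iff g, mul_inv_cancel_left]; exact hk.2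

theorem LeftOrder.isCell_self (a : G) : O.IsCell a a :=
  ⟨O.irrefl a, fun _ h => O.irrefl _ (O.trans _ _ _ h.1 h.2)⟩

theorem minimalEmbedding_symm_lt_iff {a b : G} :
    minimalEmbedding O s (s.symm a) < minimalEmbedding O s (s.symm b) ↔ O.lt a b := by
  rw [minimalEmbedding_lt_iff s.injective, s.apply_symm_apply, s.apply_symm_apply]

theorem minimalEmbedding_symm_le {a b : G} (h : ¬ O.lt b a) :
    minimalEmbedding O s (s.symm a) ≤ minimalEmbedding O s (s.symm b) :=
  not_lt.1 fun h' => h (minimalEmbedding_symm_lt_iff.1 h')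

theorem minimalEmbedding_symm_injective :
    Function.Injective fun a => minimalEmbedding O s (s.symm a) := by
  intro a b h
  rcases O.total a b with h' | h' | h'
  · exact absurd h (minimalEmbedding_symm_lt_iff.2 h').ne
  · exact h'
  · exact absurd h (minimalEmbedding_symm_lt_iff.2 h').ne'

theorem cellPoint_self (a : G) (r : ℝ) :
    cellPoint O s a a r = minimalEmbedding O s (s.symm a) := by
  rw [cellPoint]; ring

theorem LeftOrder.IsCell.cellPoint_mem {a b : G} (h : O.IsCell a b) {r : ℝ} (hr : r ∈ Icc (0 : ℝ) 1) :
    minimalEmbedding O s (s.symm a) ≤ cellPoint O s a b r ∧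
      cellPoint O s a b r ≤ minimalEmbedding O s (s.symm b) := by
  have := minimalEmbedding_symm_le (s := s) h.1
  rw [cellPoint]
  constructor <;> nlinarith [hr.1, hr.2]

theorem cellPoint_mul_left_of_eq_left {a b : G} {r : ℝ}
    (h : cellPoint O s a b r = minimalEmbedding O s (s.symm a)) (g : G) :
    cellPoint O s (g * a) (g * b) r = minimalEmbedding O s (s.symm (g * a)) := by
  have h0 : r * (minimalEmbedding O s (s.symm b) - minimalEmbedding O s (s.symm a)) = 0 := by
    rw [cellPoint] at h; linarith
  rcases mul_eq_zero.1 h0 with rfl | h1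
  · rw [cellPoint]; ring
  · rw [minimalEmbedding_symm_injective (sub_eq_zero.1 h1), cellPoint_self]

theorem cellPoint_mul_left_of_eq_right {a b : G} {r : ℝ}
    (h : cellPoint O s a b r = minimalEmbedding O s (s.symm b)) (g : G) :
    cellPoint O s (g * a) (g * b) r = minimalEmbedding O s (s.symm (g * b)) := by
  have h0 : (1 - r) * (minimalEmbedding O s (s.symm b) - minimalEmbedding O s (s.symm a)) = 0 := by
    rw [cellPoint] at h; linarith
  rcases mul_eq_zero.1 h0 with h1 | h1
  · obtain rfl : r = 1 := by linarith
    rw [cellPoint]; ring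
  · rw [minimalEmbedding_symm_injective (sub_eq_zero.1 h1), cellPoint_self]

/-- Left multiplication acts monotonically on the points of the cells. -/
theorem cellPoint_mul_left_le {a b c d : G} (hab : O.IsCell a b) (hcd : O.IsCell c d) {r r' : ℝ}
    (hr : r ∈ Icc (0 : ℝ) 1) (hr' : r' ∈ Icc (0 : ℝ) 1)
    (h : cellPoint O s a b r ≤ cellPoint O s c d r') (g : G) :
    cellPoint O s (g * a) (g * b) r ≤ cellPoint O s (g * c) (g * d) r' := by
  have h1 := (hab.mul_left g).cellPoint_mem (s := s) hr
  have h2 := (hcd.mul_left g).cellPoint_mem (s := s) hr'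
  -- If a < c then b ≤ c and the cells are already separated. If a = c they coincide or one of them
  -- is degenerate. If c < a then d ≤ a, and the assumed inequality forces both points to be the
  -- common endpoint.
  rcases O.total a c with hac | rfl | hac
  · have := minimalEmbedding_symm_le (s := s) fun h' =>
      hab.2 c ⟨hac, (O.mul_lt_mul_left_iff g).1 h'⟩
    linarith
  · rcases O.total b d with hbd | rfl | hbd
    · obtain rfl : a = b := by
        rcases O.total a b with h' | h' | h'
        · exact absurd ⟨h', hbd⟩ (hcd.2 b)
        · exact h'
        · exact absurd h' hab.1
      rw [cellPoint_self]; exact h2.1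
    · rcases O.total a b with h' | rfl | h'
      · have hlt := minimalEmbedding_symm_lt_iff (s := s).2 h'
        have hlt' := minimalEmbedding_symm_lt_iff (s := s).2 (O.left_inv _ _ g h')
        have hrr : r ≤ r' := by
          rw [cellPoint, cellPoint] at h
          by_contra! hc
          nlinarith
        rw [cellPoint, cellPoint]
        nlinarith
      · rw [cellPoint_self, cellPoint_self]
      · exact absurd h' hab.1
    · obtain rfl : a = d := by
        rcases O.total a d with h' | h' | h'
        · exact absurd ⟨h', hbd⟩ (hab.2 d)
        · exact h'
        · exact absurd h' hcd.1
      rw [cellPoint_self] at h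
      rw [cellPoint_self, cellPoint_mul_left_of_eq_left (h.antisymm (hab.cellPoint_mem hr).1)]
  · have hda : ¬ O.lt a d := fun h' => hcd.2 a ⟨hac, h'⟩
    have k1 := hab.cellPoint_mem (s := s) hr
    have k2 := hcd.cellPoint_mem (s := s) hr'
    have k3 := minimalEmbedding_symm_le (s := s) hda
    obtain rfl : d = a := minimalEmbedding_symm_injective (by dsimp only; linarith)
    rw [cellPoint_mul_left_of_eq_left (by linarith), cellPoint_mul_left_of_eq_right (by linarith)]

theorem exists_cell {u v : ℝ} (huv : u < v) (h : ∀ n, minimalEmbedding O s n ∉ Ioo u v) :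
    ∃ a b, O.IsCell a b ∧ minimalEmbedding O s (s.symm a) ≤ u ∧
      v ≤ minimalEmbedding O s (s.symm b) := by
  obtain ⟨a, b, ha, hb, hab⟩ := exists_gap O s huv h
  refine ⟨s a, s b, ⟨fun h' => ?_, fun k hk => hab (s.symm k) ?_⟩, by simpa, by simpa⟩
  · have := minimalEmbedding_lt h'
    linarith
  · rw [← minimalEmbedding_symm_lt_iff (s := s), ← minimalEmbedding_symm_lt_iff (s := s)] at hk
    simpa using hk

theorem exists_eq_cellPoint {a b : G} {x : ℝ}
    (hlt : minimalEmbedding O s (s.symm a) < minimalEmbedding O s (s.symm b))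
    (hx : x ∈ Icc (minimalEmbedding O s (s.symm a)) (minimalEmbedding O s (s.symm b))) :
    ∃ r ∈ Icc (0 : ℝ) 1, x = cellPoint O s a b r := by
  have hpos := sub_pos.2 hlt
  refine ⟨(x - minimalEmbedding O s (s.symm a)) /
    (minimalEmbedding O s (s.symm b) - minimalEmbedding O s (s.symm a)),
    ⟨div_nonneg (by linarith [hx.1]) hpos.le, (div_le_one hpos).2 (by linarith [hx.2])⟩, ?_⟩
  rw [cellPoint]
  field_simp
  ring

theorem exists_cellPoint_mem_Ioo {u v : ℝ} (huv : u < v) :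
    ∃ a b r, O.IsCell a b ∧ r ∈ Icc (0 : ℝ) 1 ∧ cellPoint O s a b r ∈ Ioo u v := by
  by_cases h : ∃ n, minimalEmbedding O s n ∈ Ioo u v
  · obtain ⟨n, hn⟩ := h
    exact ⟨s n, s n, 0, O.isCell_self _, by simp, by rwa [cellPoint_self, s.symm_apply_apply]⟩
  · push Not at h
    obtain ⟨a, b, hab, ha, hb⟩ := exists_cell huv h
    obtain ⟨r, hr, e⟩ := exists_eq_cellPoint (O := O) (s := s) (a := a) (b := b) (x := (u + v) / 2)
      (by linarith) ⟨by linarith, by linarith⟩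
    exact ⟨a, b, r, hab, hr, by rw [← e]; constructor <;> linarith⟩

/-- The points of cells are dense, and a monotone map that fixes a dense set is the identity. No
continuity is needed, so the canonical maps may be defined by suprema. -/
theorem eq_self_of_monotone {f : ℝ → ℝ} (hf : Monotone f)
    (h : ∀ a b r, O.IsCell a b → r ∈ Icc (0 : ℝ) 1 → f (cellPoint O s a b r) = cellPoint O s a b r)
    (x : ℝ) : f x = x := by
  rcases lt_trichotomy (f x) x with hx | hx | hx
  · obtain ⟨a, b, r, hab, hr, h1⟩ := exists_cellPoint_mem_Ioo (O := O) (s := s) hx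
    have := hf h1.2.le
    rw [h a b r hab hr] at this
    exact absurd h1.1 this.not_gt
  · exact hx
  · obtain ⟨a, b, r, hab, hr, h1⟩ := exists_cellPoint_mem_Ioo (O := O) (s := s) hx
    have := hf h1.1.le
    rw [h a b r hab hr] at this
    exact absurd h1.2 this.not_gt

variable (O s)

/-- The values of the canonical action of `g` at the points of cells that are at most `x`. -/
def canonicalValues (g : G) (x : ℝ) : Set ℝ :=
  {y | ∃ a b r, O.IsCell a b ∧ r ∈ Icc (0 : ℝ) 1 ∧ cellPoint O s a b r ≤ x ∧
    y = cellPoint O s (g * a) (g * b) r}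

/-- The canonical action of `g`. -/
noncomputable def canonicalMap (g : G) (x : ℝ) : ℝ := sSup (canonicalValues O s g x)

theorem bddAbove_canonicalValues (g : G) (x : ℝ) : BddAbove (canonicalValues O s g x) := by
  obtain ⟨n, hn⟩ := exists_le_minimalEmbedding O s x
  refine ⟨minimalEmbedding O s (s.symm (g * s n)), ?_⟩
  rintro _ ⟨a, b, r, hab, hr, hle, rfl⟩
  rw [← cellPoint_self (g * s n) 0]
  refine cellPoint_mul_left_le hab (O.isCell_self _) hr (by simp) ?_ g
  rw [cellPoint_self, s.symm_apply_apply]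
  exact hle.trans hn

theorem monotone_canonicalMap (g : G) : Monotone (canonicalMap O s g) := by
  intro x y hxy
  refine csSup_le_csSup (bddAbove_canonicalValues O s g y) ?_ ?_
  · obtain ⟨n, hn⟩ := exists_minimalEmbedding_le O s x
    exact ⟨_, s n, s n, 0, O.isCell_self _, by simp,
      by rwa [cellPoint_self, s.symm_apply_apply], rfl⟩
  · rintro _ ⟨a, b, r, hab, hr, hle, rfl⟩
    exact ⟨a, b, r, hab, hr, hle.trans hxy, rfl⟩

variable {O s} in
theorem canonicalMap_cellPoint {a b : G} (hab : O.IsCell a b) {r : ℝ} (hr : r ∈ Icc (0 : ℝ) 1)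
    (g : G) : canonicalMap O s g (cellPoint O s a b r) = cellPoint O s (g * a) (g * b) r := by
  refine IsGreatest.csSup_eq ⟨⟨a, b, r, hab, hr, le_rfl, rfl⟩, ?_⟩
  rintro _ ⟨c, d, r', hcd, hr', hle, rfl⟩
  exact cellPoint_mul_left_le hcd hab hr' hr hle g

theorem canonicalMap_inv_canonicalMap (g : G) (x : ℝ) :
    canonicalMap O s g⁻¹ (canonicalMap O s g x) = x :=
  eq_self_of_monotone (O := O) (s := s)
    ((monotone_canonicalMap O s g⁻¹).comp (monotone_canonicalMap O s g))
    (fun a b r hab hr => by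
      rw [Function.comp_apply, canonicalMap_cellPoint hab hr,
        canonicalMap_cellPoint (hab.mul_left g) hr, inv_mul_cancel_left, inv_mul_cancel_left]) x

theorem canonicalMap_mul (g h : G) (x : ℝ) :
    canonicalMap O s (g * h) x = canonicalMap O s g (canonicalMap O s h x) := by
  -- The composition law is applied as the statement that the maps of h⁻¹, g⁻¹ and gh compose to the
  -- identity.
  have key := eq_self_of_monotone (O := O) (s := s)
    ((monotone_canonicalMap O s h⁻¹).comp ((monotone_canonicalMap O s g⁻¹).comp
      (monotone_canonicalMap O s (g * h))))
    (fun a b r hab hr => by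
      rw [Function.comp_apply, Function.comp_apply, canonicalMap_cellPoint hab hr,
        canonicalMap_cellPoint (hab.mul_left _) hr,
        canonicalMap_cellPoint ((hab.mul_left _).mul_left _) hr]
      simp [mul_assoc]) x
  rw [Function.comp_apply, Function.comp_apply] at key
  conv_rhs => rw [← key]
  have := fun g y => canonicalMap_inv_canonicalMap O s g⁻¹ y
  simp only [inv_inv] at this
  rw [this, this]

/-- The canonical action of a left ordered group. -/
noncomputable def canonicalRep (hs : s 0 = 1) : AllowedRep G where
  hom := MonoidHom.mk'
    (fun g =>
      { toFun := canonicalMap O s g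
        invFun := canonicalMap O s g⁻¹
        left_inv := canonicalMap_inv_canonicalMap O s g
        right_inv := fun x => by simpa using canonicalMap_inv_canonicalMap O s g⁻¹ x
        map_rel_iff' := fun {x y} => ⟨fun h => by
          simpa [canonicalMap_inv_canonicalMap] using monotone_canonicalMap O s g⁻¹ h,
          fun h => monotone_canonicalMap O s g h⟩ })
    fun g h => by ext x; exact canonicalMap_mul O s g h x
  injective_orbit := by
    have key : ∀ g, canonicalMap O s g 0 = minimalEmbedding O s (s.symm g) := fun g => by
      have := canonicalMap_cellPoint (s := s) (O.isCell_self 1) (r := 0) (by simp) g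
      rwa [cellPoint_self, cellPoint_self, mul_one, ← hs, s.symm_apply_apply,
        minimalEmbedding_zero] at this
    intro g h hgh
    refine minimalEmbedding_symm_injective (O := O) (s := s) ?_
    dsimp only
    rw [← key, ← key]
    exact hgh

theorem canonicalRep_hom_apply (hs : s 0 = 1) (g : G) (x : ℝ) :
    (canonicalRep O s hs).hom g x = canonicalMap O s g x := rfl

theorem isCanonicalRep_canonicalRep (hs : s 0 = 1) : IsCanonicalRep s O (canonicalRep O s hs) where
  apply_embedding g h := by
    rw [canonicalRep_hom_apply, ← cellPoint_self h 0,
      canonicalMap_cellPoint (O.isCell_self h) (by simp), cellPoint_self]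
  affine g x y hxy h r hr := by
    obtain ⟨a, b, hab, ha, hb⟩ := exists_cell hxy h
    obtain ⟨r₁, hr₁, rfl⟩ := exists_eq_cellPoint (by linarith) ⟨ha, hxy.le.trans hb⟩
    obtain ⟨r₂, hr₂, rfl⟩ := exists_eq_cellPoint (by linarith) ⟨ha.trans hxy.le, hb⟩
    have hlin : ∀ a b, (1 - r) * cellPoint O s a b r₁ + r * cellPoint O s a b r₂ =
        cellPoint O s a b ((1 - r) * r₁ + r * r₂) := fun a b => by
      simp only [cellPoint]; ring
    simp only [canonicalRep_hom_apply]
    rw [hlin, canonicalMap_cellPoint hab hr₁, canonicalMap_cellPoint hab hr₂,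
      canonicalMap_cellPoint hab ?_, hlin]
    exact convex_Icc (0 : ℝ) 1 hr₁ hr₂ (by linarith [hr.2]) hr.1 (by ring)

variable {O s} {ρ ρ' : AllowedRep G}

theorem IsCanonicalRep.hom_cellPoint (h : IsCanonicalRep s O ρ) {a b : G} (hab : O.IsCell a b)
    {r : ℝ} (hr : r ∈ Icc (0 : ℝ) 1) (g : G) :
    ρ.hom g (cellPoint O s a b r) = cellPoint O s (g * a) (g * b) r := by
  rcases O.total a b with hlt | rfl | hlt
  · rw [cellPoint, h.affine g _ _ (minimalEmbedding_symm_lt_iff.2 hlt) ?_ r hr, h.apply_embedding,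
      h.apply_embedding, cellPoint]
    intro n hn
    rw [← s.symm_apply_apply n] at hn
    exact hab.2 _ ⟨minimalEmbedding_symm_lt_iff.1 hn.1, minimalEmbedding_symm_lt_iff.1 hn.2⟩
  · rw [cellPoint_self, cellPoint_self, h.apply_embedding]
  · exact absurd hlt hab.1

/-- Both maps of g have the prescribed values at all points of cells, so one composed with the
inverse of the other is monotone and fixes these points. -/
theorem IsCanonicalRep.unique (h : IsCanonicalRep s O ρ) (h' : IsCanonicalRep s O ρ') : ρ = ρ' := by
  have key : ρ.hom = ρ'.hom := by
    ext g x
    have := eq_self_of_monotone (O := O) (s := s)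
      ((ρ'.hom g).symm.monotone.comp (ρ.hom g).monotone) (fun a b r hab hr => by
        rw [Function.comp_apply, h.hom_cellPoint hab hr, ← h'.hom_cellPoint hab hr,
          OrderIso.symm_apply_apply]) x
    rwa [Function.comp_apply, OrderIso.symm_apply_eq] at this
  cases ρ; cases ρ'; congr

theorem existsUnique_isCanonicalRep (hs : s 0 = 1) (O : LeftOrder G) :
    ∃! ρ : AllowedRep G, IsCanonicalRep s O ρ :=
  ⟨canonicalRep O s hs, isCanonicalRep_canonicalRep O s hs,
    fun _ h => h.unique (isCanonicalRep_canonicalRep O s hs)⟩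

/-- Since i(1) = 0, the orbit of 0 is the image of i, which is ordered like O. This is why the
lamination does not depend on the enumeration. -/
theorem IsCanonicalRep.order_eq (h : IsCanonicalRep s O ρ) (hs : s 0 = 1) : ρ.order = O := by
  have key : ∀ g, ρ.hom g 0 = minimalEmbedding O s (s.symm g) := fun g => by
    have := h.apply_embedding g 1
    rwa [mul_one, ← hs, s.symm_apply_apply, minimalEmbedding_zero] at this
  have hlt : ρ.order.lt = O.lt := by
    ext a b
    rw [AllowedRep.order_lt, key, key, minimalEmbedding_symm_lt_iff]
  cases O
  simp only [AllowedRep.order] at hlt ⊢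
  congr

end

end FLO

/-! ### The theorem -/

theorem mainTheorem2 {G : Type*} [Group G] [MulAction G ℍ] (hG : FLO.IsSurfaceGroup G)
    (T : FLO.OneVertexTriangulation G) :
    -- lifts of leaves are quasigeodesics with distinct endpoints, with uniform constants
    (∃ K c : ℝ, 1 ≤ K ∧ 0 ≤ c ∧ ∀ (ρ : FLO.AllowedRep G) (C : Set ℍ), T.IsLeaf ρ C →
      ((∀ g, T.vertex g ∉ C) → ∃ γ : ℝ → ℍ, range γ = C ∧ FLO.IsGoodLine K c γ) ∧
      (∀ g, T.vertex g ∈ C → ∃ n, 2 ≤ n ∧ FLO.IsGoodStar K c C (T.vertex g) n)) ∧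
    -- the foliation straightens to a geodesic lamination
    (∀ ρ : FLO.AllowedRep G, ∃ leaves, T.straightenedLeaves ρ ⊆ leaves ∧
      FLO.IsLamination (T.straightening ρ) leaves) ∧
    -- the straightening is continuous on allowed representations
    (∃ S : FLO.AllowedRep G → FLO.GeodesicLamination G, Continuous S ∧
      ∀ ρ, ((S ρ).1 : Set (FLO.Surface G)) = T.straightening ρ) ∧
    -- the straightening is well-defined and continuous on left orders
    (∃ lam : FLO.LeftOrder G → FLO.GeodesicLamination G, Continuous lam ∧
      ∀ s : ℕ ≃ G, s 0 = 1 → ∀ O : FLO.LeftOrder G,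
        (∃! ρ : FLO.AllowedRep G, FLO.IsCanonicalRep s O ρ) ∧
        ∀ ρ : FLO.AllowedRep G, FLO.IsCanonicalRep s O ρ →
          ((lam O).1 : Set (FLO.Surface G)) = T.straightening ρ) := by
  refine ⟨T.exists_isGoodLine_of_isLeaf hG, fun ρ => ⟨T.geodesics ρ.order,
    T.straightenedLeaves_subset hG, ?_⟩,
    ⟨fun ρ => T.lamination ρ.order hG,
      (T.continuous_lamination hG).comp FLO.AllowedRep.continuous_order, fun ρ => ?_⟩,
    ⟨fun O => T.lamination O hG, T.continuous_lamination hG, fun s hs O =>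
      ⟨FLO.existsUnique_isCanonicalRep hs O, fun ρ hρ => ?_⟩⟩⟩
  · rw [T.straightening_eq hG]
    exact T.isLamination ρ.order hG
  · exact (T.straightening_eq hG).symm
  · rw [T.straightening_eq hG, hρ.order_eq hs]
    rfl
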